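/- **Setting.** Let $A,B\in\mathbb C[y]$, $B\neq0$, be *reduced*: every common zero of $A$ and $B$ is a simple zero of $B$. Put $n=\max(\deg A,\deg B)$ (with $\deg 0:=0$), $L=A(\partial_x)-xB(\partial_x)$, $L^\star=A(-\partial_x)-B(-\partial_x)x$. Consider the multivalued weights $W=e^{-V}$, $V'=(A+B')/B$, and $\widehat W=e^{\widehat V}$, $\widehat V'=A/B$, on $\mathbb C\setminus B^{-1}(0)$; the product $BW\widehat W$ is locally constant. Fix $u\in\mathbb C\setminus\{0\}$. Let $U=\mathbb C$ if $\deg A>\deg B$; otherwise let $U=\{x:\operatorname{Re}((x-a/b)u)<0\}$, where $a,b$ are the coefficients of $y^{\deg B}$ in $A,B$. Solutions are holomorphic functions on $U$. **Admissible contours.** An admissible contour for a weight $\omega=e^{\int N/B}$ ($N=-(A+B')$ for $W$; $N=A$ for $\widehat W$) is a $C^1$ path in $\mathbb C\setminus B^{-1}(0)$, with a nonzero branch of $\omega$ continued along it, that is either a closed loop around which $\omega$ is single valued, or a path each of whose two ends has a limiting direction and is of one of the following kinds: * if $\deg A>\deg B$: it goes to $\infty$ with direction in an open sector where the leading term of $\operatorname{Re}\int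 N/B$ tends to $-\infty$; * if $\deg A\le\deg B$: it goes to $\infty$ in the direction $u$ (for $W$), respectively $-u$ (for $\widehat W$); * it runs into a multiple zero $b$ of $B$, with direction in an open sector at $b$ where the leading term of $\operatorname{Re}\int N/B$ tends to $-\infty$; * it runs into a simple zero $b$ of $B$ with $N(b)/B'(b)\in\{0,1,2,\dots\}$. (Ends are parametrized by $t\to\infty$ so that $\gamma(t)\sim t\varphi$, $\gamma'(t)\to\varphi$ at $\infty$, and $\gamma(t)-b\sim e^{-t}\varphi$, $\gamma'(t)\sim-e^{-t}\varphi$ at $b$, with $\varphi\ne0$.) This class contains circles around poles, lassos, petals, stems, arcs from regular points to infinity, and petals at infinity. For admissible $\Gamma$ for $W$ and $\widehat\Gamma$ for $\widehat W$ put $$f_\Gamma(x)=\int_\Gamma e^{xy}W(y)\,dy,\qquad g_{\widehat\Gamma}(x)=\int_{\widehat\Gamma}e^{-xs}\,\widehat W(s)\,ds .$$ **Bilinear concomitant.** For functions $f,g$ holomorphic on $U$ let $$\mathcal B(f,g)=-\sum_{k=0}^{n}\sum_{j<k}(-1)^jf^{(k-1-j)}(a_kg)^{(j)},\qquad a_k(x)=A_k-xB_k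 .$$ **Intersection pairing.** $\Gamma$ and $\widehat\Gamma$ are in general position if they meet for only finitely many pairs of parameters, always transversally. Then $$\widehat\Gamma\,\sharp\,\Gamma=\sum_{p}\varepsilon_p\,B(p)W(p)\widehat W(p),$$ the sum over these crossings, where $\varepsilon_p=\pm1$ is the orientation of the tangent vectors $(\widehat\Gamma',\Gamma')$ at $p$ and $W(p),\widehat W(p)$ are the values of the branches carried by the contours. (If $BW\widehat W=1$ at all crossings, this is the usual signed intersection number.) **Proposition.** For all $A,B,u$ as above: 1. For all admissible $\Gamma,\widehat\Gamma$, the integrals $f_\Gamma,g_{\widehat\Gamma}$ converge absolutely on $U$, $Lf_\Gamma=0$, $L^\star g_{\widehat\Gamma}=0$, and for every $x\in U$, with an absolutely convergent double integral, $$\mathcal B(f_\Gamma,g_{\widehat\Gamma})(x)=\int_{\widehat\Gamma}\!\int_\Gamma\Big[(B(y)-B(s))\Big(\frac x{y-s}-\frac1{(y-s)^2}\Big)-\frac{A(y)-A(s)-B'(s)}{y-s}\Big]e^{x(y-s)}\,W(y)\,\widehat W(s)\,dy\,ds .$$ For all solutions $f,g$ of $Lf=0$, $L^\star g=0$ on $U$,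 $\mathcal B(f,g)$ does not depend on $x\in U$. 2. If $\Gamma$ and $\widehat\Gamma$ are in general position, then $$\frac1{2\pi i}\,\mathcal B(f_\Gamma,g_{\widehat\Gamma})=\widehat\Gamma\,\sharp\,\Gamma .$$ 3. There are admissible contours $\Gamma_1,\dots,\Gamma_n$ and $\widehat\Gamma_1,\dots,\widehat\Gamma_n$, with normalized branches of the weights, pairwise ($\Gamma_i$ with $\widehat\Gamma_j$) in general position, such that $(f_{\Gamma_i})$ is a basis of the solutions of $Lf=0$ on $U$, $(g_{\widehat\Gamma_j})$ is a basis of the solutions of $L^\star g=0$ on $U$, and $$\frac1{2\pi i}\,\mathcal B(f_{\Gamma_i},g_{\widehat\Gamma_j})=\widehat\Gamma_j\,\sharp\,\Gamma_i=\delta_{ij}.$$ 4. Hence $\mathcal B$ is a nondegenerate pairing between the two solution spaces. -/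

import Mathlib

open Polynomial Filter Topology MeasureTheory

noncomputable section

/-- `A, B` are reduced: every common zero is a simple zero of `B`. -/
def ReducedPair (A B : ℂ[X]) : Prop :=
  ∀ z : ℂ, A.eval z = 0 → B.eval z = 0 → B.rootMultiplicity z = 1

/-! ### The adjoint equations and their (differential) bilinear concomitant -/

/-- `(A(∂) - x B(∂)) f` at the point `x`. -/
def odeOp (A B : ℂ[X]) (f : ℂ → ℂ) (x : ℂ) : ℂ :=
  (A.sum fun k a => a * iteratedDeriv k f x) - x * (B.sum fun k b => b * iteratedDeriv k f x)

/-- `(A(-∂) - B(-∂) x) g` at the point `x`. -/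
def adjointOp (A B : ℂ[X]) (g : ℂ → ℂ) (x : ℂ) : ℂ :=
  (A.sum fun k a => a * ((-1) ^ k * iteratedDeriv k g x)) -
    B.sum fun k b => b * ((-1) ^ k * iteratedDeriv k (fun z => z * g z) x)

/-- The domain of the variable `x`. It is the whole plane when `deg A > deg B`. Otherwise the
equation has (at most) the one finite singular point `a / b`, with `a, b` the coefficients of degree
`deg B` in `A, B`, and the domain is the open half plane `Re ((x - a / b) u) < 0`, on which
`exp (x y) W(y)` decays as `y` goes to infinity in the direction `u`. -/
def xDomain (A B : ℂ[X]) (u : ℂ) : Set ℂ :=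
  {x | B.natDegree < A.natDegree ∨
    ((x - A.coeff B.natDegree / B.coeff B.natDegree) * u).re < 0}

/-- `f` is a holomorphic solution of `(A(∂) - x B(∂)) f = 0` on `U`. -/
def IsSolution (A B : ℂ[X]) (U : Set ℂ) (f : ℂ → ℂ) : Prop :=
  DifferentiableOn ℂ f U ∧ ∀ x ∈ U, odeOp A B f x = 0

/-- `g` is a holomorphic solution of `(A(-∂) - B(-∂) x) g = 0` on `U`. -/
def IsAdjointSolution (A B : ℂ[X]) (U : Set ℂ) (g : ℂ → ℂ) : Prop :=
  DifferentiableOn ℂ g U ∧ ∀ x ∈ U, adjointOp A B g x = 0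

/-- The bilinear concomitant of Legendre for `L = ∑ₖ aₖ(x) ∂ᵏ`, `aₖ(x) = Aₖ - x Bₖ`,
with the sign for which its `x`-derivative is `f L⋆g - g Lf`:
`-∑ₖ ∑_{j<k} (-1)ʲ f^{(k-1-j)} (aₖ g)^{(j)}`. -/
def concomitant (A B : ℂ[X]) (f g : ℂ → ℂ) (x : ℂ) : ℂ :=
  -∑ k ∈ Finset.range (max A.natDegree B.natDegree + 1), ∑ j ∈ Finset.range k,
    (-1) ^ j * iteratedDeriv (k - 1 - j) f x *
      iteratedDeriv j (fun z => (A.coeff k - z * B.coeff k) * g z) x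

/-! ### Weighted admissible contours

A (multivalued) weight is given by its logarithmic derivative `N / B`. The weight
`W = exp (-V)`, `V' = (A + B') / B`, has `N = -(A + B')`; the dual weight
`exp Vhat`, `Vhat' = A / B`, has `N = A`. -/

/-- One end of a contour: going to infinity with asymptotic direction `φ`, or running into the
point `b` with `φ` pointing from `b` back to the contour. -/
inductive ContourEnd where
  | infinity (φ : ℂ) : ContourEnd
  | point (b φ : ℂ) : ContourEnd

/-- The path `γ` has the given end as its parameter tends to `+∞`. Ends are parametrized so that
`γ t ∼ t φ` at infinity and `γ t - b ∼ exp (-t) φ` at `b`, also after one differentiation. -/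
def ContourEnd.IsEndOf : ContourEnd → (ℝ → ℂ) → Prop
  | .infinity φ, γ =>
      Tendsto (fun t : ℝ => γ t / t) atTop (𝓝 φ) ∧ Tendsto (deriv γ) atTop (𝓝 φ)
  | .point b φ, γ =>
      Tendsto (fun t : ℝ => Real.exp t * (γ t - b)) atTop (𝓝 φ) ∧
        Tendsto (fun t : ℝ => Real.exp t * deriv γ t) atTop (𝓝 (-φ))

/-- The ends that are allowed for the weight with logarithmic derivative `N / B`.
* Infinity, `deg N > deg B`: the direction lies in one of the open sectors in which the
  leading term of `∫ N / B` has negative real part.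
* Infinity, `deg N ≤ deg B`: the chosen direction `u`.
* A multiple zero `b` of `B` (essential singularity of the weight): the direction lies in one of the
  open sectors at `b` in which the leading term of `∫ N / B` has negative real part;
  with `m + 1` the multiplicity and `β` the coefficient of `(y - b)^(m+1)` in `B`, that term is
  `-(N(b) / (m β)) (y - b)^(-m)`.
* A simple zero `b` of `B` at which the exponent `N(b) / B'(b)` of the weight is a natural number,
  so that the weight is regular there: any direction. -/
def ContourEnd.Admissible (N B : ℂ[X]) (u : ℂ) : ContourEnd → Prop
  | .infinity φ =>
      (B.natDegree < N.natDegree ∧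
        (N.leadingCoeff / B.leadingCoeff * φ ^ (N.natDegree - B.natDegree + 1)).re < 0) ∨
      (N.natDegree ≤ B.natDegree ∧ φ = u)
  | .point b φ =>
      (2 ≤ B.rootMultiplicity b ∧
        0 < (N.eval b / (taylor b B).coeff (B.rootMultiplicity b) /
          φ ^ (B.rootMultiplicity b - 1)).re) ∨
      (B.rootMultiplicity b = 1 ∧ φ ≠ 0 ∧ ∃ k : ℕ, N.eval b = k * (derivative B).eval b)

/-- `N / B` pulled back along the path `γ`. -/
def logDerivAlong (N B : ℂ[X]) (γ : ℝ → ℂ) (t : ℝ) : ℂ :=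
  N.eval (γ t) / B.eval (γ t) * deriv γ t

/-- An admissible contour for the weight with logarithmic derivative `N / B`, together with a
normalization of the weight on it. The contour is a `C¹` path in the complement of the zeros of `B`.
Either it is a closed loop (of period `1`) around which the weight is single valued, or it is
parametrized by `ℝ` and has an admissible end on either side. Circles around poles, lassos, petals,
stems, arcs from regular points to infinity and the petals at infinity are of this form. -/
structure AdmissibleContour (N B : ℂ[X]) (u : ℂ) where
  path : ℝ → ℂ
  contDiff : ContDiff ℝ 1 path
  avoids : ∀ t, B.eval (path t) ≠ 0
  isLoop : Prop
  loop : isLoop → Function.Periodic path 1 ∧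
    Complex.exp (∫ t in (0 : ℝ)..1, logDerivAlong N B path t) = 1
  arc : ¬ isLoop → ∃ e₀ e₁ : ContourEnd,
    e₀.Admissible N B u ∧ e₁.Admissible N B u ∧
      e₀.IsEndOf (fun t => path (-t)) ∧ e₁.IsEndOf path
  /-- The value of the chosen branch of the weight at `path 0`. -/
  const : ℂ
  const_ne_zero : const ≠ 0

namespace AdmissibleContour

variable {N B : ℂ[X]} {u : ℂ}

/-- The parameter set: `[0, 1)` for a loop, `ℝ` otherwise. -/
def dom (Γ : AdmissibleContour N B u) : Set ℝ := {t | Γ.isLoop → t ∈ Set.Ico (0 : ℝ) 1}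

/-- The branch of the weight, continued along the contour. -/
def weight (Γ : AdmissibleContour N B u) (t : ℝ) : ℂ :=
  Γ.const * Complex.exp (∫ s in (0 : ℝ)..t, logDerivAlong N B Γ.path s)

/-- The integrand of `∫_Γ exp (x y) W(y) dy`. -/
def integrand (Γ : AdmissibleContour N B u) (x : ℂ) (t : ℝ) : ℂ :=
  Complex.exp (x * Γ.path t) * Γ.weight t * deriv Γ.path t

/-- `∫_Γ exp (x y) W(y) dy`. -/
def fourierLaplace (Γ : AdmissibleContour N B u) (x : ℂ) : ℂ :=
  ∫ t in Γ.dom, Γ.integrand x t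

end AdmissibleContour

/-- Admissible contours for `W = exp (-V)`, `V' = (A + B') / B`. -/
abbrev PrimalContour (A B : ℂ[X]) (u : ℂ) : Type :=
  AdmissibleContour (-(A + derivative B)) B u

/-- Admissible contours for the dual weight `exp Vhat`, `Vhat' = A / B`. When there are no sectors
at infinity the dual contours go to infinity in the direction opposite to `u`. -/
abbrev DualContour (A B : ℂ[X]) (u : ℂ) : Type :=
  AdmissibleContour A B (-u)

/-- `f_Γ(x) = ∫_Γ exp (x y - V(y)) dy`. -/
def primalSolution {A B : ℂ[X]} {u : ℂ} (Γ : PrimalContour A B u) (x : ℂ) : ℂ :=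
  Γ.fourierLaplace x

/-- `g_Δ(x) = ∫_Δ exp (-x s + Vhat(s)) ds`. -/
def dualSolution {A B : ℂ[X]} {u : ℂ} (Δ : DualContour A B u) (x : ℂ) : ℂ :=
  Δ.fourierLaplace (-x)

/-! ### The concomitant as a double contour integral, and the intersection pairing -/

/-- The kernel `(B(y) - B(s)) (x / (y - s) - 1 / (y - s)²) - (A(y) - A(s) - B'(s)) / (y - s)`,
which is a polynomial in `y, s`; on the diagonal it takes its limit value. -/
def concomitantKernel (A B : ℂ[X]) (x y s : ℂ) : ℂ :=
  open Classical in
  if y = s then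
    x * (derivative B).eval s - (derivative (derivative B)).eval s / 2 - (derivative A).eval s
  else
    (B.eval y - B.eval s) * (x / (y - s) - 1 / (y - s) ^ 2) -
      (A.eval y - A.eval s - (derivative B).eval s) / (y - s)

/-- The integrand of the double contour integral, in the parameters of the two contours. -/
def concomitantIntegrand {A B : ℂ[X]} {u : ℂ} (Γ : PrimalContour A B u) (Δ : DualContour A B u)
    (x : ℂ) (t τ : ℝ) : ℂ :=
  concomitantKernel A B x (Γ.path t) (Δ.path τ) * Γ.integrand x t * Δ.integrand (-x) τ

/-- The bilinear concomitant `∫_Δ ∫_Γ [kernel] exp (x (y - s) - V(y) + Vhat(s)) dy ds`. -/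
def contourConcomitant {A B : ℂ[X]} {u : ℂ} (Γ : PrimalContour A B u) (Δ : DualContour A B u)
    (x : ℂ) : ℂ :=
  ∫ τ in Δ.dom, ∫ t in Γ.dom, concomitantIntegrand Γ Δ x t τ

/-- The pairs of parameters at which the contours meet. -/
def crossings {A B : ℂ[X]} {u : ℂ} (Γ : PrimalContour A B u) (Δ : DualContour A B u) :
    Set (ℝ × ℝ) :=
  {p | p.1 ∈ Γ.dom ∧ p.2 ∈ Δ.dom ∧ Γ.path p.1 = Δ.path p.2}

/-- The determinant of the tangent vectors of `Δ` and `Γ` (in this order). -/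
def tangentDet {A B : ℂ[X]} {u : ℂ} (Γ : PrimalContour A B u) (Δ : DualContour A B u)
    (p : ℝ × ℝ) : ℝ :=
  (starRingEnd ℂ (deriv Δ.path p.2) * deriv Γ.path p.1).im

/-- The contours meet finitely often, and transversally. -/
def InGeneralPosition {A B : ℂ[X]} {u : ℂ} (Γ : PrimalContour A B u) (Δ : DualContour A B u) :
    Prop :=
  (crossings Γ Δ).Finite ∧ ∀ p ∈ crossings Γ Δ, tangentDet Γ Δ p ≠ 0

/-- The (weighted) intersection number of `Δ` and `Γ`: every crossing contributes its sign times the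
value there of the locally constant function `B W What`. -/
def intersectionPairing {A B : ℂ[X]} {u : ℂ} (Γ : PrimalContour A B u) (Δ : DualContour A B u) :
    ℂ :=
  ∑ᶠ p ∈ crossings Γ Δ, ((SignType.sign (tangentDet Γ Δ p) : ℝ) : ℂ) *
    (B.eval (Γ.path p.1) * Γ.weight p.1 * Δ.weight p.2)

end

open Polynomial Filter Topology MeasureTheory

noncomputable section

/-! ### Growth along the ends of a contour -/

/-! Differential equations. If a weight ω has ω'/ω = N/B, then d(B e^{xy} ω) = (N + B' + xB) e^{xy}
ω dy, and the boundary terms vanish at admissible ends. Taking N = -(A + B') gives Lf = 0; taking N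
= A gives the adjoint equation after x ↦ -x (`AdmissibleContour.odeOp_fourierLaplace`,
`adjointOp_eq_odeOp`). The estimate `exists_integrand_bound` keeps a spare factor exp(r|y|), which
yields all moments and differentiation under the integral. Lagrange's identity
`hasDerivAt_concomitant` makes the concomitant of two solutions constant. On e^{xy} and e^{-xs} the
concomitant is a polynomial kernel times e^{x(y-s)} (`concomitantKernel_eq_sum`), so finite sums and
Fubini turn it into the double integral.

Intersection numbers. Off the diagonal the double integrand is ∂_y[B(y)e^{xy}W(y)/(y-s)] e^{-xs}Ŵ(s)
+ e^{xy}W(y) ∂_s[B(s)e^{-xs}Ŵ(s)/(y-s)]. Integration over y kills the first term, so the inner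
integral has an explicit primitive along the dual contour: the boundary expression B e^{-xs}Ŵ times
the Cauchy integral of e^{xy}W over Γ (`hasDerivAt_concomitantPrimitive`). This primitive is
periodic on a loop and tends to 0 at the ends of an arc, hence the double integral is the sum of its
jumps. They occur at the crossings; blowing up a transversal crossing gives the Plemelj jump 2πi ε B
W Ŵ (`tendsto_local_jump`, `integral_inv_sub_inv`). The delicate ends are those of both contours at
the same multiple zero of B. There the exponents of W and Ŵ have opposite leading terms, so the
directions lie in disjoint sectors, the distance is at least a multiple of e^{-τ}, and the decay of
the weight beats the Cauchy integral (`exists_end_separation`,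
`tendsto_concomitantPrimitive_of_end`).

Dual systems. Around one zero of B, explicit paths made of radial pieces and a circular arc have a
diagonal intersection matrix: one pair of paths at a simple zero, m + 1 pairs at a zero of order m +
1. In the case of two lassos the two crossings have opposite signs, but the monodromy of the weight
prevents cancellation (`pairing_of_follows_lasso`). After a small tilt of the plane the zeros of B
have different heights, so the local systems fit into disjoint strips (`exists_root_system`). A
piecewise shear, linear near the zeros, bends the strips at infinity into the required directions
without changing crossings. If deg A > deg B, the bent strips stay, outside a disc, in one cone, and
deg A - deg B further pairs of petals lie outside both cone and disc. Together there are n pairs,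
and rescaling the branches makes the matrix the identity.

Bases. A diagonal invertible pairing forces linear independence. The leading coefficient of the
equation has no zero on the domain, so n independent solutions are a basis, and nondegeneracy
follows by reading off coefficients. -/

theorem norm_le_mul_exp_of_hasDerivAt {J a : ℝ → ℂ} {T c : ℝ}
    (hJ : ∀ t ≥ T, HasDerivAt J (a t * J t) t) (ha : ∀ t ≥ T, (a t).re ≤ -c) :
    ∀ t ≥ T, ‖J t‖ ≤ ‖J T‖ * Real.exp (-c * (t - T)) := by
  -- The logarithmic derivative of ‖J‖² is twice the real part of `a`; the square avoids any
  -- discussion of zeros of J.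
  have hd : ∀ t ≥ T, HasDerivAt (fun s => ‖J s‖ ^ 2 * Real.exp (2 * c * (s - T)))
      (2 * ((a t).re + c) * (‖J t‖ ^ 2 * Real.exp (2 * c * (t - T)))) t := by
    intro t ht
    have h1 := (hJ t ht).norm_sq
    have h2 : HasDerivAt (fun s : ℝ => Real.exp (2 * c * (s - T)))
        (Real.exp (2 * c * (t - T)) * (2 * c * 1)) t :=
      (((hasDerivAt_id t).sub_const T).const_mul (2 * c)).exp
    refine (h1.mul h2).congr_deriv ?_
    have : inner ℝ (J t) (a t * J t) = (a t).re * ‖J t‖ ^ 2 := by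
      rw [Complex.inner, ← Complex.normSq_eq_norm_sq, Complex.normSq_apply]
      simp
      ring
    rw [this]; ring
  have hanti : AntitoneOn (fun s => ‖J s‖ ^ 2 * Real.exp (2 * c * (s - T))) (Set.Ici T) := by
    apply antitoneOn_of_deriv_nonpos (convex_Ici T)
    · exact fun t ht => (hd t ht).continuousAt.continuousWithinAt
    · intro t ht
      rw [interior_Ici] at ht
      exact (hd t (le_of_lt ht)).differentiableAt.differentiableWithinAt
    · intro t ht
      rw [interior_Ici] at ht
      rw [(hd t (le_of_lt ht)).deriv]
      have := ha t (le_of_lt ht)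
      have h3 : 0 ≤ ‖J t‖ ^ 2 * Real.exp (2 * c * (t - T)) := by positivity
      nlinarith
  intro t ht
  have h := hanti (Set.self_mem_Ici) ht ht
  simp only [sub_self, mul_zero, Real.exp_zero, mul_one] at h
  have h4 : (‖J t‖ * Real.exp (c * (t - T))) ^ 2 ≤ ‖J T‖ ^ 2 := by
    calc _ = ‖J t‖ ^ 2 * Real.exp (2 * c * (t - T)) := by
          rw [mul_pow, ← Real.exp_nat_mul]; congr 2; push_cast; ring
      _ ≤ _ := h
  have h5 := le_of_sq_le_sq h4 (norm_nonneg _)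
  calc ‖J t‖ = ‖J t‖ * Real.exp (c * (t - T)) * Real.exp (-c * (t - T)) := by
        rw [mul_assoc, ← Real.exp_add]; simp
    _ ≤ _ := by gcongr

/-- P(y)/y^d is the reversed polynomial evaluated at 1/y, whose value at 0 is the coefficient of
degree d. That coefficient may be zero. -/
theorem tendsto_eval_div_pow {α : Type*} {l : Filter α} (P : ℂ[X]) {d : ℕ} (hd : P.natDegree ≤ d)
    {γ : α → ℂ} (hγ : Tendsto (fun t => ‖γ t‖) l atTop) :
    Tendsto (fun t => P.eval (γ t) / γ t ^ d) l (𝓝 (P.coeff d)) := by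
  have h0 : Tendsto (fun t => (γ t)⁻¹) l (𝓝 0) :=
    tendsto_inv₀_cobounded.comp (tendsto_norm_atTop_iff_cobounded.1 hγ)
  have h1 : Tendsto (fun t => (reflect d P).eval (γ t)⁻¹) l (𝓝 ((reflect d P).eval 0)) :=
    ((reflect d P).continuous.tendsto 0).comp h0
  have h2 : (reflect d P).eval 0 = P.coeff d := by
    rw [← coeff_zero_eq_eval_zero, coeff_reflect, revAt_le (Nat.zero_le d)]; simp
  rw [h2] at h1
  refine h1.congr' ?_
  filter_upwards [hγ.eventually_gt_atTop 0] with t ht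
  have hne : γ t ≠ 0 := norm_pos_iff.1 ht
  let _ : Invertible (γ t) := invertibleOfNonzero hne
  have h3 := eval₂_reflect_mul_pow (RingHom.id ℂ) (γ t) d P hd
  rw [invOf_eq_inv, eval₂_id, eval₂_id] at h3
  rw [eq_div_iff (pow_ne_zero _ hne)]
  simpa [eval₂_eq_eval_map] using h3

/-- The values of `x` for which `exp (x y)` times the weight decays along the admissible ends. -/
def decayDomain (N B : ℂ[X]) (u : ℂ) : Set ℂ :=
  {x | B.natDegree < N.natDegree ∨
    ((x + N.coeff B.natDegree / B.coeff B.natDegree) * u).re < 0}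

theorem tendsto_norm_of_tendsto_div {γ : ℝ → ℂ} {φ : ℂ} (hφ : φ ≠ 0)
    (h : Tendsto (fun t : ℝ => γ t / t) atTop (𝓝 φ)) : Tendsto (fun t => ‖γ t‖) atTop atTop := by
  have h1 : Tendsto (fun t : ℝ => t * ‖γ t / t‖) atTop atTop :=
    tendsto_id.atTop_mul_pos (norm_pos_iff.2 hφ) h.norm
  refine h1.congr' ?_
  filter_upwards [eventually_gt_atTop 0] with t ht
  rw [norm_div, Complex.norm_real, Real.norm_of_nonneg ht.le]
  field_simp

/-! ### Logarithmic derivative of the weight along an end. -/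

section Ends

variable {N B : ℂ[X]} {u x φ b : ℂ} {γ : ℝ → ℂ}

theorem ContourEnd.Admissible.infinity_ne_zero
    (he : (ContourEnd.infinity φ).Admissible N B u) (hu : u ≠ 0) : φ ≠ 0 := by
  rcases he with ⟨_, h⟩ | ⟨_, h⟩
  · rintro rfl
    simp at h
  · exact h ▸ hu

theorem ContourEnd.Admissible.point_ne_zero
    (he : (ContourEnd.point b φ).Admissible N B u) : φ ≠ 0 := by
  rcases he with ⟨h2, h⟩ | ⟨_, h, _⟩
  · rintro rfl
    rw [zero_pow (by omega)] at h
    simp at h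
  · exact h

theorem ContourEnd.Admissible.eval_eq_zero
    (he : (ContourEnd.point b φ).Admissible N B u) : B.eval b = 0 := by
  have : 0 < B.rootMultiplicity b := by
    rcases he with ⟨h2, h⟩ | ⟨h1, h, _⟩ <;> omega
  exact (rootMultiplicity_pos'.1 this).2

/-- N/B behaves like a multiple of y^n, while y ∼ tφ and y' → φ. Only an upper bound on the degree
of N is assumed, so that n = 0 also covers deg N < deg B, with limit 0. -/
theorem tendsto_logDerivAlong_div_pow {n : ℕ} (hB : B ≠ 0) (hN : N.natDegree ≤ B.natDegree + n)
    (hφ : φ ≠ 0) (hγ : (ContourEnd.infinity φ).IsEndOf γ) :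
    Tendsto (fun t : ℝ => logDerivAlong N B γ t / (t : ℂ) ^ n) atTop
      (𝓝 (N.coeff (B.natDegree + n) / B.leadingCoeff * φ ^ (n + 1))) := by
  have hn := tendsto_norm_of_tendsto_div hφ hγ.1
  have h1 := tendsto_eval_div_pow N hN hn
  have h2 := tendsto_eval_div_pow B le_rfl hn
  have h3 := ((h1.div h2 (by simpa using hB)).mul ((hγ.1.pow n).mul hγ.2))
  rw [← pow_succ] at h3
  refine h3.congr' ?_
  filter_upwards [hn.eventually_gt_atTop 0, eventually_gt_atTop 0] with t ht ht0
  have hne : γ t ≠ 0 := norm_pos_iff.1 ht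
  have ht0' : (t : ℂ) ≠ 0 := by exact_mod_cast ht0.ne'
  simp only [logDerivAlong, Pi.div_apply]
  rw [pow_add, div_pow]
  field_simp

/-- If deg N > deg B, the term from N/B grows like a positive power of t and dominates xγ' for every
x. Otherwise both terms converge, and the real part of the limit is negative precisely by the half
plane condition on x. -/
theorem exists_re_rate_infinity (hB : B ≠ 0) (hu : u ≠ 0)
    (he : (ContourEnd.infinity φ).Admissible N B u) (hγ : (ContourEnd.infinity φ).IsEndOf γ)
    (hx : x ∈ decayDomain N B u) :
    ∃ c > 0, ∀ᶠ t in atTop, (x * deriv γ t + logDerivAlong N B γ t).re ≤ -c := by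
  have hφ := he.infinity_ne_zero hu
  rcases he with ⟨hd, h⟩ | ⟨hd, rfl⟩
  · obtain ⟨n, hn⟩ : ∃ n, N.natDegree = B.natDegree + n ∧ 0 < n :=
      ⟨N.natDegree - B.natDegree, by omega, by omega⟩
    have h1 := tendsto_logDerivAlong_div_pow hB hn.1.le hφ hγ
    rw [← hn.1] at h1
    have h0 : Tendsto (fun t : ℝ => ((t : ℂ) ^ n)⁻¹) atTop (𝓝 0) := by
      have : Tendsto (fun t : ℝ => ((t ^ n)⁻¹ : ℝ)) atTop (𝓝 0) :=
        tendsto_inv_atTop_zero.comp (tendsto_pow_atTop hn.2.ne')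
      have h := (Complex.continuous_ofReal.tendsto 0).comp this
      simpa [Function.comp_def] using h
    have h2 : Tendsto (fun t : ℝ => x * deriv γ t * ((t : ℂ) ^ n)⁻¹ +
        logDerivAlong N B γ t / (t : ℂ) ^ n) atTop
        (𝓝 (x * φ * 0 + N.coeff N.natDegree / B.leadingCoeff * φ ^ (n + 1))) :=
      ((hγ.2.const_mul x).mul h0).add h1
    rw [mul_zero, zero_add, coeff_natDegree] at h2
    have hh : N.natDegree - B.natDegree = n := by omega
    rw [hh] at h
    have h3 := (Complex.continuous_re.tendsto _).comp h2
    have h4 := (tendsto_pow_atTop (α := ℝ) hn.2.ne').atTop_mul_neg h h3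
    refine ⟨1, one_pos, ?_⟩
    filter_upwards [h4.eventually_le_atBot (-1), eventually_gt_atTop 0] with t ht ht0
    have ht0' : (t : ℂ) ^ n ≠ 0 := pow_ne_zero _ (by exact_mod_cast ht0.ne')
    have : x * deriv γ t + logDerivAlong N B γ t = ((t ^ n : ℝ) : ℂ) *
        (x * deriv γ t * ((t : ℂ) ^ n)⁻¹ + logDerivAlong N B γ t / (t : ℂ) ^ n) := by
      push_cast; field_simp
    rw [this, Complex.re_ofReal_mul]
    exact ht
  · have h1 := tendsto_logDerivAlong_div_pow (n := 0) hB (by simpa using hd) hφ hγ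
    have hx' : ((x + N.coeff B.natDegree / B.coeff B.natDegree) * φ).re < 0 := by
      rcases hx with h | h
      · omega
      · exact h
    have h2 := (hγ.2.const_mul x).add h1
    have h3 := (Complex.continuous_re.tendsto _).comp h2
    have h4 : (x * φ + N.coeff (B.natDegree + 0) / B.leadingCoeff * φ ^ (0 + 1)) =
        (x + N.coeff B.natDegree / B.coeff B.natDegree) * φ := by
      simp; ring
    rw [h4] at h3
    obtain ⟨c, hc0, hc⟩ : ∃ c > 0, ((x + N.coeff B.natDegree / B.coeff B.natDegree) * φ).re < -c :=
      ⟨-((x + N.coeff B.natDegree / B.coeff B.natDegree) * φ).re / 2, by linarith, by linarith⟩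
    refine ⟨c, hc0, ?_⟩
    filter_upwards [h3.eventually_lt_const hc] with t ht
    simpa using ht.le

theorem ContourEnd.IsEndOf.tendsto_point (hγ : (ContourEnd.point b φ).IsEndOf γ) :
    Tendsto γ atTop (𝓝 b) := by
  have h0 : Tendsto (fun t : ℝ => ((Real.exp (-t) : ℝ) : ℂ)) atTop (𝓝 0) := by
    have := (Complex.continuous_ofReal.tendsto 0).comp
      (Real.tendsto_exp_atBot.comp tendsto_neg_atTop_atBot)
    simpa [Function.comp_def] using this
  have h := (h0.mul hγ.1).add_const b
  rw [zero_mul, zero_add] at h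
  refine h.congr fun t => ?_
  rw [← mul_assoc, ← Complex.ofReal_mul, ← Real.exp_add]
  simp

theorem ContourEnd.IsEndOf.tendsto_deriv_point (hγ : (ContourEnd.point b φ).IsEndOf γ) :
    Tendsto (deriv γ) atTop (𝓝 0) := by
  have h0 : Tendsto (fun t : ℝ => ((Real.exp (-t) : ℝ) : ℂ)) atTop (𝓝 0) := by
    have := (Complex.continuous_ofReal.tendsto 0).comp
      (Real.tendsto_exp_atBot.comp tendsto_neg_atTop_atBot)
    simpa [Function.comp_def] using this
  have h := (h0.mul hγ.2)
  rw [zero_mul] at h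
  refine h.congr fun t => ?_
  rw [← mul_assoc, ← Complex.ofReal_mul, ← Real.exp_add]
  simp

/-- Near a zero of order m + 1, N/B is of size (y - b)^{-(m+1)} and γ' is of size y - b, which
leaves e^{mt}. The minus sign is that of γ' ∼ -e^{-t}φ. -/
theorem tendsto_logDerivAlong_point (hB : B ≠ 0) {m : ℕ} (hm : B.rootMultiplicity b = m + 1)
    (hφ : φ ≠ 0) (hγ : (ContourEnd.point b φ).IsEndOf γ) :
    Tendsto (fun t : ℝ => ((Real.exp (-(m * t)) : ℝ) : ℂ) * logDerivAlong N B γ t) atTop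
      (𝓝 (-(N.eval b / (taylor b B).coeff (m + 1) / φ ^ m))) := by
  obtain ⟨B1, hB1, hnd⟩ := exists_eq_pow_rootMultiplicity_mul_and_not_dvd B hB b
  rw [hm] at hB1
  have hb1 : B1.eval b ≠ 0 := fun h => hnd (dvd_iff_isRoot.2 h)
  have hco : (taylor b B).coeff (m + 1) = B1.eval b := by
    conv_lhs => rw [hB1]
    simp [taylor_mul, taylor_pow, coeff_X_pow_mul', taylor_coeff_zero]
  have hlim := hγ.tendsto_point
  have h1 := ((N.continuous.tendsto b).comp hlim).div ((B1.continuous.tendsto b).comp hlim) hb1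
  have h2 := hγ.2.div (hγ.1.pow (m + 1)) (pow_ne_zero _ hφ)
  have h3 := h1.mul h2
  rw [hco]
  have h5 : N.eval b / B1.eval b * (-φ / φ ^ (m + 1)) = -(N.eval b / B1.eval b / φ ^ m) := by
    rw [pow_succ]; field_simp
  rw [h5] at h3
  refine h3.congr' ?_
  have hne : ∀ᶠ t : ℝ in atTop, (Real.exp t : ℂ) * (γ t - b) ≠ 0 := hγ.1.eventually_ne hφ
  filter_upwards [hne] with t ht
  have hg : γ t - b ≠ 0 := right_ne_zero_of_mul ht
  have he : (Real.exp t : ℂ) ≠ 0 := by exact_mod_cast (Real.exp_pos t).ne'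
  have he2 : ((Real.exp (-(m * t)) : ℝ) : ℂ) = ((Real.exp t : ℂ) ^ m)⁻¹ := by
    rw [Real.exp_neg, Real.exp_nat_mul]; push_cast; rfl
  simp only [logDerivAlong, Function.comp_apply, Pi.div_apply]
  rw [he2]
  conv_rhs => rw [hB1]
  simp only [eval_mul, eval_pow, eval_sub, eval_X, eval_C]
  by_cases hz : B1.eval (γ t) = 0
  · simp [hz]
  · rw [pow_succ, pow_succ, mul_pow]
    field_simp

/-- For m ≥ 1 the real part tends to -∞ like -e^{mt}, so the weight decays faster than any
exponential of t. -/
theorem eventually_re_le_of_multiple (hB : B ≠ 0) (hm : 2 ≤ B.rootMultiplicity b)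
    (he : (ContourEnd.point b φ).Admissible N B u) (hγ : (ContourEnd.point b φ).IsEndOf γ)
    (K : ℝ) : ∀ᶠ t in atTop, (x * deriv γ t + logDerivAlong N B γ t).re ≤ -K := by
  have hφ := he.point_ne_zero
  rcases he with ⟨_, h⟩ | ⟨h1, _⟩
  · obtain ⟨m, hm'⟩ : ∃ m, B.rootMultiplicity b = m + 1 ∧ 0 < m :=
      ⟨B.rootMultiplicity b - 1, by omega, by omega⟩
    have h2 := tendsto_logDerivAlong_point (N := N) hB hm'.1 hφ hγ
    rw [hm'.1, Nat.add_sub_cancel] at h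
    have h3 := (Complex.continuous_re.tendsto _).comp h2
    have hpos : Tendsto (fun t : ℝ => Real.exp (m * t)) atTop atTop :=
      Real.tendsto_exp_atTop.comp (tendsto_id.const_mul_atTop (by exact_mod_cast hm'.2))
    have h4 := hpos.atTop_mul_neg (by simpa using h) h3
    have h5 := ((Complex.continuous_re.tendsto _).comp (hγ.tendsto_deriv_point.const_mul x))
    have h6 : ∀ᶠ t in atTop, (x * deriv γ t).re < 1 := by
      apply h5.eventually_lt_const; simp
    filter_upwards [h4.eventually_le_atBot (-K - 1), h6] with t ht ht6
    rw [Complex.add_re]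
    simp only [Function.comp_apply, Complex.re_ofReal_mul] at ht
    rw [← mul_assoc, ← Real.exp_add] at ht
    simp at ht
    simp only [Complex.mul_re] at ht6 ⊢
    linarith
  · omega

/-- Here the limit of the logarithmic derivative is -k ≤ 0. The weight need not decay, but it grows
more slowly than any exponential e^{ct}, which suffices since γ' and B(γ) decay like e^{-t}. -/
theorem eventually_re_le_of_simple (hB : B ≠ 0) (hm : B.rootMultiplicity b = 1)
    (he : (ContourEnd.point b φ).Admissible N B u) (hγ : (ContourEnd.point b φ).IsEndOf γ)
    {c : ℝ} (hc : 0 < c) :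
    ∀ᶠ t in atTop, (x * deriv γ t + logDerivAlong N B γ t).re ≤ c := by
  have hφ := he.point_ne_zero
  rcases he with ⟨h1, h⟩ | ⟨h1, _, k, hk⟩
  · omega
  · have h2 := tendsto_logDerivAlong_point (N := N) (m := 0) hB hm hφ hγ
    simp only [CharP.cast_eq_zero, zero_mul, neg_zero, Real.exp_zero, Complex.ofReal_one, one_mul,
      zero_add, pow_zero, div_one, taylor_coeff_one] at h2
    have h3 := (Complex.continuous_re.tendsto _).comp ((hγ.tendsto_deriv_point.const_mul x).add h2)
    refine (h3.eventually_lt_const ?_).mono fun t ht => ht.le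
    have hd : (derivative B).eval b ≠ 0 := by
      intro h0
      have hr : B.IsRoot b := by
        have : 0 < B.rootMultiplicity b := by omega
        exact (rootMultiplicity_pos'.1 this).2
      have := (one_lt_rootMultiplicity_iff_isRoot hB).2 ⟨hr, h0⟩
      omega
    rw [hk, mul_div_assoc, div_self hd]
    simp
    have : (0 : ℝ) ≤ k := Nat.cast_nonneg k
    linarith

end Ends

/-- Polynomial factors cost an arbitrarily small exponential rate, to be paid out of the decay of
the integrand. -/
theorem exists_norm_eval_le_exp (P : ℂ[X]) {r : ℝ} (hr : 0 < r) :
    ∃ C, 0 ≤ C ∧ ∀ y : ℂ, ‖P.eval y‖ ≤ C * Real.exp (r * ‖y‖) := by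
  induction P using Polynomial.induction_on' with
  | add p q hp hq =>
    obtain ⟨C, hC0, hC⟩ := hp
    obtain ⟨D, hD0, hD⟩ := hq
    refine ⟨C + D, by positivity, fun y => ?_⟩
    rw [eval_add, add_mul]
    exact (norm_add_le _ _).trans (add_le_add (hC y) (hD y))
  | monomial n a =>
    refine ⟨‖a‖ * (n.factorial / r ^ n), by positivity, fun y => ?_⟩
    have h := Real.pow_div_factorial_le_exp (r * ‖y‖) (by positivity) n
    rw [eval_monomial, norm_mul, norm_pow, mul_assoc]
    gcongr
    rw [mul_pow, div_le_iff₀ (by positivity)] at h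
    rw [div_mul_eq_mul_div, le_div_iff₀ (by positivity)]
    linarith

/-! ### Exponential bounds for the integrand and the boundary term. -/

section Ends

variable {N B : ℂ[X]} {u x φ b : ℂ} {γ W : ℝ → ℂ}

theorem hasDerivAt_exp_mul_weight (hγ : ContDiff ℝ 1 γ)
    (hW : ∀ t, HasDerivAt W (logDerivAlong N B γ t * W t) t) (x : ℂ) (t : ℝ) :
    HasDerivAt (fun t => Complex.exp (x * γ t) * W t)
      ((x * deriv γ t + logDerivAlong N B γ t) * (Complex.exp (x * γ t) * W t)) t := by
  have h := (hγ.differentiable one_ne_zero t).hasDerivAt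
  refine ((h.const_mul x).cexp.mul (hW t)).congr_deriv ?_
  ring

theorem exists_exp_bound (hγ : ContDiff ℝ 1 γ)
    (hW : ∀ t, HasDerivAt W (logDerivAlong N B γ t * W t) t) {c : ℝ}
    (h : ∀ᶠ t in atTop, (x * deriv γ t + logDerivAlong N B γ t).re ≤ -c) :
    ∃ C, 0 ≤ C ∧ ∀ᶠ t in atTop, ‖Complex.exp (x * γ t) * W t‖ ≤ C * Real.exp (-c * t) := by
  obtain ⟨T, hT⟩ := eventually_atTop.1 h
  refine ⟨‖Complex.exp (x * γ T) * W T‖ * Real.exp (c * T), by positivity, ?_⟩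
  filter_upwards [eventually_ge_atTop T] with t ht
  refine (norm_le_mul_exp_of_hasDerivAt
    (fun t _ => hasDerivAt_exp_mul_weight hγ hW x t) hT t ht).trans (le_of_eq ?_)
  rw [mul_assoc, ← Real.exp_add]
  congr 2; ring

theorem ContourEnd.IsEndOf.exists_point_bounds (hγ : (ContourEnd.point b φ).IsEndOf γ) :
    ∃ C, 0 < C ∧ ∀ᶠ t in atTop, ‖γ t‖ ≤ C ∧ ‖γ t - b‖ ≤ C * Real.exp (-t) ∧
      ‖deriv γ t‖ ≤ C * Real.exp (-t) := by
  refine ⟨(‖b‖ + 1) + (‖φ‖ + 1), by positivity, ?_⟩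
  filter_upwards [hγ.tendsto_point.norm.eventually_lt_const (lt_add_one _),
    hγ.1.norm.eventually_lt_const (lt_add_one _),
    hγ.2.norm.eventually_lt_const (lt_add_one _)] with t h1 h2 h3
  rw [norm_mul, Complex.norm_real, Real.norm_of_nonneg (Real.exp_pos _).le] at h2 h3
  rw [norm_neg] at h3
  have e : Real.exp t * Real.exp (-t) = 1 := by rw [← Real.exp_add]; simp
  have e0 := Real.exp_pos (-t)
  have key : ∀ z : ℝ, Real.exp t * z < ‖φ‖ + 1 →
      z ≤ ((‖b‖ + 1) + (‖φ‖ + 1)) * Real.exp (-t) := by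
    intro z hz
    have : z = Real.exp t * z * Real.exp (-t) := by
      rw [mul_right_comm, e, one_mul]
    rw [this]
    gcongr
    linarith [norm_nonneg b]
  exact ⟨by linarith [norm_nonneg φ], key _ h2, key _ h3⟩

theorem exists_norm_le_mul_of_tendsto_div (h : Tendsto (fun t : ℝ => γ t / t) atTop (𝓝 φ)) :
    ∃ C, 0 < C ∧ ∀ᶠ t : ℝ in atTop, ‖γ t‖ ≤ C * t := by
  refine ⟨‖φ‖ + 1, by positivity, ?_⟩
  filter_upwards [h.norm.eventually_lt_const (lt_add_one _), eventually_gt_atTop 0] with t h1 h0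
  rw [norm_div, Complex.norm_real, Real.norm_of_nonneg h0.le, div_lt_iff₀ h0] at h1
  exact h1.le

/-- The factor exp(r‖γ‖) is the margin needed later to differentiate in x and to multiply by powers
of y; at infinity half of the available decay is given up for it. -/
theorem exists_integrand_bound (hB : B ≠ 0) (hu : u ≠ 0) (hγ : ContDiff ℝ 1 γ)
    (hW : ∀ t, HasDerivAt W (logDerivAlong N B γ t * W t) t) {e : ContourEnd}
    (he : e.Admissible N B u) (hend : e.IsEndOf γ) (hx : x ∈ decayDomain N B u) :
    ∃ r > 0, ∃ c > 0, ∃ C, ∀ᶠ t in atTop,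
      Real.exp (r * ‖γ t‖) * ‖Complex.exp (x * γ t) * W t * deriv γ t‖ ≤ C * Real.exp (-c * t) := by
  rcases e with φ | ⟨b, φ⟩
  · obtain ⟨c, hc, h⟩ := exists_re_rate_infinity hB hu he hend hx
    obtain ⟨C, hC0, hC⟩ := exists_exp_bound hγ hW h
    obtain ⟨D, hD0, hD⟩ := exists_norm_le_mul_of_tendsto_div hend.1
    -- With ‖γ t‖ ≤ D t, the factor exp(c‖γ‖/(2D)) is at most exp(ct/2).
    refine ⟨c / (2 * D), by positivity, c / 2, by positivity, C * (‖φ‖ + 1), ?_⟩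
    filter_upwards [hC, hD, hend.2.norm.eventually_lt_const (lt_add_one _)] with t h1 h2 h3
    rw [norm_mul]
    calc _ ≤ Real.exp (c / (2 * D) * (D * t)) * (C * Real.exp (-c * t) * (‖φ‖ + 1)) := by
          gcongr
      _ = C * (‖φ‖ + 1) * (Real.exp (c / (2 * D) * (D * t)) * Real.exp (-c * t)) := by ring
      _ = _ := by
          rw [← Real.exp_add]; congr 2; field_simp; ring
  -- A growth rate of 1/2 serves both kinds of zeros: the factor γ' = O(e^{-t}) turns it into decay
  -- at rate 1/2.
  · have h : ∀ᶠ t in atTop, (x * deriv γ t + logDerivAlong N B γ t).re ≤ -(-(1 / 2)) := by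
      have he' := he
      rcases he' with ⟨h2, _⟩ | ⟨h1, _⟩
      · exact eventually_re_le_of_multiple hB h2 he hend _
      · rw [neg_neg]
        exact eventually_re_le_of_simple hB h1 he hend (by norm_num)
    obtain ⟨C, hC0, hC⟩ := exists_exp_bound hγ hW h
    obtain ⟨D, hD0, hD⟩ := hend.exists_point_bounds
    refine ⟨1, one_pos, 1 / 2, by norm_num, Real.exp D * C * D, ?_⟩
    filter_upwards [hC, hD] with t h1 h2
    rw [norm_mul, one_mul]
    calc _ ≤ Real.exp D * (C * Real.exp (- -(1/2) * t) * (D * Real.exp (-t))) := by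
          gcongr
          exacts [h2.1, h2.2.2]
      _ = Real.exp D * C * D * (Real.exp (- -(1/2) * t) * Real.exp (-t)) := by ring
      _ = _ := by
          rw [← Real.exp_add]; congr 2; ring

theorem tendsto_eval_mul_div_of_infinity (hB : B ≠ 0) (hu : u ≠ 0) (hγ : ContDiff ℝ 1 γ)
    (hW : ∀ t, HasDerivAt W (logDerivAlong N B γ t * W t) t)
    (he : (ContourEnd.infinity φ).Admissible N B u) (hend : (ContourEnd.infinity φ).IsEndOf γ)
    (hx : x ∈ decayDomain N B u) :
    Tendsto (fun t => B.eval (γ t) * (Complex.exp (x * γ t) * W t)) atTop (𝓝 0) := by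
  obtain ⟨c, hc, h⟩ := exists_re_rate_infinity hB hu he hend hx
  obtain ⟨C, hC0, hC⟩ := exists_exp_bound hγ hW h
  obtain ⟨D, hD0, hD⟩ := exists_norm_le_mul_of_tendsto_div hend.1
  obtain ⟨E, hE0, hE⟩ := exists_norm_eval_le_exp B (r := c / (2 * D)) (by positivity)
  have hlim : Tendsto (fun t : ℝ => E * C * Real.exp (-(c / 2) * t)) atTop (𝓝 0) := by
    have := (Real.tendsto_exp_atBot.comp
      (tendsto_id.const_mul_atTop_of_neg (show -(c / 2) < 0 by linarith))).const_mul (E * C)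
    simpa [Function.comp_def] using this
  refine squeeze_zero_norm' ?_ hlim
  filter_upwards [hC, hD] with t h1 h2
  rw [norm_mul]
  calc _ ≤ (E * Real.exp (c / (2 * D) * ‖γ t‖)) * (C * Real.exp (-c * t)) := by
        gcongr; exact hE _
    _ ≤ (E * Real.exp (c / (2 * D) * (D * t))) * (C * Real.exp (-c * t)) := by gcongr
    _ = E * C * (Real.exp (c / (2 * D) * (D * t)) * Real.exp (-c * t)) := by ring
    _ = _ := by
        rw [← Real.exp_add]; congr 2; field_simp; ring

theorem exists_norm_eval_le_of_point (hBb : B.eval b = 0)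
    (hend : (ContourEnd.point b φ).IsEndOf γ) :
    ∃ E, 0 ≤ E ∧ ∀ᶠ t in atTop, ‖B.eval (γ t)‖ ≤ E * Real.exp (-t) := by
  obtain ⟨D, hD0, hD⟩ := hend.exists_point_bounds
  obtain ⟨Q, hQ⟩ := dvd_iff_isRoot.2 hBb
  refine ⟨D * (‖Q.eval b‖ + 1), by positivity, ?_⟩
  have := ((Q.continuous.tendsto b).comp hend.tendsto_point).norm.eventually_lt_const (lt_add_one _)
  filter_upwards [hD, this] with t h1 h2
  rw [hQ, eval_mul, norm_mul]
  simp only [eval_sub, eval_X, eval_C]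
  calc _ ≤ (D * Real.exp (-t)) * (‖Q.eval b‖ + 1) := by
        gcongr
        · exact h1.2.1
        · exact h2.le
    _ = _ := by ring

theorem tendsto_eval_mul_of_end (hB : B ≠ 0) (hu : u ≠ 0) (hγ : ContDiff ℝ 1 γ)
    (hW : ∀ t, HasDerivAt W (logDerivAlong N B γ t * W t) t) {e : ContourEnd}
    (he : e.Admissible N B u) (hend : e.IsEndOf γ) (hx : x ∈ decayDomain N B u) :
    Tendsto (fun t => B.eval (γ t) * (Complex.exp (x * γ t) * W t)) atTop (𝓝 0) := by
  rcases e with φ | ⟨b, φ⟩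
  · exact tendsto_eval_mul_div_of_infinity hB hu hγ hW he hend hx
  · have h : ∀ᶠ t in atTop, (x * deriv γ t + logDerivAlong N B γ t).re ≤ -(-(1 / 2)) := by
      have he' := he
      rcases he' with ⟨h2, _⟩ | ⟨h1, _⟩
      · exact eventually_re_le_of_multiple hB h2 he hend _
      · rw [neg_neg]
        exact eventually_re_le_of_simple hB h1 he hend (by norm_num)
    obtain ⟨C, hC0, hC⟩ := exists_exp_bound hγ hW h
    obtain ⟨E, hE0, hE⟩ := exists_norm_eval_le_of_point he.eval_eq_zero hend
    have hlim : Tendsto (fun t : ℝ => E * C * Real.exp (-(1 / 2) * t)) atTop (𝓝 0) := by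
      have := (Real.tendsto_exp_atBot.comp
        (tendsto_id.const_mul_atTop_of_neg (show -(1 / 2 : ℝ) < 0 by norm_num))).const_mul (E * C)
      simpa [Function.comp_def] using this
    refine squeeze_zero_norm' ?_ hlim
    filter_upwards [hC, hE] with t h1 h2
    rw [norm_mul]
    calc _ ≤ (E * Real.exp (-t)) * (C * Real.exp (- -(1 / 2) * t)) := by gcongr
      _ = E * C * (Real.exp (-t) * Real.exp (- -(1 / 2) * t)) := by ring
      _ = _ := by
          rw [← Real.exp_add]; congr 2; ring

/-- The division by e^{-t} is needed because the Cauchy integral of another contour ending at the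
same multiple zero is only known to be O(e^t) there. -/
theorem tendsto_eval_mul_div_of_multiple (hB : B ≠ 0) (hγ : ContDiff ℝ 1 γ)
    (hW : ∀ t, HasDerivAt W (logDerivAlong N B γ t * W t) t)
    (he : (ContourEnd.point b φ).Admissible N B u) (hend : (ContourEnd.point b φ).IsEndOf γ)
    (hm : 2 ≤ B.rootMultiplicity b) :
    Tendsto (fun t : ℝ => ‖B.eval (γ t) * (Complex.exp (x * γ t) * W t)‖ / Real.exp (-t))
      atTop (𝓝 0) := by
  obtain ⟨C, hC0, hC⟩ := exists_exp_bound hγ hW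
    (eventually_re_le_of_multiple (x := x) hB hm he hend 1)
  obtain ⟨E, hE0, hE⟩ := exists_norm_eval_le_of_point he.eval_eq_zero hend
  have hlim : Tendsto (fun t : ℝ => E * C * Real.exp (-t)) atTop (𝓝 0) := by
    have := (Real.tendsto_exp_atBot.comp tendsto_neg_atTop_atBot).const_mul (E * C)
    simpa [Function.comp_def] using this
  refine squeeze_zero' (Eventually.of_forall fun t => by positivity) ?_ hlim
  filter_upwards [hC, hE] with t h1 h2
  rw [norm_mul, div_le_iff₀ (Real.exp_pos _)]
  calc _ ≤ (E * Real.exp (-t)) * (C * Real.exp (-1 * t)) := by gcongr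
    _ = _ := by ring_nf

end Ends

theorem integrable_of_exp_bounds {f : ℝ → ℝ} (hf : Continuous f) {c c' C C' : ℝ} (hc : 0 < c)
    (hc' : 0 < c') (h : ∀ᶠ t in atTop, ‖f t‖ ≤ C * Real.exp (-c * t))
    (h' : ∀ᶠ t in atTop, ‖f (-t)‖ ≤ C' * Real.exp (-c' * t)) : Integrable f := by
  have key : ∀ (g : ℝ → ℝ) (_ : Continuous g) (c C : ℝ) (_ : 0 < c)
      (_ : ∀ᶠ t in atTop, ‖g t‖ ≤ C * Real.exp (-c * t)), IntegrableOn g (Set.Ioi 0) := by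
    intro g hg c C hc h
    refine integrable_of_isBigO_exp_neg hc hg.continuousOn ?_
    refine Asymptotics.IsBigO.of_bound C ?_
    filter_upwards [h] with t ht
    rwa [Real.norm_of_nonneg (Real.exp_pos _).le]
  have h1 := key f hf c C hc h
  have h2 := key (fun t => f (-t)) (hf.comp continuous_neg) c' C' hc' h'
  have h3 : IntegrableOn f (Set.Iio 0) := by
    have := (Measure.measurePreserving_neg (volume : Measure ℝ)).integrableOn_comp_preimage
      (Homeomorph.neg ℝ).measurableEmbedding (f := f) (s := Set.Iio 0)
    rw [← this]
    simpa [Function.comp_def] using h2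
  have h4 : IntegrableOn f (Set.Iio 0 ∪ Set.Icc 0 0 ∪ Set.Ioi 0) :=
    (h3.union (hf.integrableOn_Icc)).union h1
  rw [← integrableOn_univ]
  convert h4
  ext t
  rcases lt_trichotomy t 0 with h | h | h <;> simp [h]

/-! ### Continuation of the weight and absolute convergence on a contour. -/

namespace AdmissibleContour

variable {N B : ℂ[X]} {u : ℂ} (Γ : AdmissibleContour N B u)

theorem continuous_path : Continuous Γ.path := Γ.contDiff.continuous

theorem continuous_deriv : Continuous (deriv Γ.path) := Γ.contDiff.continuous_deriv_one

theorem hasDerivAt_path (t : ℝ) : HasDerivAt Γ.path (deriv Γ.path t) t :=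
  (Γ.contDiff.differentiable one_ne_zero t).hasDerivAt

theorem ne_zero (Γ : AdmissibleContour N B u) : B ≠ 0 := by
  rintro rfl
  exact Γ.avoids 0 (by simp)

theorem continuous_logDerivAlong : Continuous (logDerivAlong N B Γ.path) :=
  ((N.continuous.comp Γ.continuous_path).div (B.continuous.comp Γ.continuous_path) Γ.avoids).mul
    Γ.continuous_deriv

theorem hasDerivAt_weight (t : ℝ) :
    HasDerivAt Γ.weight (logDerivAlong N B Γ.path t * Γ.weight t) t := by
  have h := intervalIntegral.integral_hasDerivAt_right
    (Γ.continuous_logDerivAlong.intervalIntegrable 0 t)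
    (Γ.continuous_logDerivAlong.stronglyMeasurableAtFilter _ _)
    Γ.continuous_logDerivAlong.continuousAt
  refine (h.cexp.const_mul Γ.const).congr_deriv ?_
  simp only [weight]; ring

theorem continuous_weight : Continuous Γ.weight :=
  continuous_iff_continuousAt.2 fun t => (Γ.hasDerivAt_weight t).continuousAt

theorem weight_ne_zero (t : ℝ) : Γ.weight t ≠ 0 :=
  mul_ne_zero Γ.const_ne_zero (Complex.exp_ne_zero _)

theorem contDiff_reverse : ContDiff ℝ 1 (fun t => Γ.path (-t)) :=
  Γ.contDiff.comp contDiff_neg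

theorem hasDerivAt_weight_reverse (t : ℝ) :
    HasDerivAt (fun t => Γ.weight (-t))
      (logDerivAlong N B (fun t => Γ.path (-t)) t * Γ.weight (-t)) t := by
  refine ((Γ.hasDerivAt_weight (-t)).scomp t (hasDerivAt_neg t)).congr_deriv ?_
  simp [logDerivAlong, deriv_comp_neg]

theorem periodic_deriv (h : Γ.isLoop) : Function.Periodic (deriv Γ.path) 1 := by
  intro t
  have h1 := (Γ.loop h).1
  have : (fun s => Γ.path (s + 1)) = Γ.path := funext h1
  conv_rhs => rw [← this]
  rw [deriv_comp_add_const]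

theorem periodic_weight (h : Γ.isLoop) : Function.Periodic Γ.weight 1 := by
  have hp : Function.Periodic (logDerivAlong N B Γ.path) 1 := fun t => by
    simp only [logDerivAlong, (Γ.loop h).1 t, Γ.periodic_deriv h t]
  intro t
  have hi : ∀ a b : ℝ, IntervalIntegrable (logDerivAlong N B Γ.path) volume a b :=
    fun a b => Γ.continuous_logDerivAlong.intervalIntegrable a b
  have h1 := intervalIntegral.integral_add_adjacent_intervals (hi 0 t) (hi t (t + 1))
  have h2 := hp.intervalIntegral_add_eq t 0
  rw [zero_add] at h2
  simp only [weight]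
  rw [← h1, h2, Complex.exp_add, (Γ.loop h).2, mul_one]

theorem periodic_integrand (h : Γ.isLoop) (x : ℂ) : Function.Periodic (Γ.integrand x) 1 := fun t => by
  simp only [integrand, (Γ.loop h).1 t, Γ.periodic_deriv h t, Γ.periodic_weight h t]

theorem continuous_integrand (x : ℂ) : Continuous (Γ.integrand x) :=
  ((Complex.continuous_exp.comp (continuous_const.mul Γ.continuous_path)).mul
    Γ.continuous_weight).mul Γ.continuous_deriv

theorem dom_of_loop (h : Γ.isLoop) : Γ.dom = Set.Ico 0 1 := by
  ext t; simp [dom, h]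

theorem dom_of_arc (h : ¬ Γ.isLoop) : Γ.dom = Set.univ := by
  ext t; simp [dom, h]

theorem measurableSet_dom : MeasurableSet Γ.dom := by
  by_cases h : Γ.isLoop
  · rw [Γ.dom_of_loop h]; exact measurableSet_Ico
  · rw [Γ.dom_of_arc h]; exact MeasurableSet.univ

theorem exists_integrable_majorant (hu : u ≠ 0) {x : ℂ} (hx : x ∈ decayDomain N B u) :
    ∃ r > 0, IntegrableOn (fun t => Real.exp (r * ‖Γ.path t‖) * ‖Γ.integrand x t‖) Γ.dom := by
  have hcont : ∀ r : ℝ, Continuous fun t => Real.exp (r * ‖Γ.path t‖) * ‖Γ.integrand x t‖ :=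
    fun r => (Real.continuous_exp.comp (continuous_const.mul Γ.continuous_path.norm)).mul
      (Γ.continuous_integrand x).norm
  by_cases h : Γ.isLoop
  · rw [Γ.dom_of_loop h]
    exact ⟨1, one_pos, (hcont 1).integrableOn_Icc.mono_set Set.Ico_subset_Icc_self⟩
  · rw [Γ.dom_of_arc h, ]
    obtain ⟨e₀, e₁, h0, h1, he0, he1⟩ := Γ.arc h
    obtain ⟨r, hr, c, hc, C, hC⟩ := exists_integrand_bound Γ.ne_zero hu Γ.contDiff
      Γ.hasDerivAt_weight h1 he1 hx
    obtain ⟨r', hr', c', hc', C', hC'⟩ := exists_integrand_bound Γ.ne_zero hu Γ.contDiff_reverse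
      Γ.hasDerivAt_weight_reverse h0 he0 hx
    refine ⟨min r r', lt_min hr hr', ?_⟩
    rw [integrableOn_univ]
    refine integrable_of_exp_bounds (hcont _) hc hc' (C := C) (C' := C') ?_ ?_
    · filter_upwards [hC] with t ht
      rw [Real.norm_of_nonneg (by positivity)]
      refine le_trans ?_ ht
      gcongr
      · exact min_le_left _ _
      · exact le_rfl
    · filter_upwards [hC'] with t ht
      rw [Real.norm_of_nonneg (by positivity)]
      refine le_trans ?_ ht
      rw [deriv_comp_neg, mul_neg, norm_neg]
      gcongr
      · exact min_le_right _ _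
      · exact le_rfl

theorem tendsto_boundary (hu : u ≠ 0) (h : ¬ Γ.isLoop) {x : ℂ} (hx : x ∈ decayDomain N B u) :
    Tendsto (fun t => B.eval (Γ.path t) * (Complex.exp (x * Γ.path t) * Γ.weight t)) atTop (𝓝 0) ∧
    Tendsto (fun t => B.eval (Γ.path t) * (Complex.exp (x * Γ.path t) * Γ.weight t)) atBot
      (𝓝 0) := by
  obtain ⟨e₀, e₁, h0, h1, he0, he1⟩ := Γ.arc h
  refine ⟨tendsto_eval_mul_of_end Γ.ne_zero hu Γ.contDiff Γ.hasDerivAt_weight h1 he1 hx, ?_⟩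
  have := (tendsto_eval_mul_of_end Γ.ne_zero hu Γ.contDiff_reverse
      Γ.hasDerivAt_weight_reverse h0 he0 hx).comp tendsto_neg_atBot_atTop
  simpa [Function.comp_def] using this

/-- Treats loops and arcs at once: a total derivative integrates to zero because its primitive
either closes up or vanishes at both ends. -/
theorem setIntegral_dom_eq_zero {F F' : ℝ → ℂ} (hF : ∀ t, HasDerivAt F (F' t) t)
    (hint : IntegrableOn F' Γ.dom) (hl : Γ.isLoop → F 1 = F 0)
    (ha : ¬ Γ.isLoop → Tendsto F atTop (𝓝 0) ∧ Tendsto F atBot (𝓝 0)) :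
    ∫ t in Γ.dom, F' t = 0 := by
  by_cases h : Γ.isLoop
  · rw [Γ.dom_of_loop h] at hint ⊢
    rw [integral_Ico_eq_integral_Ioc, ← intervalIntegral.integral_of_le zero_le_one,
      intervalIntegral.integral_eq_sub_of_hasDerivAt (fun t _ => hF t), hl h, sub_self]
    rw [intervalIntegrable_iff_integrableOn_Ico_of_le zero_le_one]
    exact hint
  · rw [Γ.dom_of_arc h] at hint ⊢
    rw [setIntegral_univ, integral_of_hasDerivAt_of_tendsto hF
      (integrableOn_univ.1 hint) (ha h).2 (ha h).1, sub_self]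

end AdmissibleContour

theorem isOpen_decayDomain (N B : ℂ[X]) (u : ℂ) : IsOpen (decayDomain N B u) := by
  by_cases h : B.natDegree < N.natDegree
  · have : decayDomain N B u = Set.univ := by ext x; simp [decayDomain, h]
    rw [this]; exact isOpen_univ
  · have : decayDomain N B u =
        {x | ((x + N.coeff B.natDegree / B.coeff B.natDegree) * u).re < 0} := by
      ext x; simp [decayDomain, h]
    rw [this]
    exact isOpen_lt (by fun_prop) continuous_const

/-- On the disc of radius r/2 around x, half of the margin exp(r‖γ‖) bounds the change of exp(xγ)
and the other half bounds the factor γ produced by differentiation. -/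
theorem hasDerivAt_integral_exp_mul {μ : Measure ℝ} {γ ω : ℝ → ℂ} (hγ : Continuous γ)
    (hω : Continuous ω) {x : ℂ} {r : ℝ} (hr : 0 < r)
    (h : Integrable (fun t => Real.exp (r * ‖γ t‖) * ‖Complex.exp (x * γ t) * ω t‖) μ) :
    HasDerivAt (fun x => ∫ t, Complex.exp (x * γ t) * ω t ∂μ)
      (∫ t, γ t * (Complex.exp (x * γ t) * ω t) ∂μ) x := by
  refine (hasDerivAt_integral_of_dominated_loc_of_deriv_le (F := fun x t => Complex.exp (x * γ t) * ω t)
    (F' := fun x t => γ t * (Complex.exp (x * γ t) * ω t))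
    (bound := fun t => 2 / r * (Real.exp (r * ‖γ t‖) * ‖Complex.exp (x * γ t) * ω t‖))
    (Metric.ball_mem_nhds x (half_pos hr)) (Eventually.of_forall fun y => ?_) ?_ ?_ ?_ (h.const_mul _)
    ?_).2
  · exact (by fun_prop : Continuous fun t => Complex.exp (y * γ t) * ω t).aestronglyMeasurable
  · refine h.mono' (by fun_prop : Continuous fun t => Complex.exp (x * γ t) * ω t).aestronglyMeasurable
      (Eventually.of_forall fun t => ?_)
    exact le_mul_of_one_le_left (norm_nonneg _) (Real.one_le_exp (by positivity))
  · exact (by fun_prop : Continuous fun t => γ t * (Complex.exp (x * γ t) * ω t)).aestronglyMeasurable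
  · refine Eventually.of_forall fun t y hy => ?_
    have h1 : ‖Complex.exp (y * γ t)‖ ≤ Real.exp (r / 2 * ‖γ t‖) * ‖Complex.exp (x * γ t)‖ := by
      have : y * γ t = (y - x) * γ t + x * γ t := by ring
      rw [this, Complex.exp_add, norm_mul]
      gcongr
      rw [Complex.norm_exp, Real.exp_le_exp]
      refine (Complex.re_le_norm _).trans ?_
      rw [norm_mul]
      gcongr
      exact (mem_ball_iff_norm.1 hy).le
    have h2 : ‖γ t‖ ≤ 2 / r * Real.exp (r / 2 * ‖γ t‖) := by
      have := Real.add_one_le_exp (r / 2 * ‖γ t‖)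
      have h3 : ‖γ t‖ = 2 / r * (r / 2 * ‖γ t‖) := by field_simp
      rw [h3]
      gcongr
      rw [← h3]
      linarith
    rw [norm_mul, norm_mul]
    calc _ ≤ (2 / r * Real.exp (r / 2 * ‖γ t‖)) *
          ((Real.exp (r / 2 * ‖γ t‖) * ‖Complex.exp (x * γ t)‖) * ‖ω t‖) := by gcongr
      _ = 2 / r * ((Real.exp (r / 2 * ‖γ t‖) * Real.exp (r / 2 * ‖γ t‖)) *
          ‖Complex.exp (x * γ t) * ω t‖) := by rw [norm_mul]; ring
      _ = _ := by rw [← Real.exp_add]; congr 4; ring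
  · refine Eventually.of_forall fun t y _ => ?_
    have := (((hasDerivAt_id y).mul_const (γ t)).cexp.mul_const (ω t))
    refine this.congr_deriv ?_
    simp; ring

/-! ### Moments, differentiation in x and integration by parts. -/

namespace AdmissibleContour

variable {N B : ℂ[X]} {u : ℂ} (Γ : AdmissibleContour N B u)

theorem exists_integrable_majorant_pow (hu : u ≠ 0) {x : ℂ} (hx : x ∈ decayDomain N B u) (k : ℕ) :
    ∃ r > 0, IntegrableOn
      (fun t => Real.exp (r * ‖Γ.path t‖) * ‖Γ.path t ^ k * Γ.integrand x t‖) Γ.dom := by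
  obtain ⟨r, hr, h⟩ := Γ.exists_integrable_majorant hu hx
  obtain ⟨C, hC0, hC⟩ := exists_norm_eval_le_exp ((X : ℂ[X]) ^ k) (half_pos hr)
  refine ⟨r / 2, half_pos hr, (h.const_mul C).mono' ?_ (Eventually.of_forall fun t => ?_)⟩
  · have h1 := Γ.continuous_path
    have h2 := Γ.continuous_integrand x
    exact (by fun_prop : Continuous _).aestronglyMeasurable
  · have := hC (Γ.path t)
    simp only [eval_pow, eval_X] at this
    rw [Real.norm_of_nonneg (by positivity), norm_mul]
    calc _ ≤ Real.exp (r / 2 * ‖Γ.path t‖) * ((C * Real.exp (r / 2 * ‖Γ.path t‖)) *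
          ‖Γ.integrand x t‖) := by gcongr
      _ = C * ((Real.exp (r / 2 * ‖Γ.path t‖) * Real.exp (r / 2 * ‖Γ.path t‖)) *
          ‖Γ.integrand x t‖) := by ring
      _ = _ := by rw [← Real.exp_add]; congr 4; ring

theorem integrableOn_pow_mul_integrand (hu : u ≠ 0) {x : ℂ} (hx : x ∈ decayDomain N B u) (k : ℕ) :
    IntegrableOn (fun t => Γ.path t ^ k * Γ.integrand x t) Γ.dom := by
  obtain ⟨r, hr, h⟩ := Γ.exists_integrable_majorant_pow hu hx k
  refine h.mono' ?_ (Eventually.of_forall fun t => ?_)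
  · have h1 := Γ.continuous_path
    have h2 := Γ.continuous_integrand x
    exact (by fun_prop : Continuous _).aestronglyMeasurable
  · exact le_mul_of_one_le_left (norm_nonneg _) (Real.one_le_exp (by positivity))

theorem integrableOn_integrand (hu : u ≠ 0) {x : ℂ} (hx : x ∈ decayDomain N B u) :
    IntegrableOn (Γ.integrand x) Γ.dom := by
  simpa using Γ.integrableOn_pow_mul_integrand hu hx 0

theorem integrableOn_eval_mul_integrand (hu : u ≠ 0) {x : ℂ} (hx : x ∈ decayDomain N B u)
    (P : ℂ[X]) : IntegrableOn (fun t => P.eval (Γ.path t) * Γ.integrand x t) Γ.dom := by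
  induction P using Polynomial.induction_on' with
  | add p q hp hq =>
    simp only [eval_add, add_mul]
    exact hp.add hq
  | monomial n a =>
    simp only [eval_monomial, mul_assoc]
    exact (Γ.integrableOn_pow_mul_integrand hu hx n).const_mul a

/-- The moments `∫ y ^ k exp (x y) W(y) dy`. -/
def moment (k : ℕ) (x : ℂ) : ℂ := ∫ t in Γ.dom, Γ.path t ^ k * Γ.integrand x t

theorem hasDerivAt_moment (hu : u ≠ 0) {x : ℂ} (hx : x ∈ decayDomain N B u) (k : ℕ) :
    HasDerivAt (Γ.moment k) (Γ.moment (k + 1) x) x := by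
  obtain ⟨r, hr, h⟩ := Γ.exists_integrable_majorant_pow hu hx k
  have e : ∀ (y : ℂ) (t : ℝ), Γ.path t ^ k * Γ.integrand y t =
      Complex.exp (y * Γ.path t) * (Γ.path t ^ k * (Γ.weight t * deriv Γ.path t)) := by
    intro y t; simp only [integrand]; ring
  simp only [e] at h
  have h1 := Γ.continuous_path
  have h2 := Γ.continuous_weight
  have h3 := Γ.continuous_deriv
  have := hasDerivAt_integral_exp_mul h1 (by fun_prop) hr h
  unfold moment
  simp only [e]
  refine this.congr_deriv ?_
  congr 1
  ext t
  simp only [integrand]; ring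

theorem iteratedDeriv_fourierLaplace (hu : u ≠ 0) (k : ℕ) {x : ℂ} (hx : x ∈ decayDomain N B u) :
    iteratedDeriv k Γ.fourierLaplace x = Γ.moment k x := by
  induction k generalizing x with
  | zero => simp [moment, fourierLaplace]
  | succ k ih =>
    rw [iteratedDeriv_succ]
    have : iteratedDeriv k Γ.fourierLaplace =ᶠ[𝓝 x] Γ.moment k :=
      eventually_of_mem ((isOpen_decayDomain N B u).mem_nhds hx) fun y hy => ih hy
    rw [this.deriv_eq, (Γ.hasDerivAt_moment hu hx k).deriv]

theorem differentiableAt_fourierLaplace (hu : u ≠ 0) {x : ℂ} (hx : x ∈ decayDomain N B u) :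
    DifferentiableAt ℂ Γ.fourierLaplace x := by
  have := (Γ.hasDerivAt_moment hu hx 0).differentiableAt
  have e : Γ.moment 0 = Γ.fourierLaplace := by ext y; simp [moment, fourierLaplace]
  rwa [e] at this

theorem setIntegral_eval_mul_integrand (hu : u ≠ 0) {x : ℂ} (hx : x ∈ decayDomain N B u)
    (P : ℂ[X]) : ∫ t in Γ.dom, P.eval (Γ.path t) * Γ.integrand x t =
      P.sum fun k a => a * Γ.moment k x := by
  simp only [eval_eq_sum, Polynomial.sum, Finset.sum_mul]
  rw [integral_finsetSum]
  · refine Finset.sum_congr rfl fun k _ => ?_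
    rw [moment, ← integral_const_mul]
    simp only [mul_assoc]
  · intro k _
    simpa only [mul_assoc] using (Γ.integrableOn_pow_mul_integrand hu hx k).const_mul _

/-- The factor B clears the denominator of the logarithmic derivative of the weight, so what remains
is a polynomial times the integrand. -/
theorem hasDerivAt_boundary (x : ℂ) (t : ℝ) :
    HasDerivAt (fun t => B.eval (Γ.path t) * (Complex.exp (x * Γ.path t) * Γ.weight t))
      ((N + derivative B + C x * B).eval (Γ.path t) * Γ.integrand x t) t := by
  have h1 := (B.hasDerivAt (Γ.path t)).scomp t (Γ.hasDerivAt_path t)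
  have h2 := hasDerivAt_exp_mul_weight Γ.contDiff Γ.hasDerivAt_weight x t
  refine (h1.mul h2).congr_deriv ?_
  have := Γ.avoids t
  simp only [logDerivAlong, integrand, eval_add, eval_mul, eval_C, smul_eq_mul, Function.comp_apply]
  field_simp
  ring

/-- The integrated total derivative. Multiplication by a polynomial in y corresponds to that
polynomial in ∂_x, so this is the differential equation in integral form. -/
theorem setIntegral_hasDerivAt_boundary (hu : u ≠ 0) {x : ℂ} (hx : x ∈ decayDomain N B u) :
    ∫ t in Γ.dom, (N + derivative B + C x * B).eval (Γ.path t) * Γ.integrand x t = 0 := by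
  refine Γ.setIntegral_dom_eq_zero (Γ.hasDerivAt_boundary x)
    (Γ.integrableOn_eval_mul_integrand hu hx _) (fun h => ?_) fun h => Γ.tendsto_boundary hu h hx
  have h1 := (Γ.loop h).1 0
  have h2 := Γ.periodic_weight h 0
  rw [zero_add] at h1 h2
  simp only [h1, h2]

end AdmissibleContour

/-! ### The differential equations -/

/-- The operator `P(∂)`. -/
def diffOp (P : ℂ[X]) (f : ℂ → ℂ) (x : ℂ) : ℂ := P.sum fun k a => a * iteratedDeriv k f x

theorem diffOp_add (P Q : ℂ[X]) (f : ℂ → ℂ) (x : ℂ) :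
    diffOp (P + Q) f x = diffOp P f x + diffOp Q f x :=
  sum_add_index P Q _ (by simp) (by intros; ring)

theorem diffOp_monomial (k : ℕ) (a : ℂ) (f : ℂ → ℂ) (x : ℂ) :
    diffOp (monomial k a) f x = a * iteratedDeriv k f x :=
  sum_monomial_index _ _ (by simp)

theorem diffOp_neg (P : ℂ[X]) (f : ℂ → ℂ) (x : ℂ) : diffOp (-P) f x = -diffOp P f x := by
  have := diffOp_add P (-P) f x
  rw [add_neg_cancel] at this
  have h0 : diffOp 0 f x = 0 := by simp [diffOp]
  rw [h0] at this
  linear_combination -this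

theorem diffOp_derivative (P : ℂ[X]) (f : ℂ → ℂ) (x : ℂ) :
    diffOp (derivative P) f x = P.sum fun k a => k * a * iteratedDeriv (k - 1) f x := by
  induction P using Polynomial.induction_on' with
  | add p q hp hq =>
    rw [derivative_add, diffOp_add, hp, hq]
    exact (sum_add_index p q _ (by simp) (by intros; ring)).symm
  | monomial n a =>
    rw [derivative_monomial, diffOp_monomial, sum_monomial_index _ _ (by simp)]
    ring

theorem odeOp_eq (A B : ℂ[X]) (f : ℂ → ℂ) (x : ℂ) :
    odeOp A B f x = diffOp A f x - x * diffOp B f x := rfl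

theorem odeOp_eq_sum (A B : ℂ[X]) (f : ℂ → ℂ) (x : ℂ) :
    odeOp A B f x = ∑ k ∈ Finset.range (max A.natDegree B.natDegree + 1),
      (A.coeff k - x * B.coeff k) * iteratedDeriv k f x := by
  rw [odeOp, sum_over_range' A (by simp) (max A.natDegree B.natDegree + 1) (by omega),
    sum_over_range' B (by simp) (max A.natDegree B.natDegree + 1) (by omega), Finset.mul_sum,
    ← Finset.sum_sub_distrib]
  exact Finset.sum_congr rfl fun k _ => by ring

theorem differentiableOn_iteratedDeriv {U : Set ℂ} (hU : IsOpen U) {f : ℂ → ℂ}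
    (hf : DifferentiableOn ℂ f U) (k : ℕ) : DifferentiableOn ℂ (iteratedDeriv k f) U := by
  induction k with
  | zero => simpa
  | succ k ih => rw [iteratedDeriv_succ]; exact ih.deriv hU

theorem hasDerivAt_iteratedDeriv {U : Set ℂ} (hU : IsOpen U) {f : ℂ → ℂ}
    (hf : DifferentiableOn ℂ f U) (k : ℕ) {x : ℂ} (hx : x ∈ U) :
    HasDerivAt (iteratedDeriv k f) (iteratedDeriv (k + 1) f x) x := by
  rw [iteratedDeriv_succ]
  exact ((differentiableOn_iteratedDeriv hU hf k).differentiableAt (hU.mem_nhds hx)).hasDerivAt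

/-- Leibniz's rule stops after two terms for an affine factor. For k = 0 the truncated `k - 1` is
harmless, being multiplied by k. -/
theorem iteratedDeriv_affine_mul {U : Set ℂ} (hU : IsOpen U) {g : ℂ → ℂ}
    (hg : DifferentiableOn ℂ g U) (a b : ℂ) (k : ℕ) {x : ℂ} (hx : x ∈ U) :
    iteratedDeriv k (fun z => (a - z * b) * g z) x =
      (a - x * b) * iteratedDeriv k g x - k * b * iteratedDeriv (k - 1) g x := by
  induction k generalizing x with
  | zero => simp
  | succ k ih =>
    have he : iteratedDeriv k (fun z => (a - z * b) * g z) =ᶠ[𝓝 x] fun x =>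
        (a - x * b) * iteratedDeriv k g x - k * b * iteratedDeriv (k - 1) g x :=
      eventually_of_mem (hU.mem_nhds hx) fun y hy => ih hy
    rw [iteratedDeriv_succ, he.deriv_eq]
    have h1 := (((hasDerivAt_id x).mul_const b).const_sub a).mul
      (hasDerivAt_iteratedDeriv hU hg k hx)
    have h2 : HasDerivAt (fun x => k * b * iteratedDeriv (k - 1) g x)
        (k * b * iteratedDeriv k g x) x := by
      rcases k with _ | k
      · simpa using hasDerivAt_const x (0 : ℂ)
      · exact (hasDerivAt_iteratedDeriv hU hg k hx).const_mul _
    refine ((h1.sub h2).congr_deriv ?_).deriv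
    simp
    ring

theorem iteratedDeriv_id_mul {U : Set ℂ} (hU : IsOpen U) {g : ℂ → ℂ}
    (hg : DifferentiableOn ℂ g U) (k : ℕ) {x : ℂ} (hx : x ∈ U) :
    iteratedDeriv k (fun z => z * g z) x =
      x * iteratedDeriv k g x + k * iteratedDeriv (k - 1) g x := by
  have := iteratedDeriv_affine_mul hU hg 0 (-1) k hx
  simpa using this

/-- The adjoint equation is an equation of the same kind for the reflected function. -/
theorem adjointOp_eq_odeOp {U : Set ℂ} (hU : IsOpen U) (A B : ℂ[X]) {g : ℂ → ℂ}
    (hg : DifferentiableOn ℂ g U) {x : ℂ} (hx : x ∈ U) :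
    adjointOp A B g x = -odeOp (-(A + derivative B)) B (fun y => g (-y)) (-x) := by
  have hr : ∀ k, iteratedDeriv k (fun y => g (-y)) (-x) = (-1) ^ k * iteratedDeriv k g x := by
    intro k
    have := iteratedDeriv_comp_neg k g (-x)
    simpa using this
  rw [odeOp_eq, diffOp_neg, diffOp_add, diffOp_derivative]
  have h1 : (B.sum fun k b => b * ((-1) ^ k * iteratedDeriv k (fun z => z * g z) x)) =
      x * diffOp B (fun y => g (-y)) (-x) -
        B.sum fun k a => k * a * iteratedDeriv (k - 1) (fun y => g (-y)) (-x) := by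
    simp only [diffOp, Polynomial.sum, Finset.mul_sum]
    rw [← Finset.sum_sub_distrib]
    refine Finset.sum_congr rfl fun k _ => ?_
    rw [hr, hr, iteratedDeriv_id_mul hU hg k hx]
    rcases k with _ | k
    · simp; ring
    · simp only [Nat.add_sub_cancel, pow_succ]; ring
  rw [adjointOp, h1]
  simp only [diffOp, hr]
  ring

/-! ### Lagrange's identity -/

theorem adjointOp_eq_sum {U : Set ℂ} (hU : IsOpen U) (A B : ℂ[X]) {g : ℂ → ℂ}
    (hg : DifferentiableOn ℂ g U) {x : ℂ} (hx : x ∈ U) :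
    adjointOp A B g x = ∑ k ∈ Finset.range (max A.natDegree B.natDegree + 1),
      (-1) ^ k * iteratedDeriv k (fun z => (A.coeff k - z * B.coeff k) * g z) x := by
  rw [adjointOp, sum_over_range' A (by simp) (max A.natDegree B.natDegree + 1) (by omega),
    sum_over_range' B (by simp) (max A.natDegree B.natDegree + 1) (by omega),
    ← Finset.sum_sub_distrib]
  refine Finset.sum_congr rfl fun k _ => ?_
  rw [iteratedDeriv_affine_mul hU hg _ _ k hx, iteratedDeriv_id_mul hU hg k hx]
  ring

/-- For each k the differentiated inner sum telescopes between f^{(k)} a_k g and (-1)^k f (a_k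
g)^{(k)}; these assemble into the operator and its adjoint. -/
theorem hasDerivAt_concomitant {U : Set ℂ} (hU : IsOpen U) (A B : ℂ[X]) {f g : ℂ → ℂ}
    (hf : DifferentiableOn ℂ f U) (hg : DifferentiableOn ℂ g U) {x : ℂ} (hx : x ∈ U) :
    HasDerivAt (concomitant A B f g) (f x * adjointOp A B g x - g x * odeOp A B f x) x := by
  have hh : ∀ k, DifferentiableOn ℂ (fun z => (A.coeff k - z * B.coeff k) * g z) U := fun k =>
    (by fun_prop : DifferentiableOn ℂ (fun z => (A.coeff k - z * B.coeff k)) U).mul hg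
  have h1 : ∀ k j, HasDerivAt (fun y => (-1) ^ j * iteratedDeriv (k - 1 - j) f y *
      iteratedDeriv j (fun z => (A.coeff k - z * B.coeff k) * g z) y)
      ((-1) ^ j * iteratedDeriv (k - 1 - j + 1) f x *
        iteratedDeriv j (fun z => (A.coeff k - z * B.coeff k) * g z) x +
      (-1) ^ j * iteratedDeriv (k - 1 - j) f x *
        iteratedDeriv (j + 1) (fun z => (A.coeff k - z * B.coeff k) * g z) x) x := fun k j =>
    ((hasDerivAt_iteratedDeriv hU hf _ hx).const_mul _).mul
      (hasDerivAt_iteratedDeriv hU (hh k) _ hx)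
  have h2 := (HasDerivAt.fun_sum fun k (_ : k ∈ Finset.range (max A.natDegree B.natDegree + 1)) =>
    HasDerivAt.fun_sum fun j (_ : j ∈ Finset.range k) => h1 k j).neg
  refine h2.congr_deriv ?_
  rw [odeOp_eq_sum, adjointOp_eq_sum hU A B hg hx, Finset.mul_sum, Finset.mul_sum,
    ← Finset.sum_sub_distrib, ← Finset.sum_neg_distrib]
  refine Finset.sum_congr rfl fun k _ => ?_
  have h3 := Finset.sum_range_sub' (fun j => (-1) ^ j * iteratedDeriv (k - j) f x *
        iteratedDeriv j (fun z => (A.coeff k - z * B.coeff k) * g z) x) k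
  have h4 : ∀ j ∈ Finset.range k, ((-1) ^ j * iteratedDeriv (k - 1 - j + 1) f x *
        iteratedDeriv j (fun z => (A.coeff k - z * B.coeff k) * g z) x +
      (-1) ^ j * iteratedDeriv (k - 1 - j) f x *
        iteratedDeriv (j + 1) (fun z => (A.coeff k - z * B.coeff k) * g z) x) =
      (-1) ^ j * iteratedDeriv (k - j) f x *
        iteratedDeriv j (fun z => (A.coeff k - z * B.coeff k) * g z) x -
      (-1) ^ (j + 1) * iteratedDeriv (k - (j + 1)) f x *
        iteratedDeriv (j + 1) (fun z => (A.coeff k - z * B.coeff k) * g z) x := by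
    intro j hj
    have : j < k := Finset.mem_range.1 hj
    rw [show k - 1 - j + 1 = k - j by omega, show k - 1 - j = k - (j + 1) by omega]
    ring
  rw [Finset.sum_congr rfl h4, h3]
  simp
  ring

theorem concomitant_eq_of_isSolution {U : Set ℂ} (hU : IsOpen U) (hc : IsPreconnected U)
    {A B : ℂ[X]} {f g : ℂ → ℂ} (hf : IsSolution A B U f) (hg : IsAdjointSolution A B U g)
    {x y : ℂ} (hx : x ∈ U) (hy : y ∈ U) : concomitant A B f g x = concomitant A B f g y := by
  have h := fun z (hz : z ∈ U) => hasDerivAt_concomitant hU A B hf.1 hg.1 hz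
  refine hU.is_const_of_deriv_eq_zero hc
    (fun z hz => (h z hz).differentiableAt.differentiableWithinAt) (fun z hz => ?_) hx hy
  rw [(h z hz).deriv, hf.2 z hz, hg.2 z hz]; simp

/-! ### Uniqueness for the differential equation -/

/-- Differentiating the equation j times expresses the leading coefficient times f^{(n+j)} through
lower derivatives. Since the leading coefficient does not vanish at x, all Taylor coefficients
follow from the first n. -/
theorem iteratedDeriv_eq_zero_of_odeOp {U : Set ℂ} (hU : IsOpen U) {A B : ℂ[X]} {f : ℂ → ℂ}
    (hf : IsSolution A B U f) {x : ℂ} (hx : x ∈ U) {n : ℕ} (hn : n = max A.natDegree B.natDegree)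
    (hlead : A.coeff n - x * B.coeff n ≠ 0) (h0 : ∀ k < n, iteratedDeriv k f x = 0) (m : ℕ) :
    iteratedDeriv m f x = 0 := by
  induction m using Nat.strong_induction_on with
  | _ m ih =>
    rcases lt_or_ge m n with h | h
    · exact h0 m h
    · obtain ⟨j, rfl⟩ := Nat.exists_eq_add_of_le h
      have hd := fun k => differentiableOn_iteratedDeriv hU hf.1 k
      have hz : (fun z => ∑ k ∈ Finset.range (n + 1),
          (A.coeff k - z * B.coeff k) * iteratedDeriv k f z) =ᶠ[𝓝 x] fun _ => 0 := by
        refine eventually_of_mem (hU.mem_nhds hx) fun y hy => ?_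
        have := hf.2 y hy
        rwa [odeOp_eq_sum, ← hn] at this
      have h1 : iteratedDeriv j (fun z => ∑ k ∈ Finset.range (n + 1),
          (A.coeff k - z * B.coeff k) * iteratedDeriv k f z) x = 0 := by
        rw [hz.iteratedDeriv_eq j]
        cases j <;> simp
      rw [iteratedDeriv_fun_sum] at h1
      · have h2 : ∀ k, iteratedDeriv j (iteratedDeriv k f) x = iteratedDeriv (k + j) f x := by
          intro k
          rw [iteratedDeriv_eq_iterate, iteratedDeriv_eq_iterate, iteratedDeriv_eq_iterate,
            add_comm, Function.iterate_add_apply]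
        have h3 : ∀ k i, iteratedDeriv i (iteratedDeriv k f) x = iteratedDeriv (k + i) f x := by
          intro k i
          rw [iteratedDeriv_eq_iterate, iteratedDeriv_eq_iterate, iteratedDeriv_eq_iterate,
            add_comm, Function.iterate_add_apply]
        have hj : ∀ k ≤ n, (j : ℂ) * B.coeff k * iteratedDeriv (j - 1) (iteratedDeriv k f) x = 0 := by
          intro k hk
          rcases j with _ | j
          · simp
          · rw [h3, ih _ (by omega), mul_zero]
        rw [Finset.sum_range_succ, Finset.sum_eq_zero, zero_add,
          iteratedDeriv_affine_mul hU (hd n) _ _ j hx, hj n le_rfl, h3, sub_zero] at h1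
        · exact (mul_eq_zero.1 h1).resolve_left hlead
        · intro k hk
          have hk' : k < n := Finset.mem_range.1 hk
          rw [iteratedDeriv_affine_mul hU (hd k) _ _ j hx, hj k hk'.le, h3, ih _ (by omega)]
          simp
      · intro k _
        have : DifferentiableOn ℂ (fun z => (A.coeff k - z * B.coeff k) * iteratedDeriv k f z) U :=
          (by fun_prop : DifferentiableOn ℂ (fun z => (A.coeff k - z * B.coeff k)) U).mul (hd k)
        exact (this.analyticAt (hU.mem_nhds hx)).contDiffAt

theorem eq_zero_of_iteratedDeriv_eq_zero {U : Set ℂ} (hU : IsOpen U) (hc : IsPreconnected U)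
    {f : ℂ → ℂ} (hf : DifferentiableOn ℂ f U) {x : ℂ} (hx : x ∈ U)
    (h : ∀ m, iteratedDeriv m f x = 0) : ∀ y ∈ U, f y = 0 := by
  obtain ⟨r, hr, hball⟩ := Metric.isOpen_iff.1 hU x hx
  have he : f =ᶠ[𝓝 x] 0 := by
    refine eventually_of_mem (Metric.ball_mem_nhds x hr) fun y hy => ?_
    have := Complex.taylorSeries_eq_on_ball (hf.mono hball) hy
    rw [← this]
    simp [h]
  exact (hf.analyticOnNhd hU).eqOn_zero_of_preconnected_of_eventuallyEq_zero hc hx he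

theorem IsSolution.sum_mul {U : Set ℂ} (hU : IsOpen U) {A B : ℂ[X]} {ι : Type*} (s : Finset ι)
    (a : ι → ℂ) {F : ι → ℂ → ℂ} (hF : ∀ i ∈ s, IsSolution A B U (F i)) :
    IsSolution A B U (fun x => ∑ i ∈ s, a i * F i x) := by
  refine ⟨DifferentiableOn.fun_sum fun i hi => (hF i hi).1.const_mul _, fun x hx => ?_⟩
  have h1 : ∀ k, iteratedDeriv k (fun x => ∑ i ∈ s, a i * F i x) x =
      ∑ i ∈ s, a i * iteratedDeriv k (F i) x := by
    intro k
    rw [iteratedDeriv_fun_sum fun i hi =>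
      (((hF i hi).1.const_mul (a i)).analyticAt (hU.mem_nhds hx)).contDiffAt]
    refine Finset.sum_congr rfl fun i hi => ?_
    exact iteratedDeriv_const_mul_field _ _
  rw [odeOp_eq_sum]
  simp only [h1, Finset.mul_sum]
  rw [Finset.sum_comm]
  refine Finset.sum_eq_zero fun i hi => ?_
  have := (hF i hi).2 x hx
  rw [odeOp_eq_sum] at this
  have h2 := congrArg (a i * ·) this
  simp only [Finset.mul_sum, mul_zero] at h2
  rw [← h2]
  exact Finset.sum_congr rfl fun k _ => by ring

/-- Linearly independent solutions, as many as the order of the equation, form a basis. -/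
theorem existsUnique_coeff_of_isSolution {U : Set ℂ} (hU : IsOpen U) (hc : IsPreconnected U)
    {A B : ℂ[X]} {n : ℕ} (hn : n = max A.natDegree B.natDegree) {x : ℂ} (hx : x ∈ U)
    (hlead : A.coeff n - x * B.coeff n ≠ 0) {F : Fin n → ℂ → ℂ}
    (hF : ∀ i, IsSolution A B U (F i))
    (hind : ∀ a : Fin n → ℂ, (∀ x ∈ U, ∑ i, a i * F i x = 0) → a = 0)
    {f : ℂ → ℂ} (hf : IsSolution A B U f) :
    ∃! a : Fin n → ℂ, ∀ x ∈ U, f x = ∑ i, a i * F i x := by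
  have hder : ∀ (a : Fin n → ℂ) k, iteratedDeriv k (fun x => ∑ i, a i * F i x) x =
      ∑ i, a i * iteratedDeriv k (F i) x := by
    intro a k
    rw [iteratedDeriv_fun_sum fun i _ =>
      (((hF i).1.const_mul (a i)).analyticAt (hU.mem_nhds hx)).contDiffAt]
    exact Finset.sum_congr rfl fun i _ => iteratedDeriv_const_mul_field _ _
  -- Coefficients are sent to the Cauchy data at x of the linear combination. Uniqueness makes this
  -- map injective, hence bijective, so every solution has the Cauchy data of some combination.
  let Φ : (Fin n → ℂ) →ₗ[ℂ] (Fin n → ℂ) :=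
    { toFun := fun a k => ∑ i, a i * iteratedDeriv k (F i) x
      map_add' := fun a b => by ext k; simp [add_mul, Finset.sum_add_distrib]
      map_smul' := fun c a => by ext k; simp [Finset.mul_sum, mul_assoc] }
  have hinj : Function.Injective Φ := by
    rw [← LinearMap.ker_eq_bot, LinearMap.ker_eq_bot']
    intro a ha
    apply hind
    have hs := IsSolution.sum_mul hU Finset.univ a fun i _ => hF i
    refine eq_zero_of_iteratedDeriv_eq_zero hU hc hs.1 hx
      (iteratedDeriv_eq_zero_of_odeOp hU hs hx hn hlead fun k hk => ?_)
    rw [hder]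
    exact congrFun ha ⟨k, hk⟩
  obtain ⟨a, ha⟩ := (LinearMap.injective_iff_surjective.1 hinj) fun k => iteratedDeriv k f x
  refine ⟨a, ?_, fun b hb => ?_⟩
  -- The index `none` carries f with coefficient 1, so that f minus the combination is itself an
  -- instance of `IsSolution.sum_mul`.
  · have hs : IsSolution A B U (fun x => ∑ i : Option (Fin n),
        (i.elim 1 fun j => -a j) * (i.elim f F) x) :=
      IsSolution.sum_mul hU Finset.univ _ fun i _ => by
        cases i
        · exact hf
        · exact hF _
    have e : (fun x => ∑ i : Option (Fin n), (i.elim 1 fun j => -a j) * (i.elim f F) x) =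
        fun x => f x - ∑ i, a i * F i x := by
      ext y; simp [Fintype.sum_option, sub_eq_add_neg]
    rw [e] at hs
    have h0 := eq_zero_of_iteratedDeriv_eq_zero hU hc hs.1 hx
      (iteratedDeriv_eq_zero_of_odeOp hU hs hx hn hlead fun k hk => ?_)
    · exact fun y hy => sub_eq_zero.1 (h0 y hy)
    · have hs' := IsSolution.sum_mul hU Finset.univ a fun i _ => hF i
      rw [iteratedDeriv_fun_sub (hf.1.analyticAt (hU.mem_nhds hx)).contDiffAt
        (hs'.1.analyticAt (hU.mem_nhds hx)).contDiffAt, hder, sub_eq_zero]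
      exact (congrFun ha ⟨k, hk⟩).symm
  · have h1 : a = b := by
      apply hinj
      rw [ha]
      ext k
      have : f =ᶠ[𝓝 x] fun x => ∑ i, b i * F i x :=
        eventually_of_mem (hU.mem_nhds hx) fun y hy => hb y hy
      rw [this.iteratedDeriv_eq, hder]
      rfl
    exact h1.symm

/-! ### The domain of the variable -/

theorem coeff_natDegree_derivative (B : ℂ[X]) : (derivative B).coeff B.natDegree = 0 := by
  rw [coeff_derivative, coeff_eq_zero_of_natDegree_lt (Nat.lt_succ_self _), zero_mul]

theorem natDegree_lt_natDegree_neg_add_derivative_iff (A B : ℂ[X]) :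
    B.natDegree < (-(A + derivative B)).natDegree ↔ B.natDegree < A.natDegree := by
  have hd : (derivative B).natDegree ≤ B.natDegree :=
    (natDegree_derivative_le B).trans (Nat.sub_le _ _)
  rw [natDegree_neg]
  constructor
  · intro h
    have := natDegree_add_le A (derivative B)
    rcases le_max_iff.1 this with h1 | h1 <;> omega
  · intro h
    rwa [natDegree_add_eq_left_of_natDegree_lt (by omega)]

theorem mem_xDomain_iff_primal {A B : ℂ[X]} {u x : ℂ} :
    x ∈ xDomain A B u ↔ x ∈ decayDomain (-(A + derivative B)) B u := by
  simp only [xDomain, decayDomain, Set.mem_ofPred_eq,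
    natDegree_lt_natDegree_neg_add_derivative_iff, coeff_neg, coeff_add,
    coeff_natDegree_derivative, add_zero, neg_div, sub_eq_add_neg]

theorem mem_xDomain_iff_dual {A B : ℂ[X]} {u x : ℂ} :
    x ∈ xDomain A B u ↔ -x ∈ decayDomain A B (-u) := by
  simp only [xDomain, decayDomain, Set.mem_ofPred_eq]
  rw [show (-x + A.coeff B.natDegree / B.coeff B.natDegree) * -u =
    (x - A.coeff B.natDegree / B.coeff B.natDegree) * u by ring]

theorem isOpen_xDomain (A B : ℂ[X]) (u : ℂ) : IsOpen (xDomain A B u) := by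
  have : xDomain A B u = decayDomain (-(A + derivative B)) B u :=
    Set.ext fun x => mem_xDomain_iff_primal
  rw [this]; exact isOpen_decayDomain _ _ _

theorem convex_xDomain (A B : ℂ[X]) (u : ℂ) : Convex ℝ (xDomain A B u) := by
  by_cases h : B.natDegree < A.natDegree
  · have : xDomain A B u = Set.univ := by ext x; simp [xDomain, h]
    rw [this]; exact convex_univ
  · intro x hx y hy a b ha hb hab
    simp only [xDomain, h, false_or, Set.mem_ofPred_eq] at hx hy ⊢
    set w := A.coeff B.natDegree / B.coeff B.natDegree
    have hab' : (b : ℂ) = 1 - a := by rw [← Complex.ofReal_one, ← Complex.ofReal_sub]; congr 1; linarith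
    have e : (a • x + b • y - w) * u = (a : ℂ) * ((x - w) * u) + (b : ℂ) * ((y - w) * u) := by
      simp only [Complex.real_smul]; rw [hab']; ring
    rw [e, Complex.add_re, Complex.re_ofReal_mul, Complex.re_ofReal_mul]
    rcases ha.eq_or_lt with rfl | ha'
    · have : b = 1 := by linarith
      subst this; simpa using hy
    · have h1 := mul_neg_of_pos_of_neg ha' hx
      have h2 := mul_nonpos_of_nonneg_of_nonpos hb hy.le
      linarith

theorem xDomain_nonempty (A B : ℂ[X]) {u : ℂ} (hu : u ≠ 0) : (xDomain A B u).Nonempty := by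
  refine ⟨A.coeff B.natDegree / B.coeff B.natDegree - u⁻¹, Or.inr ?_⟩
  have : (A.coeff B.natDegree / B.coeff B.natDegree - u⁻¹ -
      A.coeff B.natDegree / B.coeff B.natDegree) * u = -1 := by
    have : u⁻¹ * u = 1 := inv_mul_cancel₀ hu
    linear_combination -this
  rw [this]; simp

/-- If deg A ≤ deg B, the leading coefficient a - xb vanishes only at x = a/b, which lies on the
boundary of the half plane; otherwise it is a nonzero constant. -/
theorem leading_ne_zero {A B : ℂ[X]} (hB : B ≠ 0) {u x : ℂ} (hx : x ∈ xDomain A B u) :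
    A.coeff (max A.natDegree B.natDegree) - x * B.coeff (max A.natDegree B.natDegree) ≠ 0 := by
  by_cases h : B.natDegree < A.natDegree
  · rw [max_eq_left h.le, coeff_eq_zero_of_natDegree_lt h, mul_zero, sub_zero]
    have : A ≠ 0 := by rintro rfl; simp at h
    simpa using this
  · rw [max_eq_right (not_lt.1 h)]
    intro h0
    rcases hx with hx | hx
    · exact h hx
    · have hb : B.coeff B.natDegree ≠ 0 := by simpa using hB
      have : x - A.coeff B.natDegree / B.coeff B.natDegree = 0 := by
        field_simp
        linear_combination -h0
      rw [this] at hx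
      simp at hx

/-! ### Contour integrals solve the equations -/

section Solutions

variable {A B : ℂ[X]} {u : ℂ}

theorem AdmissibleContour.diffOp_fourierLaplace {N B : ℂ[X]} {u : ℂ}
    (Γ : AdmissibleContour N B u) (hu : u ≠ 0) {x : ℂ} (hx : x ∈ decayDomain N B u) (P : ℂ[X]) :
    diffOp P Γ.fourierLaplace x = ∫ t in Γ.dom, P.eval (Γ.path t) * Γ.integrand x t := by
  rw [Γ.setIntegral_eval_mul_integrand hu hx]
  simp only [diffOp, Γ.iteratedDeriv_fourierLaplace hu _ hx]

/-- One statement serves both equations: the involution N ↦ -(N + B') sends -(A + B') to A, and A to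
the polynomial of the reflected adjoint equation. -/
theorem AdmissibleContour.odeOp_fourierLaplace {N B : ℂ[X]} {u : ℂ}
    (Γ : AdmissibleContour N B u) (hu : u ≠ 0) {x : ℂ} (hx : x ∈ decayDomain N B u) :
    odeOp (-(N + derivative B)) B Γ.fourierLaplace x = 0 := by
  have h := Γ.setIntegral_hasDerivAt_boundary hu hx
  simp only [eval_add, add_mul] at h
  rw [integral_add, integral_add] at h
  · rw [odeOp_eq, diffOp_neg, diffOp_add]
    simp only [Γ.diffOp_fourierLaplace hu hx]
    simp only [eval_mul, eval_C, mul_assoc, integral_const_mul] at h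
    linear_combination -h
  · exact Γ.integrableOn_eval_mul_integrand hu hx _
  · exact Γ.integrableOn_eval_mul_integrand hu hx _
  · exact (Γ.integrableOn_eval_mul_integrand hu hx _).add (Γ.integrableOn_eval_mul_integrand hu hx _)
  · exact Γ.integrableOn_eval_mul_integrand hu hx _

theorem isSolution_primalSolution (hu : u ≠ 0) (Γ : PrimalContour A B u) :
    IsSolution A B (xDomain A B u) (primalSolution Γ) := by
  refine ⟨fun x hx => (Γ.differentiableAt_fourierLaplace hu
    (mem_xDomain_iff_primal.1 hx)).differentiableWithinAt, fun x hx => ?_⟩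
  have := Γ.odeOp_fourierLaplace hu (mem_xDomain_iff_primal.1 hx)
  rwa [show -(-(A + derivative B) + derivative B) = A by ring] at this

theorem differentiableOn_dualSolution (hu : u ≠ 0) (Δ : DualContour A B u) :
    DifferentiableOn ℂ (dualSolution Δ) (xDomain A B u) := fun x hx =>
  ((Δ.differentiableAt_fourierLaplace (neg_ne_zero.2 hu) (mem_xDomain_iff_dual.1 hx)).comp x
    differentiableAt_id.neg).differentiableWithinAt

theorem isAdjointSolution_dualSolution (hu : u ≠ 0) (Δ : DualContour A B u) :
    IsAdjointSolution A B (xDomain A B u) (dualSolution Δ) := by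
  refine ⟨differentiableOn_dualSolution hu Δ, fun x hx => ?_⟩
  rw [adjointOp_eq_odeOp (isOpen_xDomain A B u) A B (differentiableOn_dualSolution hu Δ) hx]
  have := Δ.odeOp_fourierLaplace (neg_ne_zero.2 hu) (mem_xDomain_iff_dual.1 hx)
  have e : (fun y => dualSolution Δ (-y)) = Δ.fourierLaplace := by ext y; simp [dualSolution]
  rw [e, this, neg_zero]

theorem isAdjointSolution_iff {U : Set ℂ} (hU : IsOpen U) {g : ℂ → ℂ} :
    IsAdjointSolution A B U g ↔
      IsSolution (-(A + derivative B)) B (-U) (fun y => g (-y)) := by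
  constructor
  · rintro ⟨h1, h2⟩
    refine ⟨h1.comp (differentiableOn_neg _) fun x hx => hx, fun x hx => ?_⟩
    have := h2 (-x) hx
    rw [adjointOp_eq_odeOp hU A B h1 hx, neg_neg, neg_eq_zero] at this
    exact this
  · rintro ⟨h1, h2⟩
    have h3 : DifferentiableOn ℂ g U := by
      have := h1.comp (differentiableOn_neg U) fun x hx => by simpa using hx
      simpa [Function.comp_def] using this
    refine ⟨h3, fun x hx => ?_⟩
    rw [adjointOp_eq_odeOp hU A B h3 hx, h2 (-x) (by simpa using hx), neg_zero]

end Solutions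

/-! ### The concomitant as a double integral -/

theorem sum_pow_mul_pow_mul_sub (y s : ℂ) (k : ℕ) :
    (∑ j ∈ Finset.range k, y ^ (k - 1 - j) * s ^ j) * (y - s) = y ^ k - s ^ k := by
  have h := geom_sum₂_mul s y k
  have e : ∀ j, y ^ (k - 1 - j) * s ^ j = s ^ j * y ^ (k - 1 - j) := fun j => mul_comm _ _
  simp only [e]
  linear_combination -h

theorem sum_mul_pow_succ (y s : ℂ) (k : ℕ) :
    (∑ j ∈ Finset.range (k + 1), y ^ (k - j) * (j * s ^ (j - 1))) =
      y * (∑ j ∈ Finset.range k, y ^ (k - 1 - j) * (j * s ^ (j - 1))) + k * s ^ (k - 1) := by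
  rw [Finset.sum_range_succ, Nat.sub_self, pow_zero, one_mul, Finset.mul_sum]
  congr 1
  refine Finset.sum_congr rfl fun j hj => ?_
  have : j < k := Finset.mem_range.1 hj
  rw [show k - j = (k - 1 - j) + 1 by omega, pow_succ]
  ring

/-- This is the s-derivative of the divided difference (y^k - s^k)/(y - s), cleared of denominators.
-/
theorem sum_mul_pow_mul_sub_sq (y s : ℂ) (k : ℕ) :
    (∑ j ∈ Finset.range k, y ^ (k - 1 - j) * (j * s ^ (j - 1))) * (y - s) ^ 2 =
      y ^ k - s ^ k - k * s ^ (k - 1) * (y - s) := by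
  induction k with
  | zero => simp
  | succ k ih =>
    rw [Nat.add_sub_cancel, sum_mul_pow_succ, add_mul, mul_assoc, ih]
    rcases k with _ | k
    · simp
    · simp only [Nat.add_sub_cancel]; push_cast; ring

theorem sum_mul_pow_diag (s : ℂ) (k : ℕ) :
    (∑ j ∈ Finset.range k, s ^ (k - 1 - j) * (j * s ^ (j - 1))) =
      k * (k - 1 : ℕ) * s ^ (k - 1 - 1) / 2 := by
  induction k with
  | zero => simp
  | succ k ih =>
    rw [Nat.add_sub_cancel, sum_mul_pow_succ, ih]
    rcases k with _ | _ | k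
    · simp
    · simp
    · simp only [Nat.add_sub_cancel]; push_cast; ring

theorem sum_pow_mul_pow_diag (s : ℂ) (k : ℕ) :
    (∑ j ∈ Finset.range k, s ^ (k - 1 - j) * s ^ j) = k * s ^ (k - 1) := by
  have h : ∀ j ∈ Finset.range k, s ^ (k - 1 - j) * s ^ j = s ^ (k - 1) := fun j hj => by
    have : j < k := Finset.mem_range.1 hj
    rw [← pow_add, show k - 1 - j + j = k - 1 by omega]
  rw [Finset.sum_congr rfl h]; simp

theorem eval_derivative_eq_sum_range' (P : ℂ[X]) {n : ℕ} (h : P.natDegree < n) (s : ℂ) :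
    (derivative P).eval s = ∑ k ∈ Finset.range n, P.coeff k * (k * s ^ (k - 1)) := by
  conv_lhs => rw [P.as_sum_range' n h]
  rw [derivative_sum, eval_finsetSum]
  refine Finset.sum_congr rfl fun k _ => ?_
  rw [derivative_monomial, eval_monomial]; ring

theorem eval_derivative_derivative_eq_sum_range' (P : ℂ[X]) {n : ℕ} (h : P.natDegree < n) (s : ℂ) :
    (derivative (derivative P)).eval s =
      ∑ k ∈ Finset.range n, P.coeff k * (k * (k - 1 : ℕ) * s ^ (k - 1 - 1)) := by
  conv_lhs => rw [P.as_sum_range' n h]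
  rw [derivative_sum, derivative_sum, eval_finsetSum]
  refine Finset.sum_congr rfl fun k _ => ?_
  rw [derivative_monomial, derivative_monomial, eval_monomial]; ring

/-- The right side is what the concomitant produces on e^{xy} and e^{-xs}: (-1)^j times the j-th
derivative of (a - xb)e^{-xs} is ((a - xb)s^j + b j s^{j-1}) e^{-xs}. The sums over j are divided
differences of y^k and their s-derivatives. -/
theorem concomitantKernel_eq_sum (A B : ℂ[X]) (x y s : ℂ) :
    concomitantKernel A B x y s = -∑ k ∈ Finset.range (max A.natDegree B.natDegree + 1),
      ∑ j ∈ Finset.range k, y ^ (k - 1 - j) *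
        ((A.coeff k - x * B.coeff k) * s ^ j + B.coeff k * (j * s ^ (j - 1))) := by
  have hA : A.natDegree < max A.natDegree B.natDegree + 1 := by omega
  have hB : B.natDegree < max A.natDegree B.natDegree + 1 := by omega
  have hs : ∀ k, ∑ j ∈ Finset.range k, y ^ (k - 1 - j) *
        ((A.coeff k - x * B.coeff k) * s ^ j + B.coeff k * (j * s ^ (j - 1))) =
      (A.coeff k - x * B.coeff k) * (∑ j ∈ Finset.range k, y ^ (k - 1 - j) * s ^ j) +
      B.coeff k * ∑ j ∈ Finset.range k, y ^ (k - 1 - j) * (j * s ^ (j - 1)) := by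
    intro k
    rw [Finset.mul_sum, Finset.mul_sum, ← Finset.sum_add_distrib]
    exact Finset.sum_congr rfl fun j _ => by ring
  simp only [hs]
  by_cases h : y = s
  · subst h
    simp only [concomitantKernel, if_true, sum_mul_pow_diag, sum_pow_mul_pow_diag]
    rw [eval_derivative_eq_sum_range' A hA, eval_derivative_eq_sum_range' B hB,
      eval_derivative_derivative_eq_sum_range' B hB, Finset.mul_sum, Finset.sum_div,
      ← Finset.sum_sub_distrib, ← Finset.sum_sub_distrib, ← Finset.sum_neg_distrib]
    exact Finset.sum_congr rfl fun j _ => by ring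
  · have hne : y - s ≠ 0 := sub_ne_zero.2 h
    simp only [concomitantKernel, if_neg h]
    rw [eval_eq_sum_range' hA, eval_eq_sum_range' hA, eval_eq_sum_range' hB, eval_eq_sum_range' hB,
      eval_derivative_eq_sum_range' B hB, ← Finset.sum_sub_distrib, ← Finset.sum_sub_distrib,
      ← Finset.sum_sub_distrib, Finset.sum_mul, Finset.sum_div, ← Finset.sum_sub_distrib,
      ← Finset.sum_neg_distrib]
    refine Finset.sum_congr rfl fun k _ => ?_
    have h1 := sum_pow_mul_pow_mul_sub y s k
    have h2 := sum_mul_pow_mul_sub_sq y s k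
    rw [← eq_div_iff hne] at h1
    rw [← eq_div_iff (pow_ne_zero 2 hne)] at h2
    rw [h1, h2]
    field_simp
    ring

section Fubini

variable {A B : ℂ[X]} {u : ℂ}

theorem iteratedDeriv_dualSolution (hu : u ≠ 0) (Δ : DualContour A B u) (k : ℕ) {x : ℂ}
    (hx : x ∈ xDomain A B u) :
    iteratedDeriv k (dualSolution Δ) x = (-1) ^ k * Δ.moment k (-x) := by
  rw [← Δ.iteratedDeriv_fourierLaplace (neg_ne_zero.2 hu) k (mem_xDomain_iff_dual.1 hx)]
  have := iteratedDeriv_comp_neg k Δ.fourierLaplace x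
  rw [smul_eq_mul] at this
  exact this

theorem concomitant_eq_sum_moment (hu : u ≠ 0) (Γ : PrimalContour A B u) (Δ : DualContour A B u)
    {x : ℂ} (hx : x ∈ xDomain A B u) :
    concomitant A B (primalSolution Γ) (dualSolution Δ) x =
      -∑ k ∈ Finset.range (max A.natDegree B.natDegree + 1), ∑ j ∈ Finset.range k,
        Γ.moment (k - 1 - j) x * ((A.coeff k - x * B.coeff k) * Δ.moment j (-x) +
          B.coeff k * (j * Δ.moment (j - 1) (-x))) := by
  rw [concomitant]
  congr 1
  refine Finset.sum_congr rfl fun k _ => Finset.sum_congr rfl fun j _ => ?_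
  rw [iteratedDeriv_affine_mul (isOpen_xDomain A B u) (differentiableOn_dualSolution hu Δ) _ _ j hx,
    iteratedDeriv_dualSolution hu Δ _ hx, iteratedDeriv_dualSolution hu Δ _ hx]
  have : iteratedDeriv (k - 1 - j) (primalSolution Γ) x = Γ.moment (k - 1 - j) x :=
    Γ.iteratedDeriv_fourierLaplace hu _ (mem_xDomain_iff_primal.1 hx)
  rw [this]
  have h1 : ((-1 : ℂ) ^ j) * (-1) ^ j = 1 := by rw [← mul_pow]; simp
  rcases j with _ | j
  · simp
  · simp only [Nat.add_sub_cancel]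
    have h2 : ((-1 : ℂ) ^ (j + 1)) * (-1) ^ j = -1 := by
      rw [pow_succ, mul_right_comm, ← mul_pow]; simp
    linear_combination Γ.moment (k - 1 - (j + 1)) x * ((A.coeff k - x * B.coeff k) *
      Δ.moment (j + 1) (-x)) * h1 - Γ.moment (k - 1 - (j + 1)) x * ((j + 1 : ℕ) * B.coeff k *
      Δ.moment j (-x)) * h2

theorem concomitantIntegrand_eq_sum (Γ : PrimalContour A B u) (Δ : DualContour A B u)
    (x : ℂ) (t τ : ℝ) :
    concomitantIntegrand Γ Δ x t τ =
      -∑ k ∈ Finset.range (max A.natDegree B.natDegree + 1), ∑ j ∈ Finset.range k,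
        (Γ.path t ^ (k - 1 - j) * Γ.integrand x t) *
          ((A.coeff k - x * B.coeff k) * (Δ.path τ ^ j * Δ.integrand (-x) τ) +
          B.coeff k * (j * (Δ.path τ ^ (j - 1) * Δ.integrand (-x) τ))) := by
  rw [concomitantIntegrand, concomitantKernel_eq_sum, neg_mul, neg_mul, Finset.sum_mul,
    Finset.sum_mul]
  congr 1
  refine Finset.sum_congr rfl fun k _ => ?_
  rw [Finset.sum_mul, Finset.sum_mul]
  exact Finset.sum_congr rfl fun j _ => by ring

theorem integrable_dual_factor (hu : u ≠ 0) (Δ : DualContour A B u) {x : ℂ}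
    (hx : x ∈ xDomain A B u) (c d : ℂ) (i j : ℕ) :
    IntegrableOn (fun τ => c * (Δ.path τ ^ i * Δ.integrand (-x) τ) +
      d * (j * (Δ.path τ ^ (j - 1) * Δ.integrand (-x) τ))) Δ.dom :=
  ((Δ.integrableOn_pow_mul_integrand (neg_ne_zero.2 hu) (mem_xDomain_iff_dual.1 hx) i).const_mul
    c).add (((Δ.integrableOn_pow_mul_integrand (neg_ne_zero.2 hu) (mem_xDomain_iff_dual.1 hx)
      (j - 1)).const_mul _).const_mul d)

theorem integrableOn_concomitantIntegrand (hu : u ≠ 0) (Γ : PrimalContour A B u)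
    (Δ : DualContour A B u) {x : ℂ} (hx : x ∈ xDomain A B u) :
    IntegrableOn (fun p : ℝ × ℝ => concomitantIntegrand Γ Δ x p.1 p.2) (Γ.dom ×ˢ Δ.dom) := by
  simp only [concomitantIntegrand_eq_sum]
  rw [IntegrableOn, Measure.volume_eq_prod, ← Measure.prod_restrict]
  refine Integrable.neg (integrable_finsetSum _ fun k _ => integrable_finsetSum _ fun j _ => ?_)
  exact (Γ.integrableOn_pow_mul_integrand hu (mem_xDomain_iff_primal.1 hx) _).mul_prod
    (integrable_dual_factor hu Δ hx _ _ _ _)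

theorem concomitant_eq_contourConcomitant (hu : u ≠ 0) (Γ : PrimalContour A B u)
    (Δ : DualContour A B u) {x : ℂ} (hx : x ∈ xDomain A B u) :
    concomitant A B (primalSolution Γ) (dualSolution Δ) x = contourConcomitant Γ Δ x := by
  have h1 := fun k => Γ.integrableOn_pow_mul_integrand hu (mem_xDomain_iff_primal.1 hx) k
  have h2 := fun k => Δ.integrableOn_pow_mul_integrand (neg_ne_zero.2 hu)
    (mem_xDomain_iff_dual.1 hx) k
  rw [concomitant_eq_sum_moment hu Γ Δ hx, contourConcomitant]
  simp only [concomitantIntegrand_eq_sum, integral_neg]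
  congr 1
  have h3 : ∀ τ, ∫ t in Γ.dom, ∑ k ∈ Finset.range (max A.natDegree B.natDegree + 1),
      ∑ j ∈ Finset.range k, (Γ.path t ^ (k - 1 - j) * Γ.integrand x t) *
          ((A.coeff k - x * B.coeff k) * (Δ.path τ ^ j * Δ.integrand (-x) τ) +
          B.coeff k * (j * (Δ.path τ ^ (j - 1) * Δ.integrand (-x) τ))) =
      ∑ k ∈ Finset.range (max A.natDegree B.natDegree + 1), ∑ j ∈ Finset.range k,
        Γ.moment (k - 1 - j) x *
          ((A.coeff k - x * B.coeff k) * (Δ.path τ ^ j * Δ.integrand (-x) τ) +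
          B.coeff k * (j * (Δ.path τ ^ (j - 1) * Δ.integrand (-x) τ))) := by
    intro τ
    rw [integral_finsetSum _ fun k _ => integrable_finsetSum _ fun j _ => (h1 _).mul_const _]
    refine Finset.sum_congr rfl fun k _ => ?_
    rw [integral_finsetSum _ fun j _ => (h1 _).mul_const _]
    exact Finset.sum_congr rfl fun j _ => integral_mul_const _ _
  simp only [h3]
  rw [integral_finsetSum _ fun k _ => integrable_finsetSum _ fun j _ =>
    (integrable_dual_factor hu Δ hx _ _ _ _).const_mul _]
  refine Finset.sum_congr rfl fun k _ => ?_
  rw [integral_finsetSum _ fun j _ => (integrable_dual_factor hu Δ hx _ _ _ _).const_mul _]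
  refine Finset.sum_congr rfl fun j _ => ?_
  rw [integral_const_mul, integral_add ((h2 _).const_mul _) (((h2 _).const_mul _).const_mul _),
    integral_const_mul, integral_const_mul, integral_const_mul]
  rfl

end Fubini

/-! ### Jumps of Cauchy integrals -/

/-- Only the symmetric differences H(τ - ε) - H(τ + ε) are required to converge; one-sided limits of
H are never used. Induction on the largest jump c: apply the hypothesis on [a, c - ε] and the
fundamental theorem on [c + ε, b], then let ε → 0, using that the integral of K is continuous in its
endpoints. -/
theorem integral_eq_of_jumps {H K J : ℝ → ℂ} (T : Finset ℝ) {a b : ℝ} (hab : a ≤ b)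
    (hT : ∀ τ ∈ T, τ ∈ Set.Ioo a b) (hH : ∀ τ ∈ Set.Icc a b, τ ∉ T → HasDerivAt H (K τ) τ)
    (hK : IntervalIntegrable K volume a b)
    (hJ : ∀ τ ∈ T, Tendsto (fun ε => H (τ - ε) - H (τ + ε)) (𝓝[>] 0) (𝓝 (J τ))) :
    ∫ τ in a..b, K τ = H b - H a + ∑ τ ∈ T, J τ := by
  induction T using Finset.induction_on_max generalizing b with
  | empty =>
    rw [intervalIntegral.integral_eq_sub_of_hasDerivAt (fun τ hτ => hH τ ?_ (by simp)) hK]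
    · simp
    · rwa [Set.uIcc_of_le hab] at hτ
  | insert c T hc ih =>
    have hcab := hT c (Finset.mem_insert_self c T)
    have hcT : c ∉ T := fun h => lt_irrefl _ (hc c h)
    -- For ε < e the earlier jumps stay strictly inside [a, c - ε].
    obtain ⟨e, he0, he⟩ : ∃ e > 0, ∀ τ ∈ T, τ < c - e := by
      rcases T.eq_empty_or_nonempty with rfl | hne
      · exact ⟨1, one_pos, by simp⟩
      · have := hc _ (T.max'_mem hne)
        exact ⟨(c - T.max' hne) / 2, by linarith, fun τ hτ => by
          have := T.le_max' τ hτ; linarith⟩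
    have hK' : ∀ p ∈ Set.Icc a b, ∀ q ∈ Set.Icc a b, IntervalIntegrable K volume p q :=
      fun p hp q hq => hK.mono_set (by
        rw [Set.uIcc_of_le hab]; exact Set.uIcc_subset_Icc hp hq)
    have hint : IntegrableOn K (Set.uIcc a b) := by
      rw [Set.uIcc_of_le hab]
      exact (intervalIntegrable_iff_integrableOn_Icc_of_le hab).1 hK
    have hcont := intervalIntegral.continuousOn_primitive_interval hint
    rw [Set.uIcc_of_le hab] at hcont
    have hcc : ContinuousAt (fun x => ∫ t in a..x, K t) c :=
      hcont.continuousAt (Icc_mem_nhds hcab.1 hcab.2)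
    have l1 : Tendsto (fun ε : ℝ => c - ε) (𝓝[>] 0) (𝓝 c) := by
      have : Tendsto (fun ε : ℝ => c - ε) (𝓝 0) (𝓝 (c - 0)) := by
        exact (continuous_const.sub continuous_id).tendsto 0
      rw [sub_zero] at this
      exact this.mono_left nhdsWithin_le_nhds
    have l2 : Tendsto (fun ε : ℝ => c + ε) (𝓝[>] 0) (𝓝 c) := by
      have : Tendsto (fun ε : ℝ => c + ε) (𝓝 0) (𝓝 (c + 0)) := by
        exact (continuous_const.add continuous_id).tendsto 0
      rw [add_zero] at this
      exact this.mono_left nhdsWithin_le_nhds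
    have lim1 : Tendsto (fun ε => (∫ t in a..(c - ε), K t) + ((∫ t in a..b, K t) -
        ∫ t in a..(c + ε), K t)) (𝓝[>] 0) (𝓝 (∫ t in a..b, K t)) := by
      have := (hcc.tendsto.comp l1).add (tendsto_const_nhds.sub (hcc.tendsto.comp l2)
        (a := ∫ t in a..b, K t))
      simpa using this
    have lim2 : Tendsto (fun ε => H b - H a + ∑ τ ∈ T, J τ + (H (c - ε) - H (c + ε))) (𝓝[>] 0)
        (𝓝 (H b - H a + ∑ τ ∈ T, J τ + J c)) :=
      (hJ c (Finset.mem_insert_self c T)).const_add _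
    rw [Finset.sum_insert hcT, add_comm (J c), ← add_assoc]
    refine tendsto_nhds_unique lim1 (lim2.congr' ?_)
    have hs : Set.Ioo (0 : ℝ) (min e (min (c - a) (b - c))) ∈ 𝓝[>] (0 : ℝ) :=
      Ioo_mem_nhdsGT (lt_min he0 (lt_min (by linarith [hcab.1]) (by linarith [hcab.2])))
    filter_upwards [hs] with ε hε
    obtain ⟨hε0, hε1⟩ := hε
    have h1 := lt_min_iff.1 hε1
    have h2 := lt_min_iff.1 h1.2
    have hm : c - ε ∈ Set.Icc a b := ⟨by linarith, by linarith [hcab.2]⟩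
    have hp : c + ε ∈ Set.Icc a b := ⟨by linarith [hcab.1], by linarith⟩
    have ha : a ∈ Set.Icc a b := ⟨le_rfl, hab⟩
    have hb : b ∈ Set.Icc a b := ⟨hab, le_rfl⟩
    rw [ih hm.1 (fun τ hτ => ⟨(hT τ (Finset.mem_insert_of_mem hτ)).1, by linarith [he τ hτ]⟩)
      (fun τ hτ hτT => hH τ ⟨hτ.1, hτ.2.trans hm.2⟩ ?_) (hK' a ha _ hm)
      (fun τ hτ => hJ τ (Finset.mem_insert_of_mem hτ)),
      intervalIntegral.integral_interval_sub_left (hK' a ha b hb) (hK' a ha _ hp),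
      intervalIntegral.integral_eq_sub_of_hasDerivAt (fun τ hτ => hH τ ?_ ?_) (hK' _ hp b hb)]
    · ring
    · rw [Set.uIcc_of_le hp.2] at hτ
      exact ⟨hp.1.trans hτ.1, hτ.2⟩
    · rw [Set.uIcc_of_le hp.2] at hτ
      intro h
      rcases Finset.mem_insert.1 h with h | h
      · linarith [hτ.1]
      · linarith [hc τ h, hτ.1]
    · intro h
      rcases Finset.mem_insert.1 h with h | h
      · linarith [hτ.2]
      · exact hτT h

/-- With w = ga - db, the imaginary part of conj(d)w contains only a and that of conj(g)w contains
only b. This is the quantitative independence of g and d over ℝ. -/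
theorem norm_mul_sub_mul_ge {g d : ℂ} (a b : ℝ) :
    |(starRingEnd ℂ d * g).im| * (|a| + |b|) ≤ (‖g‖ + ‖d‖) * ‖g * a - d * b‖ := by
  set w := g * a - d * b
  have h1 : |(starRingEnd ℂ d * g).im| * |a| ≤ ‖d‖ * ‖w‖ := by
    have : (starRingEnd ℂ d * w).im = (starRingEnd ℂ d * g).im * a := by
      simp [w]; ring
    rw [← abs_mul, ← this]
    refine (Complex.abs_im_le_norm _).trans ?_
    rw [norm_mul, Complex.norm_conj]
  have h2 : |(starRingEnd ℂ d * g).im| * |b| ≤ ‖g‖ * ‖w‖ := by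
    have : (starRingEnd ℂ g * w).im = (starRingEnd ℂ d * g).im * b := by
      simp [w]; ring
    rw [← abs_mul, ← this]
    refine (Complex.abs_im_le_norm _).trans ?_
    rw [norm_mul, Complex.norm_conj]
  rw [mul_add, add_mul]; linarith

theorem tendsto_log_sub_log (κ : ℂ) :
    Tendsto (fun r : ℝ => Complex.log (r - κ) - Complex.log (r + κ)) atTop (𝓝 0) := by
  have h0 : Tendsto (fun r : ℝ => κ * (r : ℂ)⁻¹) atTop (𝓝 0) := by
    have := ((Complex.continuous_ofReal.tendsto 0).comp tendsto_inv_atTop_zero).const_mul κ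
    simpa [Function.comp_def] using this
  have h1 : Tendsto (fun r : ℝ => Complex.log (1 - κ * (r : ℂ)⁻¹)) atTop (𝓝 0) := by
    have h := h0.const_sub 1
    rw [sub_zero] at h
    simpa using h.clog (by simp)
  have h2 : Tendsto (fun r : ℝ => Complex.log (1 + κ * (r : ℂ)⁻¹)) atTop (𝓝 0) := by
    have h := h0.const_add 1
    rw [add_zero] at h
    simpa using h.clog (by simp)
  have h3 := h1.sub h2
  rw [sub_zero] at h3
  refine h3.congr' ?_
  have hn : Tendsto (fun r : ℝ => κ * (r : ℂ)⁻¹) atTop (𝓝 0) := h0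
  have e1 : ∀ᶠ r : ℝ in atTop, 1 - κ * (r : ℂ)⁻¹ ≠ 0 := by
    have h := h0.const_sub 1
    rw [sub_zero] at h
    exact h.eventually_ne one_ne_zero
  have e2 : ∀ᶠ r : ℝ in atTop, 1 + κ * (r : ℂ)⁻¹ ≠ 0 := by
    have h := h0.const_add 1
    rw [add_zero] at h
    exact h.eventually_ne one_ne_zero
  filter_upwards [e1, e2, eventually_gt_atTop 0] with r h1 h2 hr
  have hr' : (r : ℂ) ≠ 0 := by exact_mod_cast hr.ne'
  have a1 : (r : ℂ) - κ = r * (1 - κ * (r : ℂ)⁻¹) := by field_simp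
  have a2 : (r : ℂ) + κ = r * (1 + κ * (r : ℂ)⁻¹) := by field_simp
  rw [a1, a2, Complex.log_ofReal_mul hr h1, Complex.log_ofReal_mul hr h2]
  ring

/-- As r → -∞, r - κ approaches the cut from below and r + κ from above, so the arguments differ by
-2π in the limit. -/
theorem tendsto_log_sub_log_atBot {κ : ℂ} (hκ : 0 < κ.im) :
    Tendsto (fun r : ℝ => Complex.log (r - κ) - Complex.log (r + κ)) atBot
      (𝓝 (-(2 * Real.pi * Complex.I))) := by
  have h := ((tendsto_log_sub_log (-κ)).comp tendsto_neg_atBot_atTop).sub_const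
    (2 * Real.pi * Complex.I)
  rw [zero_sub] at h
  refine h.congr fun r => ?_
  have h1 : Complex.log (r - κ) = Complex.log (κ - r) - Real.pi * Complex.I := by
    have e : (r : ℂ) - κ = -(κ - r) := by ring
    rw [e, Complex.log, Complex.log, norm_neg, Complex.arg_neg_eq_arg_sub_pi_of_im_pos (by simpa)]
    push_cast; ring
  have h2 : Complex.log (r + κ) = Complex.log (-κ - r) + Real.pi * Complex.I := by
    have e : (r : ℂ) + κ = -(-κ - r) := by ring
    rw [e, Complex.log, Complex.log, norm_neg,
      Complex.arg_neg_eq_arg_add_pi_of_im_neg (by simpa)]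
    push_cast; ring
  rw [h1, h2]
  simp only [Function.comp_apply, Complex.ofReal_neg]
  rw [show -(r : ℂ) - -κ = κ - r by ring, show -(r : ℂ) + -κ = -κ - r by ring]
  ring

theorem exists_one_add_sq_le {κ : ℂ} (hκ : κ.im ≠ 0) :
    ∃ c > 0, ∀ r : ℝ, c * (1 + r ^ 2) ≤ ‖(r : ℂ) ^ 2 - κ ^ 2‖ := by
  set c := |κ.im| / (1 + ‖κ‖)
  have hc : 0 < c := div_pos (abs_pos.2 hκ) (by positivity)
  have key : ∀ r b : ℝ, |b| = 1 → c * (|r| + 1) ≤ ‖(r : ℂ) - κ * b‖ := by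
    intro r b hb
    have h := norm_mul_sub_mul_ge (g := 1) (d := κ) r b
    simp only [mul_one, Complex.conj_im, abs_neg, norm_one, one_mul, hb] at h
    rw [div_mul_eq_mul_div, div_le_iff₀ (by positivity)]
    linarith
  refine ⟨c * c, by positivity, fun r => ?_⟩
  have h1 := key r 1 (by simp)
  have h2 := key r (-1) (by simp)
  rw [show (r : ℂ) ^ 2 - κ ^ 2 = (r - κ * (1 : ℝ)) * (r - κ * (-1 : ℝ)) by push_cast; ring,
    norm_mul]
  calc c * c * (1 + r ^ 2) ≤ (c * (|r| + 1)) * (c * (|r| + 1)) := by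
        have : 1 + r ^ 2 ≤ (|r| + 1) * (|r| + 1) := by nlinarith [sq_abs r, abs_nonneg r]
        calc _ ≤ c * c * ((|r| + 1) * (|r| + 1)) := by gcongr
          _ = _ := by ring
    _ ≤ _ := by gcongr

/-- The primitive is (log(r - κ) - log(r + κ))/(2κ); neither argument meets the cut for real r,
since κ is not real. -/
theorem integral_inv_sq_sub_sq {κ : ℂ} (hκ : 0 < κ.im) :
    ∫ r : ℝ, ((r : ℂ) ^ 2 - κ ^ 2)⁻¹ = Real.pi * Complex.I / κ := by
  have hκ0 : κ ≠ 0 := by rintro rfl; simp at hκ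
  obtain ⟨c, hc, hb⟩ := exists_one_add_sq_le hκ.ne'
  have hne : ∀ r : ℝ, (r : ℂ) ^ 2 - κ ^ 2 ≠ 0 := fun r => by
    have := hb r
    rw [← norm_pos_iff]
    refine lt_of_lt_of_le ?_ this
    positivity
  have hint : Integrable fun r : ℝ => ((r : ℂ) ^ 2 - κ ^ 2)⁻¹ := by
    refine (integrable_inv_one_add_sq.const_mul c⁻¹).mono' ?_ (Eventually.of_forall fun r => ?_)
    · exact (Continuous.inv₀ (by fun_prop) hne).aestronglyMeasurable
    · rw [norm_inv, ← mul_inv]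
      exact inv_anti₀ (by positivity) (hb r)
  have hd : ∀ r : ℝ, HasDerivAt
      (fun r : ℝ => (Complex.log (r - κ) - Complex.log (r + κ)) / (2 * κ))
      (((r : ℂ) ^ 2 - κ ^ 2)⁻¹) r := by
    intro r
    have s1 : (r : ℂ) - κ ∈ Complex.slitPlane := Or.inr (by simpa using hκ.ne')
    have s2 : (r : ℂ) + κ ∈ Complex.slitPlane := Or.inr (by simpa using hκ.ne')
    have h1 := ((Complex.ofRealCLM.hasDerivAt (x := r)).sub_const κ).clog_real s1
    have h2 := ((Complex.ofRealCLM.hasDerivAt (x := r)).add_const κ).clog_real s2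
    refine ((h1.sub h2).div_const (2 * κ)).congr_deriv ?_
    have n1 := Complex.slitPlane_ne_zero s1
    have n2 := Complex.slitPlane_ne_zero s2
    have n3 := hne r
    have n4 : (r : ℂ) ^ 2 - κ ^ 2 = (r - κ) * (r + κ) := by ring
    rw [n4]
    simp
    field_simp
    ring
  rw [integral_of_hasDerivAt_of_tendsto hd hint ((tendsto_log_sub_log_atBot hκ).div_const _)
    ((tendsto_log_sub_log κ).div_const _)]
  field_simp
  ring

/-- The model jump of the Cauchy kernel across a straight line. The combined integrand is a multiple
of 1/(r² - (d/g)²), and the sign of the determinant decides whether d/g or -d/g lies in the upper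
half plane. -/
theorem integral_inv_sub_inv {g d : ℂ} (hD : (starRingEnd ℂ d * g).im ≠ 0) :
    ∫ r : ℝ, ((g * r + d)⁻¹ - (g * r - d)⁻¹) =
      2 * Real.pi * Complex.I * ((SignType.sign (starRingEnd ℂ d * g).im : ℝ) : ℂ) / g := by
  have hg : g ≠ 0 := by rintro rfl; simp at hD
  have hd : d ≠ 0 := by rintro rfl; simp at hD
  have hκ : (d / g).im = -(starRingEnd ℂ d * g).im / Complex.normSq g := by
    rw [Complex.div_im]; simp; ring
  have hns : 0 < Complex.normSq g := Complex.normSq_pos.2 hg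
  have e : ∀ κ : ℂ, κ = d / g ∨ κ = -(d / g) → ∀ r : ℝ, (κ.im ≠ 0) →
      (g * r + d)⁻¹ - (g * r - d)⁻¹ = -(2 * d) / g ^ 2 * ((r : ℂ) ^ 2 - κ ^ 2)⁻¹ := by
    intro κ hκ r hκi
    obtain ⟨c, hc, hb⟩ := exists_one_add_sq_le hκi
    have hne : (r : ℂ) ^ 2 - κ ^ 2 ≠ 0 := by
      rw [← norm_pos_iff]
      exact lt_of_lt_of_le (by positivity) (hb r)
    have hκ2 : κ ^ 2 = (d / g) ^ 2 := by rcases hκ with rfl | rfl <;> ring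
    rw [hκ2] at hne ⊢
    have h3 : (g * r + d) * (g * r - d) = g ^ 2 * ((r : ℂ) ^ 2 - (d / g) ^ 2) := by
      field_simp; ring
    have h4 : (g * r + d) * (g * r - d) ≠ 0 := by
      rw [h3]; exact mul_ne_zero (pow_ne_zero _ hg) hne
    have n1 := left_ne_zero_of_mul h4
    have n2 := right_ne_zero_of_mul h4
    rw [inv_sub_inv n1 n2, h3]
    field_simp
    ring
  rcases lt_or_gt_of_ne hD with h | h
  · have him : 0 < (d / g).im := by rw [hκ]; exact div_pos (neg_pos.2 h) hns
    simp only [e (d / g) (Or.inl rfl) _ him.ne']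
    rw [integral_const_mul, integral_inv_sq_sub_sq him, sign_neg h]
    simp
    field_simp
  · have him : 0 < (-(d / g)).im := by
      rw [Complex.neg_im, hκ, neg_div, neg_neg]; exact div_pos h hns
    simp only [e (-(d / g)) (Or.inr rfl) _ him.ne']
    rw [integral_const_mul, integral_inv_sq_sub_sq him, sign_pos h]
    simp
    field_simp

/-- The linearized bound of `norm_mul_sub_mul_ge` survives: near the crossing the two linearization
errors take at most half of the constant. -/
theorem exists_separation_of_transversal {γ δ : ℝ → ℂ} {t₀ τ₀ : ℝ} {g d : ℂ}
    (hγ : HasDerivAt γ g t₀) (hδ : HasDerivAt δ d τ₀) (heq : γ t₀ = δ τ₀)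
    (hD : (starRingEnd ℂ d * g).im ≠ 0) :
    ∃ c > 0, ∃ η > 0, ∀ h k : ℝ, |h| ≤ η → |k| ≤ η →
      c * (|h| + |k|) ≤ ‖γ (t₀ + h) - δ (τ₀ + k)‖ := by
  have hg : g ≠ 0 := by rintro rfl; simp at hD
  set c := |(starRingEnd ℂ d * g).im| / (‖g‖ + ‖d‖)
  have hs : 0 < ‖g‖ + ‖d‖ := by positivity
  have hc : 0 < c := div_pos (abs_pos.2 hD) hs
  have h1 := (hasDerivAt_iff_isLittleO_nhds_zero.1 hγ).def (half_pos hc)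
  have h2 := (hasDerivAt_iff_isLittleO_nhds_zero.1 hδ).def (half_pos hc)
  obtain ⟨η, hη, hb⟩ := Metric.eventually_nhds_iff.1 (h1.and h2)
  refine ⟨c / 2, half_pos hc, η / 2, half_pos hη, fun h k hh hk => ?_⟩
  have b1 := (hb (y := h) (by rw [Real.dist_eq, sub_zero]; linarith)).1
  have b2 := (hb (y := k) (by rw [Real.dist_eq, sub_zero]; linarith)).2
  have b3 := norm_mul_sub_mul_ge (g := g) (d := d) h k
  have b4 : c * (|h| + |k|) ≤ ‖g * h - d * k‖ := by
    rw [div_mul_eq_mul_div, div_le_iff₀ hs]; linarith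
  rw [Real.norm_eq_abs] at b1 b2
  have e : g * h - d * k = (γ (t₀ + h) - δ (τ₀ + k)) - (γ (t₀ + h) - γ t₀ - h • g) +
      (δ (τ₀ + k) - δ τ₀ - k • d) := by
    rw [heq]; simp only [Complex.real_smul]; ring
  have b5 : ‖g * h - d * k‖ ≤ ‖γ (t₀ + h) - δ (τ₀ + k)‖ + c / 2 * |h| + c / 2 * |k| := by
    rw [e]
    exact (norm_add_le _ _).trans (add_le_add ((norm_sub_le _ _).trans (by gcongr)) b2)
  nlinarith

theorem HasDerivAt.exists_norm_sub_le {P : ℝ → ℂ} {τ₀ : ℝ} {p : ℂ} (hP : HasDerivAt P p τ₀) :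
    ∃ L > 0, ∀ᶠ ε in 𝓝[>] (0 : ℝ), ‖P (τ₀ - ε) - P (τ₀ + ε)‖ ≤ L * ε := by
  have h := (hasDerivAt_iff_isLittleO_nhds_zero.1 hP).def one_pos
  obtain ⟨η, hη, hb⟩ := Metric.eventually_nhds_iff.1 h
  refine ⟨2 * (1 + ‖p‖), by positivity, ?_⟩
  filter_upwards [Ioo_mem_nhdsGT hη] with ε hε
  have b1 := hb (y := ε) (by rw [Real.dist_eq, sub_zero, abs_of_pos hε.1]; exact hε.2)
  have b2 := hb (y := -ε) (by rw [Real.dist_eq, sub_zero, abs_neg, abs_of_pos hε.1]; exact hε.2)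
  rw [Real.norm_eq_abs, abs_of_pos hε.1, one_mul] at b1
  rw [Real.norm_eq_abs, abs_neg, abs_of_pos hε.1, one_mul] at b2
  have e : P (τ₀ - ε) - P (τ₀ + ε) = (P (τ₀ + -ε) - P τ₀ - (-ε) • p) -
      (P (τ₀ + ε) - P τ₀ - ε • p) - (2 * ε) * p := by
    simp only [Complex.real_smul, sub_eq_add_neg τ₀ ε]; push_cast; ring
  rw [e]
  have b3 : ‖(2 * ε : ℂ) * p‖ = 2 * ε * ‖p‖ := by
    rw [norm_mul, norm_mul, Complex.norm_real, Real.norm_of_nonneg hε.1.le]; simp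
  calc _ ≤ _ := norm_sub_le _ _
    _ ≤ (ε + ε) + 2 * ε * ‖p‖ := by
        rw [b3]; gcongr; exact (norm_sub_le _ _).trans (add_le_add b2 b1)
    _ = _ := by ring

/-- Blow up the crossing by t = t₀ + εr. The integrand tends to φP(1/(gr + d) - 1/(gr - d)), and
only the difference of the two sides is O(r^{-2}); dominated convergence with a multiple of 1/(1 +
r²) gives the model integral. -/
theorem tendsto_local_jump {γ δ φ P : ℝ → ℂ} {t₀ τ₀ : ℝ} {g d p : ℂ} (hγc : Continuous γ)
    (hφ : Continuous φ) (hP : HasDerivAt P p τ₀)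
    (hγ : HasDerivAt γ g t₀) (hδ : HasDerivAt δ d τ₀) (heq : γ t₀ = δ τ₀)
    (hD : (starRingEnd ℂ d * g).im ≠ 0) :
    ∃ η₀ > 0, ∀ η > 0, η ≤ η₀ → Tendsto (fun ε => ∫ t in Set.Icc (t₀ - η) (t₀ + η),
      φ t * (P (τ₀ - ε) / (γ t - δ (τ₀ - ε)) - P (τ₀ + ε) / (γ t - δ (τ₀ + ε)))) (𝓝[>] 0)
      (𝓝 (φ t₀ * P τ₀ * (2 * Real.pi * Complex.I *
        ((SignType.sign (starRingEnd ℂ d * g).im : ℝ) : ℂ) / g))) := by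
  obtain ⟨c, hc, η₀, hη₀, hsep⟩ := exists_separation_of_transversal hγ hδ heq hD
  refine ⟨η₀, hη₀, fun η hη hηle => ?_⟩
  obtain ⟨L₁, hL₁, hL₁'⟩ := hδ.exists_norm_sub_le
  obtain ⟨L₂, hL₂, hL₂'⟩ := hP.exists_norm_sub_le
  obtain ⟨M, hM⟩ := (isCompact_Icc (a := t₀ - η) (b := t₀ + η)).exists_bound_of_continuousOn
    hφ.continuousOn
  have hM0 : 0 ≤ M := (norm_nonneg _).trans (hM t₀ ⟨by linarith, by linarith⟩)
  have tsub : Tendsto (fun ε : ℝ => τ₀ - ε) (𝓝[>] 0) (𝓝 τ₀) := by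
    have := (tendsto_id (x := 𝓝 (0 : ℝ))).const_sub τ₀
    rw [sub_zero] at this
    exact this.mono_left nhdsWithin_le_nhds
  have tadd : Tendsto (fun ε : ℝ => τ₀ + ε) (𝓝[>] 0) (𝓝 τ₀) := by
    have := (tendsto_id (x := 𝓝 (0 : ℝ))).const_add τ₀
    rw [add_zero] at this
    exact this.mono_left nhdsWithin_le_nhds
  have hPm := hP.continuousAt.tendsto.comp tsub
  have hPp := hP.continuousAt.tendsto.comp tadd
  have hPb := hPm.norm.eventually_lt_const (lt_add_one ‖P τ₀‖)
  set F : ℝ → ℝ → ℂ := fun ε t =>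
    φ t * (P (τ₀ - ε) / (γ t - δ (τ₀ - ε)) - P (τ₀ + ε) / (γ t - δ (τ₀ + ε))) with hF
  set I := Set.Icc (t₀ - η) (t₀ + η) with hI
  -- The window becomes all of ℝ, the cut-off being carried by the indicator.
  have hscale : ∀ ε > 0, ∫ t in I, F ε t = ∫ r : ℝ, (ε : ℂ) * I.indicator (F ε) (t₀ + ε * r) := by
    intro ε hε
    rw [← integral_indicator measurableSet_Icc, integral_const_mul]
    rw [← integral_add_left_eq_self _ t₀]
    have := Measure.integral_comp_mul_left (fun s => I.indicator (F ε) (t₀ + s)) ε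
    rw [this, abs_of_pos (inv_pos.2 hε), Complex.real_smul]
    have : (ε : ℂ) ≠ 0 := by exact_mod_cast hε.ne'
    push_cast
    field_simp
    rfl
  have hlim : φ t₀ * P τ₀ * (2 * Real.pi * Complex.I *
        ((SignType.sign (starRingEnd ℂ d * g).im : ℝ) : ℂ) / g) =
      ∫ r : ℝ, φ t₀ * P τ₀ * ((g * r + d)⁻¹ - (g * r - d)⁻¹) := by
    rw [integral_const_mul, integral_inv_sub_inv hD]
  rw [hlim]
  have hev : ∀ᶠ ε in 𝓝[>] (0 : ℝ), ε ∈ Set.Ioo 0 η₀ := Ioo_mem_nhdsGT hη₀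
  refine Tendsto.congr' (hev.mono fun ε hε => (hscale ε hε.1).symm) ?_
  refine tendsto_integral_filter_of_dominated_convergence
    (fun r => (M * ((‖P τ₀‖ + 1) * L₁ / c ^ 2 + L₂ * (2 * η₀) / c)) * (1 + r ^ 2)⁻¹) ?_ ?_
    (integrable_inv_one_add_sq.const_mul _) ?_
  · refine Eventually.of_forall fun ε => ?_
    have m1 : Measurable (F ε) := by
      have := hφ.measurable
      have := hγc.measurable
      fun_prop
    have m2 : Measurable (I.indicator (F ε)) := m1.indicator measurableSet_Icc
    exact ((m2.comp (by fun_prop : Measurable fun r : ℝ => t₀ + ε * r)).const_mul _).aestronglyMeasurable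
  · filter_upwards [hev, hL₁', hL₂', hPb] with ε hε e1 e2 e3
    refine Eventually.of_forall fun r => ?_
    have hε0 : (0 : ℝ) < ε := hε.1
    have hK0 : 0 ≤ (M * ((‖P τ₀‖ + 1) * L₁ / c ^ 2 + L₂ * (2 * η₀) / c)) * (1 + r ^ 2)⁻¹ := by
      positivity
    by_cases hr : t₀ + ε * r ∈ I
    · rw [Set.indicator_of_mem hr, norm_mul, Complex.norm_real, Real.norm_of_nonneg hε0.le]
      have hr' : |ε * r| ≤ η := by
        rw [abs_le]; constructor <;> linarith [hr.1, hr.2]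
      have s1 := hsep (ε * r) (-ε) (hr'.trans hηle) (by rw [abs_neg, abs_of_pos hε0]; exact hε.2.le)
      have s2 := hsep (ε * r) ε (hr'.trans hηle) (by rw [abs_of_pos hε0]; exact hε.2.le)
      rw [abs_neg, ← sub_eq_add_neg] at s1
      rw [abs_mul, abs_of_pos hε0] at s1 s2 hr'
      set a := γ (t₀ + ε * r) - δ (τ₀ - ε)
      set b := γ (t₀ + ε * r) - δ (τ₀ + ε)
      set R := 1 + |r| with hR
      have hR1 : 1 ≤ R := by have := abs_nonneg r; linarith
      have hR0 : 0 < R := by linarith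
      have s1' : c * ε * R ≤ ‖a‖ := by rw [hR]; linarith
      have s2' : c * ε * R ≤ ‖b‖ := by rw [hR]; linarith
      have ha0 : 0 < ‖a‖ := lt_of_lt_of_le (by positivity) s1'
      have hb0 : 0 < ‖b‖ := lt_of_lt_of_le (by positivity) s2'
      have hab : b - a = δ (τ₀ - ε) - δ (τ₀ + ε) := by simp only [a, b]; ring
      have ha' : a ≠ 0 := norm_pos_iff.1 ha0
      have hb' : b ≠ 0 := norm_pos_iff.1 hb0
      have key : ‖P (τ₀ - ε) / a - P (τ₀ + ε) / b‖ ≤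
          (‖P τ₀‖ + 1) * (L₁ * ε) / ((c * ε * R) * (c * ε * R)) + L₂ * ε / (c * ε * R) := by
        have e : P (τ₀ - ε) / a - P (τ₀ + ε) / b =
            P (τ₀ - ε) * (b - a) / (a * b) + (P (τ₀ - ε) - P (τ₀ + ε)) / b := by
          field_simp; ring
        rw [e, hab]
        refine (norm_add_le _ _).trans ?_
        rw [norm_div, norm_div, norm_mul, norm_mul]
        simp only [Function.comp_apply] at e3
        gcongr
      -- The variation of P contributes only ε/R instead of 1/R². Inside the window εR is bounded,
      -- which supplies the missing factor.
      have hRε : ε * R ≤ 2 * η₀ := by rw [hR, mul_add, mul_one]; linarith [hε.2]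
      have hR2 : 1 + r ^ 2 ≤ R ^ 2 := by rw [hR]; nlinarith [sq_abs r, abs_nonneg r]
      calc _ ≤ ε * (M * ((‖P τ₀‖ + 1) * (L₁ * ε) / ((c * ε * R) * (c * ε * R)) +
            L₂ * ε / (c * ε * R))) := by
            rw [hF]
            simp only [norm_mul]
            gcongr
            · exact hM _ hr
        _ = M * ((‖P τ₀‖ + 1) * L₁ / c ^ 2 + L₂ * (ε * R) / c) * (R ^ 2)⁻¹ := by
            field_simp
        _ ≤ _ := by gcongr
    · rw [Set.indicator_of_notMem hr]; simpa using hK0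
  · refine Eventually.of_forall fun r => ?_
    have hmem : ∀ᶠ ε in 𝓝[>] (0 : ℝ), t₀ + ε * r ∈ I := by
      have : Tendsto (fun ε : ℝ => t₀ + ε * r) (𝓝 0) (𝓝 (t₀ + 0 * r)) :=
        (by fun_prop : Continuous fun ε : ℝ => t₀ + ε * r).tendsto 0
      rw [zero_mul, add_zero] at this
      exact (this.mono_left nhdsWithin_le_nhds).eventually
        (Icc_mem_nhds (by linarith) (by linarith))
    have hγr : HasDerivAt (fun ε : ℝ => γ (t₀ + ε * r)) (g * r) 0 := by
      have h0 : HasDerivAt (fun ε : ℝ => t₀ + ε * r) r 0 := by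
        simpa using ((hasDerivAt_id (0 : ℝ)).mul_const r).const_add t₀
      have := HasDerivAt.scomp (0 : ℝ) (h := fun ε : ℝ => t₀ + ε * r) (g₁ := γ) (g₁' := g) (h' := r)
        (by simpa using hγ) h0
      refine this.congr_deriv ?_
      rw [Complex.real_smul, mul_comm]
    have hδm : HasDerivAt (fun ε : ℝ => δ (τ₀ - ε)) (-d) 0 := by
      have h0 : HasDerivAt (fun ε : ℝ => τ₀ - ε) (-1) 0 := (hasDerivAt_id (0 : ℝ)).const_sub τ₀
      have := HasDerivAt.scomp (0 : ℝ) (h := fun ε : ℝ => τ₀ - ε) (g₁ := δ) (g₁' := d) (h' := -1)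
        (by simpa using hδ) h0
      refine this.congr_deriv (by simp)
    have hδp : HasDerivAt (fun ε : ℝ => δ (τ₀ + ε)) d 0 := by
      have h0 : HasDerivAt (fun ε : ℝ => τ₀ + ε) 1 0 := (hasDerivAt_id (0 : ℝ)).const_add τ₀
      have := HasDerivAt.scomp (0 : ℝ) (h := fun ε : ℝ => τ₀ + ε) (g₁ := δ) (g₁' := d) (h' := 1)
        (by simpa using hδ) h0
      refine this.congr_deriv (by simp)
    have l1 := (hγr.sub hδm).tendsto_slope_zero_right
    have l2 := (hγr.sub hδp).tendsto_slope_zero_right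
    simp only [Pi.sub_apply, zero_add, zero_mul, add_zero, sub_zero, heq, sub_self, sub_neg_eq_add] at l1 l2
    have hne : ∀ b : ℝ, |b| = 1 → g * r - d * b ≠ 0 := by
      intro b hb h0
      have := norm_mul_sub_mul_ge (g := g) (d := d) r b
      rw [h0, norm_zero, mul_zero, hb] at this
      have h3 : 0 < |(starRingEnd ℂ d * g).im| := abs_pos.2 hD
      nlinarith [abs_nonneg r]
    have n1 : g * r + d ≠ 0 := by simpa using hne (-1) (by simp)
    have n2 : g * r - d ≠ 0 := by simpa using hne 1 (by simp)
    have tφ : Tendsto (fun ε : ℝ => φ (t₀ + ε * r)) (𝓝[>] 0) (𝓝 (φ t₀)) := by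
      have : Tendsto (fun ε : ℝ => φ (t₀ + ε * r)) (𝓝 0) (𝓝 (φ (t₀ + 0 * r))) :=
        (by fun_prop : Continuous fun ε : ℝ => φ (t₀ + ε * r)).tendsto 0
      rw [zero_mul, add_zero] at this
      exact this.mono_left nhdsWithin_le_nhds
    have lim := tφ.mul ((hPm.mul (l1.inv₀ n1)).sub (hPp.mul (l2.inv₀ n2)))
    rw [← mul_sub, ← mul_assoc] at lim
    refine lim.congr' ?_
    filter_upwards [hmem, hev] with ε h1 h2
    rw [Set.indicator_of_mem h1]
    have : (ε : ℂ) ≠ 0 := by exact_mod_cast h2.1.ne'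
    simp only [hF, Function.comp_apply, Complex.real_smul, mul_inv, Complex.ofReal_inv, inv_inv,
      div_eq_mul_inv]
    ring

/-! ### Separation of the ends of primal and dual contours -/

/-- By homogeneity it is enough to treat a + b = 1; there the norm has a positive minimum on a
compact segment. -/
theorem exists_le_norm_sub_of_not_parallel {φ ψ : ℂ} (hφ : φ ≠ 0) (hψ : ψ ≠ 0)
    (h : ∀ l : ℝ, 0 < l → φ ≠ l * ψ) :
    ∃ c > 0, ∀ a b : ℝ, 0 ≤ a → 0 ≤ b → c * (a + b) ≤ ‖(a : ℂ) * φ - b * ψ‖ := by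
  have hcont : ContinuousOn (fun a : ℝ => ‖(a : ℂ) * φ - ((1 - a : ℝ) : ℂ) * ψ‖) (Set.Icc 0 1) := by
    fun_prop
  obtain ⟨a₀, ha₀, hmin⟩ := isCompact_Icc.exists_isMinOn (Set.nonempty_Icc.2 zero_le_one) hcont
  refine ⟨‖(a₀ : ℂ) * φ - ((1 - a₀ : ℝ) : ℂ) * ψ‖, ?_, fun a b ha hb => ?_⟩
  · rw [gt_iff_lt, norm_pos_iff, sub_ne_zero]
    intro he
    rcases ha₀.1.eq_or_lt with h0 | h0
    · rw [← h0] at he; simp at he; exact hψ he.symm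
    · rcases ha₀.2.eq_or_lt with h1 | h1
      · rw [h1] at he; simp at he; exact hφ he
      · refine h ((1 - a₀) / a₀) (div_pos (by linarith) h0) ?_
        have : (a₀ : ℂ) ≠ 0 := by exact_mod_cast h0.ne'
        rw [Complex.ofReal_div, div_mul_eq_mul_div, ← he]
        field_simp
  · rcases (add_nonneg ha hb).eq_or_lt with h0 | h0
    · rw [← h0, mul_zero]; exact norm_nonneg _
    · have hm := hmin (a := a / (a + b)) ⟨by positivity, by rw [div_le_one h0]; linarith⟩
      simp only [Set.mem_ofPred_eq] at hm
      have hne : ((a + b : ℝ) : ℂ) ≠ 0 := by exact_mod_cast h0.ne'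
      have e : (a : ℂ) * φ - b * ψ = ((a + b : ℝ) : ℂ) *
          (((a / (a + b) : ℝ) : ℂ) * φ - ((1 - a / (a + b) : ℝ) : ℂ) * ψ) := by
        push_cast at hne ⊢
        field_simp
        ring
      rw [e, norm_mul, Complex.norm_real, Real.norm_of_nonneg h0.le, mul_comm]
      gcongr

section

variable {A B : ℂ[X]} {u : ℂ}

/-- The leading terms of the exponents of W and Ŵ at infinity are opposite, so a direction in which
both decay is impossible; without sectors the directions are u and -u. -/
theorem not_parallel_infinity (hu : u ≠ 0) {φ ψ : ℂ}
    (h : (ContourEnd.infinity φ).Admissible (-(A + derivative B)) B u)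
    (h' : (ContourEnd.infinity ψ).Admissible A B (-u)) (l : ℝ) (hl : 0 < l) : φ ≠ l * ψ := by
  rintro rfl
  have hd := natDegree_lt_natDegree_neg_add_derivative_iff A B
  rcases h with ⟨h1, h2⟩ | ⟨h1, h2⟩
  · rcases h' with ⟨h3, h4⟩ | ⟨h3, h4⟩
    · have hdB : (derivative B).natDegree < A.natDegree :=
        ((natDegree_derivative_le B).trans (Nat.sub_le _ _)).trans_lt h3
      have e1 : (-(A + derivative B)).natDegree = A.natDegree := by
        rw [natDegree_neg, natDegree_add_eq_left_of_natDegree_lt hdB]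
      have e2 : (-(A + derivative B)).leadingCoeff = -A.leadingCoeff := by
        rw [leadingCoeff_neg, leadingCoeff_add_of_degree_lt']
        exact degree_lt_degree hdB
      rw [e1, e2, mul_pow, neg_div, ← Complex.ofReal_pow] at h2
      set m := A.natDegree - B.natDegree + 1
      have : (-(A.leadingCoeff / B.leadingCoeff) * (((l ^ m : ℝ) : ℂ) * ψ ^ m)) =
          ((-(l ^ m) : ℝ) : ℂ) * (A.leadingCoeff / B.leadingCoeff * ψ ^ m) := by push_cast; ring
      rw [this, Complex.re_ofReal_mul] at h2
      have := pow_pos hl m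
      nlinarith
    · omega
  · rcases h' with ⟨h3, h4⟩ | ⟨h3, h4⟩
    · omega
    · rw [h4] at h2
      have : (1 + l : ℂ) * u = 0 := by linear_combination -h2
      rcases mul_eq_zero.1 this with h5 | h5
      · have : ((1 + l : ℝ) : ℂ) = 0 := by push_cast; exact h5
        have := Complex.ofReal_eq_zero.1 this
        linarith
      · exact hu h5

theorem derivative_eval_ne_zero_of_simple (hB : B ≠ 0) {b : ℂ} (h : B.rootMultiplicity b = 1) :
    (derivative B).eval b ≠ 0 := by
  intro h0
  have hr : B.IsRoot b := (rootMultiplicity_pos'.1 (by omega : 0 < B.rootMultiplicity b)).2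
  have := (one_lt_rootMultiplicity_iff_isRoot hB).2 ⟨hr, h0⟩
  omega

theorem derivative_eval_eq_zero_of_multiple (hB : B ≠ 0) {b : ℂ} (h : 2 ≤ B.rootMultiplicity b) :
    (derivative B).eval b = 0 :=
  ((one_lt_rootMultiplicity_iff_isRoot hB).1 (by omega)).2

/-- At a multiple zero B' vanishes, so the two values of N are opposite and the sectors are
disjoint. At a simple zero two natural exponents k, k' would satisfy k + k' + 1 = 0, so primal and
dual contours cannot both end there. -/
theorem not_parallel_point (hB : B ≠ 0) {b φ ψ : ℂ}
    (h : (ContourEnd.point b φ).Admissible (-(A + derivative B)) B u)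
    (h' : (ContourEnd.point b ψ).Admissible A B (-u)) :
    2 ≤ B.rootMultiplicity b ∧ ∀ l : ℝ, 0 < l → φ ≠ l * ψ := by
  rcases h with ⟨h1, h2⟩ | ⟨h1, _, k, hk⟩
  · rcases h' with ⟨h3, h4⟩ | ⟨h3, _⟩
    · refine ⟨h1, ?_⟩
      rintro l hl rfl
      rw [eval_neg, eval_add, derivative_eval_eq_zero_of_multiple hB h1, add_zero, mul_pow,
        ← Complex.ofReal_pow] at h2
      set m := B.rootMultiplicity b - 1
      have hl' := pow_pos hl m
      have : ((l ^ m : ℝ) : ℂ) ≠ 0 := by exact_mod_cast hl'.ne'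
      have e : -A.eval b / (taylor b B).coeff (B.rootMultiplicity b) / (((l ^ m : ℝ) : ℂ) * ψ ^ m) =
          ((-(l ^ m)⁻¹ : ℝ) : ℂ) *
            (A.eval b / (taylor b B).coeff (B.rootMultiplicity b) / ψ ^ m) := by
        push_cast at this ⊢
        field_simp
      rw [e, Complex.re_ofReal_mul] at h2
      have := inv_pos.2 hl'
      nlinarith
    · omega
  · rcases h' with ⟨h3, h4⟩ | ⟨h3, _, k', hk'⟩
    · omega
    · have hd := derivative_eval_ne_zero_of_simple hB h1
      rw [eval_neg, eval_add, hk'] at hk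
      have : ((k + k' + 1 : ℕ) : ℂ) * (derivative B).eval b = 0 := by
        push_cast; linear_combination -hk
      rcases mul_eq_zero.1 this with h5 | h5
      · exact absurd h5 (Nat.cast_ne_zero.2 (Nat.succ_ne_zero (k + k')))
      · exact absurd h5 hd

/-- The scale on which the other contours stay away from an end. -/
def ContourEnd.scale (B : ℂ[X]) : ContourEnd → ℝ → ℝ
  | .infinity _, _ => 1
  | .point b _, t => if 2 ≤ B.rootMultiplicity b then Real.exp (-t) else 1

theorem ContourEnd.scale_pos (B : ℂ[X]) (e : ContourEnd) (t : ℝ) : 0 < e.scale B t := by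
  cases e with
  | infinity φ => exact one_pos
  | point b φ =>
    simp only [scale]
    split_ifs
    · exact Real.exp_pos _
    · exact one_pos

theorem ContourEnd.scale_le_one (B : ℂ[X]) (e : ContourEnd) {t : ℝ} (ht : 0 ≤ t) :
    e.scale B t ≤ 1 := by
  cases e with
  | infinity φ => exact le_rfl
  | point b φ =>
    simp only [scale]
    split_ifs
    · exact Real.exp_le_one_iff.2 (by linarith)
    · exact le_rfl

theorem tendsto_boundary_div_scale {N : ℂ[X]} {x : ℂ} {γ W : ℝ → ℂ} (hB : B ≠ 0) (hu : u ≠ 0)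
    (hγ : ContDiff ℝ 1 γ) (hW : ∀ t, HasDerivAt W (logDerivAlong N B γ t * W t) t) {e : ContourEnd}
    (he : e.Admissible N B u) (hend : e.IsEndOf γ) (hx : x ∈ decayDomain N B u) :
    Tendsto (fun t => ‖B.eval (γ t) * (Complex.exp (x * γ t) * W t)‖ / e.scale B t)
      atTop (𝓝 0) := by
  have h := (tendsto_eval_mul_of_end hB hu hγ hW he hend hx).norm
  rw [norm_zero] at h
  cases e with
  | infinity φ => simpa only [ContourEnd.scale, div_one] using h
  | point b φ =>
    simp only [ContourEnd.scale]
    split_ifs with hm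
    · exact tendsto_eval_mul_div_of_multiple hB hγ hW he hend hm
    · simpa only [div_one] using h

theorem ContourEnd.IsEndOf.eventually_norm_sub_le {φ : ℂ} {γ : ℝ → ℂ}
    (h : (ContourEnd.infinity φ).IsEndOf γ) {c : ℝ} (hc : 0 < c) :
    ∀ᶠ t : ℝ in atTop, ‖γ t - t * φ‖ ≤ c * t := by
  have h1 := (tendsto_iff_norm_sub_tendsto_zero.1 h.1).eventually_lt_const hc
  filter_upwards [h1, eventually_gt_atTop 0] with t ht h0
  have ht0 : (t : ℂ) ≠ 0 := by exact_mod_cast h0.ne'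
  have e : γ t - t * φ = t * (γ t / t - φ) := by field_simp
  rw [e, norm_mul, Complex.norm_real, Real.norm_of_nonneg h0.le, mul_comm]
  gcongr

theorem ContourEnd.IsEndOf.eventually_norm_sub_point_le {b φ : ℂ} {γ : ℝ → ℂ}
    (h : (ContourEnd.point b φ).IsEndOf γ) {c : ℝ} (hc : 0 < c) :
    ∀ᶠ t : ℝ in atTop, ‖γ t - b - (Real.exp (-t) : ℝ) * φ‖ ≤ c * Real.exp (-t) := by
  have h1 := (tendsto_iff_norm_sub_tendsto_zero.1 h.1).eventually_lt_const hc
  filter_upwards [h1] with t ht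
  have e0 : ((Real.exp (-t) : ℝ) : ℂ) * (Real.exp t : ℝ) = 1 := by
    rw [← Complex.ofReal_mul, ← Real.exp_add]; simp
  have e : γ t - b - (Real.exp (-t) : ℝ) * φ =
      (Real.exp (-t) : ℝ) * ((Real.exp t : ℝ) * (γ t - b) - φ) := by
    linear_combination -(γ t - b) * e0
  rw [e, norm_mul, Complex.norm_real, Real.norm_of_nonneg (Real.exp_pos _).le, mul_comm]
  gcongr

/-- Two ends at infinity, or at different points, stay a fixed distance apart. The only ends that
approach each other run into the same multiple zero in non-parallel directions; their distance is
then at least a multiple of e^{-t} + e^{-τ}, uniformly in t. -/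
theorem exists_end_separation (hB : B ≠ 0) (hu : u ≠ 0) {e e' : ContourEnd} {γ δ : ℝ → ℂ}
    (he : e.Admissible (-(A + derivative B)) B u) (hγ : e.IsEndOf γ)
    (he' : e'.Admissible A B (-u)) (hδ : e'.IsEndOf δ) :
    ∃ c > 0, ∃ T, ∀ t ≥ T, ∀ τ ≥ T, c * e'.scale B τ ≤ ‖γ t - δ τ‖ := by
  have hu' := neg_ne_zero.2 hu
  -- In all but the last configuration a constant bound is enough, because the scale is at most 1
  -- for τ ≥ 0.
  have of_const : ∀ c > 0, ∀ p q : ℝ → Prop, (∀ᶠ t in atTop, p t) → (∀ᶠ t in atTop, q t) →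
      (∀ t τ, p t → q τ → c ≤ ‖γ t - δ τ‖) →
      ∃ c > 0, ∃ T, ∀ t ≥ T, ∀ τ ≥ T, c * e'.scale B τ ≤ ‖γ t - δ τ‖ := by
    intro c hc p q hp hq h
    obtain ⟨T, hT⟩ := eventually_atTop.1 (hp.and hq)
    refine ⟨c, hc, max T 0, fun t ht τ hτ => ?_⟩
    refine le_trans ?_ (h t τ (hT t ((le_max_left _ _).trans ht)).1
      (hT τ ((le_max_left _ _).trans hτ)).2)
    exact mul_le_of_le_one_right hc.le (e'.scale_le_one B ((le_max_right _ _).trans hτ))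
  rcases e with φ | ⟨b, φ⟩ <;> rcases e' with ψ | ⟨b', ψ⟩
  · obtain ⟨c, hc, hcb⟩ := exists_le_norm_sub_of_not_parallel (he.infinity_ne_zero hu)
      (he'.infinity_ne_zero hu') (not_parallel_infinity hu he he')
    refine of_const (c / 2) (half_pos hc) (fun t : ℝ => ‖γ t - t * φ‖ ≤ c / 2 * t ∧ 1 ≤ t)
      (fun t : ℝ => ‖δ t - t * ψ‖ ≤ c / 2 * t ∧ 1 ≤ t)
      ((hγ.eventually_norm_sub_le (half_pos hc)).and (eventually_ge_atTop 1))
      ((hδ.eventually_norm_sub_le (half_pos hc)).and (eventually_ge_atTop 1)) ?_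
    rintro t τ ⟨h1, h1'⟩ ⟨h2, h2'⟩
    have h3 := hcb t τ (by linarith) (by linarith)
    have e : (t : ℂ) * φ - τ * ψ = (γ t - δ τ) - (γ t - t * φ) + (δ τ - τ * ψ) := by ring
    have h4 : ‖(t : ℂ) * φ - τ * ψ‖ ≤ ‖γ t - δ τ‖ + c / 2 * t + c / 2 * τ := by
      rw [e]
      exact (norm_add_le _ _).trans (add_le_add ((norm_sub_le _ _).trans (by gcongr)) h2)
    nlinarith
  · refine of_const 1 one_pos (fun t => ‖b'‖ + 2 ≤ ‖γ t‖) (fun t => ‖δ t‖ < ‖b'‖ + 1)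
      ((tendsto_norm_of_tendsto_div (he.infinity_ne_zero hu) hγ.1).eventually_ge_atTop _)
      (hδ.tendsto_point.norm.eventually_lt_const (lt_add_one _)) fun t τ h1 h2 => ?_
    have := norm_sub_norm_le (γ t) (δ τ)
    linarith
  · refine of_const 1 one_pos (fun t => ‖γ t‖ < ‖b‖ + 1) (fun t => ‖b‖ + 2 ≤ ‖δ t‖)
      (hγ.tendsto_point.norm.eventually_lt_const (lt_add_one _))
      ((tendsto_norm_of_tendsto_div (he'.infinity_ne_zero hu') hδ.1).eventually_ge_atTop _)
      fun t τ h1 h2 => ?_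
    have := norm_sub_norm_le (δ τ) (γ t)
    rw [norm_sub_rev]
    linarith
  · by_cases hb : b = b'
    · subst hb
      obtain ⟨hm, hp⟩ := not_parallel_point hB he he'
      obtain ⟨c, hc, hcb⟩ := exists_le_norm_sub_of_not_parallel he.point_ne_zero
        he'.point_ne_zero hp
      obtain ⟨T, hT⟩ := eventually_atTop.1 ((hγ.eventually_norm_sub_point_le (half_pos hc)).and
        (hδ.eventually_norm_sub_point_le (half_pos hc)))
      refine ⟨c / 2, half_pos hc, T, fun t ht τ hτ => ?_⟩
      have h1 := (hT t ht).1
      have h2 := (hT τ hτ).2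
      have p1 := Real.exp_pos (-t)
      have p2 := Real.exp_pos (-τ)
      have h3 := hcb _ _ p1.le p2.le
      have e : ((Real.exp (-t) : ℝ) : ℂ) * φ - (Real.exp (-τ) : ℝ) * ψ = (γ t - δ τ) -
          (γ t - b - (Real.exp (-t) : ℝ) * φ) + (δ τ - b - (Real.exp (-τ) : ℝ) * ψ) := by ring
      have h4 : ‖((Real.exp (-t) : ℝ) : ℂ) * φ - (Real.exp (-τ) : ℝ) * ψ‖ ≤
          ‖γ t - δ τ‖ + c / 2 * Real.exp (-t) + c / 2 * Real.exp (-τ) := by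
        rw [e]
        exact (norm_add_le _ _).trans (add_le_add ((norm_sub_le _ _).trans (by gcongr)) h2)
      simp only [ContourEnd.scale, if_pos hm]
      nlinarith
    · have hd : 0 < ‖b - b'‖ := norm_pos_iff.2 (sub_ne_zero.2 hb)
      refine of_const (‖b - b'‖ / 3) (by positivity) (fun t => ‖γ t - b‖ < ‖b - b'‖ / 3)
        (fun t => ‖δ t - b'‖ < ‖b - b'‖ / 3)
        ((tendsto_iff_norm_sub_tendsto_zero.1 hγ.tendsto_point).eventually_lt_const (by positivity))
        ((tendsto_iff_norm_sub_tendsto_zero.1 hδ.tendsto_point).eventually_lt_const (by positivity))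
        fun t τ h1 h2 => ?_
      have e : b - b' = (γ t - δ τ) - (γ t - b) + (δ τ - b') := by ring
      have : ‖b - b'‖ ≤ ‖γ t - δ τ‖ + ‖γ t - b‖ + ‖δ τ - b'‖ := by
        conv_lhs => rw [e]
        exact (norm_add_le _ _).trans (add_le_add_left (norm_sub_le _ _) _)
      linarith

theorem exists_compact_separation {N : ℂ[X]} {u' : ℂ} (hu : u' ≠ 0)
    (Γ : AdmissibleContour N B u) {e' : ContourEnd} {N' : ℂ[X]}
    {δ : ℝ → ℂ} (he' : e'.Admissible N' B u') (hδ : e'.IsEndOf δ) {S : Set ℝ} (hS : IsCompact S) :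
    ∃ c > 0, ∃ T, ∀ t ∈ S, ∀ τ ≥ T, c ≤ ‖Γ.path t - δ τ‖ := by
  rcases e' with ψ | ⟨b, ψ⟩
  · obtain ⟨M, hM⟩ := hS.exists_bound_of_continuousOn Γ.continuous_path.continuousOn
    obtain ⟨T, hT⟩ := eventually_atTop.1
      ((tendsto_norm_of_tendsto_div (he'.infinity_ne_zero hu) hδ.1).eventually_ge_atTop (M + 1))
    refine ⟨1, one_pos, T, fun t ht τ hτ => ?_⟩
    have h1 := hM t ht
    have h2 := hT τ hτ
    have := norm_sub_norm_le (δ τ) (Γ.path t)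
    rw [norm_sub_rev]
    linarith
  · have hb := he'.eval_eq_zero
    rcases S.eq_empty_or_nonempty with rfl | hne
    · exact ⟨1, one_pos, 0, by simp⟩
    obtain ⟨t₀, ht₀, hmin⟩ := hS.exists_isMinOn hne
      (f := fun t => ‖Γ.path t - b‖) (Γ.continuous_path.sub continuous_const).norm.continuousOn
    have hpos : 0 < ‖Γ.path t₀ - b‖ := by
      rw [norm_pos_iff, sub_ne_zero]
      intro h
      exact Γ.avoids t₀ (h ▸ hb)
    obtain ⟨T, hT⟩ := eventually_atTop.1
      ((tendsto_iff_norm_sub_tendsto_zero.1 hδ.tendsto_point).eventually_lt_const (half_pos hpos))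
    refine ⟨‖Γ.path t₀ - b‖ / 2, half_pos hpos, T, fun t ht τ hτ => ?_⟩
    have h1 := hmin ht
    simp only [Set.mem_ofPred_eq] at h1
    have h2 := hT τ hτ
    have e : Γ.path t - b = (Γ.path t - δ τ) + (δ τ - b) := by ring
    have h3 : ‖Γ.path t - b‖ ≤ ‖Γ.path t - δ τ‖ + ‖δ τ - b‖ := by
      conv_lhs => rw [e]
      exact norm_add_le _ _
    linarith

theorem exists_separation_from_end (hu : u ≠ 0) (Γ : PrimalContour A B u) {e' : ContourEnd}
    {δ : ℝ → ℂ} (he' : e'.Admissible A B (-u)) (hδ : e'.IsEndOf δ) :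
    ∃ c > 0, ∃ T, ∀ t ∈ Γ.dom, ∀ τ ≥ T, c * e'.scale B τ ≤ ‖Γ.path t - δ τ‖ := by
  by_cases h : Γ.isLoop
  · obtain ⟨c, hc, T, hT⟩ := exists_compact_separation (neg_ne_zero.2 hu) Γ he' hδ
      (isCompact_Icc (a := (0 : ℝ)) (b := 1))
    refine ⟨c, hc, max T 0, fun t ht τ hτ => ?_⟩
    rw [Γ.dom_of_loop h] at ht
    refine le_trans ?_ (hT t (Set.Ico_subset_Icc_self ht) τ ((le_max_left _ _).trans hτ))
    exact mul_le_of_le_one_right hc.le (e'.scale_le_one B ((le_max_right _ _).trans hτ))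
  · obtain ⟨e₀, e₁, h0, h1, he0, he1⟩ := Γ.arc h
    obtain ⟨c₀, hc₀, T₀, hT₀⟩ := exists_end_separation Γ.ne_zero hu h0 he0 he' hδ
    obtain ⟨c₁, hc₁, T₁, hT₁⟩ := exists_end_separation Γ.ne_zero hu h1 he1 he' hδ
    obtain ⟨c₂, hc₂, T₂, hT₂⟩ := exists_compact_separation (neg_ne_zero.2 hu) Γ he' hδ
      (isCompact_Icc (a := -T₀) (b := T₁))
    refine ⟨min c₀ (min c₁ c₂), lt_min hc₀ (lt_min hc₁ hc₂), max (max T₀ T₁) (max T₂ 0),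
      fun t _ τ hτ => ?_⟩
    have b1 := max_le_iff.1 hτ
    have b2 := max_le_iff.1 b1.1
    have b3 := max_le_iff.1 b1.2
    have hs := (e'.scale_pos B τ).le
    rcases le_total t (-T₀) with h2 | h2
    · have := hT₀ (-t) (by linarith) τ b2.1
      rw [neg_neg] at this
      refine le_trans ?_ this
      gcongr
      exact min_le_left _ _
    · rcases le_total T₁ t with h3 | h3
      · refine le_trans ?_ (hT₁ t h3 τ b2.2)
        gcongr
        exact (min_le_right _ _).trans (min_le_left _ _)
      · refine le_trans ?_ (hT₂ t ⟨h2, h3⟩ τ b3.1)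
        refine (mul_le_of_le_one_right (by positivity) (e'.scale_le_one B b3.2)).trans ?_
        exact (min_le_right _ _).trans (min_le_right _ _)

end

/-! ### The Cauchy integral along a contour -/

namespace AdmissibleContour

variable {N B : ℂ[X]} {u : ℂ} (Γ : AdmissibleContour N B u)

/-- Ends tend to infinity or to zeros of B, hence stay away from s; the rest of the contour is
compact. -/
theorem exists_dist_pos (hu : u ≠ 0) {s : ℂ} (hs : B.eval s ≠ 0) {S : Set ℝ} (hS : IsClosed S)
    (hl : Γ.isLoop → IsCompact S) (h : ∀ t ∈ S, Γ.path t ≠ s) :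
    ∃ ρ > 0, ∀ t ∈ S, ρ ≤ ‖Γ.path t - s‖ := by
  have compact : ∀ K : Set ℝ, IsCompact K → K ⊆ S → ∃ ρ > 0, ∀ t ∈ K, ρ ≤ ‖Γ.path t - s‖ := by
    intro K hK hKS
    rcases K.eq_empty_or_nonempty with rfl | hne
    · exact ⟨1, one_pos, by simp⟩
    obtain ⟨t₀, ht₀, hmin⟩ := hK.exists_isMinOn hne
      (f := fun t => ‖Γ.path t - s‖) (Γ.continuous_path.sub continuous_const).norm.continuousOn
    refine ⟨‖Γ.path t₀ - s‖, norm_pos_iff.2 (sub_ne_zero.2 (h t₀ (hKS ht₀))), fun t ht => hmin ht⟩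
  by_cases hloop : Γ.isLoop
  · exact compact S (hl hloop) subset_rfl
  · have ends : ∀ (e : ContourEnd) (γ : ℝ → ℂ), e.Admissible N B u → e.IsEndOf γ →
        ∃ ρ > 0, ∃ T, ∀ t ≥ T, ρ ≤ ‖γ t - s‖ := by
      intro e γ he hγ
      rcases e with φ | ⟨b, φ⟩
      · obtain ⟨T, hT⟩ := eventually_atTop.1
          ((tendsto_norm_of_tendsto_div (he.infinity_ne_zero hu) hγ.1).eventually_ge_atTop (‖s‖ + 1))
        refine ⟨1, one_pos, T, fun t ht => ?_⟩
        have := norm_sub_norm_le (γ t) s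
        linarith [hT t ht]
      · have hne : 0 < ‖b - s‖ := by
          rw [norm_pos_iff, sub_ne_zero]
          rintro rfl
          exact hs he.eval_eq_zero
        have := (hγ.tendsto_point.sub_const s).norm.eventually_const_lt (half_lt_self hne)
        obtain ⟨T, hT⟩ := eventually_atTop.1 this
        exact ⟨‖b - s‖ / 2, half_pos hne, T, fun t ht => (hT t ht).le⟩
    obtain ⟨e₀, e₁, h0, h1, he0, he1⟩ := Γ.arc hloop
    obtain ⟨ρ₀, hρ₀, T₀, hT₀⟩ := ends e₀ _ h0 he0
    obtain ⟨ρ₁, hρ₁, T₁, hT₁⟩ := ends e₁ _ h1 he1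
    obtain ⟨ρ₂, hρ₂, hT₂⟩ := compact (S ∩ Set.Icc (-T₀) T₁) (isCompact_Icc.inter_left hS)
      Set.inter_subset_left
    refine ⟨min ρ₀ (min ρ₁ ρ₂), lt_min hρ₀ (lt_min hρ₁ hρ₂), fun t ht => ?_⟩
    rcases le_total t (-T₀) with h2 | h2
    · have := hT₀ (-t) (by linarith)
      rw [neg_neg] at this
      exact (min_le_left _ _).trans this
    · rcases le_total T₁ t with h3 | h3
      · exact ((min_le_right _ _).trans (min_le_left _ _)).trans (hT₁ t h3)
      · exact ((min_le_right _ _).trans (min_le_right _ _)).trans (hT₂ t ⟨ht, h2, h3⟩)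

theorem exists_dist_dom_pos (hu : u ≠ 0) {s : ℂ} (hs : B.eval s ≠ 0)
    (h : ∀ t ∈ Γ.dom, Γ.path t ≠ s) : ∃ ρ > 0, ∀ t ∈ Γ.dom, ρ ≤ ‖Γ.path t - s‖ := by
  by_cases hl : Γ.isLoop
  · have hne : ∀ t ∈ Set.Icc (0 : ℝ) 1, Γ.path t ≠ s := by
      intro t ht
      rw [Γ.dom_of_loop hl] at h
      rcases ht.2.eq_or_lt with rfl | h1
      · have := (Γ.loop hl).1 0
        rw [zero_add] at this
        rw [this]
        exact h 0 ⟨le_rfl, one_pos⟩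
      · exact h t ⟨ht.1, h1⟩
    obtain ⟨ρ, hρ, hb⟩ := Γ.exists_dist_pos hu hs isClosed_Icc (fun _ => isCompact_Icc) hne
    refine ⟨ρ, hρ, fun t ht => hb t ?_⟩
    rw [Γ.dom_of_loop hl] at ht
    exact Set.Ico_subset_Icc_self ht
  · rw [Γ.dom_of_arc hl] at h ⊢
    exact Γ.exists_dist_pos hu hs isClosed_univ (fun h => absurd h hl) h

/-- The Cauchy integral of the weight `exp (x y) W(y)` along the contour. -/
def cauchy (x s : ℂ) : ℂ := ∫ t in Γ.dom, Γ.integrand x t / (Γ.path t - s)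

theorem measurable_path : Measurable Γ.path := Γ.continuous_path.measurable

theorem measurable_integrand (x : ℂ) : Measurable (Γ.integrand x) :=
  (Γ.continuous_integrand x).measurable

theorem integrableOn_div_of_dist {f : ℝ → ℂ} (hf : IntegrableOn f Γ.dom) {s : ℂ} {ρ : ℝ}
    (hρ : 0 < ρ) (h : ∀ t ∈ Γ.dom, ρ ≤ ‖Γ.path t - s‖) (k : ℕ) :
    IntegrableOn (fun t => f t / (Γ.path t - s) ^ k) Γ.dom := by
  have hm := Γ.measurable_path
  have : IntegrableOn (fun t => f t * ((Γ.path t - s) ^ k)⁻¹) Γ.dom := by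
    refine Integrable.mul_bdd (c := (ρ ^ k)⁻¹) hf (by fun_prop) ?_
    refine (ae_restrict_iff' Γ.measurableSet_dom).2 (Eventually.of_forall fun t ht => ?_)
    rw [norm_inv, norm_pow]
    exact inv_anti₀ (by positivity) (pow_le_pow_left₀ hρ.le (h t ht) k)
  simpa only [div_eq_mul_inv] using this

theorem norm_cauchy_le (x s : ℂ) {ρ : ℝ} (hx : IntegrableOn (Γ.integrand x) Γ.dom)
    (hρ : 0 < ρ) (h : ∀ t ∈ Γ.dom, ρ ≤ ‖Γ.path t - s‖) :
    ‖Γ.cauchy x s‖ ≤ (∫ t in Γ.dom, ‖Γ.integrand x t‖) / ρ := by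
  rw [← integral_div]
  refine norm_integral_le_of_norm_le (hx.norm.div_const ρ) ?_
  refine (ae_restrict_iff' Γ.measurableSet_dom).2 (Eventually.of_forall fun t ht => ?_)
  rw [norm_div]
  exact div_le_div_of_nonneg_left (norm_nonneg _) hρ (h t ht)

theorem hasDerivAt_cauchy (hu : u ≠ 0) {x : ℂ} (hx : x ∈ decayDomain N B u) {s : ℂ} {ρ : ℝ}
    (hρ : 0 < ρ) (h : ∀ t ∈ Γ.dom, ρ ≤ ‖Γ.path t - s‖) :
    HasDerivAt (Γ.cauchy x) (∫ t in Γ.dom, Γ.integrand x t / (Γ.path t - s) ^ 2) s := by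
  have hi := Γ.integrableOn_integrand hu hx
  have hm := Γ.measurable_path
  have hm' := Γ.measurable_integrand x
  have hball : ∀ t ∈ Γ.dom, ∀ z ∈ Metric.ball s (ρ / 2), ρ / 2 ≤ ‖Γ.path t - z‖ := by
    intro t ht z hz
    have h1 := h t ht
    have h2 := mem_ball_iff_norm.1 hz
    have : Γ.path t - s = (Γ.path t - z) + (z - s) := by ring
    have h3 := norm_add_le (Γ.path t - z) (z - s)
    rw [← this] at h3
    linarith
  refine (hasDerivAt_integral_of_dominated_loc_of_deriv_le
    (F := fun z t => Γ.integrand x t / (Γ.path t - z))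
    (F' := fun z t => Γ.integrand x t / (Γ.path t - z) ^ 2)
    (bound := fun t => ‖Γ.integrand x t‖ / (ρ / 2) ^ 2)
    (Metric.ball_mem_nhds s (half_pos hρ)) (Eventually.of_forall fun y => ?_) ?_ ?_ ?_ ?_ ?_).2
  · exact (hm'.div (hm.sub_const _)).aestronglyMeasurable
  · have := Γ.integrableOn_div_of_dist hi hρ h 1
    simp only [pow_one] at this
    exact this
  · exact (hm'.div ((hm.sub_const _).pow_const 2)).aestronglyMeasurable
  · refine (ae_restrict_iff' Γ.measurableSet_dom).2 (Eventually.of_forall fun t ht z hz => ?_)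
    rw [norm_div, norm_pow]
    have := hball t ht z hz
    gcongr
  · exact hi.norm.div_const _
  · refine (ae_restrict_iff' Γ.measurableSet_dom).2 (Eventually.of_forall fun t ht z hz => ?_)
    have hne : Γ.path t - z ≠ 0 := by
      rw [← norm_pos_iff]
      exact (half_pos hρ).trans_le (hball t ht z hz)
    have := ((hasDerivAt_id z).const_sub (Γ.path t)).inv hne |>.const_mul (Γ.integrand x t)
    refine (this.congr_deriv ?_).congr_of_eventuallyEq (Eventually.of_forall fun y => ?_)
    · simp [div_eq_mul_inv]
    · simp [div_eq_mul_inv]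

/-- The boundary term of the integration by parts. -/
def boundary (x : ℂ) (t : ℝ) : ℂ :=
  B.eval (Γ.path t) * (Complex.exp (x * Γ.path t) * Γ.weight t)

theorem hasDerivAt_boundary' (x : ℂ) (t : ℝ) : HasDerivAt (Γ.boundary x)
    ((N + derivative B + C x * B).eval (Γ.path t) * Γ.integrand x t) t :=
  Γ.hasDerivAt_boundary x t

theorem periodic_boundary (h : Γ.isLoop) (x : ℂ) : Function.Periodic (Γ.boundary x) 1 := fun t => by
  simp only [boundary, (Γ.loop h).1 t, Γ.periodic_weight h t]

theorem boundary_mul_deriv (x : ℂ) (t : ℝ) :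
    Γ.boundary x t * deriv Γ.path t = B.eval (Γ.path t) * Γ.integrand x t := by
  simp only [boundary, integrand]; ring

/-- The total derivative along the contour of B e^{xy}ω/(y - s). It is the part of the double
integrand that integrates to zero over y. -/
theorem setIntegral_deriv_boundary_div (hu : u ≠ 0) {x : ℂ} (hx : x ∈ decayDomain N B u) {s : ℂ}
    {ρ : ℝ} (hρ : 0 < ρ) (h : ∀ t ∈ Γ.dom, ρ ≤ ‖Γ.path t - s‖) :
    ∫ t in Γ.dom, ((N + derivative B + C x * B).eval (Γ.path t) * Γ.integrand x t /
      (Γ.path t - s) - B.eval (Γ.path t) * Γ.integrand x t / (Γ.path t - s) ^ 2) = 0 := by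
  -- The primitive has to be differentiable at every real parameter, not only on `[0, 1)`; for a
  -- loop the bound extends by periodicity.
  have hall : ∀ t, ρ ≤ ‖Γ.path t - s‖ := by
    intro t
    by_cases hl : Γ.isLoop
    · have hp : Function.Periodic (fun t => ‖Γ.path t - s‖) 1 := fun t => by
        simp only [(Γ.loop hl).1 t]
      obtain ⟨y, hy, hy'⟩ := hp.exists_mem_Ico₀ one_pos t
      rw [hy']
      exact h y (by rw [Γ.dom_of_loop hl]; exact hy)
    · exact h t (by rw [Γ.dom_of_arc hl]; trivial)
  have hne : ∀ t, Γ.path t - s ≠ 0 := fun t => norm_pos_iff.1 (hρ.trans_le (hall t))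
  refine Γ.setIntegral_dom_eq_zero (F := fun t => Γ.boundary x t / (Γ.path t - s))
    (fun t => ?_) ?_ (fun hl => ?_) fun hl => ?_
  · refine ((Γ.hasDerivAt_boundary' x t).div ((Γ.hasDerivAt_path t).sub_const s)
      (hne t)).congr_deriv ?_
    rw [Γ.boundary_mul_deriv]
    have := hne t
    field_simp
  · refine Integrable.sub ?_ ?_
    · have := Γ.integrableOn_div_of_dist (Γ.integrableOn_eval_mul_integrand hu hx
        (N + derivative B + C x * B)) hρ h 1
      simp only [pow_one] at this
      exact this
    · exact Γ.integrableOn_div_of_dist (Γ.integrableOn_eval_mul_integrand hu hx B) hρ h 2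
  · have h1 := (Γ.loop hl).1 0
    have h2 := Γ.periodic_boundary hl x 0
    rw [zero_add] at h1 h2
    simp only [h1, h2]
  · have hb := Γ.tendsto_boundary hu hl hx
    have key : ∀ l : Filter ℝ, Tendsto (Γ.boundary x) l (𝓝 0) →
        Tendsto (fun t => Γ.boundary x t / (Γ.path t - s)) l (𝓝 0) := by
      intro l hl
      have h0 := hl.norm.div_const ρ
      rw [norm_zero, zero_div] at h0
      refine squeeze_zero_norm (fun t => ?_) h0
      rw [norm_div]
      exact div_le_div_of_nonneg_left (norm_nonneg _) hρ (hall t)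
    exact ⟨key _ hb.1, key _ hb.2⟩

end AdmissibleContour

/-! ### The primitive of the inner integral. -/

section Concomitant

variable {A B : ℂ[X]} {u : ℂ} (Γ : PrimalContour A B u) (Δ : DualContour A B u)

/-- The primitive, along the dual contour, of the inner integral of the double integral. -/
def concomitantPrimitive (x : ℂ) (τ : ℝ) : ℂ := Δ.boundary (-x) τ * Γ.cauchy x (Δ.path τ)

/-- The inner integral of the double integral. -/
def innerConcomitant (x : ℂ) (τ : ℝ) : ℂ := ∫ t in Γ.dom, concomitantIntegrand Γ Δ x t τ

/-- Off the diagonal the double integrand is a y-derivative plus an s-derivative. The y-derivative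
integrates to zero over Γ, and the s-derivative is the derivative of the primitive. -/
theorem hasDerivAt_concomitantPrimitive (hu : u ≠ 0) {x : ℂ} (hx : x ∈ xDomain A B u) {τ : ℝ}
    (h : ∀ t ∈ Γ.dom, Γ.path t ≠ Δ.path τ) :
    HasDerivAt (concomitantPrimitive Γ Δ x) (innerConcomitant Γ Δ x τ) τ := by
  have hx' := mem_xDomain_iff_primal.1 hx
  obtain ⟨ρ, hρ, hb⟩ := Γ.exists_dist_dom_pos hu (Δ.avoids τ) h
  have h1 := Δ.hasDerivAt_boundary' (-x) τ
  have h2 := (Γ.hasDerivAt_cauchy hu hx' hρ hb).scomp τ (Δ.hasDerivAt_path τ)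
  refine (h1.mul h2).congr_deriv ?_
  have hi := Γ.integrableOn_integrand hu hx'
  have i1 : IntegrableOn (fun t => Γ.integrand x t / (Γ.path t - Δ.path τ)) Γ.dom := by
    simpa using Γ.integrableOn_div_of_dist hi hρ hb 1
  have i2 := Γ.integrableOn_div_of_dist hi hρ hb 2
  have i3 : IntegrableOn (fun t => ((-(A + derivative B) + derivative B + C x * B).eval (Γ.path t) *
      Γ.integrand x t / (Γ.path t - Δ.path τ) -
        B.eval (Γ.path t) * Γ.integrand x t / (Γ.path t - Δ.path τ) ^ 2)) Γ.dom := by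
    refine Integrable.sub ?_ ?_
    · have := Γ.integrableOn_div_of_dist (Γ.integrableOn_eval_mul_integrand hu hx'
        (-(A + derivative B) + derivative B + C x * B)) hρ hb 1
      simp only [pow_one] at this
      exact this
    · exact Γ.integrableOn_div_of_dist (Γ.integrableOn_eval_mul_integrand hu hx' B) hρ hb 2
  have h3 := Γ.setIntegral_deriv_boundary_div hu hx' hρ hb
  -- The exactness of the kernel, as an identity of rational functions in y and s.
  have e : ∀ t ∈ Γ.dom, concomitantIntegrand Γ Δ x t τ = Δ.integrand (-x) τ *
      (((-(A + derivative B) + derivative B + C x * B).eval (Γ.path t) *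
      Γ.integrand x t / (Γ.path t - Δ.path τ) -
        B.eval (Γ.path t) * Γ.integrand x t / (Γ.path t - Δ.path τ) ^ 2) +
      ((A + derivative B + C (-x) * B).eval (Δ.path τ) *
        (Γ.integrand x t / (Γ.path t - Δ.path τ)) +
        B.eval (Δ.path τ) * (Γ.integrand x t / (Γ.path t - Δ.path τ) ^ 2))) := by
    intro t ht
    have hne : Γ.path t - Δ.path τ ≠ 0 := sub_ne_zero.2 (h t ht)
    simp only [concomitantIntegrand, concomitantKernel, if_neg (h t ht), eval_add, eval_neg,
      eval_mul, eval_C]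
    field_simp
    ring
  have i4 : IntegrableOn (fun t => (A + derivative B + C (-x) * B).eval (Δ.path τ) *
      (Γ.integrand x t / (Γ.path t - Δ.path τ)) +
      B.eval (Δ.path τ) * (Γ.integrand x t / (Γ.path t - Δ.path τ) ^ 2)) Γ.dom :=
    (i1.const_mul _).add (i2.const_mul _)
  rw [innerConcomitant, setIntegral_congr_fun Γ.measurableSet_dom e, integral_const_mul,
    integral_add i3 i4, h3,
    integral_add (i1.const_mul _) (i2.const_mul _), integral_const_mul, integral_const_mul,
    smul_eq_mul]
  have h4 := Δ.boundary_mul_deriv (-x) τ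
  simp only [Function.comp_apply, AdmissibleContour.cauchy]
  linear_combination (∫ t in Γ.dom, Γ.integrand x t / (Γ.path t - Δ.path τ) ^ 2) * h4

/-- The Cauchy integral is O(1/scale) by the separation of the ends, while the boundary term divided
by the scale tends to zero. -/
theorem tendsto_concomitantPrimitive_of_end (hu : u ≠ 0) {x : ℂ} (hx : x ∈ xDomain A B u)
    {e : ContourEnd} {δ W : ℝ → ℂ} (hδ : ContDiff ℝ 1 δ)
    (hW : ∀ t, HasDerivAt W (logDerivAlong A B δ t * W t) t) (he : e.Admissible A B (-u))
    (hend : e.IsEndOf δ) :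
    Tendsto (fun τ => B.eval (δ τ) * (Complex.exp (-x * δ τ) * W τ) * Γ.cauchy x (δ τ))
      atTop (𝓝 0) := by
  have hx' := mem_xDomain_iff_primal.1 hx
  obtain ⟨c, hc, T, hT⟩ := exists_separation_from_end hu Γ he hend
  have h1 := (tendsto_boundary_div_scale Γ.ne_zero (neg_ne_zero.2 hu) hδ hW he hend
    (mem_xDomain_iff_dual.1 hx)).mul_const ((∫ t in Γ.dom, ‖Γ.integrand x t‖) / c)
  rw [zero_mul] at h1
  refine squeeze_zero_norm' ?_ h1
  filter_upwards [eventually_ge_atTop T] with τ hτ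
  have hs := e.scale_pos B τ
  have := Γ.norm_cauchy_le x (δ τ) (Γ.integrableOn_integrand hu hx') (mul_pos hc hs)
    fun t ht => hT t ht τ hτ
  rw [norm_mul]
  calc _ ≤ ‖B.eval (δ τ) * (Complex.exp (-x * δ τ) * W τ)‖ *
        ((∫ t in Γ.dom, ‖Γ.integrand x t‖) / (c * e.scale B τ)) := by gcongr
    _ = _ := by field_simp

theorem tendsto_concomitantPrimitive (hu : u ≠ 0) {x : ℂ} (hx : x ∈ xDomain A B u)
    (hl : ¬ Δ.isLoop) : Tendsto (concomitantPrimitive Γ Δ x) atTop (𝓝 0) ∧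
      Tendsto (fun τ => concomitantPrimitive Γ Δ x (-τ)) atTop (𝓝 0) := by
  obtain ⟨e₀, e₁, h0, h1, he0, he1⟩ := Δ.arc hl
  exact ⟨tendsto_concomitantPrimitive_of_end Γ hu hx Δ.contDiff Δ.hasDerivAt_weight h1 he1,
    tendsto_concomitantPrimitive_of_end Γ hu hx Δ.contDiff_reverse Δ.hasDerivAt_weight_reverse
      h0 he0⟩

theorem integrableOn_innerConcomitant (hu : u ≠ 0) {x : ℂ} (hx : x ∈ xDomain A B u) :
    IntegrableOn (innerConcomitant Γ Δ x) Δ.dom := by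
  have h := integrableOn_concomitantIntegrand hu Γ Δ hx
  rw [IntegrableOn, Measure.volume_eq_prod, ← Measure.prod_restrict] at h
  exact h.integral_prod_right

end Concomitant

/-! ### The intersection pairing -/

/-- A crossing of a loop may sit at the parameter 0, where the interval is cut open. Another period
interval has all crossing parameters in its interior. -/
theorem exists_fundamental_interval (F : Finset ℝ) (hF : ∀ t ∈ F, t ∈ Set.Ico (0 : ℝ) 1) :
    ∃ a : ℝ, (∀ t ∈ F, t ∈ Set.Ioo a (a + 1)) ∧
      ∀ t ∈ Set.Icc a (a + 1), t ∉ F → ∃ t' ∈ Set.Ico (0 : ℝ) 1, t' ∉ F ∧ (t' = t ∨ t' = t + 1) := by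
  obtain ⟨m, hm0, hm1, hm⟩ : ∃ m : ℝ, 0 ≤ m ∧ m < 1 ∧ ∀ t ∈ F, t ≤ m := by
    rcases F.eq_empty_or_nonempty with rfl | hne
    · exact ⟨0, le_rfl, one_pos, by simp⟩
    · have := hF _ (F.max'_mem hne)
      exact ⟨F.max' hne, this.1, this.2, fun t ht => F.le_max' t ht⟩
  -- All parameters of F lie in [0, m] with m < 1, and the midpoint of m - 1 and 0 satisfies a < 0
  -- and m < a + 1.
  refine ⟨(m - 1) / 2, fun t ht => ⟨?_, ?_⟩, fun t ht htF => ?_⟩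
  · have := (hF t ht).1; linarith
  · have := hm t ht; linarith
  · rcases lt_or_ge t 0 with h | h
    · refine ⟨t + 1, ⟨?_, ?_⟩, fun h1 => ?_, Or.inr rfl⟩
      · have := ht.1; linarith
      · linarith
      · have := hm _ h1
        have := ht.1
        linarith
    · exact ⟨t, ⟨h, by have := ht.2; linarith⟩, htF, Or.inl rfl⟩

namespace AdmissibleContour

variable {N B : ℂ[X]} {u : ℂ} (Γ : AdmissibleContour N B u)

theorem setIntegral_dom_eq_intervalIntegral (h : Γ.isLoop) {f : ℝ → ℂ}
    (hf : Function.Periodic f 1) (a : ℝ) : ∫ t in Γ.dom, f t = ∫ t in a..(a + 1), f t := by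
  rw [Γ.dom_of_loop h, integral_Ico_eq_integral_Ioc, ← intervalIntegral.integral_of_le zero_le_one]
  have := hf.intervalIntegral_add_eq 0 a
  rwa [zero_add] at this

theorem intervalIntegrable_of_integrableOn_dom (h : Γ.isLoop) {f : ℝ → ℂ}
    (hf : Function.Periodic f 1) (hi : IntegrableOn f Γ.dom) (a b : ℝ) :
    IntervalIntegrable f volume a b := by
  rw [Γ.dom_of_loop h] at hi
  have h1 : IntervalIntegrable f volume 0 (0 + 1) := by
    rw [zero_add, intervalIntegrable_iff_integrableOn_Ico_of_le zero_le_one]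
    exact hi
  exact hf.intervalIntegrable one_ne_zero h1 a b

/-- A fundamental domain of the parameter of a contour that contains given parameters in its
interior. -/
theorem exists_open_fundamental_domain {s : ℂ} {F : Finset ℝ}
    (hF : ∀ t, t ∈ F ↔ t ∈ Γ.dom ∧ Γ.path t = s) :
    ∃ D K : Set ℝ, IsOpen D ∧ IsClosed K ∧ D ⊆ K ∧ (∀ t ∈ F, t ∈ D) ∧
      (Γ.isLoop → IsCompact K) ∧ (∀ t ∈ K, t ∉ F → Γ.path t ≠ s) ∧
      ∀ f : ℝ → ℂ, (Γ.isLoop → Function.Periodic f 1) → IntegrableOn f Γ.dom →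
        IntegrableOn f D ∧ ∫ t in Γ.dom, f t = ∫ t in D, f t := by
  by_cases hl : Γ.isLoop
  · have hF' : ∀ t ∈ F, t ∈ Set.Ico (0 : ℝ) 1 := fun t ht => by
      have := ((hF t).1 ht).1
      rwa [Γ.dom_of_loop hl] at this
    obtain ⟨a, ha, hb⟩ := exists_fundamental_interval F hF'
    refine ⟨Set.Ioo a (a + 1), Set.Icc a (a + 1), isOpen_Ioo, isClosed_Icc,
      Set.Ioo_subset_Icc_self, ha, fun _ => isCompact_Icc, fun t ht htF hts => ?_,
      fun f hf hi => ⟨?_, ?_⟩⟩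
    · obtain ⟨t', ht', htF', h⟩ := hb t ht htF
      refine htF' ((hF t').2 ⟨by rwa [Γ.dom_of_loop hl], ?_⟩)
      rcases h with rfl | rfl
      · exact hts
      · rw [(Γ.loop hl).1 t]; exact hts
    · have := Γ.intervalIntegrable_of_integrableOn_dom hl (hf hl) hi a (a + 1)
      exact ((intervalIntegrable_iff_integrableOn_Icc_of_le (by linarith)).1 this).mono_set
        Set.Ioo_subset_Icc_self
    · rw [Γ.setIntegral_dom_eq_intervalIntegral hl (hf hl) a,
        intervalIntegral.integral_of_le (by linarith), integral_Ioc_eq_integral_Ioo]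
  · refine ⟨Set.univ, Set.univ, isOpen_univ, isClosed_univ, subset_rfl, fun _ _ => trivial,
      fun h => absurd h hl, fun t _ htF hts => htF ((hF t).2 ⟨?_, hts⟩), fun f _ hi => ?_⟩
    · rw [Γ.dom_of_arc hl]; trivial
    · rw [Γ.dom_of_arc hl] at hi ⊢
      exact ⟨hi, rfl⟩

end AdmissibleContour

/-! ### The jump of the primitive at a crossing parameter. -/

section Jump

variable {A B : ℂ[X]} {u : ℂ} (Γ : PrimalContour A B u) (Δ : DualContour A B u)

/-- Outside small windows around the crossings on Γ the integrands at τ₀ ± ε have the same limit and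
are dominated, so their difference vanishes in the limit. Each window contributes by
`tendsto_local_jump`. -/
theorem tendsto_concomitantPrimitive_jump (hu : u ≠ 0) {x : ℂ} (hx : x ∈ xDomain A B u) {τ₀ : ℝ}
    {F : Finset ℝ} (hF : ∀ t, t ∈ F ↔ t ∈ Γ.dom ∧ Γ.path t = Δ.path τ₀)
    (htr : ∀ t ∈ F, tangentDet Γ Δ (t, τ₀) ≠ 0)
    (hiso : ∀ᶠ ε in 𝓝[>] (0 : ℝ), ∀ t ∈ Γ.dom,
      Γ.path t ≠ Δ.path (τ₀ - ε) ∧ Γ.path t ≠ Δ.path (τ₀ + ε)) :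
    Tendsto (fun ε => concomitantPrimitive Γ Δ x (τ₀ - ε) - concomitantPrimitive Γ Δ x (τ₀ + ε))
      (𝓝[>] 0) (𝓝 (∑ t ∈ F, 2 * Real.pi * Complex.I *
        (((SignType.sign (tangentDet Γ Δ (t, τ₀)) : ℝ) : ℂ) *
        (B.eval (Γ.path t) * Γ.weight t * Δ.weight τ₀)))) := by
  have hx' := mem_xDomain_iff_primal.1 hx
  obtain ⟨D, K, hDo, hKc, hDK, hFD, hKl, hKne, hDi⟩ := Γ.exists_open_fundamental_domain hF
  set φ := Γ.integrand x with hφ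
  set P := Δ.boundary (-x) with hP
  set δ := Δ.path with hδ
  set γ := Γ.path with hγ
  have hφi : IntegrableOn φ Γ.dom := Γ.integrableOn_integrand hu hx'
  have hφc : Continuous φ := Γ.continuous_integrand x
  have hγc : Continuous γ := Γ.continuous_path
  have hPd := Δ.hasDerivAt_boundary' (-x)
  have hsep : ∀ τ, (∀ t ∈ Γ.dom, γ t ≠ δ τ) →
      IntegrableOn (fun t => φ t * (P τ / (γ t - δ τ))) D ∧
        concomitantPrimitive Γ Δ x τ = ∫ t in D, φ t * (P τ / (γ t - δ τ)) := by
    intro τ h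
    obtain ⟨ρ, hρ, hb⟩ := Γ.exists_dist_dom_pos hu (Δ.avoids τ) h
    have h1 := Γ.integrableOn_div_of_dist hφi hρ hb 1
    simp only [pow_one] at h1
    have e : ∀ t, φ t * (P τ / (γ t - δ τ)) = P τ * (φ t / (γ t - δ τ)) := fun t => by ring
    simp only [e]
    have h2 := hDi (fun t => P τ * (φ t / (γ t - δ τ)))
      (fun hl t => by simp only [hφ, hγ, Γ.periodic_integrand hl x t, (Γ.loop hl).1 t])
      (h1.const_mul _)
    refine ⟨h2.1, ?_⟩
    rw [← h2.2, integral_const_mul]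
    rfl
  -- choice of the size of the neighbourhoods of the crossings
  have hloc : ∀ t ∈ F, ∃ η₀ > 0, ∀ η > 0, η ≤ η₀ → Tendsto (fun ε => ∫ s in Set.Icc (t - η) (t + η),
      φ s * (P (τ₀ - ε) / (γ s - δ (τ₀ - ε)) - P (τ₀ + ε) / (γ s - δ (τ₀ + ε)))) (𝓝[>] 0)
      (𝓝 (φ t * P τ₀ * (2 * Real.pi * Complex.I *
        ((SignType.sign (starRingEnd ℂ (deriv δ τ₀) * deriv γ t).im : ℝ) : ℂ) / deriv γ t))) :=
    fun t ht => tendsto_local_jump hγc hφc (hPd τ₀) (Γ.hasDerivAt_path t) (Δ.hasDerivAt_path τ₀)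
      ((hF t).1 ht).2 (htr t ht)
  choose! η₀ hη₀ hlim using hloc
  -- The common half width is within every local threshold, keeps the windows in the open
  -- fundamental domain, and makes them pairwise disjoint.
  obtain ⟨η, hη, h1, h2, h3⟩ : ∃ η > 0, (∀ t ∈ F, η ≤ η₀ t) ∧
      (∀ t ∈ F, Set.Icc (t - η) (t + η) ⊆ D) ∧ (∀ t ∈ F, ∀ s ∈ F, t ≠ s → 2 * η < |t - s|) := by
    have e1 : ∀ᶠ η in 𝓝[>] (0 : ℝ), ∀ t ∈ F, η ≤ η₀ t :=
      (Finset.eventually_all F).2 fun t ht => by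
        filter_upwards [Ioo_mem_nhdsGT (hη₀ t ht)] with η h
        exact h.2.le
    have e2 : ∀ᶠ η in 𝓝[>] (0 : ℝ), ∀ t ∈ F, Set.Icc (t - η) (t + η) ⊆ D :=
      (Finset.eventually_all F).2 fun t ht => by
        obtain ⟨r, hr, hb⟩ := Metric.isOpen_iff.1 hDo t (hFD t ht)
        filter_upwards [Ioo_mem_nhdsGT hr] with η h s hs
        apply hb
        rw [Metric.mem_ball, Real.dist_eq, abs_lt]
        constructor <;> linarith [hs.1, hs.2, h.2]
    have e3 : ∀ᶠ η in 𝓝[>] (0 : ℝ), ∀ t ∈ F, ∀ s ∈ F, t ≠ s → 2 * η < |t - s| :=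
      (Finset.eventually_all F).2 fun t ht => (Finset.eventually_all F).2 fun s hs => by
        by_cases hts : t = s
        · exact Eventually.of_forall fun η h => absurd hts h
        · have : 0 < |t - s| / 2 := half_pos (abs_pos.2 (sub_ne_zero.2 hts))
          filter_upwards [Ioo_mem_nhdsGT this] with η h _
          linarith [h.2]
    obtain ⟨η, h1, h2, h3, h4⟩ := (e1.and (e2.and (e3.and self_mem_nhdsWithin))).exists
    exact ⟨η, h4, h1, h2, h3⟩
  set U : Set ℝ := ⋃ t ∈ F, Set.Icc (t - η) (t + η) with hU
  have hUm : MeasurableSet U := Finset.measurableSet_biUnion F fun t _ => measurableSet_Icc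
  have hUD : U ⊆ D := Set.iUnion₂_subset h2
  have hdisj : Set.Pairwise (↑F) (Function.onFun Disjoint fun t => Set.Icc (t - η) (t + η)) := by
    intro t ht s hs hts
    rw [Function.onFun, Set.disjoint_left]
    intro r hr hr'
    have := h3 t ht s hs hts
    rw [lt_abs] at this
    rcases this with h | h <;> linarith [hr.1, hr.2, hr'.1, hr'.2]
  set f : ℝ → ℝ → ℂ := fun ε s =>
    φ s * (P (τ₀ - ε) / (γ s - δ (τ₀ - ε)) - P (τ₀ + ε) / (γ s - δ (τ₀ + ε))) with hf
  have hsplit : ∀ᶠ ε in 𝓝[>] (0 : ℝ), (∫ s in D \ U, f ε s) +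
      ∑ t ∈ F, ∫ s in Set.Icc (t - η) (t + η), f ε s =
      concomitantPrimitive Γ Δ x (τ₀ - ε) - concomitantPrimitive Γ Δ x (τ₀ + ε) := by
    filter_upwards [hiso] with ε hε
    obtain ⟨i1, j1⟩ := hsep (τ₀ - ε) fun t ht => (hε t ht).1
    obtain ⟨i2, j2⟩ := hsep (τ₀ + ε) fun t ht => (hε t ht).2
    have hfi : IntegrableOn (f ε) D := by
      have := i1.sub i2
      refine this.congr (Eventually.of_forall fun s => ?_)
      simp only [hf, Pi.sub_apply]; ring
    rw [j1, j2, ← integral_sub i1 i2, ← integral_biUnion_finset F (fun t _ => measurableSet_Icc) hdisj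
      fun t ht => hfi.mono_set (h2 t ht)]
    have := setIntegral_union (μ := volume) (f := f ε) (s := D \ U) (t := U)
      Set.disjoint_sdiff_left hUm (hfi.mono_set Set.sdiff_subset) (hfi.mono_set hUD)
    rw [Set.sdiff_union_of_subset hUD] at this
    rw [← this]
    congr 1
    ext s
    simp only [hf]; ring
  refine Tendsto.congr' hsplit ?_
  -- the part away from the crossings
  have haway : Tendsto (fun ε => ∫ s in D \ U, f ε s) (𝓝[>] 0) (𝓝 0) := by
    -- Removing open windows from the closed domain leaves a closed set, on which the distance to
    -- the crossing point has a positive lower bound.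
    set S : Set ℝ := K \ ⋃ t ∈ F, Set.Ioo (t - η) (t + η) with hS
    have hSc : IsClosed S := hKc.sdiff (isOpen_biUnion fun t _ => isOpen_Ioo)
    obtain ⟨ρ, hρ, hb⟩ := Γ.exists_dist_pos hu (Δ.avoids τ₀) hSc
      (fun hl => (hKl hl).of_isClosed_subset hSc Set.sdiff_subset) (fun t ht => hKne t ht.1 fun h =>
        ht.2 (Set.mem_biUnion h ⟨by linarith, by linarith⟩))
    have hDS : D \ U ⊆ S := by
      intro t ht
      refine ⟨hDK ht.1, fun h => ht.2 ?_⟩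
      obtain ⟨s, hs, hts⟩ := Set.mem_iUnion₂.1 h
      exact Set.mem_biUnion hs (Set.Ioo_subset_Icc_self hts)
    have hDm : MeasurableSet (D \ U) := hDo.measurableSet.diff hUm
    have tsub : Tendsto (fun ε : ℝ => τ₀ - ε) (𝓝[>] 0) (𝓝 τ₀) := by
      have := (tendsto_id (x := 𝓝 (0 : ℝ))).const_sub τ₀
      rw [sub_zero] at this
      exact this.mono_left nhdsWithin_le_nhds
    have tadd : Tendsto (fun ε : ℝ => τ₀ + ε) (𝓝[>] 0) (𝓝 τ₀) := by
      have := (tendsto_id (x := 𝓝 (0 : ℝ))).const_add τ₀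
      rw [add_zero] at this
      exact this.mono_left nhdsWithin_le_nhds
    have hPc := (hPd τ₀).continuousAt.tendsto
    have hδc := Δ.continuous_path.tendsto τ₀
    have key : ∀ w : ℝ → ℝ, Tendsto w (𝓝[>] 0) (𝓝 τ₀) →
        (∀ᶠ ε in 𝓝[>] (0 : ℝ), ∀ t ∈ D \ U,
          ‖P (w ε) / (γ t - δ (w ε))‖ ≤ (‖P τ₀‖ + 1) / (ρ / 2)) ∧
        ∀ t ∈ D \ U, Tendsto (fun ε => P (w ε) / (γ t - δ (w ε))) (𝓝[>] 0)
          (𝓝 (P τ₀ / (γ t - δ τ₀))) := by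
      intro w hw
      constructor
      · have c1 := (hPc.comp hw).norm.eventually_lt_const (lt_add_one _)
        have c2 := (tendsto_iff_norm_sub_tendsto_zero.1 (hδc.comp hw)).eventually_lt_const
          (half_pos hρ)
        filter_upwards [c1, c2] with ε d1 d2 t ht
        have d3 := hb t (hDS ht)
        simp only [Function.comp_apply] at d1 d2
        have d4 : ρ / 2 ≤ ‖γ t - δ (w ε)‖ := by
          have e : γ t - δ τ₀ = (γ t - δ (w ε)) + (δ (w ε) - δ τ₀) := by ring
          have := norm_add_le (γ t - δ (w ε)) (δ (w ε) - δ τ₀)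
          rw [← e] at this
          linarith
        rw [norm_div]
        gcongr
      · intro t ht
        refine (hPc.comp hw).div ((hδc.comp hw).const_sub _) ?_
        exact norm_pos_iff.1 (hρ.trans_le (hb t (hDS ht)))
    obtain ⟨k1, k2⟩ := key _ tsub
    obtain ⟨k3, k4⟩ := key _ tadd
    have hφD : IntegrableOn φ D := (hDi φ (fun hl => Γ.periodic_integrand hl x) hφi).1
    have hint0 : ∫ s in D \ U, (0 : ℂ) = 0 := by simp
    rw [← hint0]
    refine tendsto_integral_filter_of_dominated_convergence
      (fun s => ‖φ s‖ * ((‖P τ₀‖ + 1) / (ρ / 2) + (‖P τ₀‖ + 1) / (ρ / 2))) ?_ ?_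
      ((hφD.mono_set Set.sdiff_subset).norm.mul_const _) ?_
    · refine Eventually.of_forall fun ε => ?_
      have m1 := hφc.measurable
      have m2 := hγc.measurable
      have : Measurable (f ε) := by
        simp only [hf]
        fun_prop
      exact this.aestronglyMeasurable
    · filter_upwards [k1, k3] with ε e1 e2
      refine (ae_restrict_iff' hDm).2 (Eventually.of_forall fun t ht => ?_)
      rw [hf, norm_mul]
      gcongr
      exact (norm_sub_le _ _).trans (add_le_add (e1 t ht) (e2 t ht))
    · refine (ae_restrict_iff' hDm).2 (Eventually.of_forall fun t ht => ?_)
      have := ((k2 t ht).sub (k4 t ht)).const_mul (φ t)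
      rwa [sub_self, mul_zero] at this
  have hsum : Tendsto (fun ε => ∑ t ∈ F, ∫ s in Set.Icc (t - η) (t + η), f ε s) (𝓝[>] 0)
      (𝓝 (∑ t ∈ F, φ t * P τ₀ * (2 * Real.pi * Complex.I *
        ((SignType.sign (starRingEnd ℂ (deriv δ τ₀) * deriv γ t).im : ℝ) : ℂ) / deriv γ t))) :=
    tendsto_finsetSum F fun t ht => hlim t ht η hη (h1 t ht)
  have hfin := haway.add hsum
  rw [zero_add] at hfin
  convert hfin using 2
  refine Finset.sum_congr rfl fun t ht => ?_
  have hg : deriv γ t ≠ 0 := by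
    intro h
    apply htr t ht
    simp only [tangentDet]
    rw [← hγ, h]; simp
  have hts := ((hF t).1 ht).2
  -- At a crossing y = s, so the exponentials cancel; the factor γ' of the integrand cancels the
  -- denominator of the local jump. Hence x disappears.
  have hexp : Complex.exp (x * γ t) * Complex.exp (-(x * δ τ₀)) = 1 := by
    rw [← Complex.exp_add, hts]; simp
  simp only [tangentDet, hφ, hP, AdmissibleContour.integrand, AdmissibleContour.boundary]
  rw [← hγ, ← hδ, ← hts] at *
  field_simp
  linear_combination (-(B.eval (γ t)) * Γ.weight t * Δ.weight τ₀ *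
    (SignType.sign (starRingEnd ℂ (deriv δ τ₀) * deriv γ t).im : ℝ)) * hexp

/-! ### Summation of the jumps over all crossings. -/

section Intersection

variable {A B : ℂ[X]} {u : ℂ} (Γ : PrimalContour A B u) (Δ : DualContour A B u)

theorem periodic_concomitantPrimitive (hl : Δ.isLoop) (x : ℂ) :
    Function.Periodic (concomitantPrimitive Γ Δ x) 1 := fun τ => by
  simp only [concomitantPrimitive, Δ.periodic_boundary hl (-x) τ, (Δ.loop hl).1 τ]

theorem periodic_innerConcomitant (hl : Δ.isLoop) (x : ℂ) :
    Function.Periodic (innerConcomitant Γ Δ x) 1 := fun τ => by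
  simp only [innerConcomitant, concomitantIntegrand, Δ.periodic_integrand hl (-x) τ,
    (Δ.loop hl).1 τ]

/-- The contribution of a crossing to the intersection pairing. -/
def crossingWeight (p : ℝ × ℝ) : ℂ :=
  ((SignType.sign (tangentDet Γ Δ p) : ℝ) : ℂ) *
    (B.eval (Γ.path p.1) * Γ.weight p.1 * Δ.weight p.2)

variable {Γ Δ}

theorem intersectionPairing_eq_sum (hfin : (crossings Γ Δ).Finite) :
    intersectionPairing Γ Δ = ∑ p ∈ hfin.toFinset, crossingWeight Γ Δ p :=
  finsum_mem_eq_finite_toFinset_sum _ hfin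

/-- The jump formula with crossings grouped by their parameter on the dual contour. -/
theorem intervalIntegral_innerConcomitant (hu : u ≠ 0) {x : ℂ} (hx : x ∈ xDomain A B u)
    (hg : InGeneralPosition Γ Δ) {a b : ℝ} (hab : a ≤ b)
    (hT : ∀ p ∈ crossings Γ Δ, p.2 ∈ Set.Ioo a b)
    (hoff : ∀ τ ∈ Set.Icc a b, (∀ p ∈ crossings Γ Δ, p.2 ≠ τ) → ∀ t ∈ Γ.dom,
      Γ.path t ≠ Δ.path τ)
    (hK : IntervalIntegrable (innerConcomitant Γ Δ x) volume a b) :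
    ∫ τ in a..b, innerConcomitant Γ Δ x τ = concomitantPrimitive Γ Δ x b -
      concomitantPrimitive Γ Δ x a + 2 * Real.pi * Complex.I * intersectionPairing Γ Δ := by
  classical
  obtain ⟨hfin, htr⟩ := hg
  set T := hfin.toFinset.image Prod.snd with hTdef
  have hmemT : ∀ τ, τ ∈ T ↔ ∃ p ∈ crossings Γ Δ, p.2 = τ := fun τ => by simp [hTdef]
  have hnot : ∀ τ, τ ∉ T → ∀ p ∈ crossings Γ Δ, p.2 ≠ τ := fun τ h p hp e =>
    h ((hmemT τ).2 ⟨p, hp, e⟩)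
  -- Several parameters of Γ may belong to one τ, for instance when Γ passes through the same point
  -- twice.
  set F : ℝ → Finset ℝ := fun τ => (hfin.toFinset.filter fun p => p.2 = τ).image Prod.fst with hF
  have hmemF : ∀ τ t, t ∈ F τ ↔ (t, τ) ∈ crossings Γ Δ := by
    intro τ t
    simp only [hF, Finset.mem_image, Finset.mem_filter, Set.Finite.mem_toFinset]
    exact ⟨fun ⟨p, ⟨h1, h2⟩, h3⟩ => by rwa [← h3, ← h2], fun h => ⟨(t, τ), ⟨h, rfl⟩, rfl⟩⟩
  have key := integral_eq_of_jumps (H := concomitantPrimitive Γ Δ x) T hab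
    (J := fun τ => ∑ t ∈ F τ, 2 * Real.pi * Complex.I * crossingWeight Γ Δ (t, τ))
    (fun τ hτ => by
      obtain ⟨p, hp, rfl⟩ := (hmemT τ).1 hτ
      exact hT p hp)
    (fun τ hτ hτT => hasDerivAt_concomitantPrimitive Γ Δ hu hx (hoff τ hτ (hnot τ hτT))) hK
    (fun τ hτ => by
      obtain ⟨p, hp, rfl⟩ := (hmemT τ).1 hτ
      refine tendsto_concomitantPrimitive_jump Γ Δ hu hx (fun t => ?_) (fun t ht => ?_) ?_
      · rw [hmemF]
        exact ⟨fun h => ⟨h.1, h.2.2⟩, fun h => ⟨h.1, hp.2.1, h.2⟩⟩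
      · exact htr _ ((hmemF _ _).1 ht)
      · have hI := hT p hp
        have hnear : ∀ᶠ τ in 𝓝[≠] p.2, ∀ t ∈ Γ.dom, Γ.path t ≠ Δ.path τ := by
          have e1 : ∀ᶠ τ in 𝓝[≠] p.2, τ ∈ Set.Ioo a b :=
            mem_nhdsWithin_of_mem_nhds (isOpen_Ioo.mem_nhds hI)
          have e2 : ∀ᶠ τ in 𝓝[≠] p.2, τ ∉ T := by
            have : IsClosed ((T.erase p.2 : Finset ℝ) : Set ℝ) := (Finset.finite_toSet _).isClosed
            have h3 := this.isOpen_compl.mem_nhds (x := p.2) (by simp)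
            filter_upwards [mem_nhdsWithin_of_mem_nhds h3, self_mem_nhdsWithin] with τ h4 h5 h6
            exact h4 (Finset.mem_coe.2 (Finset.mem_erase.2 ⟨h5, h6⟩))
          filter_upwards [e1, e2] with τ h1 h2
          exact hoff τ (Set.Ioo_subset_Icc_self h1) (hnot τ h2)
        have t1 : Tendsto (fun ε : ℝ => p.2 - ε) (𝓝[>] 0) (𝓝[≠] p.2) := by
          refine tendsto_nhdsWithin_of_tendsto_nhds_of_eventually_within _ ?_ ?_
          · have := (tendsto_id (x := 𝓝 (0 : ℝ))).const_sub p.2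
            rw [sub_zero] at this
            exact this.mono_left nhdsWithin_le_nhds
          · filter_upwards [self_mem_nhdsWithin] with ε (hε : 0 < ε)
            simp [hε.ne']
        have t2 : Tendsto (fun ε : ℝ => p.2 + ε) (𝓝[>] 0) (𝓝[≠] p.2) := by
          refine tendsto_nhdsWithin_of_tendsto_nhds_of_eventually_within _ ?_ ?_
          · have := (tendsto_id (x := 𝓝 (0 : ℝ))).const_add p.2
            rw [add_zero] at this
            exact this.mono_left nhdsWithin_le_nhds
          · filter_upwards [self_mem_nhdsWithin] with ε (hε : 0 < ε)
            simp [hε.ne']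
        filter_upwards [t1.eventually hnear, t2.eventually hnear] with ε h1 h2 t ht
        exact ⟨h1 t ht, h2 t ht⟩)
  rw [key, intersectionPairing_eq_sum hfin,
    ← Finset.sum_fiberwise_of_maps_to (t := T) (g := Prod.snd)
      (fun p hp => Finset.mem_image_of_mem _ hp), Finset.mul_sum]
  congr 1
  refine Finset.sum_congr rfl fun τ _ => ?_
  rw [hF, Finset.sum_image, Finset.mul_sum]
  · refine Finset.sum_congr rfl fun p hp => ?_
    rw [← (Finset.mem_filter.1 hp).2]
  · intro p hp q hq h
    exact Prod.ext h ((Finset.mem_filter.1 hp).2.trans (Finset.mem_filter.1 hq).2.symm)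

/-- Only the jumps survive: on a loop the primitive is periodic, on an arc its values at ±R tend to
zero as R → ∞. -/
theorem contourConcomitant_eq_intersectionPairing (hu : u ≠ 0) {x : ℂ} (hx : x ∈ xDomain A B u)
    (hg : InGeneralPosition Γ Δ) :
    contourConcomitant Γ Δ x = 2 * Real.pi * Complex.I * intersectionPairing Γ Δ := by
  classical
  have hi := integrableOn_innerConcomitant Γ Δ hu hx
  change ∫ τ in Δ.dom, innerConcomitant Γ Δ x τ = _
  by_cases hl : Δ.isLoop
  · have hper := periodic_innerConcomitant Γ Δ hl x
    obtain ⟨a, ha, hb⟩ := exists_fundamental_interval (hg.1.toFinset.image Prod.snd) fun τ hτ => by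
      obtain ⟨p, hp, rfl⟩ := Finset.mem_image.1 hτ
      have := (hg.1.mem_toFinset.1 hp).2.1
      rwa [Δ.dom_of_loop hl] at this
    rw [Δ.setIntegral_dom_eq_intervalIntegral hl hper a,
      intervalIntegral_innerConcomitant hu hx hg (by linarith)
        (fun p hp => ha _ (Finset.mem_image_of_mem _ (hg.1.mem_toFinset.2 hp))) ?_
        (Δ.intervalIntegrable_of_integrableOn_dom hl hper hi a (a + 1)),
      periodic_concomitantPrimitive Γ Δ hl x a, sub_self, zero_add]
    intro τ hτ hτ' t ht h
    obtain ⟨τ', h1, h2, h3⟩ := hb τ hτ fun h => by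
      obtain ⟨p, hp, h⟩ := Finset.mem_image.1 h
      exact hτ' p (hg.1.mem_toFinset.1 hp) h
    refine h2 (Finset.mem_image.2 ⟨(t, τ'), hg.1.mem_toFinset.2 ⟨ht, ?_, ?_⟩, rfl⟩)
    · rw [Δ.dom_of_loop hl]; exact h1
    · rcases h3 with rfl | rfl
      · exact h
      · rw [(Δ.loop hl).1 τ]; exact h
  · rw [Δ.dom_of_arc hl, setIntegral_univ]
    rw [Δ.dom_of_arc hl, integrableOn_univ] at hi
    have hlim := intervalIntegral_tendsto_integral hi tendsto_neg_atTop_atBot tendsto_id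
    obtain ⟨l1, l2⟩ := tendsto_concomitantPrimitive Γ Δ hu hx hl
    have hlim' := (l1.sub l2).add_const (2 * Real.pi * Complex.I * intersectionPairing Γ Δ)
    rw [sub_zero, zero_add] at hlim'
    refine tendsto_nhds_unique hlim (hlim'.congr' ?_)
    have hR : ∀ᶠ R : ℝ in atTop, ∀ p ∈ hg.1.toFinset, |p.2| < R :=
      (Finset.eventually_all _).2 fun p _ => eventually_gt_atTop _
    filter_upwards [hR, eventually_ge_atTop 0] with R h1 h2
    refine (intervalIntegral_innerConcomitant hu hx hg (neg_le_self h2)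
      (fun p hp => abs_lt.1 (h1 p (hg.1.mem_toFinset.2 hp))) (fun τ _ hτ t ht h => ?_)
      hi.intervalIntegrable).symm
    exact hτ (t, τ) ⟨ht, by rw [Δ.dom_of_arc hl]; trivial, h⟩ rfl

end Intersection

/-! ### Profile functions -/

/-- The derivative of `ramp`. -/
def rampDeriv (s : ℝ) : ℝ := max 0 (min 1 (s - 1))

/-- A `C¹` function that vanishes on `(-∞, 1]` and is a translation on `[2, ∞)`. -/
def ramp (t : ℝ) : ℝ := ∫ s in (1 : ℝ)..t, rampDeriv s

/-- The derivative of `step`. -/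
def stepDeriv (s : ℝ) : ℝ := max 0 (3 / 4 * (1 - s ^ 2))

/-- A `C¹` function that increases from `0` to `1` on `[-1, 1]` and is constant outside. -/
def step (t : ℝ) : ℝ := ∫ s in (-1 : ℝ)..t, stepDeriv s

theorem continuous_rampDeriv : Continuous rampDeriv := by unfold rampDeriv; fun_prop

theorem continuous_stepDeriv : Continuous stepDeriv := by unfold stepDeriv; fun_prop

theorem hasDerivAt_ramp (t : ℝ) : HasDerivAt ramp (rampDeriv t) t :=
  intervalIntegral.integral_hasDerivAt_right (continuous_rampDeriv.intervalIntegrable _ _)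
    (continuous_rampDeriv.stronglyMeasurableAtFilter _ _) continuous_rampDeriv.continuousAt

theorem hasDerivAt_step (t : ℝ) : HasDerivAt step (stepDeriv t) t :=
  intervalIntegral.integral_hasDerivAt_right (continuous_stepDeriv.intervalIntegrable _ _)
    (continuous_stepDeriv.stronglyMeasurableAtFilter _ _) continuous_stepDeriv.continuousAt

theorem contDiff_one_of_hasDerivAt {E : Type*} [NormedAddCommGroup E] [NormedSpace ℝ E]
    {f f' : ℝ → E} (h : ∀ t, HasDerivAt f (f' t) t) (hc : Continuous f') : ContDiff ℝ 1 f := by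
  rw [contDiff_one_iff_deriv]
  refine ⟨fun t => (h t).differentiableAt, ?_⟩
  rwa [show deriv f = f' from funext fun t => (h t).deriv]

theorem contDiff_ramp : ContDiff ℝ 1 ramp :=
  contDiff_one_of_hasDerivAt hasDerivAt_ramp continuous_rampDeriv

theorem contDiff_step : ContDiff ℝ 1 step :=
  contDiff_one_of_hasDerivAt hasDerivAt_step continuous_stepDeriv

theorem rampDeriv_of_le_one {s : ℝ} (h : s ≤ 1) : rampDeriv s = 0 :=
  max_eq_left ((min_le_right _ _).trans (by linarith))

theorem rampDeriv_of_two_le {s : ℝ} (h : 2 ≤ s) : rampDeriv s = 1 := by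
  rw [rampDeriv, min_eq_left (by linarith), max_eq_right zero_le_one]

theorem rampDeriv_pos {s : ℝ} (h : 1 < s) : 0 < rampDeriv s :=
  lt_max_of_lt_right (lt_min one_pos (by linarith))

theorem rampDeriv_nonneg (s : ℝ) : 0 ≤ rampDeriv s := le_max_left _ _

theorem ramp_of_le_one {t : ℝ} (h : t ≤ 1) : ramp t = 0 := by
  rw [ramp, intervalIntegral.integral_congr (g := fun _ => 0)]
  · simp
  · intro s hs
    rw [Set.uIcc_of_ge h] at hs
    exact rampDeriv_of_le_one hs.2

theorem monotone_ramp : Monotone ramp :=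
  monotone_of_deriv_nonneg (fun t => (hasDerivAt_ramp t).differentiableAt) fun t => by
    rw [(hasDerivAt_ramp t).deriv]; exact rampDeriv_nonneg t

theorem ramp_nonneg (t : ℝ) : 0 ≤ ramp t := by
  rcases le_total t 1 with h | h
  · rw [ramp_of_le_one h]
  · rw [← ramp_of_le_one le_rfl]; exact monotone_ramp h

theorem strictMonoOn_ramp : StrictMonoOn ramp (Set.Ici 1) := by
  refine strictMonoOn_of_deriv_pos (convex_Ici 1) contDiff_ramp.continuous.continuousOn ?_
  intro t ht
  rw [interior_Ici] at ht
  rw [(hasDerivAt_ramp t).deriv]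
  exact rampDeriv_pos ht

theorem ramp_pos {t : ℝ} (h : 1 < t) : 0 < ramp t := by
  rw [← ramp_of_le_one le_rfl]
  exact strictMonoOn_ramp (Set.mem_Ici.2 le_rfl) h.le h

/-- `ramp` is the translation by `-rampShift` on `[2, ∞)`. -/
def rampShift : ℝ := 2 - ramp 2

theorem ramp_of_two_le {t : ℝ} (h : 2 ≤ t) : ramp t = t - rampShift := by
  have h1 : ramp t = ramp 2 + ∫ s in (2 : ℝ)..t, rampDeriv s :=
    (intervalIntegral.integral_add_adjacent_intervals
      (continuous_rampDeriv.intervalIntegrable _ _)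
      (continuous_rampDeriv.intervalIntegrable _ _)).symm
  have h2 : ∫ s in (2 : ℝ)..t, rampDeriv s = ∫ s in (2 : ℝ)..t, (1 : ℝ) := by
    refine intervalIntegral.integral_congr fun s hs => ?_
    rw [Set.uIcc_of_le h] at hs
    exact rampDeriv_of_two_le hs.1
  rw [h1, h2, rampShift]
  simp
  ring

theorem exists_ramp_eq {v : ℝ} (hv : 0 < v) : ∃ t, 1 < t ∧ ramp t = v := by
  have h2 : v ≤ ramp (max 2 (v + rampShift)) := by
    rw [ramp_of_two_le (le_max_left _ _)]
    linarith [le_max_right 2 (v + rampShift)]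
  have h1 : (1 : ℝ) ≤ max 2 (v + rampShift) := by
    linarith [le_max_left 2 (v + rampShift)]
  obtain ⟨t, ht, hv'⟩ := intermediate_value_Icc h1 contDiff_ramp.continuous.continuousOn
    ⟨by rw [ramp_of_le_one le_rfl]; exact hv.le, h2⟩
  refine ⟨t, lt_of_le_of_ne ht.1 ?_, hv'⟩
  rintro rfl
  rw [ramp_of_le_one le_rfl] at hv'
  exact hv.ne hv'

theorem ramp_injective {s t : ℝ} (hs : 1 < s) (ht : 1 < t) (h : ramp s = ramp t) : s = t :=
  strictMonoOn_ramp.injOn hs.le ht.le h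

theorem stepDeriv_of_not_mem {s : ℝ} (h : s ≤ -1 ∨ 1 ≤ s) : stepDeriv s = 0 := by
  refine max_eq_left ?_
  have : 1 ≤ s ^ 2 := by rcases h with h | h <;> nlinarith
  linarith

theorem stepDeriv_of_mem {s : ℝ} (h : s ∈ Set.Icc (-1 : ℝ) 1) :
    stepDeriv s = 3 / 4 * (1 - s ^ 2) := by
  refine max_eq_right ?_
  nlinarith [h.1, h.2]

theorem stepDeriv_pos {s : ℝ} (h : s ∈ Set.Ioo (-1 : ℝ) 1) : 0 < stepDeriv s := by
  rw [stepDeriv_of_mem (Set.Ioo_subset_Icc_self h)]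
  nlinarith [h.1, h.2]

theorem step_of_le {t : ℝ} (h : t ≤ -1) : step t = 0 := by
  rw [step, intervalIntegral.integral_congr (g := fun _ => 0)]
  · simp
  · intro s hs
    rw [Set.uIcc_of_ge h] at hs
    exact stepDeriv_of_not_mem (Or.inl hs.2)

theorem step_one : step 1 = 1 := by
  have : ∫ s in (-1 : ℝ)..1, stepDeriv s = ∫ s in (-1 : ℝ)..1, (3 / 4 - 3 / 4 * s ^ 2 : ℝ) := by
    refine intervalIntegral.integral_congr fun s hs => ?_
    rw [Set.uIcc_of_le (by norm_num)] at hs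
    rw [stepDeriv_of_mem hs]; ring
  rw [step, this, intervalIntegral.integral_sub (by simp) (by
    exact (by fun_prop : Continuous fun s : ℝ => 3 / 4 * s ^ 2).intervalIntegrable _ _)]
  simp
  norm_num

theorem step_of_ge {t : ℝ} (h : 1 ≤ t) : step t = 1 := by
  have h1 : step t = step 1 + ∫ s in (1 : ℝ)..t, stepDeriv s :=
    (intervalIntegral.integral_add_adjacent_intervals
      (continuous_stepDeriv.intervalIntegrable _ _)
      (continuous_stepDeriv.intervalIntegrable _ _)).symm
  have h2 : ∫ s in (1 : ℝ)..t, stepDeriv s = ∫ s in (1 : ℝ)..t, (0 : ℝ) := by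
    refine intervalIntegral.integral_congr fun s hs => ?_
    rw [Set.uIcc_of_le h] at hs
    exact stepDeriv_of_not_mem (Or.inr hs.1)
  rw [h1, h2, step_one]; simp

theorem monotone_step : Monotone step :=
  monotone_of_deriv_nonneg (fun t => (hasDerivAt_step t).differentiableAt) fun t => by
    rw [(hasDerivAt_step t).deriv]; exact le_max_left _ _

theorem step_mem (t : ℝ) : step t ∈ Set.Icc (0 : ℝ) 1 := by
  constructor
  · rw [← step_of_le (min_le_right t (-1))]; exact monotone_step (min_le_left _ _)
  · rw [← step_of_ge (le_max_right t 1)]; exact monotone_step (le_max_left _ _)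

theorem step_neg (t : ℝ) : step (-t) = 1 - step t := by
  have hd : ∀ t, HasDerivAt (fun t => step t + step (-t)) 0 t := by
    intro t
    have h := (hasDerivAt_step t).add ((hasDerivAt_step (-t)).comp t (hasDerivAt_neg t))
    have e : stepDeriv (-t) = stepDeriv t := by simp [stepDeriv]
    exact h.congr_deriv (by rw [e]; ring)
  have h := is_const_of_deriv_eq_zero (fun t => (hd t).differentiableAt) (fun t => (hd t).deriv) t 1
  simp only [step_one, step_of_le le_rfl] at h
  linarith

theorem step_zero : step 0 = 1 / 2 := by
  have := step_neg 0
  rw [neg_zero] at this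
  linarith

theorem eq_zero_of_step_eq {t : ℝ} (h : step t = 1 / 2) : t = 0 := by
  have hm : StrictMonoOn step (Set.Icc (-1) 1) := by
    refine strictMonoOn_of_deriv_pos (convex_Icc _ _) contDiff_step.continuous.continuousOn ?_
    intro t ht
    rw [interior_Icc] at ht
    rw [(hasDerivAt_step t).deriv]
    exact stepDeriv_pos ht
  rcases le_or_gt t (-1) with h1 | h1
  · rw [step_of_le h1] at h; norm_num at h
  rcases le_or_gt 1 t with h2 | h2
  · rw [step_of_ge h2] at h; norm_num at h
  · exact hm.injOn ⟨h1.le, h2.le⟩ ⟨by norm_num, by norm_num⟩ (h.trans step_zero.symm)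

/-! ### Polar paths -/

/-- The factor by which the modulus changes along a radial piece: growing to infinity, or
decreasing to `0`. -/
def radialFactor (r : ℝ) : Bool → ℝ → ℝ
  | true, s => 1 + s / r
  | false, s => Real.exp (-s)

theorem radialFactor_zero (r : ℝ) (o : Bool) : radialFactor r o 0 = 1 := by
  cases o <;> simp [radialFactor]

theorem radialFactor_pos {r : ℝ} (hr : 0 < r) (o : Bool) {s : ℝ} (hs : 0 ≤ s) :
    0 < radialFactor r o s := by
  cases o
  · exact Real.exp_pos _
  · have := div_nonneg hs hr.le
    simp only [radialFactor]; linarith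

theorem contDiff_radialFactor (r : ℝ) (o : Bool) : ContDiff ℝ 1 (radialFactor r o) := by
  cases o
  · change ContDiff ℝ 1 fun s => Real.exp (-s)
    fun_prop
  · change ContDiff ℝ 1 fun s => 1 + s / r
    fun_prop

theorem deriv_radialFactor_ne_zero {r : ℝ} (hr : 0 < r) (o : Bool) (s : ℝ) :
    deriv (radialFactor r o) s ≠ 0 := by
  cases o
  · have : HasDerivAt (radialFactor r false) (-Real.exp (-s)) s := by
      change HasDerivAt (fun s => Real.exp (-s)) _ s
      simpa using (hasDerivAt_neg s).exp
    rw [this.deriv]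
    exact neg_ne_zero.2 (Real.exp_pos _).ne'
  · have : HasDerivAt (radialFactor r true) (1 / r) s :=
      ((hasDerivAt_id s).div_const r).const_add 1
    rw [this.deriv]
    positivity

/-- A radial piece at the angle `startAngle`, an arc of the circle of the given radius around `0`,
and a radial piece at the angle `endAngle`; each radial piece runs to infinity (`true`) or to `0`
(`false`). -/
structure PolarPath where
  radius : ℝ
  startAngle : ℝ
  endAngle : ℝ
  startOut : Bool
  endOut : Bool

namespace PolarPath

variable (P Q : PolarPath)

/-- At most one of the two radial factors differs from 1: the first only for t > 1, the second only
for t < -1. As the angle varies only on [-1, 1], rotation and radial motion never overlap. -/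
def modulus (t : ℝ) : ℝ :=
  P.radius * radialFactor P.radius P.endOut (ramp t) *
    radialFactor P.radius P.startOut (ramp (-t))

def angle (t : ℝ) : ℝ := P.startAngle + (P.endAngle - P.startAngle) * step t

def toFun (t : ℝ) : ℂ := P.modulus t * Complex.exp (P.angle t * Complex.I)

/-- The path with the opposite orientation. -/
def reverse : PolarPath := ⟨P.radius, P.endAngle, P.startAngle, P.endOut, P.startOut⟩

theorem modulus_reverse (t : ℝ) : P.reverse.modulus t = P.modulus (-t) := by
  simp only [modulus, reverse, neg_neg]; ring

theorem angle_reverse (t : ℝ) : P.reverse.angle t = P.angle (-t) := by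
  simp only [angle, reverse, step_neg]; ring

theorem toFun_reverse (t : ℝ) : P.reverse.toFun t = P.toFun (-t) := by
  simp only [toFun, modulus_reverse, angle_reverse]

variable {P Q}

theorem modulus_pos (hr : 0 < P.radius) (t : ℝ) : 0 < P.modulus t :=
  mul_pos (mul_pos hr (radialFactor_pos hr _ (ramp_nonneg _)))
    (radialFactor_pos hr _ (ramp_nonneg _))

theorem toFun_ne_zero (hr : 0 < P.radius) (t : ℝ) : P.toFun t ≠ 0 :=
  mul_ne_zero (Complex.ofReal_ne_zero.2 (modulus_pos hr t).ne') (Complex.exp_ne_zero _)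

theorem norm_toFun (hr : 0 < P.radius) (t : ℝ) : ‖P.toFun t‖ = P.modulus t := by
  rw [toFun, norm_mul, Complex.norm_exp_ofReal_mul_I, mul_one, Complex.norm_real,
    Real.norm_of_nonneg (modulus_pos hr t).le]

theorem modulus_right {t : ℝ} (h : -1 ≤ t) :
    P.modulus t = P.radius * radialFactor P.radius P.endOut (ramp t) := by
  rw [modulus, ramp_of_le_one (by linarith : -t ≤ 1), radialFactor_zero, mul_one]

theorem modulus_left {t : ℝ} (h : t ≤ 1) :
    P.modulus t = P.radius * radialFactor P.radius P.startOut (ramp (-t)) := by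
  rw [modulus, ramp_of_le_one h, radialFactor_zero, mul_one]

theorem modulus_mid {t : ℝ} (h : -1 ≤ t) (h' : t ≤ 1) : P.modulus t = P.radius := by
  rw [modulus_right h, ramp_of_le_one h', radialFactor_zero, mul_one]

theorem modulus_right_out (hr : 0 < P.radius) (ho : P.endOut = true) {t : ℝ} (h : -1 ≤ t) :
    P.modulus t = P.radius + ramp t := by
  rw [modulus_right h, ho]; simp only [radialFactor]; field_simp

theorem modulus_left_out (hr : 0 < P.radius) (ho : P.startOut = true) {t : ℝ} (h : t ≤ 1) :
    P.modulus t = P.radius + ramp (-t) := by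
  rw [modulus_left h, ho]; simp only [radialFactor]; field_simp

theorem modulus_right_in (ho : P.endOut = false) {t : ℝ} (h : -1 ≤ t) :
    P.modulus t = P.radius * Real.exp (-ramp t) := by
  rw [modulus_right h, ho, radialFactor]

theorem modulus_lt_of_in (hr : 0 < P.radius) (ho : P.endOut = false) {t : ℝ} (h : 1 < t) :
    P.modulus t < P.radius := by
  rw [modulus_right_in ho (by linarith)]
  exact mul_lt_of_lt_one_right hr (Real.exp_lt_one_iff.2 (neg_neg_of_pos (ramp_pos h)))

theorem lt_modulus_of_out (hr : 0 < P.radius) (ho : P.endOut = true) {t : ℝ} (h : 1 < t) :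
    P.radius < P.modulus t := by
  rw [modulus_right_out hr ho (by linarith)]
  linarith [ramp_pos h]

theorem modulus_lt_of_in' (hr : 0 < P.radius) (ho : P.startOut = false) {t : ℝ} (h : t < -1) :
    P.modulus t < P.radius := by
  have := modulus_lt_of_in (P := P.reverse) hr ho (t := -t) (by linarith)
  rwa [modulus_reverse, neg_neg] at this

theorem lt_modulus_of_out' (hr : 0 < P.radius) (ho : P.startOut = true) {t : ℝ} (h : t < -1) :
    P.radius < P.modulus t := by
  have := lt_modulus_of_out (P := P.reverse) hr ho (t := -t) (by linarith)
  rwa [modulus_reverse, neg_neg] at this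

theorem le_modulus (hr : 0 < P.radius) (h0 : P.startOut = true) (h1 : P.endOut = true) (t : ℝ) :
    P.radius ≤ P.modulus t := by
  rcases lt_or_ge t (-1) with h | h
  · exact (lt_modulus_of_out' hr h0 h).le
  · rw [modulus_right_out hr h1 h]; linarith [ramp_nonneg t]

theorem modulus_le (hr : 0 < P.radius) (h0 : P.startOut = false) (h1 : P.endOut = false) (t : ℝ) :
    P.modulus t ≤ P.radius := by
  rcases lt_or_ge t (-1) with h | h
  · exact (modulus_lt_of_in' hr h0 h).le
  rcases lt_or_ge 1 t with h' | h'
  · exact (modulus_lt_of_in hr h1 h').le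
  · exact (modulus_mid h h').le

theorem angle_right {t : ℝ} (h : 1 ≤ t) : P.angle t = P.endAngle := by
  rw [angle, step_of_ge h]; ring

theorem angle_left {t : ℝ} (h : t ≤ -1) : P.angle t = P.startAngle := by
  rw [angle, step_of_le h]; ring

theorem angle_zero : P.angle 0 = (P.startAngle + P.endAngle) / 2 := by
  rw [angle, step_zero]; ring

theorem angle_mem_uIcc (t : ℝ) : P.angle t ∈ Set.uIcc P.startAngle P.endAngle := by
  obtain ⟨h0, h1⟩ := step_mem t
  rw [Set.mem_uIcc, angle]
  rcases le_total P.startAngle P.endAngle with h | h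
  · left; constructor <;> nlinarith
  · right; constructor <;> nlinarith

theorem eq_zero_of_angle_eq (h : P.startAngle ≠ P.endAngle) {t : ℝ}
    (ht : P.angle t = (P.startAngle + P.endAngle) / 2) : t = 0 := by
  refine eq_zero_of_step_eq ?_
  rw [angle] at ht
  have h2 : (P.endAngle - P.startAngle) * (step t - 1 / 2) = 0 := by linear_combination ht
  have := (mul_eq_zero.1 h2).resolve_left (sub_ne_zero.2 h.symm)
  linarith

theorem toFun_eq_toFun_iff (hP : 0 < P.radius) (hQ : 0 < Q.radius) {t τ : ℝ} :
    P.toFun t = Q.toFun τ ↔ P.modulus t = Q.modulus τ ∧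
      ∃ n : ℤ, P.angle t = Q.angle τ + n * (2 * Real.pi) := by
  constructor
  · intro h
    have h1 : P.modulus t = Q.modulus τ := by
      rw [← norm_toFun hP, h, norm_toFun hQ]
    refine ⟨h1, ?_⟩
    have h2 : (Q.modulus τ : ℂ) ≠ 0 := Complex.ofReal_ne_zero.2 (modulus_pos hQ τ).ne'
    rw [toFun, toFun, h1] at h
    obtain ⟨n, hn⟩ := Complex.exp_eq_exp_iff_exists_int.1 (mul_left_cancel₀ h2 h)
    refine ⟨n, ?_⟩
    have h3 : ((P.angle t : ℂ) - (Q.angle τ + n * (2 * Real.pi))) * Complex.I = 0 := by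
      linear_combination hn
    have h4 := (mul_eq_zero.1 h3).resolve_right Complex.I_ne_zero
    rw [sub_eq_zero] at h4
    exact_mod_cast h4
  · rintro ⟨h1, n, hn⟩
    rw [toFun, toFun, h1]
    congr 1
    refine Complex.exp_eq_exp_iff_exists_int.2 ⟨n, ?_⟩
    rw [hn]; push_cast; ring

theorem contDiff_modulus : ContDiff ℝ 1 P.modulus :=
  (contDiff_const.mul ((contDiff_radialFactor _ _).comp contDiff_ramp)).mul
    ((contDiff_radialFactor _ _).comp (contDiff_ramp.comp contDiff_neg))

theorem contDiff_angle : ContDiff ℝ 1 P.angle :=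
  contDiff_const.add (contDiff_const.mul contDiff_step)

theorem contDiff_toFun : ContDiff ℝ 1 P.toFun :=
  (Complex.ofRealCLM.contDiff.comp contDiff_modulus).mul
    (((Complex.ofRealCLM.contDiff.comp contDiff_angle).mul contDiff_const).cexp)

theorem hasDerivAt_modulus (t : ℝ) : HasDerivAt P.modulus (deriv P.modulus t) t :=
  (contDiff_modulus.differentiable one_ne_zero t).hasDerivAt

theorem hasDerivAt_angle (t : ℝ) :
    HasDerivAt P.angle ((P.endAngle - P.startAngle) * stepDeriv t) t :=
  ((hasDerivAt_step t).const_mul _).const_add _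

theorem hasDerivAt_toFun (t : ℝ) : HasDerivAt P.toFun
    ((deriv P.modulus t + P.modulus t * ((P.endAngle - P.startAngle) * stepDeriv t : ℝ) *
      Complex.I) * Complex.exp (P.angle t * Complex.I)) t := by
  have h1 := (hasDerivAt_modulus (P := P) t).ofReal_comp
  have h2 := ((hasDerivAt_angle (P := P) t).ofReal_comp.mul_const Complex.I).cexp
  exact (h1.mul h2).congr_deriv (by ring)

theorem deriv_modulus_ne_zero_right (hr : 0 < P.radius) {t : ℝ} (h : 1 < t) :
    deriv P.modulus t ≠ 0 := by
  have h1 : P.modulus =ᶠ[𝓝 t] fun t => P.radius * radialFactor P.radius P.endOut (ramp t) := by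
    filter_upwards [isOpen_Ioi.mem_nhds h] with s (hs : 1 < s)
    exact modulus_right (by linarith)
  have h2 := ((((contDiff_radialFactor P.radius P.endOut).differentiable one_ne_zero
    (ramp t)).hasDerivAt).comp t (hasDerivAt_ramp t)).const_mul P.radius
  rw [h1.deriv_eq]
  erw [h2.deriv]
  exact mul_ne_zero hr.ne' (mul_ne_zero (deriv_radialFactor_ne_zero hr _ _) (rampDeriv_pos h).ne')

theorem deriv_modulus_reverse (t : ℝ) : deriv P.reverse.modulus t = -deriv P.modulus (-t) := by
  rw [show P.reverse.modulus = fun t => P.modulus (-t) from funext fun t => P.modulus_reverse t]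
  exact deriv_comp_neg _ _

theorem deriv_modulus_ne_zero (hr : 0 < P.radius) {t : ℝ} (h : 1 < |t|) :
    deriv P.modulus t ≠ 0 := by
  rcases lt_abs.1 h with h | h
  · exact deriv_modulus_ne_zero_right hr h
  · have := deriv_modulus_ne_zero_right (P := P.reverse) hr h
    rw [deriv_modulus_reverse, neg_neg] at this
    exact fun h' => this (by rw [h', neg_zero])

/-- The determinant of the tangent vectors at a crossing of polar paths. -/
theorem tangentDet_eq (hP : 0 < P.radius) (hQ : 0 < Q.radius) {t τ : ℝ}
    (h : P.toFun t = Q.toFun τ) :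
    (starRingEnd ℂ (deriv Q.toFun τ) * deriv P.toFun t).im = P.modulus t *
      (deriv Q.modulus τ * ((P.endAngle - P.startAngle) * stepDeriv t) -
        deriv P.modulus t * ((Q.endAngle - Q.startAngle) * stepDeriv τ)) := by
  have h1 := ((toFun_eq_toFun_iff hP hQ).1 h).1
  have h2 : Complex.exp (P.angle t * Complex.I) = Complex.exp (Q.angle τ * Complex.I) := by
    have h2 : (Q.modulus τ : ℂ) ≠ 0 := Complex.ofReal_ne_zero.2 (modulus_pos hQ τ).ne'
    rw [toFun, toFun, h1] at h
    exact mul_left_cancel₀ h2 h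
  rw [(hasDerivAt_toFun τ).deriv, (hasDerivAt_toFun t).deriv, h2, ← h1, map_mul]
  have h3 : starRingEnd ℂ (Complex.exp (Q.angle τ * Complex.I)) *
      Complex.exp (Q.angle τ * Complex.I) = 1 := by
    rw [mul_comm, Complex.mul_conj, Complex.normSq_eq_norm_sq, Complex.norm_exp_ofReal_mul_I]
    simp
  have e : ∀ a b c d : ℂ, a * b * (c * d) = a * c * (b * d) := fun a b c d => by ring
  rw [e, h3, mul_one]
  simp
  ring

end PolarPath

/-! ### Crossings of polar paths around the same centre -/

theorem not_angle_eq {x y : ℝ} {n : ℤ} (h : x = y + n * (2 * Real.pi)) (h1 : y < x)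
    (h2 : x < y + 2 * Real.pi) : False := by
  have hp := Real.pi_pos
  have a1 : (0 : ℝ) < n := by
    by_contra! hn
    nlinarith
  have a2 : (n : ℝ) < 1 := by
    by_contra! hn
    nlinarith
  have b1 : 0 < n := by exact_mod_cast a1
  have b2 : n < 1 := by exact_mod_cast a2
  omega

theorem angle_eq_of_abs_lt {x y : ℝ} {n : ℤ} (h : x = y + n * (2 * Real.pi))
    (h1 : y - 2 * Real.pi < x) (h2 : x < y + 2 * Real.pi) : x = y := by
  rcases lt_trichotomy x y with h3 | h3 | h3
  · exact (not_angle_eq (x := x + 2 * Real.pi) (n := n + 1) (by rw [h]; push_cast; ring)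
      (by linarith) (by linarith)).elim
  · exact h3
  · exact (not_angle_eq h h3 h2).elim

namespace PolarPath

variable {P Q : PolarPath}

/-- The midpoint of the arc of P has nonzero angular speed, while Q moves radially there with
nonzero speed. -/
theorem tangentDet_ne_zero_of_arc (hP : 0 < P.radius) (hQ : 0 < Q.radius)
    (hne : P.startAngle ≠ P.endAngle) {τ : ℝ} (h : P.toFun 0 = Q.toFun τ) (hτ : 1 < |τ|) :
    (starRingEnd ℂ (deriv Q.toFun τ) * deriv P.toFun 0).im ≠ 0 := by
  rw [tangentDet_eq hP hQ h, stepDeriv_of_not_mem (s := τ) (by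
    rcases lt_abs.1 hτ with h | h
    · exact Or.inr h.le
    · exact Or.inl (by linarith)), mul_zero, mul_zero, sub_zero]
  exact mul_ne_zero (modulus_pos hP _).ne' (mul_ne_zero (deriv_modulus_ne_zero hQ hτ)
    (mul_ne_zero (sub_ne_zero.2 hne.symm) (stepDeriv_pos (by norm_num)).ne'))

theorem tangentDet_ne_zero_of_arc' (hP : 0 < P.radius) (hQ : 0 < Q.radius)
    (hne : Q.startAngle ≠ Q.endAngle) {t : ℝ} (h : P.toFun t = Q.toFun 0) (ht : 1 < |t|) :
    (starRingEnd ℂ (deriv Q.toFun 0) * deriv P.toFun t).im ≠ 0 := by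
  rw [tangentDet_eq hP hQ h, stepDeriv_of_not_mem (s := t) (by
    rcases lt_abs.1 ht with h | h
    · exact Or.inr h.le
    · exact Or.inl (by linarith)), mul_zero, mul_zero, zero_sub]
  exact mul_ne_zero (modulus_pos hP _).ne' (neg_ne_zero.2
    (mul_ne_zero (deriv_modulus_ne_zero hP ht)
    (mul_ne_zero (sub_ne_zero.2 hne.symm) (stepDeriv_pos (by norm_num)).ne')))

/-- A path from infinity, around the origin, and back to infinity. -/
def lasso (r α : ℝ) : PolarPath := ⟨r, α, α + 2 * Real.pi, true, true⟩

/-- A path from infinity, on the positive real axis, to the origin, with a given final angle. -/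
def stem (r β : ℝ) : PolarPath := ⟨r, 0, β, true, false⟩

/-- A path from the origin, with a given angle, to infinity, on the negative real axis. -/
def dualStem (r α : ℝ) : PolarPath := ⟨r, α, Real.pi, false, true⟩

/-- A path from the origin to the origin. -/
def petal (r α β : ℝ) : PolarPath := ⟨r, α, β, false, false⟩

/-- A path from infinity to infinity. -/
def outerPetal (r α β : ℝ) : PolarPath := ⟨r, α, β, true, true⟩

/-- The radii are ordered: 4s for primal lassos, 3s for dual lassos and stems, 2s for primal stems,
s for petals. Comparing moduli leaves only radial pieces as candidates. Here the dual stem reaches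
modulus 4s only on its outgoing ray at angle π, which the lasso, with angles in [0, 2π], meets at
the middle of its arc. -/
theorem lasso_crosses_dualStem {s α : ℝ} (hs : 0 < s) :
    ∃ τ₀, 1 < |τ₀| ∧ ∀ t τ, (lasso (4 * s) 0).toFun t = (dualStem (3 * s) α).toFun τ ↔
      t = 0 ∧ τ = τ₀ := by
  have hp := Real.pi_pos
  set P := lasso (4 * s) 0 with hP
  set Q := dualStem (3 * s) α with hQ
  have rP : 0 < P.radius := by simp only [hP, lasso]; linarith
  have rQ : 0 < Q.radius := by simp only [hQ, dualStem]; linarith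
  obtain ⟨τ₀, h1, h2⟩ := exists_ramp_eq hs
  refine ⟨τ₀, lt_abs.2 (Or.inl h1), fun t τ => ?_⟩
  rw [toFun_eq_toFun_iff rP rQ]
  constructor
  · rintro ⟨hm, n, hn⟩
    have hτ : 1 < τ := by
      by_contra! h
      have a1 : 4 * s ≤ P.modulus t := le_modulus rP rfl rfl t
      have a2 : Q.modulus τ ≤ 3 * s := by
        rcases lt_or_ge τ (-1) with h' | h'
        · exact (modulus_lt_of_in' rQ rfl h').le
        · exact (modulus_mid h' h).le
      linarith
    have ha : Q.angle τ = Real.pi := angle_right hτ.le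
    have hb : P.angle t ∈ Set.uIcc (0 : ℝ) (0 + 2 * Real.pi) := angle_mem_uIcc (P := P) t
    rw [Set.uIcc_of_le (by linarith)] at hb
    rw [ha] at hn
    have hc := angle_eq_of_abs_lt hn (by linarith [hb.1]) (by linarith [hb.2])
    have ht : t = 0 := eq_zero_of_angle_eq (P := P) (by simp [hP, lasso])
      (by rw [hc]; simp [hP, lasso])
    refine ⟨ht, ?_⟩
    rw [ht, modulus_mid (by norm_num) (by norm_num),
      modulus_right_out rQ rfl (by linarith : -1 ≤ τ)] at hm
    apply ramp_injective hτ h1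
    simp only [hP, hQ, lasso, dualStem] at hm
    linarith
  · rintro ⟨rfl, rfl⟩
    refine ⟨?_, 0, ?_⟩
    · rw [modulus_mid (by norm_num) (by norm_num), modulus_right_out rQ rfl (by linarith), h2]
      simp only [hP, hQ, lasso, dualStem]; ring
    · rw [angle_zero, angle_right h1.le]
      simp [hP, hQ, lasso, dualStem]

/-- Both radial pieces of the dual lasso lie on the same ray, at angles π and 3π, so the primal arc
is met twice, at opposite parameters. -/
theorem lasso_crosses_lasso {s : ℝ} (hs : 0 < s) :
    ∃ τ₀, 1 < τ₀ ∧ ∀ t τ, (lasso (4 * s) 0).toFun t = (lasso (3 * s) Real.pi).toFun τ ↔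
      t = 0 ∧ (τ = τ₀ ∨ τ = -τ₀) := by
  have hp := Real.pi_pos
  set P := lasso (4 * s) 0 with hP
  set Q := lasso (3 * s) Real.pi with hQ
  have rP : 0 < P.radius := by simp only [hP, lasso]; linarith
  have rQ : 0 < Q.radius := by simp only [hQ, lasso]; linarith
  obtain ⟨τ₀, h1, h2⟩ := exists_ramp_eq hs
  refine ⟨τ₀, h1, fun t τ => ?_⟩
  rw [toFun_eq_toFun_iff rP rQ]
  constructor
  · rintro ⟨hm, n, hn⟩
    have a1 : 4 * s ≤ P.modulus t := le_modulus rP rfl rfl t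
    have hb : P.angle t ∈ Set.uIcc (0 : ℝ) (0 + 2 * Real.pi) := angle_mem_uIcc (P := P) t
    rw [Set.uIcc_of_le (by linarith)] at hb
    have hc : P.angle t = Real.pi := by
      rcases lt_or_ge τ (-1) with h | h
      · rw [angle_left (P := Q) h.le] at hn
        exact angle_eq_of_abs_lt (y := Real.pi) hn (by linarith [hb.1]) (by linarith [hb.2])
      rcases lt_or_ge 1 τ with h' | h'
      · rw [angle_right (P := Q) h'.le] at hn
        -- The end angle is 3π, one turn more than π.
        refine angle_eq_of_abs_lt (n := n + 1) (by rw [hn]; simp only [hQ, lasso]; push_cast; ring)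
          (by linarith [hb.1]) (by linarith [hb.2])
      · have : Q.modulus τ = 3 * s := modulus_mid h h'
        linarith
    have ht : t = 0 := eq_zero_of_angle_eq (P := P) (by simp [hP, lasso])
      (by rw [hc]; simp [hP, lasso])
    refine ⟨ht, ?_⟩
    have hm' : Q.modulus τ = 4 * s := by
      rw [← hm, ht, modulus_mid (by norm_num) (by norm_num)]; rfl
    rcases lt_or_ge τ (-1) with h | h
    · right
      rw [modulus_left_out rQ rfl (by linarith)] at hm'
      rw [← neg_eq_iff_eq_neg]
      apply ramp_injective (by linarith) h1
      simp only [hQ, lasso] at hm'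
      linarith
    rcases lt_or_ge 1 τ with h' | h'
    · left
      rw [modulus_right_out rQ rfl (by linarith)] at hm'
      apply ramp_injective h' h1
      simp only [hQ, lasso] at hm'
      linarith
    · have : Q.modulus τ = 3 * s := modulus_mid h h'
      linarith
  · rintro ⟨rfl, rfl | rfl⟩
    · refine ⟨?_, -1, ?_⟩
      · rw [modulus_mid (by norm_num) (by norm_num), modulus_right_out rQ rfl (by linarith), h2]
        simp only [hP, hQ, lasso]; ring
      · rw [angle_zero, angle_right h1.le]
        simp [hP, hQ, lasso]
    · refine ⟨?_, 0, ?_⟩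
      · rw [modulus_mid (by norm_num) (by norm_num), modulus_left_out rQ rfl (by linarith), neg_neg,
          h2]
        simp only [hP, hQ, lasso]; ring
      · rw [angle_zero, angle_left (by linarith)]
        simp [hP, hQ, lasso]

/-- The stem reaches modulus 3s only on its incoming ray, the positive real axis, and the dual arc
from π to 3π meets that axis at its middle, 2π. -/
theorem stem_crosses_lasso {s : ℝ} (hs : 0 < s) :
    ∃ t₀, 1 < |t₀| ∧ ∀ t τ, (stem (2 * s) 0).toFun t = (lasso (3 * s) Real.pi).toFun τ ↔
      t = t₀ ∧ τ = 0 := by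
  have hp := Real.pi_pos
  set P := stem (2 * s) 0 with hP
  set Q := lasso (3 * s) Real.pi with hQ
  have rP : 0 < P.radius := by simp only [hP, stem]; linarith
  have rQ : 0 < Q.radius := by simp only [hQ, lasso]; linarith
  obtain ⟨t₀, h1, h2⟩ := exists_ramp_eq hs
  refine ⟨-t₀, by rw [abs_neg]; exact lt_abs.2 (Or.inl h1), fun t τ => ?_⟩
  rw [toFun_eq_toFun_iff rP rQ]
  constructor
  · rintro ⟨hm, n, hn⟩
    have ht : t < -1 := by
      by_contra! h
      have a1 : 3 * s ≤ Q.modulus τ := le_modulus rQ rfl rfl τ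
      have a2 : P.modulus t ≤ 2 * s := by
        rcases lt_or_ge 1 t with h' | h'
        · exact (modulus_lt_of_in rP rfl h').le
        · exact (modulus_mid h h').le
      linarith
    have ha : P.angle t = 0 := angle_left ht.le
    have hb : Q.angle τ ∈ Set.uIcc Real.pi (Real.pi + 2 * Real.pi) := angle_mem_uIcc (P := Q) τ
    rw [Set.uIcc_of_le (by linarith)] at hb
    rw [ha] at hn
    have hc : Q.angle τ = 2 * Real.pi := by
      refine angle_eq_of_abs_lt (n := -(n + 1)) (by push_cast; linarith) (by linarith [hb.1])
        (by linarith [hb.2])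
    have hτ : τ = 0 := eq_zero_of_angle_eq (P := Q) (by simp [hQ, lasso])
      (by rw [hc]; simp only [hQ, lasso]; ring)
    refine ⟨?_, hτ⟩
    rw [hτ, modulus_mid (P := Q) (by norm_num) (by norm_num),
      modulus_left_out rP rfl (by linarith)] at hm
    rw [← neg_eq_iff_eq_neg]
    apply ramp_injective (by linarith) h1
    simp only [hP, hQ, lasso, stem] at hm
    linarith
  · rintro ⟨rfl, rfl⟩
    refine ⟨?_, -1, ?_⟩
    · rw [modulus_mid (P := Q) (by norm_num) (by norm_num), modulus_left_out rP rfl (by linarith),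
        neg_neg, h2]
      simp only [hP, hQ, lasso, stem]; ring
    · rw [angle_zero, angle_left (by linarith)]
      simp only [hP, hQ, lasso, stem]
      push_cast; ring

theorem lasso_ne_petal {s α β : ℝ} (hs : 0 < s) (t τ : ℝ) :
    (lasso (4 * s) 0).toFun t ≠ (petal s α β).toFun τ := by
  intro h
  have h1 := ((toFun_eq_toFun_iff (P := lasso (4 * s) 0) (Q := petal s α β)
    (by simp only [lasso]; linarith) hs).1 h).1
  have a1 : 4 * s ≤ (lasso (4 * s) 0).modulus t :=
    le_modulus (P := lasso (4 * s) 0) (by simp only [lasso]; linarith) rfl rfl t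
  have a2 : (petal s α β).modulus τ ≤ s := modulus_le hs rfl rfl τ
  linarith

/-- On the inner ray of the dual stem the angle is α, which the stem avoids modulo 2π because its
angle stays between 0 and β. Elsewhere the dual stem has modulus at least 3s, where the stem runs on
the positive axis, while the angle of the dual stem stays strictly between 0 and 2π. -/
theorem stem_ne_dualStem {s α β : ℝ} (hs : 0 < s) (hα : 0 < α) (hα' : α < 2 * Real.pi)
    (hβ : α - 2 * Real.pi < β) (hβ' : β < α) (t τ : ℝ) :
    (stem (2 * s) β).toFun t ≠ (dualStem (3 * s) α).toFun τ := by
  have hp := Real.pi_pos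
  set P := stem (2 * s) β with hP
  set Q := dualStem (3 * s) α with hQ
  have rP : 0 < P.radius := by simp only [hP, stem]; linarith
  have rQ : 0 < Q.radius := by simp only [hQ, dualStem]; linarith
  rw [Ne, toFun_eq_toFun_iff rP rQ]
  rintro ⟨hm, n, hn⟩
  rcases lt_or_ge τ (-1) with h | h
  · have hb : P.angle t ∈ Set.uIcc 0 β := angle_mem_uIcc (P := P) t
    have ha : Q.angle τ = α := angle_left h.le
    have hb' : α - 2 * Real.pi < P.angle t ∧ P.angle t < α := by
      rw [Set.mem_uIcc] at hb
      constructor <;> rcases hb with hb | hb <;> linarith [hb.1, hb.2]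
    rw [ha] at hn
    exact hb'.2.ne (angle_eq_of_abs_lt hn hb'.1 (by linarith))
  · have ht : t < -1 := by
      by_contra! h'
      have a1 : 3 * s ≤ Q.modulus τ := by
        rw [modulus_right_out rQ rfl h]
        simp only [hQ, dualStem]
        linarith [ramp_nonneg τ]
      have a2 : P.modulus t ≤ 2 * s := by
        rcases lt_or_ge 1 t with h' | h'
        · exact (modulus_lt_of_in rP rfl h').le
        · exact (modulus_mid (by assumption) h').le
      linarith
    have ha : P.angle t = 0 := angle_left ht.le
    have hb : Q.angle τ ∈ Set.uIcc α Real.pi := angle_mem_uIcc (P := Q) τ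
    have hb' : 0 < Q.angle τ ∧ Q.angle τ < 2 * Real.pi := by
      rw [Set.mem_uIcc] at hb
      constructor <;> rcases hb with hb | hb <;> linarith [hb.1, hb.2]
    rw [ha] at hn
    exact not_angle_eq (x := Q.angle τ) (y := 0) (n := -n) (by push_cast; linarith) hb'.1
      (by linarith [hb'.2])

/-- If the angles `α - 2 i π / m` and `α + x π / m - 2 k π / m`, `|x| ≤ 1`, agree, then `x = 0` and
`i ≡ k` modulo `m`. -/
theorem eq_of_sector_angle_eq {m : ℕ} (hm : 0 < m) {i k n : ℤ} {x : ℝ} (hx : |x| ≤ 1) {α : ℝ}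
    (h : α - 2 * i * Real.pi / m = α + x * Real.pi / m - 2 * k * Real.pi / m + n * (2 * Real.pi)) :
    x = 0 ∧ k - i = n * m := by
  have hp := Real.pi_pos.ne'
  have hm' : (m : ℝ) ≠ 0 := by positivity
  have h1 : x = 2 * ((k - i - n * m : ℤ) : ℝ) := by
    push_cast
    field_simp at h
    apply mul_left_cancel₀ hp
    linear_combination -h
  have h2 : k - i - n * m = 0 := by
    rw [h1, abs_mul, abs_two] at hx
    have : |((k - i - n * m : ℤ) : ℝ)| < 1 := by linarith
    exact Int.abs_lt_one_iff.1 (by exact_mod_cast this)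
  exact ⟨by rw [h1, h2]; simp, by linarith⟩

theorem angle_eq_mid_add (P : PolarPath) (t : ℝ) : ∃ x : ℝ, |x| ≤ 1 ∧
    P.angle t = (P.startAngle + P.endAngle) / 2 + x * ((P.startAngle - P.endAngle) / 2) := by
  obtain ⟨h0, h1⟩ := step_mem t
  exact ⟨1 - 2 * step t, abs_le.2 ⟨by linarith, by linarith⟩, by rw [angle]; ring⟩

/-- Only the final ray of a stem enters the disc of radius s. Its angle is the bisector of the i-th
petal, and the petals of different index, modulo m, do not contain it. -/
theorem stem_crossing_petal {m : ℕ} (hm : 0 < m) {s α : ℝ} (hs : 0 < s) {i k : ℤ} {t τ : ℝ}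
    (h : (stem (2 * s) (α - (2 * i - 1) * Real.pi / m)).toFun t =
      (petal s (α - 2 * (k - 1) * Real.pi / m) (α - 2 * k * Real.pi / m)).toFun τ) :
    1 < t ∧ τ = 0 ∧ ∃ n : ℤ, k - i = n * m := by
  have hp := Real.pi_pos
  have hm' : (0 : ℝ) < m := by positivity
  set P := stem (2 * s) (α - (2 * i - 1) * Real.pi / m) with hP
  set Q := petal s (α - 2 * (k - 1) * Real.pi / m) (α - 2 * k * Real.pi / m) with hQ
  have rP : 0 < P.radius := by simp only [hP, stem]; linarith
  have rQ : 0 < Q.radius := hs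
  obtain ⟨hmod, n, hn⟩ := (toFun_eq_toFun_iff rP rQ).1 h
  have a2 : Q.modulus τ ≤ s := modulus_le hs rfl rfl τ
  have ht : 1 < t := by
    by_contra! h'
    have : 2 * s ≤ P.modulus t := by
      rw [modulus_left_out rP rfl h']
      simp only [hP, stem]
      linarith [ramp_nonneg (-t)]
    linarith
  obtain ⟨x, hx, hx'⟩ := Q.angle_eq_mid_add τ
  have ha : P.angle t = α - (2 * i - 1) * Real.pi / m := angle_right ht.le
  have key := eq_of_sector_angle_eq hm hx (α := α + Real.pi / m) (i := i) (k := k) (n := n) (by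
    rw [ha, hx'] at hn
    simp only [hQ, petal] at hn
    field_simp at hn ⊢
    linarith)
  refine ⟨ht, ?_, n, key.2⟩
  refine eq_zero_of_angle_eq (P := Q) ?_ (by rw [hx', key.1]; ring)
  simp only [hQ, petal]
  have : 0 < Real.pi / m := by positivity
  intro h
  field_simp at h
  linarith

theorem stem_crosses_petal {m : ℕ} (hm : 0 < m) {s α : ℝ} (hs : 0 < s) (i : ℤ) :
    ∃ t₀, 1 < |t₀| ∧ ∀ t τ, (stem (2 * s) (α - (2 * i - 1) * Real.pi / m)).toFun t =
      (petal s (α - 2 * (i - 1) * Real.pi / m) (α - 2 * i * Real.pi / m)).toFun τ ↔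
      t = t₀ ∧ τ = 0 := by
  have hm' : (0 : ℝ) < m := by positivity
  -- The modulus 2s e^{-ramp} equals s exactly when the ramp is log 2.
  obtain ⟨t₀, h1, h2⟩ := exists_ramp_eq (Real.log_pos one_lt_two)
  refine ⟨t₀, lt_abs.2 (Or.inl h1), fun t τ => ?_⟩
  have rP : 0 < (stem (2 * s) (α - (2 * i - 1) * Real.pi / m)).radius := by
    simp only [stem]; linarith
  have rQ : 0 < (petal s (α - 2 * (i - 1) * Real.pi / m) (α - 2 * i * Real.pi / m)).radius := hs
  constructor
  · intro h
    obtain ⟨a1, rfl, -⟩ := stem_crossing_petal hm hs h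
    refine ⟨?_, rfl⟩
    have hmod := ((toFun_eq_toFun_iff rP rQ).1 h).1
    rw [modulus_right_in rfl (by linarith), modulus_mid (by norm_num) (by norm_num)] at hmod
    apply ramp_injective a1 h1
    simp only [stem, petal] at hmod
    have : Real.exp (-ramp t) = Real.exp (-Real.log 2) := by
      rw [Real.exp_neg (Real.log 2), Real.exp_log two_pos]
      have : s * (2 * Real.exp (-ramp t) - 1) = 0 := by linear_combination hmod
      have := (mul_eq_zero.1 this).resolve_left hs.ne'
      linarith
    rw [h2]
    exact neg_injective (Real.exp_injective this)
  · rintro ⟨rfl, rfl⟩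
    rw [toFun_eq_toFun_iff rP rQ]
    refine ⟨?_, 0, ?_⟩
    · rw [modulus_right_in rfl (by linarith), modulus_mid (by norm_num) (by norm_num), h2,
        Real.exp_neg, Real.exp_log two_pos]
      simp only [stem, petal]; ring
    · rw [angle_zero, angle_right h1.le]
      simp only [stem, petal]
      push_cast; ring

/-- The primal petal reaches modulus 2s only on its rays, at angles α and α - 2iπ/m. The k-th dual
petal covers half width π/m around α - 2kπ/m, so 0 < k < m excludes the common starting ray and
leaves i = k. -/
theorem outerPetal_crossing {m : ℕ} (hm : 0 < m) {s α : ℝ} (hs : 0 < s) {i k : ℤ} {t τ : ℝ}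
    (hi : 0 < i) (hi' : i < m) (hk : 0 < k) (hk' : k < m)
    (h : (outerPetal s α (α - 2 * i * Real.pi / m)).toFun t =
      (outerPetal (2 * s) (α - 2 * k * Real.pi / m + Real.pi / m)
        (α - 2 * k * Real.pi / m - Real.pi / m)).toFun τ) :
    1 < t ∧ τ = 0 ∧ i = k := by
  have hp := Real.pi_pos
  have hm' : (0 : ℝ) < m := by positivity
  set P := outerPetal s α (α - 2 * i * Real.pi / m) with hP
  set Q := outerPetal (2 * s) (α - 2 * k * Real.pi / m + Real.pi / m)
        (α - 2 * k * Real.pi / m - Real.pi / m) with hQ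
  have rP : 0 < P.radius := hs
  have rQ : 0 < Q.radius := by simp only [hQ, outerPetal]; linarith
  obtain ⟨hmod, n, hn⟩ := (toFun_eq_toFun_iff rP rQ).1 h
  have a2 : 2 * s ≤ Q.modulus τ := le_modulus rQ rfl rfl τ
  obtain ⟨x, hx, hx'⟩ := Q.angle_eq_mid_add τ
  have hxx : x = 0 → τ = 0 := fun h0 => by
    refine eq_zero_of_angle_eq (P := Q) ?_ (by rw [hx', h0]; ring)
    simp only [hQ, outerPetal]
    have : 0 < Real.pi / m := by positivity
    intro h
    linarith
  have small : ∀ j : ℤ, -m < j → j < m → (∃ n : ℤ, j = n * m) → j = 0 := by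
    rintro j h1 h2 ⟨n, rfl⟩
    have h3 : (0 : ℤ) < m := by exact_mod_cast hm
    have : n < 1 := by by_contra! h; nlinarith
    have : -1 < n := by by_contra! h; nlinarith
    have : n = 0 := by omega
    simp [this]
  have key : ∀ j : ℤ, P.angle t = α - 2 * j * Real.pi / m → x = 0 ∧ k - j = n * m := by
    intro j hj
    refine eq_of_sector_angle_eq hm hx (α := α) ?_
    rw [hj, hx'] at hn
    simp only [hQ, outerPetal] at hn
    rw [hn]; ring
  rcases lt_or_ge t (-1) with h1 | h1
  · have e : P.angle t = α := angle_left h1.le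
    have := small (k - 0) (by omega) (by omega) ⟨n, (key 0 (by rw [e]; simp)).2⟩
    omega
  rcases lt_or_ge 1 t with h2 | h2
  · have e : P.angle t = α - 2 * i * Real.pi / m := angle_right h2.le
    obtain ⟨k1, k2⟩ := key i e
    have := small (k - i) (by omega) (by omega) ⟨n, k2⟩
    exact ⟨h2, hxx k1, by omega⟩
  · have : P.modulus t = s := modulus_mid h1 h2
    linarith

theorem outerPetal_crosses_outerPetal {m : ℕ} (hm : 0 < m) {s α : ℝ} (hs : 0 < s) {i : ℤ}
    (hi : 0 < i) (hi' : i < m) :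
    ∃ t₀, 1 < |t₀| ∧ ∀ t τ, (outerPetal s α (α - 2 * i * Real.pi / m)).toFun t =
      (outerPetal (2 * s) (α - 2 * i * Real.pi / m + Real.pi / m)
        (α - 2 * i * Real.pi / m - Real.pi / m)).toFun τ ↔ t = t₀ ∧ τ = 0 := by
  obtain ⟨t₀, h1, h2⟩ := exists_ramp_eq hs
  refine ⟨t₀, lt_abs.2 (Or.inl h1), fun t τ => ?_⟩
  have rP : 0 < (outerPetal s α (α - 2 * i * Real.pi / m)).radius := hs
  have rQ : 0 < (outerPetal (2 * s) (α - 2 * i * Real.pi / m + Real.pi / m)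
        (α - 2 * i * Real.pi / m - Real.pi / m)).radius := by simp only [outerPetal]; linarith
  constructor
  · intro h
    obtain ⟨a1, rfl, -⟩ := outerPetal_crossing hm hs hi hi' hi hi' h
    refine ⟨?_, rfl⟩
    have hmod := ((toFun_eq_toFun_iff rP rQ).1 h).1
    rw [modulus_right_out rP rfl (by linarith), modulus_mid (by norm_num) (by norm_num)] at hmod
    apply ramp_injective a1 h1
    simp only [outerPetal] at hmod
    linarith
  · rintro ⟨rfl, rfl⟩
    rw [toFun_eq_toFun_iff rP rQ]
    refine ⟨?_, 0, ?_⟩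
    · rw [modulus_right_out rP rfl (by linarith), modulus_mid (by norm_num) (by norm_num), h2]
      simp only [outerPetal]; ring
    · rw [angle_zero, angle_right h1.le]
      simp only [outerPetal]
      push_cast; ring

end PolarPath

/-! ### Bent coordinates on the plane -/

/-- The map `ζ ↦ p (ζ + i h(Re ζ))`, where `h` vanishes for `|ξ| ≤ w` and is affine, with slopes
`-l` and `r`, near `-∞` and `+∞`. -/
structure Bend where
  scale : ℂ
  left : ℝ
  right : ℝ
  width : ℝ

namespace Bend

variable (Φ : Bend)

def height (ξ : ℝ) : ℝ := Φ.right * ramp (ξ - Φ.width) + Φ.left * ramp (-ξ - Φ.width)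

def heightDeriv (ξ : ℝ) : ℝ :=
  Φ.right * rampDeriv (ξ - Φ.width) - Φ.left * rampDeriv (-ξ - Φ.width)

def toFun (ζ : ℂ) : ℂ := Φ.scale * (ζ + Φ.height ζ.re * Complex.I)

theorem hasDerivAt_height (ξ : ℝ) : HasDerivAt Φ.height (Φ.heightDeriv ξ) ξ := by
  have h1 := ((hasDerivAt_ramp (ξ - Φ.width)).comp ξ
    ((hasDerivAt_id ξ).sub_const Φ.width)).const_mul Φ.right
  have h2 := ((hasDerivAt_ramp (-ξ - Φ.width)).comp ξ
    ((hasDerivAt_neg ξ).sub_const Φ.width)).const_mul Φ.left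
  exact (h1.add h2).congr_deriv (by simp only [heightDeriv]; ring)

theorem contDiff_height : ContDiff ℝ 1 Φ.height :=
  contDiff_one_of_hasDerivAt Φ.hasDerivAt_height (by
    have := continuous_rampDeriv
    unfold heightDeriv
    fun_prop)

theorem height_eq_zero {ξ : ℝ} (h : |ξ| ≤ Φ.width) : Φ.height ξ = 0 := by
  have := abs_le.1 h
  rw [height, ramp_of_le_one (by linarith), ramp_of_le_one (by linarith)]; ring

theorem heightDeriv_eq_zero {ξ : ℝ} (h : |ξ| ≤ Φ.width) : Φ.heightDeriv ξ = 0 := by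
  have := abs_le.1 h
  rw [heightDeriv, rampDeriv_of_le_one (by linarith), rampDeriv_of_le_one (by linarith)]; ring

theorem toFun_eq_of_abs_le {ζ : ℂ} (h : |ζ.re| ≤ Φ.width) : Φ.toFun ζ = Φ.scale * ζ := by
  rw [toFun, Φ.height_eq_zero h]; simp

variable {Φ}

theorem injective (hs : Φ.scale ≠ 0) : Function.Injective Φ.toFun := by
  intro ζ ζ' h
  have h1 := mul_left_cancel₀ hs h
  have h2 : ζ.re = ζ'.re := by simpa using congrArg Complex.re h1
  rw [h2] at h1
  exact add_right_cancel h1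

theorem hasDerivAt_comp {γ : ℝ → ℂ} {γ' : ℂ} {t : ℝ} (h : HasDerivAt γ γ' t) :
    HasDerivAt (fun t => Φ.toFun (γ t))
      (Φ.scale * (γ' + (Φ.heightDeriv (γ t).re * γ'.re : ℝ) * Complex.I)) t := by
  have h1 : HasDerivAt (fun t => (γ t).re) γ'.re t :=
    (Complex.reCLM.hasFDerivAt.comp_hasDerivAt t h)
  have h2 := ((Φ.hasDerivAt_height (γ t).re).comp t h1).ofReal_comp
  exact (h.add (h2.mul_const Complex.I)).const_mul Φ.scale

theorem contDiff_comp {γ : ℝ → ℂ} (h : ContDiff ℝ 1 γ) : ContDiff ℝ 1 fun t => Φ.toFun (γ t) :=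
  contDiff_const.mul (h.add ((Complex.ofRealCLM.contDiff.comp
    (Φ.contDiff_height.comp (Complex.reCLM.contDiff.comp h))).mul contDiff_const))

/-- The bend is a shear of real Jacobian 1 followed by multiplication by the scale. Hence
transversality and orientation can be read off in the straight coordinates. -/
theorem im_conj_deriv_mul_deriv {γ δ : ℝ → ℂ} {t τ : ℝ} (hγ : DifferentiableAt ℝ γ t)
    (hδ : DifferentiableAt ℝ δ τ) (h : γ t = δ τ) :
    (starRingEnd ℂ (deriv (fun t => Φ.toFun (δ t)) τ) * deriv (fun t => Φ.toFun (γ t)) t).im =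
      Complex.normSq Φ.scale * (starRingEnd ℂ (deriv δ τ) * deriv γ t).im := by
  rw [(hasDerivAt_comp hγ.hasDerivAt).deriv, (hasDerivAt_comp hδ.hasDerivAt).deriv, h]
  simp only [map_mul, map_add, Complex.conj_ofReal, Complex.conj_I, Complex.mul_im, Complex.mul_re,
    Complex.add_re, Complex.add_im, Complex.conj_re, Complex.conj_im, Complex.ofReal_re,
    Complex.ofReal_im, Complex.I_re, Complex.I_im, Complex.neg_re, Complex.neg_im,
    Complex.normSq_apply]
  ring

end Bend

/-! ### Ends of bent polar paths -/

theorem deriv_eq_of_forall_ge {f g : ℝ → ℂ} {T : ℝ} (h : ∀ t, T ≤ t → f t = g t) {t : ℝ}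
    (ht : T < t) : deriv f t = deriv g t := by
  have : f =ᶠ[𝓝 t] g := by
    filter_upwards [isOpen_Ioi.mem_nhds ht] with s hs
    exact h s (le_of_lt hs)
  exact this.deriv_eq

theorem ContourEnd.isEndOf_infinity {γ : ℝ → ℂ} {φ d : ℂ} {T : ℝ}
    (h : ∀ t, T ≤ t → γ t = t * φ + d) : (ContourEnd.infinity φ).IsEndOf γ := by
  constructor
  · have h1 : Tendsto (fun t : ℝ => φ + d * ((t⁻¹ : ℝ) : ℂ)) atTop (𝓝 (φ + d * ((0 : ℝ) : ℂ))) :=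
      (((Complex.continuous_ofReal.tendsto 0).comp tendsto_inv_atTop_zero).const_mul d).const_add φ
    rw [Complex.ofReal_zero, mul_zero, add_zero] at h1
    refine h1.congr' ?_
    filter_upwards [eventually_ge_atTop T, eventually_gt_atTop 0] with t ht ht0
    have : (t : ℂ) ≠ 0 := Complex.ofReal_ne_zero.2 ht0.ne'
    rw [h t ht]
    push_cast
    field_simp
  · refine tendsto_const_nhds.congr' ?_
    filter_upwards [eventually_gt_atTop T] with t ht
    rw [deriv_eq_of_forall_ge h ht]
    have : HasDerivAt (fun t : ℝ => (t : ℂ) * φ + d) (1 * φ) t :=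
      ((hasDerivAt_id t).ofReal_comp.mul_const φ).add_const d
    rw [this.deriv, one_mul]

theorem ContourEnd.isEndOf_point {γ : ℝ → ℂ} {b φ : ℂ} {T : ℝ}
    (h : ∀ t, T ≤ t → γ t = b + (Real.exp (-t) : ℝ) * φ) : (ContourEnd.point b φ).IsEndOf γ := by
  have e : ∀ t : ℝ, (Real.exp t : ℂ) * (Real.exp (-t) : ℝ) = 1 := fun t => by
    rw [← Complex.ofReal_mul, ← Real.exp_add]; simp
  constructor
  · refine tendsto_const_nhds.congr' ?_
    filter_upwards [eventually_ge_atTop T] with t ht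
    rw [h t ht]
    linear_combination -φ * e t
  · refine tendsto_const_nhds.congr' ?_
    filter_upwards [eventually_gt_atTop T] with t ht
    rw [deriv_eq_of_forall_ge h ht]
    have : HasDerivAt (fun t : ℝ => b + (Real.exp (-t) : ℝ) * φ) ((-Real.exp (-t) : ℝ) * φ) t := by
      have h1 : HasDerivAt (fun t : ℝ => Real.exp (-t)) (-Real.exp (-t)) t := by
        simpa using (hasDerivAt_neg t).exp
      exact (h1.ofReal_comp.mul_const φ).const_add b
    rw [this.deriv]
    push_cast
    have := e t
    push_cast at this
    linear_combination φ * this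

namespace PolarPath

variable {Φ : Bend} {P : PolarPath} {z : ℂ}

theorem toFun_of_endOut (hr : 0 < P.radius) (ho : P.endOut = true) {t : ℝ} (ht : 2 ≤ t) :
    P.toFun t = (P.radius + (t - rampShift) : ℝ) * Complex.exp (P.endAngle * Complex.I) := by
  rw [toFun, modulus_right_out hr ho (by linarith), angle_right (by linarith), ramp_of_two_le ht]

/-- The final ray stays where |Re| is at most the width, so the bend is just multiplication by the
scale there. -/
theorem isEndOf_point (ho : P.endOut = false) (hr : 0 < P.radius)
    (hw : |z.re| + P.radius ≤ Φ.width) :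
    (ContourEnd.point (Φ.scale * z) (Φ.scale * ((P.radius * Real.exp rampShift : ℝ) *
      Complex.exp (P.endAngle * Complex.I)))).IsEndOf (fun t => Φ.toFun (z + P.toFun t)) := by
  refine ContourEnd.isEndOf_point (T := 2) fun t ht => ?_
  have h1 : |(z + P.toFun t).re| ≤ Φ.width := by
    rw [Complex.add_re]
    refine (abs_add_le _ _).trans (le_trans ?_ hw)
    gcongr
    refine (Complex.abs_re_le_norm _).trans ?_
    rw [norm_toFun hr]
    exact (modulus_lt_of_in hr ho (by linarith)).le
  rw [Φ.toFun_eq_of_abs_le h1, toFun, modulus_right_in ho (by linarith),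
    angle_right (by linarith), ramp_of_two_le ht, neg_sub, Real.exp_sub, Real.exp_neg]
  push_cast
  field_simp

theorem isEndOf_infinity_right (ho : P.endOut = true) (hr : 0 < P.radius)
    (ha : Complex.exp (P.endAngle * Complex.I) = 1) (hw : 0 ≤ Φ.width) :
    (ContourEnd.infinity (Φ.scale * (1 + Φ.right * Complex.I))).IsEndOf
      (fun t => Φ.toFun (z + P.toFun t)) := by
  -- Beyond this parameter the real part is at least width + 2, where the height is affine with
  -- slope `right`.
  refine ContourEnd.isEndOf_infinity (T := max 2 (Φ.width + 2 - (z.re + P.radius - rampShift)))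
    (d := Φ.scale * (z + (P.radius - rampShift) + (Φ.right * (z.re + P.radius - rampShift - Φ.width
      - rampShift) : ℝ) * Complex.I)) fun t ht => ?_
  have h1 := (le_max_left _ _).trans ht
  have h2 := (le_max_right _ _).trans ht
  have h3 : (z + P.toFun t).re = t + (z.re + P.radius - rampShift) := by
    rw [toFun_of_endOut hr ho h1, ha, mul_one, Complex.add_re, Complex.ofReal_re]; ring
  rw [Bend.toFun, h3, Bend.height, ramp_of_two_le (by linarith), ramp_of_le_one (by linarith),
    toFun_of_endOut hr ho h1, ha]
  push_cast
  ring

theorem isEndOf_infinity_left (ho : P.endOut = true) (hr : 0 < P.radius)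
    (ha : Complex.exp (P.endAngle * Complex.I) = -1) (hw : 0 ≤ Φ.width) :
    (ContourEnd.infinity (Φ.scale * (-1 + Φ.left * Complex.I))).IsEndOf
      (fun t => Φ.toFun (z + P.toFun t)) := by
  refine ContourEnd.isEndOf_infinity (T := max 2 (Φ.width + 2 - (-z.re + P.radius - rampShift)))
    (d := Φ.scale * (z - (P.radius - rampShift) + (Φ.left * (-z.re + P.radius - rampShift - Φ.width
      - rampShift) : ℝ) * Complex.I)) fun t ht => ?_
  have h1 := (le_max_left _ _).trans ht
  have h2 := (le_max_right _ _).trans ht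
  have h3 : (z + P.toFun t).re = -(t + (-z.re + P.radius - rampShift)) := by
    rw [toFun_of_endOut hr ho h1, ha, mul_neg_one, Complex.add_re, Complex.neg_re,
      Complex.ofReal_re]; ring
  rw [Bend.toFun, h3, Bend.height, ramp_of_le_one (by linarith), neg_neg,
    ramp_of_two_le (by linarith), toFun_of_endOut hr ho h1, ha]
  push_cast
  ring

theorem isEndOf_infinity_straight (ho : P.endOut = true) (hr : 0 < P.radius)
    (hl : Φ.left = 0) (hr' : Φ.right = 0) :
    (ContourEnd.infinity (Φ.scale * Complex.exp (P.endAngle * Complex.I))).IsEndOf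
      (fun t => Φ.toFun (z + P.toFun t)) := by
  refine ContourEnd.isEndOf_infinity (T := 2) (d := Φ.scale * (z + (P.radius - rampShift) *
    Complex.exp (P.endAngle * Complex.I))) fun t ht => ?_
  rw [Bend.toFun, Bend.height, hl, hr', toFun_of_endOut hr ho ht]
  push_cast
  ring

end PolarPath

/-! ### Contours along bent polar paths -/

namespace AdmissibleContour

variable {N B : ℂ[X]} {u : ℂ}

/-- The contour `Γ` follows the polar path `P` around `z` in the bent coordinates. -/
def Follows (Γ : AdmissibleContour N B u) (Φ : Bend) (z : ℂ) (P : PolarPath) : Prop :=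
  ¬ Γ.isLoop ∧ Γ.path = fun t => Φ.toFun (z + P.toFun t)

theorem exists_follows {Φ : Bend} {z : ℂ} {P : PolarPath}
    (h : ∀ t, B.eval (Φ.toFun (z + P.toFun t)) ≠ 0)
    (h0 : ∃ e : ContourEnd, e.Admissible N B u ∧
      e.IsEndOf fun t => Φ.toFun (z + P.reverse.toFun t))
    (h1 : ∃ e : ContourEnd, e.Admissible N B u ∧ e.IsEndOf fun t => Φ.toFun (z + P.toFun t)) :
    ∃ Γ : AdmissibleContour N B u, Γ.Follows Φ z P := by
  refine ⟨{
    path := fun t => Φ.toFun (z + P.toFun t)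
    contDiff := Bend.contDiff_comp (contDiff_const.add PolarPath.contDiff_toFun)
    avoids := h
    isLoop := False
    loop := False.elim
    arc := fun _ => ?_
    const := 1
    const_ne_zero := one_ne_zero }, id, rfl⟩
  obtain ⟨e₀, a0, b0⟩ := h0
  obtain ⟨e₁, a1, b1⟩ := h1
  simp only [PolarPath.toFun_reverse] at b0
  exact ⟨e₀, e₁, a0, a1, b0, b1⟩

end AdmissibleContour

section Crossings

variable {A B : ℂ[X]} {u : ℂ} {Γ : PrimalContour A B u} {Δ : DualContour A B u}

theorem pairing_of_crossings_eq_empty (h : ∀ t τ, Γ.path t ≠ Δ.path τ) :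
    InGeneralPosition Γ Δ ∧ intersectionPairing Γ Δ = 0 := by
  have he : crossings Γ Δ = ∅ := Set.eq_empty_of_forall_notMem fun p hp => h _ _ hp.2.2
  refine ⟨⟨by rw [he]; exact Set.finite_empty, by simp [he]⟩, ?_⟩
  simp [intersectionPairing, he]

theorem sign_ne_zero_of_ne_zero {x : ℝ} (h : x ≠ 0) : ((SignType.sign x : ℝ) : ℂ) ≠ 0 := by
  rcases lt_or_gt_of_ne h with h | h <;> simp [h]

theorem crossingWeight_ne_zero {p : ℝ × ℝ} (h : tangentDet Γ Δ p ≠ 0) :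
    crossingWeight Γ Δ p ≠ 0 :=
  mul_ne_zero (sign_ne_zero_of_ne_zero h)
    (mul_ne_zero (mul_ne_zero (Γ.avoids _) (Γ.weight_ne_zero _)) (Δ.weight_ne_zero _))

theorem pairing_of_crossings_eq_singleton {p : ℝ × ℝ} (h : crossings Γ Δ = {p})
    (hd : tangentDet Γ Δ p ≠ 0) :
    InGeneralPosition Γ Δ ∧ intersectionPairing Γ Δ ≠ 0 := by
  refine ⟨⟨by rw [h]; exact Set.finite_singleton p, by simpa [h] using hd⟩, ?_⟩
  rw [intersectionPairing, h, finsum_mem_singleton]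
  exact crossingWeight_ne_zero hd

theorem pairing_of_crossings_eq_pair {p q : ℝ × ℝ} (h : crossings Γ Δ = {p, q}) (hpq : p ≠ q)
    (hp : tangentDet Γ Δ p ≠ 0) (hq : tangentDet Γ Δ q ≠ 0)
    (hsum : crossingWeight Γ Δ p + crossingWeight Γ Δ q ≠ 0) :
    InGeneralPosition Γ Δ ∧ intersectionPairing Γ Δ ≠ 0 := by
  refine ⟨⟨by rw [h]; exact Set.toFinite _, ?_⟩, ?_⟩
  · rw [h]; rintro r (rfl | rfl) <;> assumption
  · rw [intersectionPairing, h, finsum_mem_pair hpq]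
    exact hsum

variable {Φ : Bend} {z : ℂ} {P Q : PolarPath}

theorem mem_crossings_iff (hΦ : Φ.scale ≠ 0) (hΓ : Γ.Follows Φ z P) (hΔ : Δ.Follows Φ z Q)
    (p : ℝ × ℝ) : p ∈ crossings Γ Δ ↔ P.toFun p.1 = Q.toFun p.2 := by
  simp only [crossings, Set.mem_ofPred_eq, Γ.dom_of_arc hΓ.1, Δ.dom_of_arc hΔ.1, Set.mem_univ,
    true_and, hΓ.2, hΔ.2, (Bend.injective hΦ).eq_iff, add_right_inj]

theorem tangentDet_of_follows (hΓ : Γ.Follows Φ z P) (hΔ : Δ.Follows Φ z Q)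
    {t τ : ℝ} (h : P.toFun t = Q.toFun τ) : tangentDet Γ Δ (t, τ) =
      Complex.normSq Φ.scale * (starRingEnd ℂ (deriv Q.toFun τ) * deriv P.toFun t).im := by
  have h1 := PolarPath.hasDerivAt_toFun (P := P) t
  have h2 := PolarPath.hasDerivAt_toFun (P := Q) τ
  have e1 : deriv (fun t => z + P.toFun t) t = deriv P.toFun t := by
    rw [(h1.const_add z).deriv, h1.deriv]
  have e2 : deriv (fun t => z + Q.toFun t) τ = deriv Q.toFun τ := by
    rw [(h2.const_add z).deriv, h2.deriv]
  simp only [tangentDet, hΓ.2, hΔ.2]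
  rw [Bend.im_conj_deriv_mul_deriv (h1.const_add z).differentiableAt
    (h2.const_add z).differentiableAt (by rw [h]), e1, e2]

theorem pairing_of_follows_arc (hΦ : Φ.scale ≠ 0) (hΓ : Γ.Follows Φ z P) (hΔ : Δ.Follows Φ z Q)
    (hP : 0 < P.radius) (hQ : 0 < Q.radius) (hne : P.startAngle ≠ P.endAngle) {τ₀ : ℝ}
    (hτ₀ : 1 < |τ₀|) (h : ∀ t τ, P.toFun t = Q.toFun τ ↔ t = 0 ∧ τ = τ₀) :
    InGeneralPosition Γ Δ ∧ intersectionPairing Γ Δ ≠ 0 := by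
  have h0 := (h 0 τ₀).2 ⟨rfl, rfl⟩
  refine pairing_of_crossings_eq_singleton (p := (0, τ₀)) ?_ ?_
  · ext p
    rw [mem_crossings_iff hΦ hΓ hΔ, h, Set.mem_singleton_iff, Prod.ext_iff]
  · rw [tangentDet_of_follows hΓ hΔ h0]
    exact mul_ne_zero (Complex.normSq_pos.2 hΦ).ne'
      (PolarPath.tangentDet_ne_zero_of_arc hP hQ hne h0 hτ₀)

theorem pairing_of_follows_arc' (hΦ : Φ.scale ≠ 0) (hΓ : Γ.Follows Φ z P) (hΔ : Δ.Follows Φ z Q)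
    (hP : 0 < P.radius) (hQ : 0 < Q.radius) (hne : Q.startAngle ≠ Q.endAngle) {t₀ : ℝ}
    (ht₀ : 1 < |t₀|) (h : ∀ t τ, P.toFun t = Q.toFun τ ↔ t = t₀ ∧ τ = 0) :
    InGeneralPosition Γ Δ ∧ intersectionPairing Γ Δ ≠ 0 := by
  have h0 := (h t₀ 0).2 ⟨rfl, rfl⟩
  refine pairing_of_crossings_eq_singleton (p := (t₀, 0)) ?_ ?_
  · ext p
    rw [mem_crossings_iff hΦ hΓ hΔ, h, Set.mem_singleton_iff, Prod.ext_iff]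
  · rw [tangentDet_of_follows hΓ hΔ h0]
    exact mul_ne_zero (Complex.normSq_pos.2 hΦ).ne'
      (PolarPath.tangentDet_ne_zero_of_arc' hP hQ hne h0 ht₀)

end Crossings

/-! ### Monodromy of the weight around a simple zero -/

namespace PolarPath

theorem modulus_lasso_neg (r α t : ℝ) : (lasso r α).modulus (-t) = (lasso r α).modulus t := by
  rw [← modulus_reverse]; rfl

theorem deriv_modulus_lasso_neg (r α t : ℝ) :
    deriv (lasso r α).modulus (-t) = -deriv (lasso r α).modulus t := by
  have h := (lasso r α).deriv_modulus_reverse t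
  have e : (lasso r α).reverse.modulus = (lasso r α).modulus := rfl
  rw [e] at h
  rw [h, neg_neg]

theorem modulus_lasso_le {r α : ℝ} (hr : 0 < r) {t T : ℝ} (h : |t| ≤ T) :
    (lasso r α).modulus t ≤ (lasso r α).modulus T := by
  have h0 := (abs_nonneg t).trans h
  have hP : 0 < (lasso r α).radius := hr
  rw [modulus_right_out hP rfl (by linarith : -1 ≤ T)]
  rcases le_total 0 t with h1 | h1
  · rw [modulus_right_out hP rfl (by linarith)]
    have := monotone_ramp ((le_abs_self t).trans h)
    linarith
  · rw [modulus_left_out hP rfl (by linarith)]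
    have := monotone_ramp ((neg_le_abs t).trans h)
    linarith

end PolarPath

/-- At a simple zero A/B differs from its principal part by a function holomorphic on the disc,
which therefore has a primitive there. -/
theorem exists_eval_div_eq {A B : ℂ[X]} {b : ℂ} {R : ℝ} (hb : B.eval b = 0)
    (hb' : (derivative B).eval b ≠ 0)
    (hR : ∀ y ∈ Metric.ball b R, B.eval y = 0 → y = b) :
    ∃ G G' : ℂ → ℂ, (∀ y ∈ Metric.ball b R, HasDerivAt G (G' y) y) ∧
      ∀ y ∈ Metric.ball b R, y ≠ b → A.eval y / B.eval y =
        A.eval b / (derivative B).eval b / (y - b) + G' y := by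
  obtain ⟨D, hD⟩ := dvd_iff_isRoot.2 (show B.IsRoot b from hb)
  have hDb : (derivative B).eval b = D.eval b := by rw [hD]; simp
  rw [hDb] at hb' ⊢
  set α := A.eval b / D.eval b with hα
  obtain ⟨E, hE⟩ := dvd_iff_isRoot.2 (show (A - C α * D).IsRoot b by
    simp [IsRoot, hα]; field_simp; simp)
  have hDy : ∀ y ∈ Metric.ball b R, D.eval y ≠ 0 := by
    intro y hy h
    have := hR y hy (by rw [hD]; simp [h])
    rw [this] at h
    exact hb' h
  have hd : DifferentiableOn ℂ (fun y => E.eval y / D.eval y) (Metric.ball b R) :=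
    E.differentiable.differentiableOn.div D.differentiable.differentiableOn hDy
  obtain ⟨G, hG⟩ := hd.isExactOn_ball
  refine ⟨G, fun y => E.eval y / D.eval y, hG, fun y hy hyb => ?_⟩
  have h1 : A.eval y - α * D.eval y = (y - b) * E.eval y := by
    have := congrArg (eval y) hE
    simpa using this
  have h2 : B.eval y = (y - b) * D.eval y := by
    have := congrArg (eval y) hD
    simpa using this
  have h3 := sub_ne_zero.2 hyb
  have h4 := hDy y hy
  rw [h2]
  field_simp
  linear_combination h1

namespace AdmissibleContour

variable {A B : ℂ[X]} {u : ℂ}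

/-- Along the lasso a logarithm of the weight is α(log modulus + i angle) + G(path), α being the
residue of A/B. Between -T and T the modulus and the point return while the angle gains 2π. -/
theorem weight_lasso (Δ : AdmissibleContour A B u) {Φ : Bend} {z : ℂ} {r R β T : ℝ} (hr : 0 < r)
    (hΦ : Φ.scale ≠ 0) (hΔ : Δ.Follows Φ z (PolarPath.lasso r β)) (hw : |z.re| + R ≤ Φ.width)
    (hb : B.eval (Φ.scale * z) = 0) (hb' : (derivative B).eval (Φ.scale * z) ≠ 0)
    (hR : ∀ ζ ∈ Metric.ball z R, B.eval (Φ.scale * ζ) = 0 → ζ = z) (hT : 1 ≤ T)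
    (hTR : (PolarPath.lasso r β).modulus T < R) :
    Δ.weight T = Δ.weight (-T) * Complex.exp (2 * Real.pi * Complex.I *
      (A.eval (Φ.scale * z) / (derivative B).eval (Φ.scale * z))) := by
  set p := Φ.scale with hp
  set Q := PolarPath.lasso r β with hQ
  have rQ : 0 < Q.radius := hr
  set α := A.eval (p * z) / (derivative B).eval (p * z) with hα
  have hp0 : 0 < ‖p‖ := norm_pos_iff.2 hΦ
  obtain ⟨G, G', hG, hG'⟩ := exists_eval_div_eq (A := A) (R := ‖p‖ * R) hb hb' (by
    intro y hy h
    have e : p * (p⁻¹ * y) = y := mul_inv_cancel_left₀ hΦ y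
    have := hR (p⁻¹ * y) (by
      rw [mem_ball_iff_norm] at hy ⊢
      rw [← e, ← mul_sub, norm_mul] at hy
      exact lt_of_mul_lt_mul_left hy hp0.le) (by rw [e]; exact h)
    rw [← this, e])
  have hmod : ∀ τ, |τ| ≤ T → Q.modulus τ < R := fun τ h =>
    (PolarPath.modulus_lasso_le hr h).trans_lt hTR
  have hre : ∀ τ, |τ| ≤ T → |(z + Q.toFun τ).re| ≤ Φ.width := by
    intro τ h
    rw [Complex.add_re]
    refine (abs_add_le _ _).trans (le_trans ?_ hw)
    gcongr
    refine (Complex.abs_re_le_norm _).trans ?_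
    rw [PolarPath.norm_toFun rQ]
    exact (hmod τ h).le
  have hpath : ∀ τ, |τ| ≤ T → Δ.path τ = p * z + p * Q.toFun τ := by
    intro τ h
    rw [hΔ.2]
    simp only []
    rw [Φ.toFun_eq_of_abs_le (hre τ h), mul_add]
  have hball : ∀ τ, |τ| ≤ T → Δ.path τ ∈ Metric.ball (p * z) (‖p‖ * R) := by
    intro τ h
    rw [mem_ball_iff_norm, hpath τ h, add_sub_cancel_left, norm_mul, PolarPath.norm_toFun rQ]
    exact mul_lt_mul_of_pos_left (hmod τ h) hp0
  have hder : ∀ τ, |τ| ≤ T → deriv Δ.path τ = p * deriv Q.toFun τ := by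
    intro τ h
    have h1 := (PolarPath.hasDerivAt_toFun (P := Q) τ)
    have h2 := Bend.hasDerivAt_comp (Φ := Φ) (h1.const_add z)
    rw [hΔ.2, h2.deriv, Φ.heightDeriv_eq_zero (hre τ h), h1.deriv]
    simp [hp]
  set F : ℝ → ℂ := fun τ => α * ((Real.log (Q.modulus τ) : ℝ) + (Q.angle τ : ℝ) * Complex.I) +
    G (Δ.path τ) with hF
  have hFd : ∀ τ ∈ Set.uIcc (-T) T, HasDerivAt F (logDerivAlong A B Δ.path τ) τ := by
    intro τ hτ
    rw [Set.uIcc_of_le (by linarith)] at hτ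
    have h := abs_le.2 hτ
    have m0 := PolarPath.modulus_pos rQ τ
    have d1 := ((PolarPath.hasDerivAt_modulus (P := Q) τ).log m0.ne').ofReal_comp
    have d2 := (PolarPath.hasDerivAt_angle (P := Q) τ).ofReal_comp.mul_const Complex.I
    have d3 := (hG _ (hball τ h)).scomp τ (Δ.hasDerivAt_path τ)
    refine (((d1.add d2).const_mul α).add d3).congr_deriv ?_
    have hne : Δ.path τ ≠ p * z := by
      rw [hpath τ h]
      simpa using ⟨hΦ, PolarPath.toFun_ne_zero rQ τ⟩
    rw [logDerivAlong, hG' _ (hball τ h) hne, smul_eq_mul, add_mul, mul_comm (deriv Δ.path τ)]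
    congr 1
    rw [← hα, hder τ h, hpath τ h, add_sub_cancel_left, (PolarPath.hasDerivAt_toFun (P := Q) τ).deriv,
      PolarPath.toFun]
    have m1 : (Q.modulus τ : ℂ) ≠ 0 := Complex.ofReal_ne_zero.2 m0.ne'
    have m2 := Complex.exp_ne_zero (Q.angle τ * Complex.I)
    push_cast
    field_simp
  have hint := intervalIntegral.integral_eq_sub_of_hasDerivAt hFd
    (Δ.continuous_logDerivAlong.intervalIntegrable _ _)
  have hsame : Δ.path T = Δ.path (-T) := by
    have h1 : |T| ≤ T := (abs_of_pos (by linarith)).le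
    rw [hpath T h1, hpath (-T) (by rwa [abs_neg])]
    congr 2
    rw [PolarPath.toFun_eq_toFun_iff rQ rQ]
    refine ⟨(PolarPath.modulus_lasso_neg _ _ _).symm, 1, ?_⟩
    rw [PolarPath.angle_right hT, PolarPath.angle_left (by linarith)]
    simp [hQ, PolarPath.lasso]
  have hval : F T - F (-T) = 2 * Real.pi * Complex.I * α := by
    simp only [hF, hsame, hQ, PolarPath.modulus_lasso_neg]
    rw [PolarPath.angle_right hT, PolarPath.angle_left (by linarith)]
    simp only [PolarPath.lasso]
    push_cast
    ring
  have hadd := intervalIntegral.integral_add_adjacent_intervals (a := -T) (b := 0) (c := T)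
    (μ := volume) (Δ.continuous_logDerivAlong.intervalIntegrable _ _)
    (Δ.continuous_logDerivAlong.intervalIntegrable _ _)
  rw [← hval, ← hint, ← hadd, intervalIntegral.integral_symm 0 (-T), weight, weight, mul_assoc,
    ← Complex.exp_add]
  congr 2
  ring

end AdmissibleContour

section LassoPairing

theorem two_pi_I_ne_zero : (2 * Real.pi * Complex.I : ℂ) ≠ 0 := by
  simp [Real.pi_ne_zero]

variable {A B : ℂ[X]} {u : ℂ} {Γ : PrimalContour A B u} {Δ : DualContour A B u} {Φ : Bend} {z : ℂ}

/-- The reflection t ↦ -t of the dual lasso gives the two crossings opposite signs. Their weights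
differ by the monodromy factor e^{2πiα}, so the sum is a nonzero multiple of e^{2πiα} - 1, which
vanishes only for integral α. -/
theorem pairing_of_follows_lasso {s : ℝ} (hs : 0 < s) (hΦ : Φ.scale ≠ 0)
    (hΓ : Γ.Follows Φ z (PolarPath.lasso (4 * s) 0))
    (hΔ : Δ.Follows Φ z (PolarPath.lasso (3 * s) Real.pi)) (hw : |z.re| + 5 * s ≤ Φ.width)
    (hb : B.eval (Φ.scale * z) = 0) (hb' : (derivative B).eval (Φ.scale * z) ≠ 0)
    (hR : ∀ ζ ∈ Metric.ball z (5 * s), B.eval (Φ.scale * ζ) = 0 → ζ = z)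
    (hα : ∀ n : ℤ, A.eval (Φ.scale * z) ≠ n * (derivative B).eval (Φ.scale * z)) :
    InGeneralPosition Γ Δ ∧ intersectionPairing Γ Δ ≠ 0 := by
  obtain ⟨T, hT, hc⟩ := PolarPath.lasso_crosses_lasso hs
  set P := PolarPath.lasso (4 * s) 0 with hP
  set Q := PolarPath.lasso (3 * s) Real.pi with hQ
  have rP : 0 < P.radius := by simp only [hP, PolarPath.lasso]; linarith
  have rQ : 0 < Q.radius := by simp only [hQ, PolarPath.lasso]; linarith
  have hneP : P.startAngle ≠ P.endAngle := by
    simp [hP, PolarPath.lasso]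
  have h1 := (hc 0 T).2 ⟨rfl, Or.inl rfl⟩
  have h2 := (hc 0 (-T)).2 ⟨rfl, Or.inr rfl⟩
  have d1 := PolarPath.tangentDet_ne_zero_of_arc rP rQ hneP h1 (lt_abs.2 (Or.inl hT))
  have d2 := PolarPath.tangentDet_ne_zero_of_arc rP rQ hneP h2
    (by rw [abs_neg]; exact lt_abs.2 (Or.inl hT))
  have hn := (Complex.normSq_pos.2 hΦ).ne'
  have e1 := tangentDet_of_follows hΓ hΔ h1
  have e2 := tangentDet_of_follows hΓ hΔ h2
  have hneg : tangentDet Γ Δ (0, -T) = -tangentDet Γ Δ (0, T) := by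
    rw [e1, e2, PolarPath.tangentDet_eq rP rQ h1, PolarPath.tangentDet_eq rP rQ h2,
      stepDeriv_of_not_mem (s := T) (Or.inr hT.le),
      stepDeriv_of_not_mem (s := -T) (Or.inl (by linarith)), hQ, PolarPath.deriv_modulus_lasso_neg]
    ring
  have t1 : tangentDet Γ Δ (0, T) ≠ 0 := by rw [e1]; exact mul_ne_zero hn d1
  have t2 : tangentDet Γ Δ (0, -T) ≠ 0 := by rw [e2]; exact mul_ne_zero hn d2
  refine pairing_of_crossings_eq_pair (p := (0, T)) (q := (0, -T)) ?_ ?_ t1 t2 ?_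
  · ext p
    rw [mem_crossings_iff hΦ hΓ hΔ, hc, Set.mem_insert_iff, Set.mem_singleton_iff, Prod.ext_iff,
      Prod.ext_iff]
    tauto
  · intro h
    have := congrArg Prod.snd h
    simp only at this
    linarith
  · have hTR : Q.modulus T < 5 * s := by
      rw [← ((PolarPath.toFun_eq_toFun_iff rP rQ).1 h1).1,
        PolarPath.modulus_mid (by norm_num) (by norm_num)]
      simp only [hP, PolarPath.lasso]
      linarith
    have hm := Δ.weight_lasso (by linarith : 0 < 3 * s) hΦ hΔ hw hb hb' hR hT.le hTR
    have hne : Complex.exp (2 * Real.pi * Complex.I *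
        (A.eval (Φ.scale * z) / (derivative B).eval (Φ.scale * z))) ≠ 1 := by
      rw [Ne, Complex.exp_eq_one_iff]
      rintro ⟨n, hn⟩
      apply hα n
      have h3 := two_pi_I_ne_zero
      rw [mul_comm (n : ℂ)] at hn
      have h4 := mul_left_cancel₀ h3 hn
      field_simp at h4
      exact h4.trans (mul_comm _ _)
    have key : crossingWeight Γ Δ (0, T) + crossingWeight Γ Δ (0, -T) =
        ((SignType.sign (tangentDet Γ Δ (0, T)) : ℝ) : ℂ) *
          (B.eval (Γ.path 0) * Γ.weight 0 * Δ.weight (-T)) * (Complex.exp (2 * Real.pi * Complex.I *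
        (A.eval (Φ.scale * z) / (derivative B).eval (Φ.scale * z))) - 1) := by
      simp only [crossingWeight, hneg, hm, Left.sign_neg, SignType.coe_neg]
      push_cast
      ring
    rw [key]
    exact mul_ne_zero (mul_ne_zero (sign_ne_zero_of_ne_zero t1)
      (mul_ne_zero (mul_ne_zero (Γ.avoids _) (Γ.weight_ne_zero _)) (Δ.weight_ne_zero _)))
      (sub_ne_zero.2 hne)

end LassoPairing

/-! ### Dual systems of contours at a zero of `B` -/

/-- The intersection matrix of the two families of contours is diagonal and invertible. -/
def IsDualSystem {A B : ℂ[X]} {u : ℂ} {ι : Type*} (Γ : ι → PrimalContour A B u)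
    (Δ : ι → DualContour A B u) : Prop :=
  ∀ i j, InGeneralPosition (Γ i) (Δ j) ∧ (i ≠ j → intersectionPairing (Γ i) (Δ j) = 0) ∧
    (i = j → intersectionPairing (Γ i) (Δ j) ≠ 0)

section Entries

variable {A B : ℂ[X]} {u : ℂ} {ι : Type*} {Γ : PrimalContour A B u} {Δ : DualContour A B u}
  {i j : ι}

theorem dualSystem_entry_of_ne (hij : i ≠ j) (h : ∀ t τ, Γ.path t ≠ Δ.path τ) :
    InGeneralPosition Γ Δ ∧ (i ≠ j → intersectionPairing Γ Δ = 0) ∧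
      (i = j → intersectionPairing Γ Δ ≠ 0) :=
  ⟨(pairing_of_crossings_eq_empty h).1, fun _ => (pairing_of_crossings_eq_empty h).2,
    fun h => absurd h hij⟩

theorem dualSystem_entry_of_eq (hij : i = j)
    (h : InGeneralPosition Γ Δ ∧ intersectionPairing Γ Δ ≠ 0) :
    InGeneralPosition Γ Δ ∧ (i ≠ j → intersectionPairing Γ Δ = 0) ∧
      (i = j → intersectionPairing Γ Δ ≠ 0) :=
  ⟨h.1, fun h' => absurd hij h', fun _ => h.2⟩

theorem path_ne_of_follows {Φ : Bend} {z : ℂ} {P Q : PolarPath} (hΦ : Φ.scale ≠ 0)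
    (hΓ : Γ.Follows Φ z P) (hΔ : Δ.Follows Φ z Q) (h : ∀ t τ, P.toFun t ≠ Q.toFun τ) (t τ : ℝ) :
    Γ.path t ≠ Δ.path τ := by
  rw [hΓ.2, hΔ.2]
  exact fun h' => h t τ (add_left_cancel (Bend.injective hΦ h'))

end Entries

namespace PolarPath

/-- Outgoing rays are horizontal and everything else stays in the disc, so the path lies in a
horizontal strip. This is what keeps the systems at different zeros apart. -/
theorem abs_im_toFun_le {P : PolarPath} (hr : 0 < P.radius)
    (h0 : P.startOut = true → (Complex.exp (P.startAngle * Complex.I)).im = 0)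
    (h1 : P.endOut = true → (Complex.exp (P.endAngle * Complex.I)).im = 0) (t : ℝ) :
    |(P.toFun t).im| ≤ P.radius := by
  have key : P.modulus t ≤ P.radius → |(P.toFun t).im| ≤ P.radius := fun h =>
    (Complex.abs_im_le_norm _).trans ((norm_toFun hr t).le.trans h)
  rcases lt_or_ge t (-1) with h | h
  · cases ho : P.startOut
    · exact key (modulus_lt_of_in' hr ho h).le
    · rw [toFun, angle_left h.le, Complex.im_ofReal_mul, h0 ho]
      simpa using hr.le
  rcases lt_or_ge 1 t with h' | h'
  · cases ho : P.endOut
    · exact key (modulus_lt_of_in hr ho h').le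
    · rw [toFun, angle_right h'.le, Complex.im_ofReal_mul, h1 ho]
      simpa using hr.le
  · exact key (modulus_mid h h').le

/-- The final piece of the path runs, at the angle `arg ε`, to infinity, or it runs into `p z` in an
admissible direction. -/
def GoodEnd (N B : ℂ[X]) (u p z ε : ℂ) (P : PolarPath) : Prop :=
  (P.endOut = true ∧ Complex.exp (P.endAngle * Complex.I) = ε) ∨
  (P.endOut = false ∧ ∀ c : ℝ, 0 < c → (ContourEnd.point (p * z)
    (p * (c * Complex.exp (P.endAngle * Complex.I)))).Admissible N B u)

end PolarPath

theorem AdmissibleContour.exists_follows_of_goodEnd {N B : ℂ[X]} {u z ε : ℂ} {Φ : Bend} {s : ℝ}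
    (hw : |z.re| + 5 * s ≤ Φ.width)
    (hz : ∀ ζ, |(ζ - z).im| ≤ 5 * s → B.eval (Φ.toFun ζ) = 0 → ζ = z) (hε : ε.im = 0)
    (hinf : ∀ P : PolarPath, P.endOut = true → 0 < P.radius →
      Complex.exp (P.endAngle * Complex.I) = ε → ∃ e : ContourEnd, e.Admissible N B u ∧
        e.IsEndOf fun t => Φ.toFun (z + P.toFun t)) {P : PolarPath}
    (h0 : P.reverse.GoodEnd N B u Φ.scale z ε) (h1 : P.GoodEnd N B u Φ.scale z ε)
    (hr : 0 < P.radius) (hr' : P.radius ≤ 4 * s) :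
    ∃ Γ : AdmissibleContour N B u, Γ.Follows Φ z P ∧ ∀ t, |(P.toFun t).im| ≤ 4 * s := by
  have hend : ∀ P : PolarPath, P.GoodEnd N B u Φ.scale z ε → 0 < P.radius → P.radius ≤ 4 * s →
      ∃ e : ContourEnd, e.Admissible N B u ∧ e.IsEndOf fun t => Φ.toFun (z + P.toFun t) := by
    rintro P (⟨ho, ha⟩ | ⟨ho, ha⟩) hr hr'
    · exact hinf P ho hr ha
    · exact ⟨_, ha _ (mul_pos hr (Real.exp_pos rampShift)),
        PolarPath.isEndOf_point ho hr (by linarith)⟩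
  have him : ∀ P : PolarPath, P.GoodEnd N B u Φ.scale z ε → P.endOut = true →
      (Complex.exp (P.endAngle * Complex.I)).im = 0 := by
    rintro P (⟨ho, ha⟩ | ⟨ho, ha⟩) ho'
    · rw [ha, hε]
    · rw [ho] at ho'; cases ho'
  have hstrip : ∀ t, |(P.toFun t).im| ≤ 4 * s := fun t =>
    (PolarPath.abs_im_toFun_le hr (him _ h0) (him _ h1) t).trans hr'
  have havoid : ∀ t, B.eval (Φ.toFun (z + P.toFun t)) ≠ 0 := by
    intro t h
    have := hz _ (by
      rw [add_sub_cancel_left]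
      linarith [hstrip t]) h
    exact PolarPath.toFun_ne_zero hr t (by simpa using this)
  obtain ⟨Γ, hΓ⟩ := AdmissibleContour.exists_follows havoid (hend _ h0 hr hr') (hend _ h1 hr hr')
  exact ⟨Γ, hΓ, hstrip⟩

theorem ContourEnd.admissible_point_of_multiple {N B : ℂ[X]} {u b p : ℂ} {m : ℕ}
    (hm : 0 < m) (hb : B.rootMultiplicity b = m + 1) {β : ℝ}
    (h : 0 < (N.eval b / (taylor b B).coeff (m + 1) / p ^ m / Complex.exp (m * β * Complex.I)).re)
    {c : ℝ} (hc : 0 < c) :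
    (ContourEnd.point b (p * (c * Complex.exp (β * Complex.I)))).Admissible N B u := by
  refine Or.inl ⟨by omega, ?_⟩
  rw [hb, Nat.add_sub_cancel]
  have e : N.eval b / (taylor b B).coeff (m + 1) / (p * (c * Complex.exp (β * Complex.I))) ^ m =
      N.eval b / (taylor b B).coeff (m + 1) / p ^ m / Complex.exp (m * β * Complex.I) *
        (((c ^ m)⁻¹ : ℝ) : ℂ) := by
    rw [mul_pow, mul_pow, ← Complex.exp_nat_mul, mul_assoc (m : ℂ)]
    push_cast
    field_simp
  rw [e, Complex.re_mul_ofReal]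
  positivity

theorem exists_decay_angle {w : ℂ} (hw : w ≠ 0) {m : ℕ} (hm : 0 < m) :
    ∃ α : ℝ, 0 < α ∧ α < 2 * Real.pi ∧ 0 < (w / Complex.exp (m * α * Complex.I)).re := by
  have hp := Real.pi_pos
  have hm1 : (1 : ℝ) ≤ m := by exact_mod_cast hm
  have hw' := norm_pos_iff.2 hw
  have key : ∀ x : ℝ, (w / Complex.exp (x * Complex.I)).re = ‖w‖ * Real.cos (w.arg - x) := by
    intro x
    conv_lhs => rw [← Complex.norm_mul_exp_arg_mul_I w]
    rw [mul_div_assoc, ← Complex.exp_sub, ← sub_mul, ← Complex.ofReal_sub, Complex.re_ofReal_mul,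
      Complex.exp_ofReal_mul_I_re]
  have hx : ∀ x : ℝ, 0 < x → x < 2 * Real.pi → 0 < Real.cos (w.arg - x) →
      ∃ α : ℝ, 0 < α ∧ α < 2 * Real.pi ∧ 0 < (w / Complex.exp (m * α * Complex.I)).re := by
    intro x h1 h2 h3
    refine ⟨x / m, by positivity, ?_, ?_⟩
    · exact (div_le_self h1.le hm1).trans_lt h2
    · have e : (m : ℂ) * ((x / m : ℝ) : ℂ) = (x : ℝ) := by
        have : (m : ℂ) ≠ 0 := by exact_mod_cast hm.ne'
        push_cast
        field_simp
      rw [e, key]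
      positivity
  rcases le_or_gt w.arg 0 with h | h
  -- The shift by π/4 keeps the angle strictly below 2π when arg w = 0, and cos(π/4) is still
  -- positive.
  · refine hx (w.arg + 2 * Real.pi - Real.pi / 4) ?_ (by linarith) ?_
    · linarith [Complex.neg_pi_lt_arg w]
    · rw [show w.arg - (w.arg + 2 * Real.pi - Real.pi / 4) = Real.pi / 4 - 2 * Real.pi by ring,
        Real.cos_sub_two_pi, Real.cos_pi_div_four]
      positivity
  · refine hx w.arg h ?_ (by simp)
    linarith [Complex.arg_le_pi w]

theorem exp_sector_angle {m : ℕ} (hm : 0 < m) (α : ℝ) (k : ℤ) :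
    Complex.exp (m * ((α - 2 * k * Real.pi / m : ℝ) : ℂ) * Complex.I) =
      Complex.exp (m * α * Complex.I) := by
  have hm' : (m : ℂ) ≠ 0 := by exact_mod_cast hm.ne'
  have e : (m : ℂ) * ((α - 2 * k * Real.pi / m : ℝ) : ℂ) * Complex.I =
      m * α * Complex.I - k * (2 * Real.pi * Complex.I) := by
    push_cast
    field_simp
  rw [e, Complex.exp_sub, Complex.exp_int_mul_two_pi_mul_I, div_one]

/-- The half-way angles change the sign of the leading term: they bisect the gaps between dual
directions and serve as primal directions. -/
theorem exp_sector_angle' {m : ℕ} (hm : 0 < m) (α : ℝ) (k : ℤ) :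
    Complex.exp (m * ((α - (2 * k - 1) * Real.pi / m : ℝ) : ℂ) * Complex.I) =
      -Complex.exp (m * α * Complex.I) := by
  have hm' : (m : ℂ) ≠ 0 := by exact_mod_cast hm.ne'
  have e : (m : ℂ) * ((α - (2 * k - 1) * Real.pi / m : ℝ) : ℂ) * Complex.I =
      m * α * Complex.I - k * (2 * Real.pi * Complex.I) + Real.pi * Complex.I := by
    push_cast
    field_simp
    ring
  rw [e, Complex.exp_add, Complex.exp_sub, Complex.exp_int_mul_two_pi_mul_I, div_one,
    Complex.exp_pi_mul_I, mul_neg_one]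

section LocalSystem

variable {A B : ℂ[X]} {u z : ℂ} {Φ : Bend} {s : ℝ}

theorem exists_follows_primal (hs : 0 < s) (hw : |z.re| + 5 * s ≤ Φ.width)
    (hz : ∀ ζ, |(ζ - z).im| ≤ 5 * s → B.eval (Φ.toFun ζ) = 0 → ζ = z)
    (hp : (ContourEnd.infinity (Φ.scale * (1 + Φ.right * Complex.I))).Admissible
      (-(A + derivative B)) B u) {P : PolarPath}
    (h0 : P.reverse.GoodEnd (-(A + derivative B)) B u Φ.scale z 1)
    (h1 : P.GoodEnd (-(A + derivative B)) B u Φ.scale z 1)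
    (hr : 0 < P.radius) (hr' : P.radius ≤ 4 * s) :
    ∃ Γ : PrimalContour A B u, Γ.Follows Φ z P ∧ ∀ t, |(P.toFun t).im| ≤ 4 * s :=
  AdmissibleContour.exists_follows_of_goodEnd hw hz (by simp) (fun _ ho hr ha =>
    ⟨_, hp, PolarPath.isEndOf_infinity_right ho hr ha (by linarith [abs_nonneg z.re])⟩) h0 h1 hr hr'

theorem exists_follows_dual (hs : 0 < s) (hw : |z.re| + 5 * s ≤ Φ.width)
    (hz : ∀ ζ, |(ζ - z).im| ≤ 5 * s → B.eval (Φ.toFun ζ) = 0 → ζ = z)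
    (hd : (ContourEnd.infinity (Φ.scale * (-1 + Φ.left * Complex.I))).Admissible A B (-u))
    {P : PolarPath} (h0 : P.reverse.GoodEnd A B (-u) Φ.scale z (-1))
    (h1 : P.GoodEnd A B (-u) Φ.scale z (-1)) (hr : 0 < P.radius) (hr' : P.radius ≤ 4 * s) :
    ∃ Δ : DualContour A B u, Δ.Follows Φ z P ∧ ∀ t, |(P.toFun t).im| ≤ 4 * s :=
  AdmissibleContour.exists_follows_of_goodEnd hw hz (by simp) (fun _ ho hr ha =>
    ⟨_, hd, PolarPath.isEndOf_infinity_left ho hr ha (by linarith [abs_nonneg z.re])⟩) h0 h1 hr hr'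

/-- A dual system of contours in a strip around a simple zero of `B`. -/
theorem exists_local_system_of_simple (hB : B ≠ 0) (hΦ : Φ.scale ≠ 0) (hs : 0 < s)
    (hw : |z.re| + 5 * s ≤ Φ.width)
    (hz : ∀ ζ, |(ζ - z).im| ≤ 5 * s → B.eval (Φ.toFun ζ) = 0 → ζ = z)
    (hp : (ContourEnd.infinity (Φ.scale * (1 + Φ.right * Complex.I))).Admissible
      (-(A + derivative B)) B u)
    (hd : (ContourEnd.infinity (Φ.scale * (-1 + Φ.left * Complex.I))).Admissible A B (-u))
    (hb : B.rootMultiplicity (Φ.scale * z) = 1) :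
    ∃ (P Q : PolarPath) (Γ : PrimalContour A B u) (Δ : DualContour A B u),
      (Γ.Follows Φ z P ∧ ∀ t, |(P.toFun t).im| ≤ 4 * s) ∧
      (Δ.Follows Φ z Q ∧ ∀ t, |(Q.toFun t).im| ≤ 4 * s) ∧
      InGeneralPosition Γ Δ ∧ intersectionPairing Γ Δ ≠ 0 := by
  have hb0 : B.eval (Φ.scale * z) = 0 :=
    (rootMultiplicity_pos'.1 (by omega : 0 < B.rootMultiplicity (Φ.scale * z))).2
  have hb' := derivative_eval_ne_zero_of_simple hB hb
  have e1 : Complex.exp (((0 : ℝ) : ℂ) * Complex.I) = 1 := by simp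
  have e2 : Complex.exp (((0 + 2 * Real.pi : ℝ) : ℂ) * Complex.I) = 1 := by
    rw [zero_add]; push_cast; exact Complex.exp_two_pi_mul_I
  have e3 : Complex.exp ((Real.pi : ℂ) * Complex.I) = -1 := Complex.exp_pi_mul_I
  have e4 : Complex.exp (((Real.pi + 2 * Real.pi : ℝ) : ℂ) * Complex.I) = -1 := by
    push_cast
    rw [add_mul, Complex.exp_add, Complex.exp_two_pi_mul_I, Complex.exp_pi_mul_I, mul_one]
  have hpt : ∀ (N : ℂ[X]) (v : ℂ) (k : ℕ), N.eval (Φ.scale * z) =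
      k * (derivative B).eval (Φ.scale * z) → ∀ (β c : ℝ), 0 < c → (ContourEnd.point (Φ.scale * z)
        (Φ.scale * (c * Complex.exp (β * Complex.I)))).Admissible N B v := by
    intro N v k hk β c hc
    exact Or.inr ⟨hb, mul_ne_zero hΦ (mul_ne_zero (Complex.ofReal_ne_zero.2 hc.ne')
      (Complex.exp_ne_zero _)), k, hk⟩
  -- Let α = A(b)/B'(b). If α is a natural number the dual weight is regular at b and a dual stem
  -- may end there; if α is a negative integer the primal weight is regular and a primal stem may.
  -- Otherwise α is not an integer and two lassos are used.
  by_cases c1 : ∃ k : ℕ, A.eval (Φ.scale * z) = k * (derivative B).eval (Φ.scale * z)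
  · obtain ⟨k, hk⟩ := c1
    obtain ⟨Γ, hΓ, sΓ⟩ := exists_follows_primal (P := .lasso (4 * s) 0) hs hw hz hp
      (Or.inl ⟨rfl, e1⟩) (Or.inl ⟨rfl, e2⟩) (by simp only [PolarPath.lasso]; linarith) le_rfl
    obtain ⟨Δ, hΔ, sΔ⟩ := exists_follows_dual (P := .dualStem (3 * s) Real.pi) hs hw hz hd
      (Or.inr ⟨rfl, hpt A _ k hk _⟩) (Or.inl ⟨rfl, e3⟩)
      (by simp only [PolarPath.dualStem]; linarith) (by simp only [PolarPath.dualStem]; linarith)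
    obtain ⟨τ₀, h1, h2⟩ := PolarPath.lasso_crosses_dualStem (α := Real.pi) hs
    exact ⟨_, _, Γ, Δ, ⟨hΓ, sΓ⟩, ⟨hΔ, sΔ⟩, pairing_of_follows_arc hΦ hΓ hΔ
      (by simp only [PolarPath.lasso]; linarith) (by simp only [PolarPath.dualStem]; linarith)
      (by simp [PolarPath.lasso]) h1 h2⟩
  obtain ⟨Δ, hΔ, sΔ⟩ := exists_follows_dual (P := .lasso (3 * s) Real.pi) hs hw hz hd
    (Or.inl ⟨rfl, e3⟩) (Or.inl ⟨rfl, e4⟩) (by simp only [PolarPath.lasso]; linarith)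
    (by simp only [PolarPath.lasso]; linarith)
  by_cases c2 : ∃ k : ℕ, (-(A + derivative B)).eval (Φ.scale * z) =
      k * (derivative B).eval (Φ.scale * z)
  · obtain ⟨k, hk⟩ := c2
    obtain ⟨Γ, hΓ, sΓ⟩ := exists_follows_primal (P := .stem (2 * s) 0) hs hw hz hp
      (Or.inl ⟨rfl, e1⟩) (Or.inr ⟨rfl, hpt _ _ k hk _⟩)
      (by simp only [PolarPath.stem]; linarith) (by simp only [PolarPath.stem]; linarith)
    obtain ⟨t₀, h1, h2⟩ := PolarPath.stem_crosses_lasso hs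
    exact ⟨_, _, Γ, Δ, ⟨hΓ, sΓ⟩, ⟨hΔ, sΔ⟩, pairing_of_follows_arc' hΦ hΓ hΔ
      (by simp only [PolarPath.stem]; linarith) (by simp only [PolarPath.lasso]; linarith)
      (by simp [PolarPath.lasso]) h1 h2⟩
  · obtain ⟨Γ, hΓ, sΓ⟩ := exists_follows_primal (P := .lasso (4 * s) 0) hs hw hz hp
      (Or.inl ⟨rfl, e1⟩) (Or.inl ⟨rfl, e2⟩) (by simp only [PolarPath.lasso]; linarith) le_rfl
    refine ⟨_, _, Γ, Δ, ⟨hΓ, sΓ⟩, ⟨hΔ, sΔ⟩, pairing_of_follows_lasso hs hΦ hΓ hΔ hw hb0 hb'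
      (fun ζ hζ h => ?_) fun n hn => ?_⟩
    · rw [mem_ball_iff_norm] at hζ
      refine hz ζ ((Complex.abs_im_le_norm _).trans hζ.le) ?_
      rw [Φ.toFun_eq_of_abs_le]
      · exact h
      · rw [show ζ = z + (ζ - z) by ring, Complex.add_re]
        refine (abs_add_le _ _).trans (le_trans ?_ hw)
        gcongr
        exact (Complex.abs_re_le_norm _).trans hζ.le
    · rcases le_or_gt 0 n with h | h
      · obtain ⟨k, rfl⟩ := Int.eq_ofNat_of_zero_le h
        exact c1 ⟨k, by simpa using hn⟩
      · obtain ⟨k, hk⟩ := Int.eq_ofNat_of_zero_le (by omega : 0 ≤ -n - 1)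
        refine c2 ⟨k, ?_⟩
        have : n = -(k : ℤ) - 1 := by omega
        rw [this] at hn
        rw [eval_neg, eval_add, hn]
        push_cast
        ring

/-- A dual system of contours in a strip around a multiple zero of `B`. -/
theorem exists_local_system_of_multiple (hB : B ≠ 0) (hred : ReducedPair A B) (hΦ : Φ.scale ≠ 0)
    (hs : 0 < s) (hw : |z.re| + 5 * s ≤ Φ.width)
    (hz : ∀ ζ, |(ζ - z).im| ≤ 5 * s → B.eval (Φ.toFun ζ) = 0 → ζ = z)
    (hp : (ContourEnd.infinity (Φ.scale * (1 + Φ.right * Complex.I))).Admissible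
      (-(A + derivative B)) B u)
    (hd : (ContourEnd.infinity (Φ.scale * (-1 + Φ.left * Complex.I))).Admissible A B (-u))
    {m : ℕ} (hm : 0 < m) (hb : B.rootMultiplicity (Φ.scale * z) = m + 1) :
    ∃ (P Q : Fin (m + 1) → PolarPath) (Γ : Fin (m + 1) → PrimalContour A B u)
      (Δ : Fin (m + 1) → DualContour A B u),
      (∀ i, (Γ i).Follows Φ z (P i) ∧ ∀ t, |((P i).toFun t).im| ≤ 4 * s) ∧
      (∀ i, (Δ i).Follows Φ z (Q i) ∧ ∀ t, |((Q i).toFun t).im| ≤ 4 * s) ∧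
      IsDualSystem Γ Δ := by
  set b := Φ.scale * z with hbdef
  have hpi := Real.pi_pos
  have hm' : (0 : ℝ) < m := by exact_mod_cast hm
  have hb0 : B.eval b = 0 := (rootMultiplicity_pos'.1 (by omega : 0 < B.rootMultiplicity b)).2
  have hb' := derivative_eval_eq_zero_of_multiple hB (b := b) (by omega)
  have hA : A.eval b ≠ 0 := fun h => by
    have := hred b h hb0
    omega
  have hcoef : (taylor b B).coeff (m + 1) ≠ 0 := by
    obtain ⟨D, hD, hnd⟩ := exists_eq_pow_rootMultiplicity_mul_and_not_dvd B hB b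
    rw [hb] at hD
    have : (taylor b B).coeff (m + 1) = D.eval b := by
      conv_lhs => rw [hD]
      simp [taylor_mul, taylor_pow, coeff_X_pow_mul', taylor_coeff_zero]
    rw [this]
    exact fun h => hnd (dvd_iff_isRoot.2 h)
  set w := A.eval b / (taylor b B).coeff (m + 1) / Φ.scale ^ m with hwdef
  have hw0 : w ≠ 0 := div_ne_zero (div_ne_zero hA hcoef) (pow_ne_zero _ hΦ)
  -- The dual directions are α - 2kπ/m; the primal ones lie half-way between, because B'(b) = 0
  -- makes the leading terms opposite.
  obtain ⟨α, hα0, hα1, hα⟩ := exists_decay_angle hw0 hm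
  have e1 : Complex.exp (((0 : ℝ) : ℂ) * Complex.I) = 1 := by simp
  have e2 : Complex.exp (((0 + 2 * Real.pi : ℝ) : ℂ) * Complex.I) = 1 := by
    rw [zero_add]; push_cast; exact Complex.exp_two_pi_mul_I
  have e3 : Complex.exp ((Real.pi : ℂ) * Complex.I) = -1 := Complex.exp_pi_mul_I
  have hpd : ∀ (k : ℤ) (c : ℝ), 0 < c → (ContourEnd.point b (Φ.scale * (c * Complex.exp
      (((α - 2 * k * Real.pi / m : ℝ) : ℂ) * Complex.I)))).Admissible A B (-u) := fun k c hc =>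
    ContourEnd.admissible_point_of_multiple hm hb (by rw [exp_sector_angle hm]; exact hα) hc
  have hpp : ∀ (k : ℤ) (c : ℝ), 0 < c → (ContourEnd.point b (Φ.scale * (c * Complex.exp
      (((α - (2 * k - 1) * Real.pi / m : ℝ) : ℂ) * Complex.I)))).Admissible
        (-(A + derivative B)) B u := fun k c hc =>
    ContourEnd.admissible_point_of_multiple hm hb (by
      rw [exp_sector_angle' hm, eval_neg, eval_add, hb', add_zero, neg_div, neg_div, neg_div_neg_eq]
      exact hα) hc
  -- Index 0 pairs a lasso with a dual stem. The other m indices pair a stem into each primal sector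
  -- with the petal joining the two adjacent dual sectors.
  let P : Fin (m + 1) → PolarPath := Fin.cases (.lasso (4 * s) 0)
    fun j => .stem (2 * s) (α - (2 * ((j : ℕ) + 1 : ℤ) - 1) * Real.pi / m)
  let Q : Fin (m + 1) → PolarPath := Fin.cases (.dualStem (3 * s) α)
    fun j => .petal s (α - 2 * (((j : ℕ) + 1 : ℤ) - 1) * Real.pi / m)
      (α - 2 * ((j : ℕ) + 1 : ℤ) * Real.pi / m)
  have hΓ : ∀ i, ∃ Γ : PrimalContour A B u,
      Γ.Follows Φ z (P i) ∧ ∀ t, |((P i).toFun t).im| ≤ 4 * s := by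
    intro i
    refine Fin.cases ?_ (fun j => ?_) i
    · exact exists_follows_primal hs hw hz hp
        (Or.inl ⟨rfl, e1⟩) (Or.inl ⟨rfl, e2⟩) (by simp only [P, Fin.cases_zero, PolarPath.lasso]; linarith) le_rfl
    · exact exists_follows_primal hs hw hz hp
        (Or.inl ⟨rfl, e1⟩) (Or.inr ⟨rfl, hpp _⟩)
        (by simp only [P, Fin.cases_succ, PolarPath.stem]; linarith)
        (by simp only [P, Fin.cases_succ, PolarPath.stem]; linarith)
  have hΔ : ∀ i, ∃ Δ : DualContour A B u,
      Δ.Follows Φ z (Q i) ∧ ∀ t, |((Q i).toFun t).im| ≤ 4 * s := by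
    intro i
    refine Fin.cases ?_ (fun j => ?_) i
    · exact exists_follows_dual hs hw hz hd
        (Or.inr ⟨rfl, fun c hc => by
          have := hpd 0 c hc
          simpa [Q, PolarPath.reverse, PolarPath.dualStem] using this⟩) (Or.inl ⟨rfl, e3⟩)
        (by simp only [Q, Fin.cases_zero, PolarPath.dualStem]; linarith)
        (by simp only [Q, Fin.cases_zero, PolarPath.dualStem]; linarith)
    · exact exists_follows_dual hs hw hz hd
        (Or.inr ⟨rfl, fun c hc => by
          have := hpd (j : ℕ) c hc
          simpa [Q, PolarPath.reverse, PolarPath.petal] using this⟩) (Or.inr ⟨rfl, hpd _⟩)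
        hs (by simp only [Q, Fin.cases_succ, PolarPath.petal]; linarith)
  choose Γ hΓ using hΓ
  choose Δ hΔ using hΔ
  refine ⟨P, Q, Γ, Δ, hΓ, hΔ, fun i j => ?_⟩
  have hγ := (hΓ i).1
  have hδ := (hΔ j).1
  generalize Γ i = γ at hγ
  generalize Δ j = δ at hδ
  induction i using Fin.cases with
  | zero =>
    induction j using Fin.cases with
    | zero =>
      obtain ⟨τ₀, h1, h2⟩ := PolarPath.lasso_crosses_dualStem (α := α) hs
      exact dualSystem_entry_of_eq rfl (pairing_of_follows_arc hΦ hγ hδ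
        (by simp only [P, Fin.cases_zero, PolarPath.lasso]; linarith)
        (by simp only [Q, Fin.cases_zero, PolarPath.dualStem]; linarith)
        (by simp [P, PolarPath.lasso]) h1 h2)
    | succ j =>
      exact dualSystem_entry_of_ne (Fin.succ_ne_zero j).symm
        (path_ne_of_follows hΦ hγ hδ (PolarPath.lasso_ne_petal hs))
  | succ i =>
    have hi : ((i : ℕ) : ℝ) + 1 ≤ m := by exact_mod_cast i.2
    have hi0 : (0 : ℝ) ≤ (i : ℕ) := by positivity
    induction j using Fin.cases with
    | zero =>
      refine dualSystem_entry_of_ne (Fin.succ_ne_zero i)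
        (path_ne_of_follows hΦ hγ hδ (PolarPath.stem_ne_dualStem hs hα0 hα1 ?_ ?_))
      · push_cast
        have : (2 * ((i : ℕ) + 1 : ℝ) - 1) * Real.pi / m < 2 * Real.pi := by
          rw [div_lt_iff₀ hm']
          nlinarith
        linarith
      · push_cast
        have : 0 < (2 * ((i : ℕ) + 1 : ℝ) - 1) * Real.pi / m := by
          apply div_pos (mul_pos _ hpi) hm'
          linarith
        linarith
    | succ j =>
      by_cases hij : i = j
      · subst hij
        obtain ⟨t₀, h1, h2⟩ := PolarPath.stem_crosses_petal hm (α := α) hs ((i : ℕ) + 1 : ℤ)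
        refine dualSystem_entry_of_eq rfl (pairing_of_follows_arc' hΦ hγ hδ
          (by simp only [P, Fin.cases_succ, PolarPath.stem]; linarith) hs ?_ h1 h2)
        simp only [Q, Fin.cases_succ, PolarPath.petal]
        have : 0 < Real.pi / m := by positivity
        intro h
        field_simp at h
        linarith
      · refine dualSystem_entry_of_ne (fun h => hij (Fin.succ_injective _ h))
          (path_ne_of_follows hΦ hγ hδ fun t τ h => hij ?_)
        obtain ⟨-, -, n, hn⟩ := PolarPath.stem_crossing_petal hm hs h
        have h1 := i.2
        have h2 := j.2
        have h3 : (0 : ℤ) < m := by exact_mod_cast hm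
        have h4 : n < 1 := by
          by_contra! h
          nlinarith
        have h5 : -1 < n := by
          by_contra! h
          nlinarith
        have h6 : n = 0 := by omega
        rw [h6] at hn
        apply Fin.ext
        simp only at hn
        omega

end LocalSystem

/-! ### Dual systems of contours at all zeros of `B` -/

/-- The difference of heights is Im w + σ Re w with w = (b - b')/p ≠ 0, which is nonzero for all
small σ ≠ 0. Small tilts therefore give the zeros of B distinct heights. -/
theorem eventually_im_ne (F : Finset ℂ) {p : ℂ} (hp : p ≠ 0) :
    ∀ᶠ σ : ℝ in 𝓝[≠] 0, ∀ b ∈ F, ∀ b' ∈ F, b ≠ b' →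
      (b / (p / (1 + σ * Complex.I))).im ≠ (b' / (p / (1 + σ * Complex.I))).im := by
  refine (Finset.eventually_all F).2 fun b _ => (Finset.eventually_all F).2 fun b' _ => ?_
  by_cases hb : b = b'
  · exact Eventually.of_forall fun σ h => absurd hb h
  set w := (b - b') / p with hw
  have hw0 : w ≠ 0 := div_ne_zero (sub_ne_zero.2 hb) hp
  have e : ∀ σ : ℝ, (b / (p / (1 + σ * Complex.I))).im - (b' / (p / (1 + σ * Complex.I))).im =
      w.im + σ * w.re := by
    intro σ
    rw [← Complex.sub_im, ← sub_div, div_div_eq_mul_div, mul_div_right_comm, ← hw]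
    simp only [Complex.mul_im, Complex.add_re, Complex.add_im, Complex.one_re, Complex.one_im,
      Complex.mul_re, Complex.ofReal_re, Complex.ofReal_im, Complex.I_re, Complex.I_im]
    ring
  have key : ∀ᶠ σ in 𝓝[≠] (0 : ℝ), w.im + σ * w.re ≠ 0 := by
    by_cases h : w.im = 0
    · have hre : w.re ≠ 0 := fun h' => hw0 (Complex.ext h' h)
      filter_upwards [self_mem_nhdsWithin] with σ hσ
      rw [h, zero_add]
      exact mul_ne_zero hσ hre
    · have hc : ContinuousAt (fun σ : ℝ => w.im + σ * w.re) 0 := by fun_prop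
      have := hc.eventually_ne (y := 0) (by simpa using h)
      exact mem_nhdsWithin_of_mem_nhds this
  filter_upwards [key] with σ hσ _ h
  exact hσ (by rw [← e, h, sub_self])

section FiniteSystem

variable {A B : ℂ[X]} {u : ℂ}

/-- A dual system of contours in a strip around a zero of `B`. -/
theorem exists_local_system (hB : B ≠ 0) (hred : ReducedPair A B) {Φ : Bend} {z : ℂ} {s : ℝ}
    (hΦ : Φ.scale ≠ 0) (hs : 0 < s) (hw : |z.re| + 5 * s ≤ Φ.width)
    (hz : ∀ ζ, |(ζ - z).im| ≤ 5 * s → B.eval (Φ.toFun ζ) = 0 → ζ = z)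
    (hp : (ContourEnd.infinity (Φ.scale * (1 + Φ.right * Complex.I))).Admissible
      (-(A + derivative B)) B u)
    (hd : (ContourEnd.infinity (Φ.scale * (-1 + Φ.left * Complex.I))).Admissible A B (-u))
    {n : ℕ} (hn : 0 < n) (hb : B.rootMultiplicity (Φ.scale * z) = n) :
    ∃ (P Q : Fin n → PolarPath) (Γ : Fin n → PrimalContour A B u) (Δ : Fin n → DualContour A B u),
      (∀ i, (Γ i).Follows Φ z (P i) ∧ ∀ t, |((P i).toFun t).im| ≤ 4 * s) ∧
      (∀ i, (Δ i).Follows Φ z (Q i) ∧ ∀ t, |((Q i).toFun t).im| ≤ 4 * s) ∧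
      IsDualSystem Γ Δ := by
  obtain ⟨m, rfl⟩ : ∃ m, n = m + 1 := ⟨n - 1, by omega⟩
  rcases m.eq_zero_or_pos with rfl | hm
  · obtain ⟨P, Q, Γ, Δ, hΓ, hΔ, h⟩ := exists_local_system_of_simple hB hΦ hs hw hz hp hd hb
    exact ⟨fun _ => P, fun _ => Q, fun _ => Γ, fun _ => Δ, fun _ => hΓ, fun _ => hΔ,
      fun i j => dualSystem_entry_of_eq (Fin.ext (by omega)) h⟩
  · exact exists_local_system_of_multiple hB hred hΦ hs hw hz hp hd hm hb

/-- The indices of the system of contours at the zeros of `B`. -/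
abbrev RootIndex (B : ℂ[X]) : Type := Σ b : B.roots.toFinset, Fin (B.rootMultiplicity (b : ℂ))

theorem card_rootIndex (B : ℂ[X]) : Fintype.card (RootIndex B) = B.natDegree := by
  rw [Fintype.card_sigma]
  simp only [Fintype.card_fin]
  rw [Finset.sum_coe_sort B.roots.toFinset (fun b => B.rootMultiplicity b)]
  simp only [← count_roots]
  rw [Multiset.toFinset_sum_count_eq]
  exact (IsAlgClosed.splits B).natDegree_eq_card_roots.symm

/-- With distinct heights, strips of half width 4s around the zeros are disjoint, and the bend,
injective, keeps them so. The bend starts only beyond all the zeros, so it is linear on a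
neighbourhood of each. -/
theorem exists_root_system (hB : B ≠ 0) (hred : ReducedPair A B) {p : ℂ} (hp0 : p ≠ 0) {l r : ℝ}
    (him : ∀ b ∈ B.roots.toFinset, ∀ b' ∈ B.roots.toFinset, b ≠ b' → (b / p).im ≠ (b' / p).im)
    (hp : (ContourEnd.infinity (p * (1 + r * Complex.I))).Admissible (-(A + derivative B)) B u)
    (hd : (ContourEnd.infinity (p * (-1 + l * Complex.I))).Admissible A B (-u)) :
    ∃ (M C : ℝ) (Γ : RootIndex B → PrimalContour A B u) (Δ : RootIndex B → DualContour A B u),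
      IsDualSystem Γ Δ ∧
      (∀ i t, ∃ ζ : ℂ, |ζ.im| ≤ C ∧ (Γ i).path t = (Bend.mk p l r M).toFun ζ) ∧
      ∀ i t, ∃ ζ : ℂ, |ζ.im| ≤ C ∧ (Δ i).path t = (Bend.mk p l r M).toFun ζ := by
  set F := B.roots.toFinset with hF
  obtain ⟨s, hs, hgap⟩ : ∃ s > 0, ∀ b ∈ F, ∀ b' ∈ F, b ≠ b' →
      8 * s < |(b / p).im - (b' / p).im| := by
    have : ∀ᶠ s in 𝓝[>] (0 : ℝ), ∀ b ∈ F, ∀ b' ∈ F, b ≠ b' →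
        8 * s < |(b / p).im - (b' / p).im| := by
      refine (Finset.eventually_all F).2 fun b hb => (Finset.eventually_all F).2 fun b' hb' => ?_
      by_cases h : b = b'
      · exact Eventually.of_forall fun s h' => absurd h h'
      · have : 0 < |(b / p).im - (b' / p).im| / 8 :=
          div_pos (abs_pos.2 (sub_ne_zero.2 (him b hb b' hb' h))) (by norm_num)
        filter_upwards [Ioo_mem_nhdsGT this] with s hs _
        linarith [hs.2]
    obtain ⟨s, h1, h2⟩ := (this.and self_mem_nhdsWithin).exists
    exact ⟨s, h2, h1⟩
  obtain ⟨M, hM⟩ : ∃ M, ∀ b ∈ F, |(b / p).re| + 5 * s ≤ M :=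
    ((Finset.eventually_all F).2 fun b _ => eventually_ge_atTop _).exists
  obtain ⟨C, hC⟩ : ∃ C, ∀ b ∈ F, |(b / p).im| + 4 * s ≤ C :=
    ((Finset.eventually_all F).2 fun b _ => eventually_ge_atTop _).exists
  set Φ : Bend := ⟨p, l, r, M⟩ with hΦ
  have hpb : ∀ b, p * (b / p) = b := fun b => mul_div_cancel₀ b hp0
  -- Since the bend is injective and linear on the band containing all b/p, it takes a zero b of B
  -- as value only at b/p, so no further zero enters the strips.
  have hz : ∀ b ∈ F, ∀ ζ, |(ζ - b / p).im| ≤ 5 * s → B.eval (Φ.toFun ζ) = 0 → ζ = b / p := by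
    intro b hb ζ hζ h
    have hb' : Φ.toFun ζ ∈ F := by
      rw [hF, Multiset.mem_toFinset, mem_roots hB]; exact h
    have e : ζ = Φ.toFun ζ / p := by
      apply Bend.injective (Φ := Φ) hp0
      rw [Φ.toFun_eq_of_abs_le (ζ := Φ.toFun ζ / p) (by linarith [hM _ hb'])]
      exact (hpb _).symm
    by_cases hbb : Φ.toFun ζ = b
    · rw [e, hbb]
    · have := hgap _ hb' _ hb hbb
      rw [← Complex.sub_im, ← e] at this
      linarith
  have hloc := fun b : F => exists_local_system (Φ := Φ) (z := b / p) hB hred hp0 hs (hM b b.2)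
    (hz b b.2) hp hd (n := B.rootMultiplicity (b : ℂ))
    ((rootMultiplicity_pos hB).2 ((mem_roots hB).1 (Multiset.mem_toFinset.1 b.2)))
    (by rw [show Φ.scale * (b / p) = b from hpb b])
  choose P Q Γ Δ hΓ hΔ hdual using hloc
  have hΓ' : ∀ (i : RootIndex B) t, ∃ ζ : ℂ, |ζ.im - ((i.1 : ℂ) / p).im| ≤ 4 * s ∧
      (Γ i.1 i.2).path t = Φ.toFun ζ := fun i t => by
    obtain ⟨h1, h2⟩ := hΓ i.1 i.2
    exact ⟨_, by rw [Complex.add_im, add_sub_cancel_left]; exact h2 t, by rw [h1.2]⟩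
  have hΔ' : ∀ (i : RootIndex B) t, ∃ ζ : ℂ, |ζ.im - ((i.1 : ℂ) / p).im| ≤ 4 * s ∧
      (Δ i.1 i.2).path t = Φ.toFun ζ := fun i t => by
    obtain ⟨h1, h2⟩ := hΔ i.1 i.2
    exact ⟨_, by rw [Complex.add_im, add_sub_cancel_left]; exact h2 t, by rw [h1.2]⟩
  have hstrip : ∀ (b : F) (ζ : ℂ), |ζ.im - ((b : ℂ) / p).im| ≤ 4 * s → |ζ.im| ≤ C := by
    intro b ζ h
    have h1 := hC b b.2
    have h2 := abs_add_le (ζ.im - ((b : ℂ) / p).im) ((b : ℂ) / p).im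
    rw [sub_add_cancel] at h2
    linarith
  refine ⟨M, C, fun i => Γ i.1 i.2, fun i => Δ i.1 i.2, ?_, fun i t => ?_, fun i t => ?_⟩
  · rintro ⟨b, i⟩ ⟨b', j⟩
    by_cases hbb : b = b'
    · subst hbb
      obtain ⟨h1, h2, h3⟩ := hdual b i j
      exact ⟨h1, fun h => h2 fun hij => h (by rw [hij]), fun h => h3 (by simpa using h)⟩
    · refine dualSystem_entry_of_ne (fun h => hbb (congrArg Sigma.fst h)) fun t τ h => ?_
      obtain ⟨ζ, h1, h2⟩ := hΓ' ⟨b, i⟩ t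
      obtain ⟨ζ', h3, h4⟩ := hΔ' ⟨b', j⟩ τ
      have h5 : ζ = ζ' := Bend.injective (Φ := Φ) hp0 (by rw [← h2, ← h4]; exact h)
      rw [← h5] at h3
      have h6 := hgap b b.2 b' b'.2 fun h => hbb (Subtype.ext h)
      have h7 := abs_sub_le ((b : ℂ) / p).im ζ.im ((b' : ℂ) / p).im
      rw [abs_sub_comm ((b : ℂ) / p).im ζ.im] at h7
      simp only at h1 h3
      linarith
  · obtain ⟨ζ, h1, h2⟩ := hΓ' i t
    exact ⟨ζ, hstrip _ _ h1, h2⟩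
  · obtain ⟨ζ, h1, h2⟩ := hΔ' i t
    exact ⟨ζ, hstrip _ _ h1, h2⟩

end FiniteSystem

/-! ### Dual systems of contours at infinity -/

theorem Real.cos_le_cos_of_mem_reflected {a θ : ℝ} (ha : 0 ≤ a) (h1 : -(2 * Real.pi - a) ≤ θ)
    (h2 : θ ≤ -a) : Real.cos θ ≤ Real.cos a := by
  rcases le_total (-θ) Real.pi with h | h
  · rw [← Real.cos_neg θ]
    exact Real.cos_le_cos_of_nonneg_of_le_pi ha h (by linarith)
  · rw [← Real.cos_add_two_pi θ]
    exact Real.cos_le_cos_of_nonneg_of_le_pi ha (by linarith) (by linarith)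

theorem PolarPath.re_toFun (P : PolarPath) (t : ℝ) :
    (P.toFun t).re = P.modulus t * Real.cos (P.angle t) := by
  rw [toFun, Complex.re_ofReal_mul, Complex.exp_ofReal_mul_I_re]

section Cone

/-- The image of a strip under a bend with slopes `cot (a / 2)` lies, away from a disc, in the
sector of opening `2 a` around its axis. -/
theorem Bend.exists_cone_bound {a κ : ℝ} (M C : ℝ) (ha : 0 < a) (ha' : a < Real.pi / 2)
    (hκ : κ * Real.sin (a / 2) = Real.cos (a / 2)) :
    ∃ R : ℝ, ∀ q ζ ζ' : ℂ, q ≠ 0 → |ζ.im| ≤ C → R ≤ ‖ζ'‖ → ζ'.re ≤ Real.cos a * ‖ζ'‖ →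
      (Bend.mk (-(Complex.I * q)) κ κ M).toFun ζ ≠ q * ζ' := by
  have hsin : 0 < Real.sin a := Real.sin_pos_of_pos_of_lt_pi ha (by linarith [Real.pi_pos])
  have hcos : 0 < Real.cos a := Real.cos_pos_of_mem_Ioo ⟨by linarith [Real.pi_pos], ha'⟩
  -- Slope cot(a/2) means arms at angle a/2 from the axis, half the opening a of the cone.
  have hκs : κ * Real.sin a = 1 + Real.cos a := by
    have e1 : Real.sin a = 2 * Real.sin (a / 2) * Real.cos (a / 2) := by
      rw [← Real.sin_two_mul]; ring_nf
    have e2 : Real.cos a = 2 * Real.cos (a / 2) ^ 2 - 1 := by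
      rw [← Real.cos_two_mul]; ring_nf
    rw [e1, e2]
    linear_combination 2 * Real.cos (a / 2) * hκ
  -- E absorbs the delayed start of the arms and the half width of the strip; beyond |Re ζ| = Y the
  -- height is affine and the arms are inside the cone.
  set E := (κ * (M + rampShift) + C) * Real.sin a with hE
  set Y := max (|M| + 2) E with hY
  have hcont : ∀ q, Continuous (Bend.mk q κ κ M).height := fun q => (contDiff_height _).continuous
  obtain ⟨K, hK⟩ := (isCompact_Icc (a := -Y) (b := Y)).exists_bound_of_continuousOn
    (hcont 0).continuousOn
  refine ⟨K + C + Y + 1, fun q ζ ζ' hq hζ hR hre h => ?_⟩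
  set Φ : Bend := ⟨-(Complex.I * q), κ, κ, M⟩
  set η := Φ.height ζ.re with hη
  have hv : -Complex.I * (ζ + η * Complex.I) = ζ' := by
    apply mul_left_cancel₀ hq
    rw [← h, Bend.toFun]
    ring
  have hvre : ζ'.re = η + ζ.im := by
    rw [← hv]; simp; ring
  have hvim : ζ'.im = -ζ.re := by
    rw [← hv]; simp
  have hζ' := abs_le.1 hζ
  rcases le_or_gt |ζ.re| Y with hξ | hξ
  · have h1 : |η| ≤ K := hK ζ.re (abs_le.1 hξ)
    have h2 := Complex.norm_le_abs_re_add_abs_im ζ'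
    rw [hvre, hvim, abs_neg] at h2
    have h3 := abs_add_le η ζ.im
    linarith
  · have hX : |M| + 2 < |ζ.re| := (le_max_left _ _).trans_lt hξ
    have hEξ : E < |ζ.re| := (le_max_right _ _).trans_lt hξ
    have hM := abs_le.1 (le_refl |M|)
    have hηe : η = κ * (|ζ.re| - M - rampShift) := by
      change κ * ramp (ζ.re - M) + κ * ramp (-ζ.re - M) = _
      rcases le_total 0 ζ.re with h0 | h0
      · rw [abs_of_nonneg h0] at hX ⊢
        rw [ramp_of_two_le (by linarith [hM.2]), ramp_of_le_one (by linarith [hM.1])]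
        ring
      · rw [abs_of_nonpos h0] at hX ⊢
        rw [ramp_of_le_one (by linarith [hM.1]), ramp_of_two_le (by linarith [hM.2])]
        ring
    have hx : Real.cos a * |ζ.re| < ζ'.re * Real.sin a := by
      have e : ζ'.re * Real.sin a = (1 + Real.cos a) * |ζ.re| - E + (ζ.im + C) * Real.sin a := by
        rw [hvre, hηe, hE]
        linear_combination (|ζ.re|) * hκs
      have : 0 ≤ (ζ.im + C) * Real.sin a := mul_nonneg (by linarith) hsin.le
      rw [e]
      linarith
    have hξ0 : 0 ≤ |ζ.re| := abs_nonneg _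
    have hx0 : 0 < ζ'.re := by
      by_contra! h0
      have h1 := mul_nonneg hcos.le hξ0
      have h2 := mul_nonpos_of_nonpos_of_nonneg h0 hsin.le
      linarith
    have hsq : (Real.cos a * ‖ζ'‖) ^ 2 < ζ'.re ^ 2 := by
      have h1 : ‖ζ'‖ ^ 2 = ζ'.re ^ 2 + |ζ.re| ^ 2 := by
        rw [← Complex.normSq_eq_norm_sq, Complex.normSq_apply, hvim, sq_abs]; ring
      have h2 : (Real.cos a * |ζ.re|) ^ 2 < (ζ'.re * Real.sin a) ^ 2 :=
        pow_lt_pow_left₀ hx (mul_nonneg hcos.le hξ0) two_ne_zero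
      have h3 := Real.sin_sq_add_cos_sq a
      rw [mul_pow, h1]
      nlinarith
    have := lt_of_pow_lt_pow_left₀ 2 hx0.le hsq
    linarith

end Cone

section OuterSystem

variable {A B : ℂ[X]} {u : ℂ}

theorem ContourEnd.admissible_infinity_primal (hdeg : B.natDegree < A.natDegree) {φ : ℂ}
    (h : 0 < (A.leadingCoeff / B.leadingCoeff * φ ^ (A.natDegree - B.natDegree + 1)).re) :
    (ContourEnd.infinity φ).Admissible (-(A + derivative B)) B u := by
  have hd : (derivative B).natDegree < A.natDegree :=
    ((natDegree_derivative_le B).trans (Nat.sub_le _ _)).trans_lt hdeg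
  have h1 : (-(A + derivative B)).natDegree = A.natDegree := by
    rw [natDegree_neg, natDegree_add_eq_left_of_natDegree_lt hd]
  have h2 : (-(A + derivative B)).leadingCoeff = -A.leadingCoeff := by
    rw [leadingCoeff_neg, leadingCoeff_add_of_degree_lt' (degree_lt_degree hd)]
  refine Or.inl ⟨by rwa [h1], ?_⟩
  rw [h1, h2, neg_div, neg_mul, Complex.neg_re]
  linarith

/-- A dual system of contours outside a large disc and a sector. -/
theorem exists_outer_system (hB : B ≠ 0) (hdeg : B.natDegree < A.natDegree) {q : ℂ} (hq : q ≠ 0)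
    (hdecay : (A.leadingCoeff / B.leadingCoeff * q ^ (A.natDegree - B.natDegree + 1) *
      Complex.I).re < 0) (R : ℝ) :
    ∃ (Γ : Fin (A.natDegree - B.natDegree) → PrimalContour A B u)
      (Δ : Fin (A.natDegree - B.natDegree) → DualContour A B u), IsDualSystem Γ Δ ∧
      (∀ i t, ∃ ζ : ℂ, (Γ i).path t = q * ζ ∧ R ≤ ‖ζ‖ ∧
        ζ.re ≤ Real.cos (Real.pi / (2 * (A.natDegree - B.natDegree + 1 : ℕ))) * ‖ζ‖) ∧
      ∀ i t, ∃ ζ : ℂ, (Δ i).path t = q * ζ ∧ R ≤ ‖ζ‖ ∧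
        ζ.re ≤ Real.cos (Real.pi / (2 * (A.natDegree - B.natDegree + 1 : ℕ))) * ‖ζ‖ := by
  obtain ⟨d, hd⟩ : ∃ d, d = A.natDegree - B.natDegree := ⟨_, rfl⟩
  rw [← hd] at hdecay ⊢
  set m := d + 1 with hm
  have hm0 : 0 < m := Nat.succ_pos _
  have hpi := Real.pi_pos
  have hmr : (0 : ℝ) < m := by exact_mod_cast hm0
  set a := Real.pi / (2 * (m : ℕ)) with ha
  have ha0 : 0 ≤ a := by positivity
  have ham : Real.pi / m = 2 * a := by rw [ha]; field_simp
  have ham' : m * a = Real.pi / 2 := by rw [ha]; field_simp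
  obtain ⟨s, hs, hsR, hsB⟩ : ∃ s : ℝ, 0 < s ∧ R ≤ s ∧ ∀ ζ : ℂ, s ≤ ‖ζ‖ → B.eval (q * ζ) ≠ 0 := by
    obtain ⟨s, h1, h2, h3⟩ := ((eventually_gt_atTop (0 : ℝ)).and ((eventually_ge_atTop R).and
      ((Finset.eventually_all B.roots.toFinset).2 fun b _ =>
        eventually_gt_atTop ‖b / q‖))).exists
    refine ⟨s, h1, h2, fun ζ hζ h => ?_⟩
    have := h3 (q * ζ) (by rw [Multiset.mem_toFinset, mem_roots hB]; exact h)
    rw [mul_div_cancel_left₀ ζ hq] at this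
    linarith
  set Φ : Bend := ⟨q, 0, 0, 0⟩ with hΦ
  have hΦe : ∀ ζ, Φ.toFun (0 + ζ) = q * ζ := fun ζ => by
    simp [Bend.toFun, Bend.height, hΦ]
  have hpow : ∀ x : ℝ, (Φ.scale * Complex.exp (x * Complex.I)) ^ m =
      q ^ m * Complex.exp (m * x * Complex.I) := fun x => by
    rw [mul_pow, ← Complex.exp_nat_mul, mul_assoc (m : ℂ)]
  -- Since ma = π/2, the angle -a multiplies the leading term by -i, so by the decay hypothesis it
  -- is a primal direction.
  have hbase : Complex.exp (m * ((-a : ℝ) : ℂ) * Complex.I) = -Complex.I := by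
    rw [show (m : ℂ) * ((-a : ℝ) : ℂ) * Complex.I = ((-(m * a) : ℝ) : ℂ) * Complex.I by
      push_cast; ring, ham', Complex.exp_mul_I, ← Complex.ofReal_cos, ← Complex.ofReal_sin,
      Real.cos_neg, Real.sin_neg, Real.cos_pi_div_two, Real.sin_pi_div_two]
    simp
  have hprimal : ∀ k : ℤ, (ContourEnd.infinity (Φ.scale * Complex.exp
      (((-a - 2 * k * Real.pi / m : ℝ) : ℂ) * Complex.I))).Admissible
        (-(A + derivative B)) B u := fun k => by
    apply ContourEnd.admissible_infinity_primal hdeg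
    rw [← hd, hpow, exp_sector_angle hm0, hbase, ← mul_assoc, mul_neg, Complex.neg_re]
    linarith
  have hdual : ∀ k : ℤ, (ContourEnd.infinity (Φ.scale * Complex.exp
      (((-a - (2 * k - 1) * Real.pi / m : ℝ) : ℂ) * Complex.I))).Admissible A B (-u) := fun k => by
    refine Or.inl ⟨hdeg, ?_⟩
    rw [← hd, hpow, exp_sector_angle' hm0, hbase, neg_neg, ← mul_assoc]
    exact hdecay
  have hdual' : ∀ k : ℤ, (ContourEnd.infinity (Φ.scale * Complex.exp
      (((-a - 2 * k * Real.pi / m + Real.pi / m : ℝ) : ℂ) * Complex.I))).Admissible A B (-u) ∧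
      (ContourEnd.infinity (Φ.scale * Complex.exp
      (((-a - 2 * k * Real.pi / m - Real.pi / m : ℝ) : ℂ) * Complex.I))).Admissible A B (-u) := by
    intro k
    have h1 := hdual k
    have h2 := hdual (k + 1)
    rw [show -a - (2 * (k : ℝ) - 1) * Real.pi / m = -a - 2 * k * Real.pi / m + Real.pi / m by
      ring] at h1
    rw [show -a - (2 * ((k + 1 : ℤ) : ℝ) - 1) * Real.pi / m =
      -a - 2 * k * Real.pi / m - Real.pi / m by push_cast; ring] at h2
    exact ⟨h1, h2⟩
  -- All primal petals start in the same sector, at angle -a, and end in the d others; the j-th dual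
  -- petal encloses the end of the j-th primal one.
  let P : Fin d → PolarPath := fun j =>
    .outerPetal s (-a) (-a - 2 * ((j : ℕ) + 1 : ℤ) * Real.pi / m)
  let Q : Fin d → PolarPath := fun j =>
    .outerPetal (2 * s) (-a - 2 * ((j : ℕ) + 1 : ℤ) * Real.pi / m + Real.pi / m)
      (-a - 2 * ((j : ℕ) + 1 : ℤ) * Real.pi / m - Real.pi / m)
  have hfollow : ∀ (N : ℂ[X]) (v : ℂ) (S : PolarPath), s ≤ S.radius → S.startOut = true →
      S.endOut = true → (ContourEnd.infinity (Φ.scale * Complex.exp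
        (S.startAngle * Complex.I))).Admissible N B v → (ContourEnd.infinity (Φ.scale * Complex.exp
        (S.endAngle * Complex.I))).Admissible N B v →
      ∃ Γ : AdmissibleContour N B v, Γ.Follows Φ 0 S := by
    intro N v S h1 h2 h3 h4 h5
    have hr : 0 < S.radius := hs.trans_le h1
    refine AdmissibleContour.exists_follows (fun t => ?_)
      ⟨_, h4, PolarPath.isEndOf_infinity_straight (P := S.reverse) h2 hr rfl rfl⟩
      ⟨_, h5, PolarPath.isEndOf_infinity_straight h3 hr rfl rfl⟩
    rw [hΦe]
    apply hsB
    rw [PolarPath.norm_toFun hr]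
    exact h1.trans (PolarPath.le_modulus hr h2 h3 t)
  have hΓ : ∀ i, ∃ Γ : PrimalContour A B u, Γ.Follows Φ 0 (P i) := fun i =>
    hfollow _ _ _ le_rfl rfl rfl (by simpa [P, PolarPath.outerPetal] using hprimal 0) (hprimal _)
  have hΔ : ∀ i, ∃ Δ : DualContour A B u, Δ.Follows Φ 0 (Q i) := fun i =>
    hfollow _ _ _ (by simp only [Q, PolarPath.outerPetal]; linarith) rfl rfl
      (hdual' _).1 (hdual' _).2
  -- Angles between -(2π - a) and -a avoid the open cone |arg| < a, which is left to the system at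
  -- the zeros of B.
  have hsector : ∀ (S : PolarPath), s ≤ S.radius → S.startOut = true → S.endOut = true →
      S.startAngle ∈ Set.Icc (-(2 * Real.pi - a)) (-a) →
      S.endAngle ∈ Set.Icc (-(2 * Real.pi - a)) (-a) → ∀ t, R ≤ ‖S.toFun t‖ ∧
        (S.toFun t).re ≤ Real.cos a * ‖S.toFun t‖ := by
    intro S h1 h2 h3 h4 h5 t
    have hr : 0 < S.radius := hs.trans_le h1
    rw [PolarPath.re_toFun, PolarPath.norm_toFun hr, mul_comm]
    refine ⟨hsR.trans (h1.trans (PolarPath.le_modulus hr h2 h3 t)), ?_⟩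
    have h6 := Set.uIcc_subset_Icc h4 h5 (S.angle_mem_uIcc t)
    exact mul_le_mul_of_nonneg_right (Real.cos_le_cos_of_mem_reflected ha0 h6.1 h6.2)
      (PolarPath.modulus_pos hr t).le
  have hangle : ∀ j : Fin d, -(2 * Real.pi - a) ≤ -a - 2 * ((j : ℕ) + 1 : ℝ) * Real.pi / m -
      Real.pi / m ∧ -a - 2 * ((j : ℕ) + 1 : ℝ) * Real.pi / m + Real.pi / m ≤ -a := by
    intro j
    have h1 : ((j : ℕ) : ℝ) + 1 + 1 ≤ m := by
      have := j.2
      exact_mod_cast (by omega : (j : ℕ) + 1 + 1 ≤ m)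
    have h2 : (0 : ℝ) ≤ (j : ℕ) := by positivity
    have e : 2 * ((j : ℕ) + 1 : ℝ) * Real.pi / m = 2 * ((j : ℕ) + 1 : ℝ) * (2 * a) := by
      rw [← ham]; ring
    rw [e, ham]
    have h3 : Real.pi = 2 * (m * a) := by rw [ham']; ring
    rw [h3]
    constructor <;> nlinarith
  choose Γ hΓ using hΓ
  choose Δ hΔ using hΔ
  have hΦ0 : Φ.scale ≠ 0 := hq
  refine ⟨Γ, Δ, fun i j => ?_, fun i t => ?_, fun i t => ?_⟩
  · have hi : (((i : ℕ) + 1 : ℤ)) < m := by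
      have := i.2
      omega
    have hj : (((j : ℕ) + 1 : ℤ)) < m := by
      have := j.2
      omega
    by_cases hij : i = j
    · subst hij
      obtain ⟨t₀, h1, h2⟩ := PolarPath.outerPetal_crosses_outerPetal hm0 (α := -a) hs
        (i := ((i : ℕ) + 1 : ℤ)) (by omega) hi
      refine dualSystem_entry_of_eq rfl (pairing_of_follows_arc' hΦ0 (hΓ i) (hΔ i) hs
        (by simp only [Q, PolarPath.outerPetal]; linarith) ?_ h1 h2)
      simp only [Q, PolarPath.outerPetal]
      have : 0 < Real.pi / m := by positivity
      intro h
      linarith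
    · refine dualSystem_entry_of_ne hij (path_ne_of_follows hΦ0 (hΓ i) (hΔ j) fun t τ h => hij ?_)
      have := (PolarPath.outerPetal_crossing hm0 hs (by omega) hi (by omega) hj h).2.2
      apply Fin.ext
      omega
  · have h0 := hangle i
    have h1 : 0 < Real.pi / m := by positivity
    refine ⟨(P i).toFun t, by rw [(hΓ i).2]; exact hΦe _, hsector (P i) le_rfl rfl rfl ?_ ?_ t⟩
    · simp only [P, PolarPath.outerPetal]
      exact ⟨by linarith, le_rfl⟩
    · simp only [P, PolarPath.outerPetal]
      push_cast
      exact ⟨by linarith, by linarith⟩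
  · have h0 := hangle i
    have h1 : 0 < Real.pi / m := by positivity
    refine ⟨(Q i).toFun t, by rw [(hΔ i).2]; exact hΦe _,
      hsector (Q i) (by simp only [Q, PolarPath.outerPetal]; linarith) rfl rfl ?_ ?_ t⟩
    · simp only [Q, PolarPath.outerPetal]
      push_cast
      exact ⟨by linarith, by linarith⟩
    · simp only [Q, PolarPath.outerPetal]
      push_cast
      exact ⟨by linarith, by linarith⟩

end OuterSystem

/-! ### Existence of dual systems of contours -/

section Normalization

variable {A B : ℂ[X]} {u : ℂ}

/-- The same contour with the branch of the weight multiplied by a constant. -/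
def AdmissibleContour.rescale {N : ℂ[X]} (Γ : AdmissibleContour N B u) (c : ℂ) (hc : c ≠ 0) :
    AdmissibleContour N B u :=
  { Γ with
    const := c * Γ.const
    const_ne_zero := mul_ne_zero hc Γ.const_ne_zero }

theorem InGeneralPosition.rescale {Γ : PrimalContour A B u} {Δ : DualContour A B u}
    (h : InGeneralPosition Γ Δ) {c : ℂ} (hc : c ≠ 0) : InGeneralPosition (Γ.rescale c hc) Δ := h

theorem intersectionPairing_rescale {Γ : PrimalContour A B u} {Δ : DualContour A B u}
    (h : InGeneralPosition Γ Δ) {c : ℂ} (hc : c ≠ 0) :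
    intersectionPairing (Γ.rescale c hc) Δ = c * intersectionPairing Γ Δ := by
  rw [intersectionPairing_eq_sum h.1, intersectionPairing_eq_sum (h.rescale hc).1, Finset.mul_sum]
  refine Finset.sum_congr rfl fun p _ => ?_
  simp only [crossingWeight, tangentDet, AdmissibleContour.weight, AdmissibleContour.rescale]
  ring

theorem IsDualSystem.exists_normalized {ι : Type*} [Fintype ι] {Γ : ι → PrimalContour A B u}
    {Δ : ι → DualContour A B u} (h : IsDualSystem Γ Δ) {n : ℕ} (hn : Fintype.card ι = n) :
    ∃ (Γ : Fin n → PrimalContour A B u) (Δ : Fin n → DualContour A B u),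
      (∀ i j, InGeneralPosition (Γ i) (Δ j)) ∧
      ∀ i j, intersectionPairing (Γ i) (Δ j) = (1 : Matrix (Fin n) (Fin n) ℂ) i j := by
  have e := (Fintype.equivFinOfCardEq hn).symm
  have hc : ∀ i, (intersectionPairing (Γ (e i)) (Δ (e i)))⁻¹ ≠ 0 := fun i =>
    inv_ne_zero ((h (e i) (e i)).2.2 rfl)
  refine ⟨fun i => (Γ (e i)).rescale _ (hc i), fun j => Δ (e j),
    fun i j => (h (e i) (e j)).1.rescale (hc i), fun i j => ?_⟩
  rw [intersectionPairing_rescale (h (e i) (e j)).1, Matrix.one_apply]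
  split_ifs with hij
  · subst hij
    exact inv_mul_cancel₀ ((h (e i) (e i)).2.2 rfl)
  · rw [(h (e i) (e j)).2.1 fun h' => hij (e.injective h'), mul_zero]

theorem IsDualSystem.sumElim {ι κ : Type*} {Γ : ι → PrimalContour A B u}
    {Δ : ι → DualContour A B u} {Γ' : κ → PrimalContour A B u} {Δ' : κ → DualContour A B u}
    (h : IsDualSystem Γ Δ) (h' : IsDualSystem Γ' Δ')
    (hd : ∀ i j t τ, (Γ i).path t ≠ (Δ' j).path τ)
    (hd' : ∀ i j t τ, (Γ' i).path t ≠ (Δ j).path τ) :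
    IsDualSystem (Sum.elim Γ Γ') (Sum.elim Δ Δ') := by
  rintro (i | i) (j | j)
  · obtain ⟨h1, h2, h3⟩ := h i j
    exact ⟨h1, fun hij => h2 fun e => hij (by rw [e]), fun hij => h3 (Sum.inl_injective hij)⟩
  · exact dualSystem_entry_of_ne Sum.inl_ne_inr (hd i j)
  · exact dualSystem_entry_of_ne Sum.inr_ne_inl (hd' i j)
  · obtain ⟨h1, h2, h3⟩ := h' i j
    exact ⟨h1, fun hij => h2 fun e => hij (by rw [e]), fun hij => h3 (Sum.inr_injective hij)⟩

end Normalization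

section Existence

variable {A B : ℂ[X]}

/-- With scale u/(1 + iσ) the tilt separates the zeros, and the slopes σ and -σ at the two ends
restore the prescribed directions u and -u exactly. -/
theorem exists_dual_system_of_natDegree_le (hB : B ≠ 0) (hred : ReducedPair A B)
    (hdeg : A.natDegree ≤ B.natDegree) {u : ℂ} (hu : u ≠ 0) :
    ∃ (Γ : RootIndex B → PrimalContour A B u) (Δ : RootIndex B → DualContour A B u),
      IsDualSystem Γ Δ := by
  obtain ⟨σ, hσ⟩ := (eventually_im_ne B.roots.toFinset hu).exists
  have h1 : (1 + σ * Complex.I : ℂ) ≠ 0 := fun h => by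
    have := congrArg Complex.re h
    simp at this
  have hN : (-(A + derivative B)).natDegree ≤ B.natDegree := by
    rw [← not_lt, natDegree_lt_natDegree_neg_add_derivative_iff, not_lt]; exact hdeg
  obtain ⟨_, _, Γ, Δ, h, -⟩ := exists_root_system (A := A) (u := u) (l := -σ) (r := σ) hB hred
    (div_ne_zero hu h1) hσ (Or.inr ⟨hN, div_mul_cancel₀ u h1⟩) (Or.inr ⟨hdeg, by
      push_cast
      field_simp
      ring⟩)
  exact ⟨Γ, Δ, h⟩

/-- The strips around the zeros are laid across the q-axis, with scale -iq, and both arms are bent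
towards it: the primal ones to the angle -a/2, the dual ones to a/2. The axis lies close to a
boundary between a primal and a dual sector, so both directions are admissible. The cone bound
separates these contours from the outer petals. -/
theorem exists_dual_system_of_lt_natDegree (hB : B ≠ 0) (hred : ReducedPair A B)
    (hdeg : B.natDegree < A.natDegree) (u : ℂ) :
    ∃ (Γ : RootIndex B ⊕ Fin (A.natDegree - B.natDegree) → PrimalContour A B u)
      (Δ : RootIndex B ⊕ Fin (A.natDegree - B.natDegree) → DualContour A B u),
      IsDualSystem Γ Δ := by
  set m := A.natDegree - B.natDegree + 1 with hm
  have hm0 : 0 < m := Nat.succ_pos _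
  have hm1 : (1 : ℝ) < m := by exact_mod_cast (by omega : 1 < m)
  have hmc : (m : ℂ) ≠ 0 := by exact_mod_cast hm0.ne'
  have hpi := Real.pi_pos
  have hA : A ≠ 0 := by rintro rfl; simp at hdeg
  set c := A.leadingCoeff / B.leadingCoeff with hc
  have hc0 : c ≠ 0 := div_ne_zero (leadingCoeff_ne_zero.2 hA) (leadingCoeff_ne_zero.2 hB)
  -- With c q₀^m = i the axis is exactly the boundary between a primal sector, clockwise, and a dual
  -- one, counterclockwise.
  obtain ⟨q₀, hq₀⟩ := IsAlgClosed.exists_pow_nat_eq (Complex.I / c) hm0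
  have hq₀0 : q₀ ≠ 0 := by
    rintro rfl
    rw [zero_pow hm0.ne'] at hq₀
    exact div_ne_zero Complex.I_ne_zero hc0 hq₀.symm
  have hp₀0 : -(Complex.I * q₀) ≠ 0 := neg_ne_zero.2 (mul_ne_zero Complex.I_ne_zero hq₀0)
  -- the leading term of `∫ A / B` in the direction of the axis
  set W : ℝ → ℂ := fun σ => Complex.I / (1 + σ * Complex.I) ^ m with hW
  have h1 : ∀ σ : ℝ, (1 + σ * Complex.I : ℂ) ≠ 0 := fun σ h => by
    have := congrArg Complex.re h
    simp at this
  have hWc : Continuous W := by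
    refine continuous_const.div (by fun_prop) fun σ => pow_ne_zero _ (h1 σ)
  have hW0 : W 0 = Complex.I := by simp [hW]
  -- The decay conditions are strict at σ = 0, so they survive the small tilt needed to separate the
  -- zeros.
  have hev : ∀ e : ℂ, ∀ᶠ σ in 𝓝[≠] (0 : ℝ), (Complex.I * e).re < 0 → (W σ * e).re < 0 := by
    intro e
    by_cases h : (Complex.I * e).re < 0
    · have hce : Continuous fun σ => (W σ * e).re :=
        Complex.continuous_re.comp (hWc.mul continuous_const)
      have := (hce.tendsto 0).eventually_lt_const (show (W 0 * e).re < 0 by rwa [hW0])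
      filter_upwards [mem_nhdsWithin_of_mem_nhds this] with σ hσ _ using hσ
    · exact Eventually.of_forall fun σ h' => absurd h' h
  have hcos : 0 < Real.cos (Real.pi / 4) := by rw [Real.cos_pi_div_four]; positivity
  have hsin : 0 < Real.sin (Real.pi / 4) := by rw [Real.sin_pi_div_four]; positivity
  set e₁ := Complex.exp (((Real.pi / 4 : ℝ) : ℂ) * Complex.I) with he₁
  set e₂ := Complex.exp (((-(Real.pi / 4) : ℝ) : ℂ) * Complex.I) with he₂
  obtain ⟨σ, hσ, hσ0, hσ1, hσ2⟩ := ((eventually_im_ne B.roots.toFinset hp₀0).and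
    ((hev Complex.I).and ((hev e₁).and (hev (-e₂))))).exists
  replace hσ0 := hσ0 (by simp)
  replace hσ1 := hσ1 (by
    rw [Complex.I_mul_re, he₁, Complex.exp_ofReal_mul_I_im]; linarith)
  replace hσ2 := hσ2 (by
    rw [Complex.I_mul_re, Complex.neg_im, he₂, Complex.exp_ofReal_mul_I_im, Real.sin_neg]; linarith)
  set q := q₀ / (1 + σ * Complex.I) with hq
  have hq0 : q ≠ 0 := div_ne_zero hq₀0 (h1 σ)
  have hp : -(Complex.I * q₀) / (1 + σ * Complex.I) = -(Complex.I * q) := by rw [hq]; ring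
  rw [hp] at hσ
  have hcq : c * q ^ m = W σ := by
    rw [hq, div_pow, hq₀, hW]
    field_simp
  set a := Real.pi / (2 * (m : ℕ)) with ha
  have ha0 : 0 < a := by positivity
  have ha1 : a < Real.pi / 2 := by
    rw [ha, div_lt_div_iff_of_pos_left hpi (by positivity) two_pos]; linarith
  have hs : 0 < Real.sin (a / 2) := Real.sin_pos_of_pos_of_lt_pi (by linarith) (by linarith)
  -- κ ∓ i is a positive multiple of e^{∓ia/2}, and m a/2 = π/4, so the arms turn the leading term
  -- by ∓π/4.
  set κ := Real.cos (a / 2) / Real.sin (a / 2) with hκ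
  have hκs : κ * Real.sin (a / 2) = Real.cos (a / 2) := div_mul_cancel₀ _ hs.ne'
  have hsc : (Real.sin (a / 2) : ℂ) ≠ 0 := Complex.ofReal_ne_zero.2 hs.ne'
  have hκc : (κ : ℂ) * Real.sin (a / 2) = Real.cos (a / 2) := by exact_mod_cast hκs
  have hma : (m : ℝ) * (a / 2) = Real.pi / 4 := by
    rw [ha]; field_simp; norm_num
  have hdir : ∀ x : ℝ, c * (q * ((Real.sin (a / 2) : ℂ)⁻¹ * Complex.exp (x * Complex.I))) ^ m =
      W σ * Complex.exp ((m * x : ℝ) * Complex.I) * (((Real.sin (a / 2) ^ m)⁻¹ : ℝ) : ℂ) := by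
    intro x
    rw [mul_pow, mul_pow, ← Complex.exp_nat_mul, ← mul_assoc, hcq]
    push_cast
    rw [mul_assoc (m : ℂ)]
    ring
  have hsp : 0 < (Real.sin (a / 2) ^ m)⁻¹ := inv_pos.2 (pow_pos hs m)
  have hprim : (ContourEnd.infinity (-(Complex.I * q) * (1 + κ * Complex.I))).Admissible
      (-(A + derivative B)) B u := by
    apply ContourEnd.admissible_infinity_primal hdeg
    have e : -(Complex.I * q) * (1 + κ * Complex.I) =
        q * ((Real.sin (a / 2) : ℂ)⁻¹ * Complex.exp ((-(a / 2) : ℝ) * Complex.I)) := by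
      rw [Complex.exp_mul_I, ← Complex.ofReal_cos, ← Complex.ofReal_sin, Real.cos_neg, Real.sin_neg,
        ← hκc]
      push_cast
      push_cast at hsc
      field_simp
      linear_combination (-(κ : ℂ)) * Complex.I_sq
    rw [e, ← hm, ← hc, hdir, mul_neg, hma, ← he₂, Complex.re_mul_ofReal]
    rw [mul_neg, Complex.neg_re] at hσ2
    exact mul_pos (by linarith) hsp
  have hdual : (ContourEnd.infinity (-(Complex.I * q) * (-1 + κ * Complex.I))).Admissible
      A B (-u) := by
    refine Or.inl ⟨hdeg, ?_⟩
    have e : -(Complex.I * q) * (-1 + κ * Complex.I) =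
        q * ((Real.sin (a / 2) : ℂ)⁻¹ * Complex.exp ((a / 2 : ℝ) * Complex.I)) := by
      rw [Complex.exp_mul_I, ← Complex.ofReal_cos, ← Complex.ofReal_sin, ← hκc]
      push_cast
      push_cast at hsc
      field_simp
      linear_combination (-(κ : ℂ)) * Complex.I_sq
    rw [e, ← hm, ← hc, hdir, hma, ← he₁, Complex.re_mul_ofReal]
    exact mul_neg_of_neg_of_pos hσ1 hsp
  obtain ⟨M, C, Γ, Δ, h, hΓ, hΔ⟩ := exists_root_system (A := A) (u := u) hB hred
    (neg_ne_zero.2 (mul_ne_zero Complex.I_ne_zero hq0)) hσ hprim hdual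
  obtain ⟨R, hR⟩ := Bend.exists_cone_bound M C ha0 ha1 hκs
  obtain ⟨Γ', Δ', h', hΓ', hΔ'⟩ := exists_outer_system (u := u) hB hdeg hq0
    (by rw [← hm, ← hc, hcq]; exact hσ0) R
  refine ⟨_, _, h.sumElim h' (fun i j t τ e => ?_) fun i j t τ e => ?_⟩
  · obtain ⟨ζ, h1, h2⟩ := hΓ i t
    obtain ⟨ζ', h3, h4, h5⟩ := hΔ' j τ
    exact hR q ζ ζ' hq0 h1 h4 h5 (by rw [← h2, ← h3, e])
  · obtain ⟨ζ, h1, h2⟩ := hΔ j τ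
    obtain ⟨ζ', h3, h4, h5⟩ := hΓ' i t
    exact hR q ζ ζ' hq0 h1 h4 h5 (by rw [← h2, ← h3, e])

theorem exists_dual_contours (hB : B ≠ 0) (hred : ReducedPair A B) {u : ℂ} (hu : u ≠ 0) :
    ∃ (Γ : Fin (max A.natDegree B.natDegree) → PrimalContour A B u)
      (Δ : Fin (max A.natDegree B.natDegree) → DualContour A B u),
      (∀ i j, InGeneralPosition (Γ i) (Δ j)) ∧
      ∀ i j, intersectionPairing (Γ i) (Δ j) = (1 : Matrix (Fin (max A.natDegree B.natDegree))
        (Fin (max A.natDegree B.natDegree)) ℂ) i j := by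
  rcases le_or_gt A.natDegree B.natDegree with hdeg | hdeg
  · obtain ⟨Γ, Δ, h⟩ := exists_dual_system_of_natDegree_le hB hred hdeg hu
    exact h.exists_normalized (by rw [card_rootIndex, max_eq_right hdeg])
  · obtain ⟨Γ, Δ, h⟩ := exists_dual_system_of_lt_natDegree hB hred hdeg u
    refine h.exists_normalized ?_
    rw [Fintype.card_sum, card_rootIndex, Fintype.card_fin, max_eq_left hdeg.le]
    omega

end Existence

/-! ### Dual bases and nondegeneracy -/

theorem concomitant_eq_sum_left {U : Set ℂ} (hU : IsOpen U) {A B : ℂ[X]} {ι : Type*} [Fintype ι]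
    {f : ℂ → ℂ} (g : ℂ → ℂ) {F : ι → ℂ → ℂ} {a : ι → ℂ} (hF : ∀ i, DifferentiableOn ℂ (F i) U)
    (hf : ∀ x ∈ U, f x = ∑ i, a i * F i x) {x : ℂ} (hx : x ∈ U) :
    concomitant A B f g x = ∑ i, a i * concomitant A B (F i) g x := by
  have h : ∀ k, iteratedDeriv k f x = ∑ i, a i * iteratedDeriv k (F i) x := by
    intro k
    have : f =ᶠ[𝓝 x] fun x => ∑ i, a i * F i x :=
      eventually_of_mem (hU.mem_nhds hx) fun y hy => hf y hy
    rw [this.iteratedDeriv_eq, iteratedDeriv_fun_sum fun i _ =>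
      (((hF i).const_mul (a i)).analyticAt (hU.mem_nhds hx)).contDiffAt]
    exact Finset.sum_congr rfl fun i _ => iteratedDeriv_const_mul_field _ _
  simp only [concomitant, h, Finset.mul_sum, Finset.sum_mul, mul_neg, Finset.sum_neg_distrib]
  rw [neg_inj, eq_comm, Finset.sum_comm]
  refine Finset.sum_congr rfl fun k _ => ?_
  rw [Finset.sum_comm]
  exact Finset.sum_congr rfl fun j _ => Finset.sum_congr rfl fun i _ => by ring

theorem concomitant_eq_sum_right {U : Set ℂ} (hU : IsOpen U) {A B : ℂ[X]} {ι : Type*} [Fintype ι]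
    (f : ℂ → ℂ) {g : ℂ → ℂ} {G : ι → ℂ → ℂ} {a : ι → ℂ} (hG : ∀ i, DifferentiableOn ℂ (G i) U)
    (hg : ∀ x ∈ U, g x = ∑ i, a i * G i x) {x : ℂ} (hx : x ∈ U) :
    concomitant A B f g x = ∑ i, a i * concomitant A B f (G i) x := by
  have h : ∀ j p q, iteratedDeriv j (fun z => (p - z * q) * g z) x =
      ∑ i, a i * iteratedDeriv j (fun z => (p - z * q) * G i z) x := by
    intro j p q
    have : (fun z => (p - z * q) * g z) =ᶠ[𝓝 x]
        fun z => ∑ i, a i * ((p - z * q) * G i z) :=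
      eventually_of_mem (hU.mem_nhds hx) fun y hy => by
        simp only [hg y hy, Finset.mul_sum]
        exact Finset.sum_congr rfl fun i _ => by ring
    have hd : ∀ i, DifferentiableOn ℂ (fun z => (p - z * q) * G i z) U := fun i =>
      DifferentiableOn.mul (by fun_prop) (hG i)
    rw [this.iteratedDeriv_eq, iteratedDeriv_fun_sum fun i _ =>
      (((hd i).const_mul (a i)).analyticAt (hU.mem_nhds hx)).contDiffAt]
    exact Finset.sum_congr rfl fun i _ => iteratedDeriv_const_mul_field _ _
  simp only [concomitant, h, Finset.mul_sum, mul_neg, Finset.sum_neg_distrib]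
  rw [neg_inj, eq_comm, Finset.sum_comm]
  refine Finset.sum_congr rfl fun k _ => ?_
  rw [Finset.sum_comm]
  exact Finset.sum_congr rfl fun j _ => Finset.sum_congr rfl fun i _ => by ring

section DualBases

variable {A B : ℂ[X]} {u : ℂ} {n : ℕ} {Γ : Fin n → PrimalContour A B u}
  {Δ : Fin n → DualContour A B u}

/-- Pairing with the j-th dual solution reads off 2πi times the j-th coefficient. This gives
independence when f = 0 and nondegeneracy in general. -/
theorem eq_zero_of_sum_primalSolution (hu : u ≠ 0)
    (h : ∀ i j, ∀ x ∈ xDomain A B u, concomitant A B (primalSolution (Γ i)) (dualSolution (Δ j)) x =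
      2 * Real.pi * Complex.I * (1 : Matrix (Fin n) (Fin n) ℂ) i j)
    {f : ℂ → ℂ} {a : Fin n → ℂ}
    (hf : ∀ x ∈ xDomain A B u, f x = ∑ i, a i * primalSolution (Γ i) x)
    (h0 : ∀ j, ∀ x ∈ xDomain A B u, concomitant A B f (dualSolution (Δ j)) x = 0) : a = 0 := by
  obtain ⟨x, hx⟩ := xDomain_nonempty A B hu
  ext j
  have := h0 j x hx
  rw [concomitant_eq_sum_left (isOpen_xDomain A B u) _
    (fun i => (isSolution_primalSolution hu (Γ i)).1) hf hx] at this
  simp only [h _ _ x hx, Matrix.one_apply] at this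
  simpa [Real.pi_ne_zero] using this

theorem eq_zero_of_sum_dualSolution (hu : u ≠ 0)
    (h : ∀ i j, ∀ x ∈ xDomain A B u, concomitant A B (primalSolution (Γ i)) (dualSolution (Δ j)) x =
      2 * Real.pi * Complex.I * (1 : Matrix (Fin n) (Fin n) ℂ) i j)
    {g : ℂ → ℂ} {a : Fin n → ℂ}
    (hg : ∀ x ∈ xDomain A B u, g x = ∑ j, a j * dualSolution (Δ j) x)
    (h0 : ∀ i, ∀ x ∈ xDomain A B u, concomitant A B (primalSolution (Γ i)) g x = 0) : a = 0 := by
  obtain ⟨x, hx⟩ := xDomain_nonempty A B hu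
  ext i
  have := h0 i x hx
  rw [concomitant_eq_sum_right (isOpen_xDomain A B u) _
    (fun i => differentiableOn_dualSolution hu (Δ i)) hg hx] at this
  simp only [h _ _ x hx, Matrix.one_apply] at this
  simpa [Real.pi_ne_zero] using this

theorem concomitant_zero_left (A B : ℂ[X]) (g : ℂ → ℂ) (x : ℂ) :
    concomitant A B (fun _ => 0) g x = 0 := by
  simp [concomitant]

theorem concomitant_zero_right (A B : ℂ[X]) (f : ℂ → ℂ) (x : ℂ) :
    concomitant A B f (fun _ => 0) x = 0 := by
  simp [concomitant]

theorem existsUnique_coeff_primalSolution (hB : B ≠ 0) (hu : u ≠ 0)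
    (hn : n = max A.natDegree B.natDegree)
    (h : ∀ i j, ∀ x ∈ xDomain A B u, concomitant A B (primalSolution (Γ i)) (dualSolution (Δ j)) x =
      2 * Real.pi * Complex.I * (1 : Matrix (Fin n) (Fin n) ℂ) i j)
    {f : ℂ → ℂ} (hf : IsSolution A B (xDomain A B u) f) :
    ∃! a : Fin n → ℂ, ∀ x ∈ xDomain A B u, f x = ∑ i, a i * primalSolution (Γ i) x := by
  obtain ⟨x, hx⟩ := xDomain_nonempty A B hu
  refine existsUnique_coeff_of_isSolution (isOpen_xDomain A B u)
    (convex_xDomain A B u).isPreconnected hn hx (by rw [hn]; exact leading_ne_zero hB hx)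
    (fun i => isSolution_primalSolution hu (Γ i)) (fun a ha => ?_) hf
  exact eq_zero_of_sum_primalSolution hu h (f := fun _ => 0) (fun x hx => (ha x hx).symm)
    fun j x _ => concomitant_zero_left _ _ _ _

theorem max_natDegree_neg_add_derivative (A B : ℂ[X]) :
    max (-(A + derivative B)).natDegree B.natDegree = max A.natDegree B.natDegree := by
  have hd : (derivative B).natDegree ≤ B.natDegree :=
    (natDegree_derivative_le B).trans (Nat.sub_le _ _)
  by_cases h : B.natDegree < A.natDegree
  · rw [natDegree_neg, natDegree_add_eq_left_of_natDegree_lt (by omega)]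
  · have := mt (natDegree_lt_natDegree_neg_add_derivative_iff A B).1 h
    rw [max_eq_right (not_lt.1 h), max_eq_right (not_lt.1 this)]

theorem existsUnique_coeff_dualSolution (hB : B ≠ 0) (hu : u ≠ 0)
    (hn : n = max A.natDegree B.natDegree)
    (h : ∀ i j, ∀ x ∈ xDomain A B u, concomitant A B (primalSolution (Γ i)) (dualSolution (Δ j)) x =
      2 * Real.pi * Complex.I * (1 : Matrix (Fin n) (Fin n) ℂ) i j)
    {g : ℂ → ℂ} (hg : IsAdjointSolution A B (xDomain A B u) g) :
    ∃! a : Fin n → ℂ, ∀ x ∈ xDomain A B u, g x = ∑ i, a i * dualSolution (Δ i) x := by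
  obtain ⟨x, hx⟩ := xDomain_nonempty A B hu
  have hU := isOpen_xDomain A B u
  have hx' : -x ∈ -xDomain A B u := by simpa using hx
  have hlead : (-(A + derivative B)).coeff n - (-x) * B.coeff n ≠ 0 := by
    have h1 := leading_ne_zero hB hx
    rw [← hn] at h1
    have h2 : (derivative B).coeff n = 0 := by
      rcases (le_max_right A.natDegree B.natDegree).lt_or_eq with h3 | h3
      · exact coeff_eq_zero_of_natDegree_lt
          (((natDegree_derivative_le B).trans (Nat.sub_le _ _)).trans_lt (hn ▸ h3))
      · rw [hn, ← h3, coeff_natDegree_derivative]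
    rw [coeff_neg, coeff_add, h2]
    intro h3
    apply h1
    linear_combination -h3
  -- The adjoint case is the same theorem for the reflected functions on -U, with A replaced by -(A
  -- + B').
  have key := existsUnique_coeff_of_isSolution hU.neg
    (convex_xDomain A B u).neg.isPreconnected
    (hn.trans (max_natDegree_neg_add_derivative A B).symm) hx' hlead
    (F := fun i y => dualSolution (Δ i) (-y))
    (fun i => (isAdjointSolution_iff hU).1 (isAdjointSolution_dualSolution hu (Δ i)))
    (fun a ha => eq_zero_of_sum_dualSolution hu h (g := fun _ => 0) (fun x hx => ?_)
      fun j x _ => concomitant_zero_right _ _ _ _)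
    ((isAdjointSolution_iff hU).1 hg)
  · obtain ⟨a, ha, hua⟩ := key
    refine ⟨a, fun x hx => ?_, fun b hb => hua b fun x hx => hb (-x) hx⟩
    simpa using ha (-x) (by simpa using hx)
  · simpa using (ha (-x) (by simpa using hx)).symm

end DualBases

theorem proposition3p1 (A B : ℂ[X]) (hB : B ≠ 0) (hred : ReducedPair A B)
    (u : ℂ) (hu : u ≠ 0) :
    -- the contour integrals converge absolutely and solve the two adjoint equations
    (∀ Γ : PrimalContour A B u,
      (∀ x ∈ xDomain A B u, IntegrableOn (Γ.integrand x) Γ.dom) ∧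
      IsSolution A B (xDomain A B u) (primalSolution Γ)) ∧
    (∀ Δ : DualContour A B u,
      (∀ x ∈ xDomain A B u, IntegrableOn (Δ.integrand (-x)) Δ.dom) ∧
      IsAdjointSolution A B (xDomain A B u) (dualSolution Δ)) ∧
    -- on them the bilinear concomitant is the (absolutely convergent) double contour integral
    (∀ (Γ : PrimalContour A B u) (Δ : DualContour A B u), ∀ x ∈ xDomain A B u,
      IntegrableOn (fun p : ℝ × ℝ => concomitantIntegrand Γ Δ x p.1 p.2) (Γ.dom ×ˢ Δ.dom) ∧
      concomitant A B (primalSolution Γ) (dualSolution Δ) x = contourConcomitant Γ Δ x) ∧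
    -- the concomitant of two solutions does not depend on `x`
    (∀ f g : ℂ → ℂ, IsSolution A B (xDomain A B u) f → IsAdjointSolution A B (xDomain A B u) g →
      ∀ x ∈ xDomain A B u, ∀ x' ∈ xDomain A B u,
        concomitant A B f g x = concomitant A B f g x') ∧
    -- normalized by `1 / (2πi)`, the concomitant is the intersection pairing
    (∀ (Γ : PrimalContour A B u) (Δ : DualContour A B u), InGeneralPosition Γ Δ →
      ∀ x ∈ xDomain A B u,
        (2 * Real.pi * Complex.I)⁻¹ * contourConcomitant Γ Δ x = intersectionPairing Γ Δ) ∧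
    -- suitable contours give bases in which it is the identity matrix
    (∃ (Γ : Fin (max A.natDegree B.natDegree) → PrimalContour A B u)
       (Δ : Fin (max A.natDegree B.natDegree) → DualContour A B u),
      (∀ f : ℂ → ℂ, IsSolution A B (xDomain A B u) f →
        ∃! a : Fin (max A.natDegree B.natDegree) → ℂ,
          ∀ x ∈ xDomain A B u, f x = ∑ i, a i * primalSolution (Γ i) x) ∧
      (∀ g : ℂ → ℂ, IsAdjointSolution A B (xDomain A B u) g →
        ∃! a : Fin (max A.natDegree B.natDegree) → ℂ,
          ∀ x ∈ xDomain A B u, g x = ∑ i, a i * dualSolution (Δ i) x) ∧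
      (∀ i j, InGeneralPosition (Γ i) (Δ j)) ∧
      (∀ i j, intersectionPairing (Γ i) (Δ j) =
        (1 : Matrix (Fin (max A.natDegree B.natDegree)) (Fin (max A.natDegree B.natDegree)) ℂ) i j) ∧
      (∀ i j, ∀ x ∈ xDomain A B u,
        (2 * Real.pi * Complex.I)⁻¹ * contourConcomitant (Γ i) (Δ j) x =
          (1 : Matrix (Fin (max A.natDegree B.natDegree))
            (Fin (max A.natDegree B.natDegree)) ℂ) i j)) ∧
    -- the pairing of the two solution spaces is nondegenerate
    (∀ f : ℂ → ℂ, IsSolution A B (xDomain A B u) f →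
      (∀ g : ℂ → ℂ, IsAdjointSolution A B (xDomain A B u) g →
        ∀ x ∈ xDomain A B u, concomitant A B f g x = 0) →
      ∀ x ∈ xDomain A B u, f x = 0) ∧
    (∀ g : ℂ → ℂ, IsAdjointSolution A B (xDomain A B u) g →
      (∀ f : ℂ → ℂ, IsSolution A B (xDomain A B u) f →
        ∀ x ∈ xDomain A B u, concomitant A B f g x = 0) →
      ∀ x ∈ xDomain A B u, g x = 0) := by
  obtain ⟨Γ, Δ, hgp, hpair⟩ := exists_dual_contours hB hred hu
  have hcc : ∀ i j, ∀ x ∈ xDomain A B u, contourConcomitant (Γ i) (Δ j) x =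
      2 * Real.pi * Complex.I * (1 : Matrix (Fin (max A.natDegree B.natDegree))
        (Fin (max A.natDegree B.natDegree)) ℂ) i j := fun i j x hx => by
    rw [contourConcomitant_eq_intersectionPairing hu hx (hgp i j), hpair]
  have hconc : ∀ i j, ∀ x ∈ xDomain A B u,
      concomitant A B (primalSolution (Γ i)) (dualSolution (Δ j)) x =
      2 * Real.pi * Complex.I * (1 : Matrix (Fin (max A.natDegree B.natDegree))
        (Fin (max A.natDegree B.natDegree)) ℂ) i j := fun i j x hx => by
    rw [concomitant_eq_contourConcomitant hu (Γ i) (Δ j) hx, hcc i j x hx]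
  have hbasis := fun f hf => existsUnique_coeff_primalSolution (f := f) hB hu rfl hconc hf
  have hbasis' := fun g hg => existsUnique_coeff_dualSolution (g := g) hB hu rfl hconc hg
  refine ⟨fun Γ => ⟨fun x hx => Γ.integrableOn_integrand hu (mem_xDomain_iff_primal.1 hx),
      isSolution_primalSolution hu Γ⟩,
    fun Δ => ⟨fun x hx => Δ.integrableOn_integrand (neg_ne_zero.2 hu) (mem_xDomain_iff_dual.1 hx),
      isAdjointSolution_dualSolution hu Δ⟩,
    fun Γ Δ x hx => ⟨integrableOn_concomitantIntegrand hu Γ Δ hx,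
      concomitant_eq_contourConcomitant hu Γ Δ hx⟩,
    fun f g hf hg x hx x' hx' => concomitant_eq_of_isSolution (isOpen_xDomain A B u)
      (convex_xDomain A B u).isPreconnected hf hg hx hx',
    fun Γ Δ hg x hx => ?_,
    ⟨Γ, Δ, hbasis, hbasis', hgp, hpair, fun i j x hx => ?_⟩, fun f hf h0 x hx => ?_,
    fun g hg h0 x hx => ?_⟩
  · rw [contourConcomitant_eq_intersectionPairing hu hx hg, inv_mul_cancel_left₀ two_pi_I_ne_zero]
  · rw [hcc i j x hx, inv_mul_cancel_left₀ two_pi_I_ne_zero]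
  · obtain ⟨a, ha, -⟩ := hbasis f hf
    have := eq_zero_of_sum_primalSolution hu hconc ha fun j =>
      h0 _ (isAdjointSolution_dualSolution hu (Δ j))
    rw [ha x hx, this]; simp
  · obtain ⟨a, ha, -⟩ := hbasis' g hg
    have := eq_zero_of_sum_dualSolution hu hconc ha fun i =>
      h0 _ (isSolution_primalSolution hu (Γ i))
    rw [ha x hx, this]; simp
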